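/- **Definitions.** Let $\mathfrak e\neq 0$ be a real number (the elementary charge). For integers $l\ge 0$, $-l\le m\le l$, let $P_{l,m}(y)=\frac{(-1)^m}{2^l\,l!}(1-y^2)^{m/2}\frac{d^{\,l+m}}{dy^{\,l+m}}(y^2-1)^l$ be the associated Legendre functions, and, for $l,l'\ge 1$, $|m|\le\min(l,l')$ and $\lambda\geq 0$, put $$A_{l,m\;l',m}(\lambda)=\sqrt{\tfrac{l(l+1)(2l+1)(l-m)!\,(2l'+1)(l'-m)!}{l'(l'+1)\,2(l+m)!\,2(l'+m)!}}\int_{-1}^{1}P_{l,m}(y)\,P_{l',m}\Big(\tfrac{\tanh\lambda+y}{1+y\tanh\lambda}\Big)dy,\qquad B_{l,0}(\lambda)=i\,\mathfrak e\sqrt{\tfrac83}\int_0^\lambda A_{1,0\;l,0}(\lambda')\,d\lambda'.$$ For a complex $2\times2$ matrix $a$ let $$T^{l}_{m\,m'}(a)=(-1)^{2l-m-m'}\sqrt{\tfrac{(l-m)!(l+m)!}{(l-m')!(l+m')!}}\sum_{k=\max\{0,-m-m'\}}^{\min\{l-m,l-m'\}}\tbinom{l-m'}{k}\tbinom{l+m'}{l-m-k}a_{11}^{k}a_{12}^{l-m-k}a_{21}^{l-m'-k}a_{22}^{m+m'+k},$$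 and let $P^l_{m\,n}(\cos\varphi)$, $0\le\varphi\le\pi$, be the value of $T^l_{m\,n}$ at $a_{11}=a_{22}=\cos(\varphi/2)$, $a_{12}=a_{21}=i\sin(\varphi/2)$. For a non-negative integer $l_0$, integers $l,l'\ge l_0$, $|n|\le\min(l,l')$, and $\rho\in\mathbb C$, let $$U^{(l_0,i\rho)}_{l,n\;l',n}(\lambda)=\tfrac12\sqrt{(2l'+1)(2l+1)}\,(\cosh\lambda)^{i\rho-1}\int_{-1}^{1}(1-ty)^{i\rho-1}\,\overline{P^{l'}_{l_0\,n}(y)}\,P^{l}_{l_0\,n}\Big(\tfrac{y-t}{1-ty}\Big)dy,\qquad t=\tanh\lambda .$$ These are the matrix elements of the representation $(l_0,i\rho)$ of $SL(2,\mathbb C)$ at the hyperbolic rotation by the angle $\lambda$. Consider the following functions of $(\rho,z)$, given by absolutely convergent integrals for $|\mathrm{Im}\,\rho|<\mathrm{Re}\,z-1$ (in particular for real $\rho$ and $z>1$). (1) For $\alpha=(l,m)$ with $l\ge1$, $|m|\le l$, and $0\le l_0\le l$, the Fourier weight $$\big[K(l_0,i\rho;z)\big]_{\alpha\alpha}=\Big(\tfrac{4\pi\mathfrak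 e}{2l+1}\Big)^2e^z\int_0^\infty\Big[\sum_{n=-l}^{l}\overline{A_{l,n\;l,n}}\,U^{(l_0,i\rho)}_{l,n\;l,n}+\tfrac z4(-1)^l\big|\tfrac1{\mathfrak e}B_{l,0}\big|^2U^{(l_0,i\rho)}_{l,0\;l,0}\Big]e^{-z\lambda\coth\lambda}\,\pi^2\sinh^2\lambda\,d\lambda .$$ (2) For $\alpha=(l,m)$, $\alpha'=(l',m')$ with $l,l'\ge1$, $|m|\le l$, $|m'|\le l'$, and $0\le l_0\le\min(l,l')$, the projection function $$\tfrac{(4\pi\mathfrak e)^2e^z}{(2l+1)(2l'+1)}\int_0^\infty\Big[\sum_{|n|\le\min(l,l')}\overline{A_{l,n\;l',n}}\,U^{(l_0,i\rho)}_{l,n\;l',n}+\tfrac z4(-1)^l\,\overline{\tfrac1{\mathfrak e}B_{l',0}}\,\tfrac1{\mathfrak e}B_{l,0}\,U^{(l_0,i\rho)}_{l,0\;l',0}\Big]e^{-z\lambda\coth\lambda}\,\pi^2\sinh^2\lambda\,d\lambda .$$ (3) For $l\ge1$, the projection function $$\tfrac{4\pi^{7/2}\sqrt z\,e^z}{2l+1}\int_0^\infty\overline{B_{l,0}(\lambda)}\,U^{(0,i\rho)}_{0,0\;l,0}(\lambda)\,e^{-z\lambda\coth\lambda}\sinh^2\lambda\,d\lambda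 .$$ **Statement.** Each of the integrals in (1)–(3) has an analytic continuation, as a function of the two complex variables $(\rho,z)$, to $\mathbb C^2$ without the hyperplanes $\rho=\pm i(m+z)$, $m=-1,0,1,2,\dots$. The functions (1)–(3) are continued by multiplying the continued integrals with the factors in front of them ($\sqrt z$ is the principal square root). For every complex $z\neq0$: * the continuation of (1) is identically zero as a function of $\rho$ if and only if $l_0=l=1$; * the continuation of (2) is identically zero as a function of $\rho$ if and only if $l_0=l=1$ or $l_0=l'=1$; * the continuation of (3) is never identically zero as a function of $\rho$. -/

import Mathlib

open scoped Nat Polynomial ComplexConjugate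

namespace CoulombField

/-- The associated Legendre function `P_{l,m}` on `[-1,1]` for integers `-l ≤ m ≤ l`,
with the sign `(-1)^m`, given by Rodrigues' formula
`P_{l,m}(y) = (-1)^m / (2^l l!) (1 - y²)^{m/2} (d/dy)^{l+m} (y² - 1)^l`. -/
noncomputable def legendreP (l : ℕ) (m : ℤ) (y : ℝ) : ℝ :=
  (-1 : ℝ) ^ m / (2 ^ l * (l ! : ℝ)) * (1 - y ^ 2) ^ ((m : ℝ) / 2) *
    ((Polynomial.derivative^[((l : ℤ) + m).toNat] ((Polynomial.X ^ 2 - 1) ^ l : ℝ[X])).eval y)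

/-- The matrix elements `A_{l,m; l',m'}(lam)` (`l, l' ≥ 1`) of the representation
`(l₀ = 1, l₁ = 0)` of `SL(2,ℂ)` at the hyperbolic rotation with hyperbolic angle `lam`. -/
noncomputable def matA (l : ℕ) (m : ℤ) (l' : ℕ) (m' : ℤ) (lam : ℝ) : ℝ :=
  if m = m' then
    Real.sqrt
      (((l : ℝ) * (l + 1) * (2 * l + 1) * (((l : ℤ) - m).toNat ! : ℝ) *
          (2 * l' + 1) * (((l' : ℤ) - m').toNat ! : ℝ)) /
        ((l' : ℝ) * (l' + 1) * 2 * (((l : ℤ) + m).toNat ! : ℝ) *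
          2 * (((l' : ℤ) + m').toNat ! : ℝ))) *
      ∫ y in (-1 : ℝ)..1,
        legendreP l m y * legendreP l' m' ((Real.tanh lam + y) / (1 + Real.tanh lam * y))
  else 0

/-- The components `B_{l,m}(lam)` (`l ≥ 1`) of the inhomogeneous term of the transformation rule
of the creation and annihilation operators; `q` is the elementary charge. -/
noncomputable def vecB (q : ℝ) (l : ℕ) (m : ℤ) (lam : ℝ) : ℂ :=
  Complex.I * (q : ℂ) * (Real.sqrt (8 / 3) : ℂ) *
    ((∫ s in (0 : ℝ)..lam, matA 1 0 l m s : ℝ) : ℂ)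

/-- The standard matrix elements `T^l_{m,m'}(a)`, `-l ≤ m, m' ≤ l`, of the irreducible
representation of integer weight `l` of `SU(2)`. -/
noncomputable def matT (l : ℕ) (m m' : ℤ) (a : Matrix (Fin 2) (Fin 2) ℂ) : ℂ :=
  (-1 : ℂ) ^ (2 * (l : ℤ) - m - m') *
    (Real.sqrt
      (((((l : ℤ) - m).toNat ! : ℝ) * (((l : ℤ) + m).toNat ! : ℝ)) /
        ((((l : ℤ) - m').toNat ! : ℝ) * (((l : ℤ) + m').toNat ! : ℝ))) : ℂ) *
    ∑ k ∈ Finset.Icc (max 0 (-m - m')).toNat (min ((l : ℤ) - m) ((l : ℤ) - m')).toNat,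
      ((((l : ℤ) - m').toNat.choose k : ℕ) : ℂ) *
        ((((l : ℤ) + m').toNat.choose ((l : ℤ) - m - k).toNat : ℕ) : ℂ) *
        a 0 0 ^ k * a 0 1 ^ ((l : ℤ) - m - k).toNat *
        a 1 0 ^ ((l : ℤ) - m' - k).toNat * a 1 1 ^ (m + m' + k).toNat

/-- The function `P^l_{m,n}` on `[-1,1]`: `P^l_{m,n}(cos φ)` is `T^l_{m,n}` at the matrix with
diagonal entries `cos (φ/2)` and off-diagonal entries `i sin (φ/2)`, `0 ≤ φ ≤ π`. -/
noncomputable def jacobiP (l : ℕ) (m n : ℤ) (y : ℝ) : ℂ :=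
  matT l m n
    !![(Real.sqrt ((1 + y) / 2) : ℂ), Complex.I * (Real.sqrt ((1 - y) / 2) : ℂ);
       Complex.I * (Real.sqrt ((1 - y) / 2) : ℂ), (Real.sqrt ((1 + y) / 2) : ℂ)]

/-- The matrix elements `U^{(l₀, iρ)}_{l,m; l',m'}(lam)` (`l, l' ≥ |l₀|`) of the principal series
at the hyperbolic rotation with hyperbolic angle `lam`, as entire functions of `ρ`. -/
noncomputable def matU (l₀ : ℤ) (ρ : ℂ) (l : ℕ) (m : ℤ) (l' : ℕ) (m' : ℤ) (lam : ℝ) : ℂ :=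
  if m = m' then
    (1 / 2) * (Real.sqrt ((2 * l' + 1) * (2 * l + 1)) : ℂ) *
      (Real.cosh lam : ℂ) ^ (Complex.I * ρ - 1) *
      ∫ y in (-1 : ℝ)..1,
        ((1 - Real.tanh lam * y : ℝ) : ℂ) ^ (Complex.I * ρ - 1) *
          conj (jacobiP l' l₀ m' y) *
          jacobiP l l₀ m ((y - Real.tanh lam) / (1 - Real.tanh lam * y))
  else 0

/-- The indices `α = (l, m)` with `l ≥ 1` and `-l ≤ m ≤ l`. -/
def IsIndex (α : ℕ × ℤ) : Prop :=
  1 ≤ α.1 ∧ -(α.1 : ℤ) ≤ α.2 ∧ α.2 ≤ (α.1 : ℤ)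

/-- The common weight `e^{-z lam coth lam} sinh² lam` of the integrals. -/
noncomputable def radialWeight (z : ℂ) (lam : ℝ) : ℂ :=
  Complex.exp (-z * ((lam * (Real.cosh lam / Real.sinh lam) : ℝ) : ℂ)) *
    ((Real.sinh lam ^ 2 : ℝ) : ℂ)

/-- The factor in front of the integral for the diagonal Fourier weight
`[K(l₀, iρ; z)]_{α,α}`. -/
noncomputable def fourierFactor (q : ℝ) (α : ℕ × ℤ) (z : ℂ) : ℂ :=
  (4 * (Real.pi : ℂ) * (q : ℂ) / (2 * (α.1 : ℂ) + 1)) ^ 2 * Complex.exp z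

/-- The integrand for the diagonal Fourier weight `[K(l₀, iρ; z)]_{α,α}`. -/
noncomputable def fourierIntegrand (q : ℝ) (l₀ : ℕ) (α : ℕ × ℤ) (ρ z : ℂ) (lam : ℝ) : ℂ :=
  ((∑ n ∈ Finset.Icc (-(α.1 : ℤ)) (α.1 : ℤ),
      conj (matA α.1 n α.1 n lam : ℂ) * matU l₀ ρ α.1 n α.1 n lam) +
    z / 4 * (-1) ^ α.1 * ((‖1 / (q : ℂ) * vecB q α.1 0 lam‖ ^ 2 : ℝ) : ℂ) *
      matU l₀ ρ α.1 0 α.1 0 lam) *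
    ((Real.pi : ℂ) ^ 2 * radialWeight z lam)

/-- The factor in front of the integral for the projection function that joins the cyclic
representations with cyclic vectors `c_α⁺|u⟩` and `c_{α'}⁺|u⟩`, smeared with the component
`(β, β')`. -/
noncomputable def projFactor (q : ℝ) (α β α' β' : ℕ × ℤ) (z : ℂ) : ℂ :=
  (if β = α then 1 else 0) * (if β' = α' then 1 else 0) *
    (4 * (Real.pi : ℂ) * (q : ℂ)) ^ 2 * Complex.exp z /
    ((2 * (α.1 : ℂ) + 1) * (2 * (α'.1 : ℂ) + 1))

/-- The integrand for the projection function that joins the cyclic representations with cyclic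
vectors `c_α⁺|u⟩` and `c_{α'}⁺|u⟩`. -/
noncomputable def projIntegrand (q : ℝ) (l₀ : ℕ) (α α' : ℕ × ℤ) (ρ z : ℂ) (lam : ℝ) : ℂ :=
  ((∑ n ∈ Finset.Icc (-(min α.1 α'.1 : ℤ)) (min α.1 α'.1 : ℤ),
      conj (matA α.1 n α'.1 n lam : ℂ) * matU l₀ ρ α.1 n α'.1 n lam) +
    z / 4 * (-1) ^ α.1 * conj (1 / (q : ℂ) * vecB q α'.1 0 lam) *
      (1 / (q : ℂ) * vecB q α.1 0 lam) * matU l₀ ρ α.1 0 α'.1 0 lam) *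
    ((Real.pi : ℂ) ^ 2 * radialWeight z lam)

/-- The factor in front of the integral for the projection function that joins the cyclic
representations with cyclic vectors `|u⟩` and `c_{l,0}⁺|u⟩`; the square root is the principal
one. -/
noncomputable def cyclicFactor (l : ℕ) (z : ℂ) : ℂ :=
  4 * ((Real.pi ^ (7 / 2 : ℝ) : ℝ) : ℂ) * z ^ (1 / 2 : ℂ) * Complex.exp z / (2 * (l : ℂ) + 1)

/-- The integrand for the projection function that joins the cyclic representations with cyclic
vectors `|u⟩` and `c_{l,0}⁺|u⟩`. -/
noncomputable def cyclicIntegrand (q : ℝ) (l : ℕ) (ρ z : ℂ) (lam : ℝ) : ℂ :=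
  conj (vecB q l 0 lam) * matU 0 ρ 0 0 l 0 lam * radialWeight z lam

/-- The tube of points `(ρ, z)` with `|Im ρ| < Re z - 1`, where the integrals converge. It
contains all points with `ρ` real and `z > 1`. -/
def convergenceTube : Set (ℂ × ℂ) :=
  {p | |p.1.im| + 1 < p.2.re}

/-- The union of the polar hyperplanes `ρ = ± i (m + z)`, `m = -1, 0, 1, 2, …`. -/
def polarSet : Set (ℂ × ℂ) :=
  {p | ∃ m : ℤ, -1 ≤ m ∧
    (p.1 = Complex.I * ((m : ℂ) + p.2) ∨ p.1 = -(Complex.I * ((m : ℂ) + p.2)))}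

/-- `Φ` is the analytic continuation of `(ρ, z) ↦ ∫₀^∞ g ρ z lam d lam`: this integral converges
absolutely on the tube, and `Φ` is analytic in the two variables `(ρ, z)` on all of `ℂ²` outside
the polar hyperplanes and equals the integral on the tube. -/
structure IsIntegralContinuation (g : ℂ → ℂ → ℝ → ℂ) (Φ : ℂ × ℂ → ℂ) : Prop where
  integrableOn : ∀ p ∈ convergenceTube,
    MeasureTheory.IntegrableOn (g p.1 p.2) (Set.Ioi 0) MeasureTheory.volume
  eq_integral : ∀ p ∈ convergenceTube, Φ p = ∫ lam in Set.Ioi (0 : ℝ), g p.1 p.2 lam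
  analytic : AnalyticOnNhd ℂ Φ polarSetᶜ

/-- `F` is the analytic continuation of `(ρ, z) ↦ c z * ∫₀^∞ g ρ z lam d lam`: the factor `c z` in
front, times the analytic continuation of the integral. -/
def IsContinuation (c : ℂ → ℂ) (g : ℂ → ℂ → ℝ → ℂ) (F : ℂ × ℂ → ℂ) : Prop :=
  ∃ Φ : ℂ × ℂ → ℂ, IsIntegralContinuation g Φ ∧ ∀ p, F p = c p.2 * Φ p

/-- For the fixed `z`, the function `ρ ↦ F (ρ, z)` vanishes identically (off its poles). -/
def VanishesAt (F : ℂ × ℂ → ℂ) (z : ℂ) : Prop :=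
  ∀ ρ : ℂ, (ρ, z) ∉ polarSet → F (ρ, z) = 0

end CoulombField

/-!
Write `w = iρ` and `t` for the hyperbolic angle. After the substitution `cosh t - y sinh t = e^σ`,
`|σ| ≤ t`, every matrix element that occurs is a finite sum of terms `e^{-ft} η^N K(w + j, t)` with
integers `f`, `j`, where `η = 1 / (1 - e^{-2t})` and `K(a, t) = ∫_{-t}^t e^{as} ds` (`rInt_eq`); for
the coefficients `A` and the components `B`, which are matrix elements with `l₀ = 0` at `w = -1`
(`matA_eq`, `integral_matA`), an additional factor `t` can arise from `K(0, t) = 2t`.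

*Continuation.* For large `t`, the factor `e^{-z t coth t}` is `e^{-zt}` times a convergent series in
`t e^{-2t}` and `e^{-2t}`. Expanding up to the order `M` gives finitely many Laplace transforms of
`tⁱ K(w + j, t)`, rational functions with poles on the polar hyperplanes only, and a remainder whose
integral is analytic on a convex region that grows with `M`. Since a convex open set stays connected
when the hyperplanes are removed (`isPreconnected_sdiff_polarSetW`), the resulting functions agree
where they are both defined and can be glued (`exists_glue`, `hasCont_atom`).

*Nonvanishing.* At `w = z + l₀ - 1 + 2k` the continued integral has a pole of order at most `k + 1`:
each factor `t` costs a factor `e^{-2t}`, so that the order grows with the distance from the first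
pole. The limit of `(z + l₀ - 1 + 2k - w)^{k+1} Φ(w, z)` therefore sees only the terms of the
expansion in which `t` and `e^{-2t}` occur in the combination `t e^{-2t}`; these are recorded by a
polynomial, the symbol (`HasExpansion`, `hasCont_mul_rInt`). The Chu–Vandermonde identity sums them
up (`leadSum_eq`). Up to nonzero factors, and with `L = l (l + 1)`, `L' = l' (l' + 1)`, the limit is
`(z + L k) (z + L' k) / z` for `l₀ = 0` (`reducedCoeff_zero`) and
`k (L - 2) (L' - 2) / (z + 2k)` for `l₀ = 1` (`reducedCoeff_one`); for `l₀ ≥ 2` it grows linearly in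
`k`, owing to the summand `n = -l₀` (`tendsto_reducedCoeff`). So it is nonzero for some large `k`,
unless `l₀ = 1` and `l = 1` or `l' = 1`. The projection functions with the cyclic vector `|u⟩` are
treated in the same way (`exists_cyclicCoeff_ne_zero`).

*Vanishing.* For `l₀ = l = 1` the integrand is the derivative of a constant multiple of
`b sinh² t r e^{-z t coth t}`, where `b` and `r` are the unnormalized component `B_{l',0}` and matrix
element with `n = 0` (`hasDerivAt_primitive`). This rests on three relations: the unnormalized
`B_{1,0}` is `-(t coth t)'`, the coefficients `A` with `n = ±1` are multiples of `B_{l',0} / sinh t`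
by Legendre's equation, and `(sinh² t r)'` is a combination of the matrix elements with `n = ±1`.
The case `l' = 1` follows by the symmetry that exchanges `l` and `l'` and reverses the sign of `w`
(`projCore_swap`).
-/

namespace CoulombField

open MeasureTheory Set Filter Topology BoundedContinuousFunction

/-! ### Connectedness and uniqueness off the polar hyperplanes -/

/-- Removing a countable set from a convex open set of real dimension at least two leaves a
preconnected set. Two points `a`, `b` are joined by the broken lines through `c + t y`, where `c` is
the midpoint and `y` is independent of `b - a`; distinct values of `t` give lines that meet only in
`a` and `b`, so that all but countably many of them avoid the countable set. -/
theorem isPreconnected_sdiff_countable {E : Type*} [AddCommGroup E] [Module ℝ E]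
    [TopologicalSpace E] [ContinuousAdd E] [ContinuousSMul ℝ E]
    (h : 1 < Module.rank ℝ E) {C s : Set E} (hC : Convex ℝ C) (hCo : IsOpen C)
    (hs : s.Countable) : IsPreconnected (C \ s) := by
  refine isPreconnected_of_forall_pair fun a ha b hb => ?_
  suffices H : JoinedIn (C \ s) a b by
    obtain ⟨γ, hγ⟩ := H
    refine ⟨range γ, range_subset_iff.2 hγ, ⟨0, by simp⟩, ⟨1, by simp⟩, ?_⟩
    exact isPreconnected_range γ.continuous
  rcases eq_or_ne a b with rfl | hab
  · exact JoinedIn.refl ha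
  let c := (2 : ℝ)⁻¹ • (a + b)
  let x := (2 : ℝ)⁻¹ • (b - a)
  have Ia : c - x = a := by simp only [c, x]; module
  have Ib : c + x = b := by simp only [c, x]; module
  have x_ne_zero : x ≠ 0 := by simpa [x] using sub_ne_zero.2 hab.symm
  obtain ⟨y, hy⟩ : ∃ y, LinearIndependent ℝ ![x, y] :=
    exists_linearIndependent_pair_of_one_lt_rank h x_ne_zero
  have A : Set.Countable {t : ℝ | (segment ℝ (c + x) (c + t • y) ∩ s).Nonempty} := by
    apply countable_ofPred_nonempty_of_disjoint _ (fun t ↦ inter_subset_right) hs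
    intro t t' htt'
    apply disjoint_iff_inter_eq_empty.2
    have N : {c + x} ∩ s = ∅ := by
      simpa only [singleton_inter_eq_empty, mem_compl_iff, Ib] using hb.2
    rw [inter_assoc, inter_comm s, inter_assoc, inter_self, ← inter_assoc, ← subset_empty_iff, ← N]
    apply inter_subset_inter_left
    apply Eq.subset
    apply segment_inter_eq_endpoint_of_linearIndependent_of_ne hy htt'.symm
  have B : Set.Countable {t : ℝ | (segment ℝ (c - x) (c + t • y) ∩ s).Nonempty} := by
    apply countable_ofPred_nonempty_of_disjoint _ (fun t ↦ inter_subset_right) hs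
    intro t t' htt'
    apply disjoint_iff_inter_eq_empty.2
    have N : {c - x} ∩ s = ∅ := by
      simpa only [singleton_inter_eq_empty, mem_compl_iff, Ia] using ha.2
    rw [inter_assoc, inter_comm s, inter_assoc, inter_self, ← inter_assoc, ← subset_empty_iff, ← N]
    apply inter_subset_inter_left
    rw [sub_eq_add_neg _ x]
    apply Eq.subset
    apply segment_inter_eq_endpoint_of_linearIndependent_of_ne _ htt'.symm
    convert! hy.units_smul ![-1, 1]
    simp [← List.ofFn_inj]
  have hcC : c ∈ C := by
    have := hC ha.1 hb.1 (by norm_num : (0:ℝ) ≤ 2⁻¹) (by norm_num : (0:ℝ) ≤ 2⁻¹) (by norm_num)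
    simpa [c, smul_add] using this
  have hopen : IsOpen {t : ℝ | c + t • y ∈ C} :=
    hCo.preimage (by fun_prop : Continuous fun t : ℝ => c + t • y)
  obtain ⟨t, htC, ht⟩ := ((A.union B).dense_compl ℝ).inter_open_nonempty _ hopen
    ⟨0, by simpa using hcC⟩
  let z := c + t • y
  simp only [compl_union, mem_inter_iff, mem_compl_iff, mem_ofPred_eq, not_nonempty_iff_eq_empty]
    at ht
  have JA : JoinedIn (C \ s) a z := by
    apply JoinedIn.of_segment_subset
    rw [subset_sdiff, disjoint_iff_inter_eq_empty]
    refine ⟨hC.segment_subset ha.1 htC, ?_⟩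
    convert! ht.2
    exact Ia.symm
  have JB : JoinedIn (C \ s) b z := by
    apply JoinedIn.of_segment_subset
    rw [subset_sdiff, disjoint_iff_inter_eq_empty]
    refine ⟨hC.segment_subset hb.1 htC, ?_⟩
    convert! ht.1
    exact Ib.symm
  exact JA.trans JB.symm

/-- The polar hyperplanes in the variables `(w, z)` with `w = iρ`. -/
def polarSetW : Set (ℂ × ℂ) :=
  {p | ∃ m : ℤ, -1 ≤ m ∧ (p.1 = (m : ℂ) + p.2 ∨ p.1 = -((m : ℂ) + p.2))}

theorem isClosed_polarSetW : IsClosed polarSetW := by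
  have hcl : IsClosed ((fun m : ℤ => (m : ℂ)) '' Ici (-1)) := by
    have h1 : IsClosedEmbedding (fun m : ℤ => (m : ℂ)) := Complex.isClosedEmbedding_intCast
    exact h1.isClosedMap _ isClosed_Ici
  have : polarSetW = (fun p : ℂ × ℂ => p.1 - p.2) ⁻¹' ((fun m : ℤ => (m : ℂ)) '' Ici (-1)) ∪
      (fun p : ℂ × ℂ => -p.1 - p.2) ⁻¹' ((fun m : ℤ => (m : ℂ)) '' Ici (-1)) := by
    ext p
    constructor
    · rintro ⟨m, hm, h | h⟩
      · exact Or.inl ⟨m, hm, by simp [h]⟩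
      · exact Or.inr ⟨m, hm, by simp [h]⟩
    · rintro (⟨m, hm, h⟩ | ⟨m, hm, h⟩)
      · exact ⟨m, hm, Or.inl (by simp only at h; linear_combination -h)⟩
      · exact ⟨m, hm, Or.inr (by simp only at h; linear_combination h)⟩
  rw [this]
  exact (hcl.preimage (by fun_prop)).union (hcl.preimage (by fun_prop))

/-- A convex open set minus the polar hyperplanes is preconnected: a complex line through a point off
the hyperplanes meets them in countably many points. -/
theorem isPreconnected_sdiff_polarSetW {C : Set (ℂ × ℂ)} (hC : Convex ℝ C) (hCo : IsOpen C) :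
    IsPreconnected (C \ polarSetW) := by
  refine isPreconnected_of_forall_pair fun a ha b hb => ?_
  let ψ : ℂ → ℂ × ℂ := fun t => (a.1 + t * (b.1 - a.1), a.2 + t * (b.2 - a.2))
  have hψc : Continuous ψ := by fun_prop
  have hψ0 : ψ 0 = a := by simp [ψ]
  have hψ1 : ψ 1 = b := by simp [ψ]
  have hconv : Convex ℝ (ψ ⁻¹' C) := by
    intro x hx y hy s t hs ht hst
    have := hC hx hy hs ht hst
    simp only [mem_preimage] at *
    convert this using 1
    have h1 : (s : ℂ) + t = 1 := by exact_mod_cast hst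
    apply Prod.ext
    · simp only [ψ, Prod.fst_add, Prod.smul_fst, Complex.real_smul]
      linear_combination (-a.1) * h1
    · simp only [ψ, Prod.snd_add, Prod.smul_snd, Complex.real_smul]
      linear_combination (-a.2) * h1
  have hcount : (ψ ⁻¹' polarSetW).Countable := by
    -- an affine function of `t` that does not vanish at `0` has at most one zero
    have key : ∀ α β : ℂ, α ≠ 0 → {t : ℂ | α + t * β = 0}.Countable := by
      intro α β hα
      refine Set.Subsingleton.countable fun x hx y hy => ?_
      simp only [mem_ofPred_eq] at hx hy
      have hβ : β ≠ 0 := by rintro rfl; simp at hx; exact hα hx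
      exact mul_right_cancel₀ hβ (by linear_combination hx - hy)
    have : ψ ⁻¹' polarSetW ⊆ ⋃ m : ℤ, ⋃ _ : -1 ≤ m,
        ({t : ℂ | (a.1 - (m + a.2)) + t * ((b.1 - a.1) - (b.2 - a.2)) = 0} ∪
        {t : ℂ | (a.1 + (m + a.2)) + t * ((b.1 - a.1) + (b.2 - a.2)) = 0}) := by
      rintro t ⟨m, hm, h | h⟩
      · exact mem_iUnion₂.2 ⟨m, hm, Or.inl (by
          simp only [ψ] at h; simp only [mem_ofPred_eq]; linear_combination h)⟩
      · exact mem_iUnion₂.2 ⟨m, hm, Or.inr (by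
          simp only [ψ] at h; simp only [mem_ofPred_eq]; linear_combination h)⟩
    refine Set.Countable.mono this (countable_iUnion fun m => countable_iUnion fun hm => ?_)
    refine (key _ _ ?_).union (key _ _ ?_)
    · intro h
      exact ha.2 ⟨m, hm, Or.inl (by linear_combination h)⟩
    · intro h
      exact ha.2 ⟨m, hm, Or.inr (by linear_combination h)⟩
  have hpre := isPreconnected_sdiff_countable (E := ℂ) (by simp) hconv (hCo.preimage hψc) hcount
  refine ⟨ψ '' (ψ ⁻¹' C \ ψ ⁻¹' polarSetW), ?_, ⟨0, ⟨?_, ?_⟩, hψ0⟩, ⟨1, ⟨?_, ?_⟩, hψ1⟩,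
    hpre.image _ hψc.continuousOn⟩
  · rintro _ ⟨t, ht, rfl⟩; exact ht
  · simpa [hψ0] using ha.1
  · simpa [hψ0] using ha.2
  · simpa [hψ1] using hb.1
  · simpa [hψ1] using hb.2

/-- The tube `|Re w| + 1 < Re z` in the variables `(w, z)`. -/
def tubeW : Set (ℂ × ℂ) := {p | |p.1.re| + 1 < p.2.re}

/-- The increasing convex regions `|Re w| < Re z + J`. -/
def region (J : ℕ) : Set (ℂ × ℂ) := {p | |p.1.re| < p.2.re + J}

theorem isOpen_region (J : ℕ) : IsOpen (region J) :=
  isOpen_lt (by fun_prop) (by fun_prop)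

theorem isOpen_tubeW : IsOpen tubeW := isOpen_lt (by fun_prop) (by fun_prop)

theorem convex_region (J : ℕ) : Convex ℝ (region J) := by
  intro x hx y hy s t hs ht hst
  simp only [region, mem_ofPred_eq, Prod.fst_add, Prod.smul_fst, Prod.snd_add, Prod.smul_snd,
    Complex.add_re, Complex.real_smul, Complex.mul_re, Complex.ofReal_re, Complex.ofReal_im,
    zero_mul, sub_zero] at *
  rw [abs_lt] at *
  have e : (J : ℝ) = s * J + t * J := by rw [← add_mul, hst, one_mul]
  rcases hs.eq_or_lt with rfl | hs'
  · have : t = 1 := by linarith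
    subst this; constructor <;> linarith [hy.1, hy.2]
  · have h1 := mul_lt_mul_of_pos_left hx.1 hs'
    have h2 := mul_lt_mul_of_pos_left hx.2 hs'
    have h3 := mul_le_mul_of_nonneg_left hy.1.le ht
    have h4 := mul_le_mul_of_nonneg_left hy.2.le ht
    constructor <;> rw [e] <;> linarith

theorem tubeW_subset_region (J : ℕ) : tubeW ⊆ region J := by
  intro p hp
  simp only [tubeW, region, mem_ofPred_eq] at *
  have : (0 : ℝ) ≤ J := J.cast_nonneg
  linarith

theorem region_mono {J K : ℕ} (h : J ≤ K) : region J ⊆ region K := by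
  intro p hp
  simp only [region, mem_ofPred_eq] at *
  have : (J : ℝ) ≤ K := by exact_mod_cast h
  linarith

theorem exists_mem_region (p : ℂ × ℂ) : ∃ J, p ∈ region J := by
  obtain ⟨J, hJ⟩ := exists_nat_gt (|p.1.re| - p.2.re)
  exact ⟨J, by simp only [region, mem_ofPred_eq]; linarith⟩

theorem tubeW_disjoint_polarSetW : Disjoint tubeW polarSetW := by
  rw [Set.disjoint_left]
  rintro p hp ⟨m, hm, h⟩
  have hm' : (-1 : ℝ) ≤ m := by exact_mod_cast hm
  simp only [tubeW, mem_ofPred_eq] at hp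
  have h1 := le_abs_self p.1.re
  have h2 := neg_le_abs p.1.re
  rcases h with h | h <;> rw [h] at h1 h2 hp <;> simp at h1 h2 hp <;> linarith

/-- Two analytic functions off the polar hyperplanes of a convex open set that agree on the tube
agree everywhere. -/
theorem eqOn_of_eqOn_tubeW {C : Set (ℂ × ℂ)} (hC : Convex ℝ C) (hCo : IsOpen C)
    (hsub : tubeW ⊆ C) {F G : ℂ × ℂ → ℂ} (hF : AnalyticOnNhd ℂ F (C \ polarSetW))
    (hG : AnalyticOnNhd ℂ G (C \ polarSetW)) (h : EqOn F G tubeW) :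
    EqOn F G (C \ polarSetW) := by
  -- the tube is nonempty, so that the two functions have the same germ at a point of it
  have h0 : ((0 : ℂ), (2 : ℂ)) ∈ tubeW := by simp [tubeW]
  refine hF.eqOn_of_preconnected_of_eventuallyEq hG (isPreconnected_sdiff_polarSetW hC hCo)
    (z₀ := (0, 2)) ⟨hsub h0, Set.disjoint_left.1 tubeW_disjoint_polarSetW h0⟩ ?_
  exact h.eventuallyEq_of_mem (isOpen_tubeW.mem_nhds h0)

/-- Gluing: analytic functions on the regions that agree on the tube come from one function. -/
theorem exists_glue {F : ℕ → ℂ × ℂ → ℂ}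
    (hF : ∀ J, AnalyticOnNhd ℂ (F J) (region J \ polarSetW))
    (h : ∀ J, EqOn (F J) (F 0) tubeW) :
    ∃ Φ : ℂ × ℂ → ℂ, AnalyticOnNhd ℂ Φ polarSetWᶜ ∧
      ∀ J, EqOn Φ (F J) (region J \ polarSetW) := by
  classical
  -- the regions increase and are convex, so uniqueness applies on the smaller one
  have agree : ∀ {J K}, J ≤ K → EqOn (F J) (F K) (region J \ polarSetW) := fun {J K} hJK =>
    eqOn_of_eqOn_tubeW (convex_region J) (isOpen_region J) (tubeW_subset_region J) (hF J)
      ((hF K).mono (sdiff_subset_sdiff_left (region_mono hJK)))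
      ((h J).trans (h K).symm)
  have hΦ : ∀ J, EqOn (fun p => F (Nat.find (exists_mem_region p)) p) (F J)
      (region J \ polarSetW) := by
    intro J p hp
    exact agree (Nat.find_min' _ hp.1) ⟨Nat.find_spec (exists_mem_region p), hp.2⟩
  refine ⟨fun p => F (Nat.find (exists_mem_region p)) p, fun p hp => ?_, hΦ⟩
  obtain ⟨J, hJ⟩ := exists_mem_region p
  refine (hF J p ⟨hJ, hp⟩).congr ?_
  exact ((hΦ J).symm.eventuallyEq_of_mem
    (((isOpen_region J).sdiff isClosed_polarSetW).mem_nhds ⟨hJ, hp⟩))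

/-! ### Analytic dependence of integrals on two complex parameters -/

/-- The Cauchy kernel `z ↦ 1 / (E - z)` is analytic as a map to the Banach algebra of bounded
continuous functions, because it is an inverse in that algebra. -/
theorem analyticAt_boundedKernel {X : Type*} [TopologicalSpace X] (E : X →ᵇ ℂ) (z₀ : ℂ) {δ : ℝ}
    (hδ : 0 < δ) (h : ∀ᶠ z in 𝓝 z₀, ∀ x, δ ≤ ‖E x - z‖) :
    ∃ k : ℂ → X →ᵇ ℂ, AnalyticAt ℂ k z₀ ∧ ∀ᶠ z in 𝓝 z₀, ∀ x, k z x = (E x - z)⁻¹ := by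
  have hu : ∀ z, (∀ x, δ ≤ ‖E x - z‖) → ∃ u : (X →ᵇ ℂ)ˣ, (u : X →ᵇ ℂ) = E - z • 1 ∧
      ∀ x, ((u⁻¹ : (X →ᵇ ℂ)ˣ) : X →ᵇ ℂ) x = (E x - z)⁻¹ := by
    intro z hz
    have hne : ∀ x, E x - z ≠ 0 := fun x hx => by
      have := hz x; rw [hx, norm_zero] at this; linarith
    let g : X →ᵇ ℂ := BoundedContinuousFunction.ofNormedAddCommGroup (fun x => (E x - z)⁻¹)
      ((E.continuous.sub continuous_const).inv₀ hne) δ⁻¹ (fun x => by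
        rw [norm_inv]; exact inv_anti₀ hδ (hz x))
    refine ⟨⟨E - z • 1, g, ?_, ?_⟩, rfl, fun x => rfl⟩ <;> ext x <;>
      simp [g, hne x]
  refine ⟨fun z => Ring.inverse (E - z • (1 : X →ᵇ ℂ)), ?_, ?_⟩
  · obtain ⟨u, hu1, -⟩ := hu z₀ h.self_of_nhds
    have h1 : AnalyticAt ℂ Ring.inverse (E - z₀ • (1 : X →ᵇ ℂ)) := by
      rw [← hu1]; exact analyticAt_inverse u
    exact AnalyticAt.fun_comp (f := fun z : ℂ => E - z • (1 : X →ᵇ ℂ)) h1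
      (analyticAt_const.sub (analyticAt_id.smul analyticAt_const))
  · filter_upwards [h] with z hz x
    obtain ⟨u, hu1, hu2⟩ := hu z hz
    rw [← hu1, Ring.inverse_unit, hu2]

/-- Integration against an integrable function, as a functional on bounded continuous functions. -/
theorem exists_integralFunctional {X : Type*} [TopologicalSpace X] [MeasurableSpace X]
    [OpensMeasurableSpace X] {μ : Measure X} {g : X → ℂ} (hg : Integrable g μ) :
    ∃ Λ : (X →ᵇ ℂ) →L[ℂ] ℂ, ∀ h, Λ h = ∫ x, g x * h x ∂μ := by
  have hint : ∀ h : X →ᵇ ℂ, Integrable (fun x => g x * h x) μ := fun h =>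
    hg.mul_bdd (c := ‖h‖) h.continuous.measurable.aestronglyMeasurable
      (Eventually.of_forall fun x => h.norm_coe_le_norm x)
  refine ⟨LinearMap.mkContinuous
    { toFun := fun h => ∫ x, g x * h x ∂μ
      map_add' := fun h k => by
        simp only [BoundedContinuousFunction.coe_add, Pi.add_apply, mul_add]
        exact integral_add (hint h) (hint k)
      map_smul' := fun c h => by
        simp only [BoundedContinuousFunction.coe_smul, smul_eq_mul, RingHom.id_apply]
        rw [← integral_const_mul]
        congr 1; ext x; ring } (∫ x, ‖g x‖ ∂μ) fun h => ?_, fun h => rfl⟩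
  calc ‖∫ x, g x * h x ∂μ‖ ≤ ∫ x, ‖g x * h x‖ ∂μ := norm_integral_le_integral_norm _
    _ ≤ ∫ x, ‖g x‖ * ‖h‖ ∂μ := by
        refine integral_mono (hint h).norm (hg.norm.mul_const _) fun x => ?_
        simp only [norm_mul]
        gcongr
        exact h.norm_coe_le_norm x
    _ = _ := by rw [integral_mul_const]

/-- Osgood's lemma in two variables: a continuous function that is separately holomorphic is jointly
analytic. On a bidisc it is a continuous linear functional of the product of two Cauchy kernels,
and the kernels are analytic maps to the bounded continuous functions on the torus. -/
theorem analyticOnNhd_of_separately {f : ℂ × ℂ → ℂ} {U : Set (ℂ × ℂ)} (hU : IsOpen U)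
    (hf : ContinuousOn f U)
    (h1 : ∀ p ∈ U, DifferentiableAt ℂ (fun z => f (z, p.2)) p.1)
    (h2 : ∀ p ∈ U, DifferentiableAt ℂ (fun w => f (p.1, w)) p.2) :
    AnalyticOnNhd ℂ f U := by
  rintro ⟨a, b⟩ hab
  obtain ⟨R, hR, hRU⟩ : ∃ R > 0, ∀ z ∈ Metric.closedBall a R, ∀ w ∈ Metric.closedBall b R,
      (z, w) ∈ U := by
    obtain ⟨ε, hε, hsub⟩ := Metric.isOpen_iff.1 hU _ hab
    refine ⟨ε / 2, by positivity, fun z hz w hw => hsub ?_⟩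
    rw [← ball_prod_same]
    rw [Metric.mem_closedBall] at hz hw
    exact ⟨by rw [Metric.mem_ball]; linarith, by rw [Metric.mem_ball]; linarith⟩
  -- the evaluation functions on the torus
  have bound : ∀ (c : ℂ) (θ : ℝ), ‖circleMap c R θ‖ ≤ ‖c‖ + R := fun c θ => by
    have h := circleMap_mem_sphere c hR.le θ
    rw [mem_sphere_iff_norm] at h
    calc ‖circleMap c R θ‖ = ‖c + (circleMap c R θ - c)‖ := by ring_nf
      _ ≤ _ := (norm_add_le _ _).trans (by rw [h])
  let E1 : ℝ × ℝ →ᵇ ℂ := BoundedContinuousFunction.ofNormedAddCommGroup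
    (fun x => circleMap a R x.1) (by fun_prop) (‖a‖ + R) (fun x => bound a _)
  let E2 : ℝ × ℝ →ᵇ ℂ := BoundedContinuousFunction.ofNormedAddCommGroup
    (fun x => circleMap b R x.2) (by fun_prop) (‖b‖ + R) (fun x => bound b _)
  have far : ∀ c : ℂ, ∀ᶠ z in 𝓝 c, ∀ θ, R / 2 ≤ ‖circleMap c R θ - z‖ := fun c => by
    filter_upwards [Metric.ball_mem_nhds c (half_pos hR)] with z hz θ
    have h := circleMap_mem_sphere c hR.le θ
    rw [mem_sphere_iff_norm] at h
    rw [mem_ball_iff_norm] at hz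
    have : ‖circleMap c R θ - c‖ ≤ ‖circleMap c R θ - z‖ + ‖z - c‖ := by
      rw [← sub_add_sub_cancel (circleMap c R θ) z c]; exact norm_add_le _ _
    linarith
  obtain ⟨k1, hk1, hk1'⟩ := analyticAt_boundedKernel E1 a (half_pos hR)
    ((far a).mono fun z hz x => hz x.1)
  obtain ⟨k2, hk2, hk2'⟩ := analyticAt_boundedKernel E2 b (half_pos hR)
    ((far b).mono fun z hz x => hz x.2)
  let g : ℝ × ℝ → ℂ := fun x => deriv (circleMap a R) x.1 * deriv (circleMap b R) x.2 *
    f (circleMap a R x.1, circleMap b R x.2)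
  have hmem : ∀ (c : ℂ) θ, circleMap c R θ ∈ Metric.closedBall c R := fun c θ =>
    circleMap_mem_closedBall c hR.le θ
  have hg : Continuous g := by
    refine Continuous.mul ?_ (hf.comp_continuous (by fun_prop) fun x => hRU _ (hmem a _) _ (hmem b _))
    simp only [deriv_circleMap]
    fun_prop
  let I : Set ℝ := Ioc 0 (2 * Real.pi)
  let μ : Measure (ℝ × ℝ) := (volume.restrict I).prod (volume.restrict I)
  have hcont_int : ∀ G : ℝ × ℝ → ℂ, Continuous G → Integrable G μ := fun G hG => by
    simp only [μ, Measure.prod_restrict]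
    exact (hG.continuousOn.integrableOn_compact
      (isCompact_Icc.prod isCompact_Icc)).mono_set
        (Set.prod_mono Ioc_subset_Icc_self Ioc_subset_Icc_self)
  obtain ⟨Λ, hΛ⟩ := exists_integralFunctional (hcont_int g hg)
  have hana : AnalyticAt ℂ (fun p : ℂ × ℂ =>
      (2 * Real.pi * Complex.I : ℂ)⁻¹ * ((2 * Real.pi * Complex.I : ℂ)⁻¹ *
        Λ (k1 p.1 * k2 p.2))) (a, b) := by
    have h1 : AnalyticAt ℂ (fun p : ℂ × ℂ => k1 p.1) (a, b) := AnalyticAt.fun_comp hk1 analyticAt_fst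
    have h2 : AnalyticAt ℂ (fun p : ℂ × ℂ => k2 p.2) (a, b) := AnalyticAt.fun_comp hk2 analyticAt_snd
    exact analyticAt_const.mul (analyticAt_const.mul ((Λ.analyticAt _).fun_comp (h1.mul h2)))
  refine hana.congr ?_
  have hz : ∀ᶠ p : ℂ × ℂ in 𝓝 (a, b), p.1 ∈ Metric.ball a R ∧ p.2 ∈ Metric.ball b R ∧
      (∀ x, k1 p.1 x = (E1 x - p.1)⁻¹) ∧ (∀ x, k2 p.2 x = (E2 x - p.2)⁻¹) := by
    have t1 : Tendsto (Prod.fst : ℂ × ℂ → ℂ) (𝓝 (a, b)) (𝓝 a) := continuous_fst.tendsto _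
    have t2 : Tendsto (Prod.snd : ℂ × ℂ → ℂ) (𝓝 (a, b)) (𝓝 b) := continuous_snd.tendsto _
    filter_upwards [t1.eventually (Metric.ball_mem_nhds a hR),
      t2.eventually (Metric.ball_mem_nhds b hR), t1.eventually hk1', t2.eventually hk2']
      with p e1 e2 e3 e4 using ⟨e1, e2, e3, e4⟩
  filter_upwards [hz] with p hp
  obtain ⟨hp1, hp2, hp3, hp4⟩ := hp
  -- the iterated Cauchy formula
  have inner : ∀ ζ ∈ Metric.closedBall a R, f (ζ, p.2) = (2 * Real.pi * Complex.I : ℂ)⁻¹ *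
      ∫ t in (0)..(2 * Real.pi), deriv (circleMap b R) t *
        ((circleMap b R t - p.2)⁻¹ * f (ζ, circleMap b R t)) := by
    intro ζ hζ
    have := Complex.two_pi_I_inv_smul_circleIntegral_sub_inv_smul_of_differentiable_on_off_countable
      countable_empty hp2 (f := fun w => f (ζ, w))
      (hf.comp (by fun_prop) fun w hw => hRU _ hζ _ hw)
      (fun w hw => h2 (ζ, w) (hRU _ hζ _ (Metric.ball_subset_closedBall hw.1)))
    rw [← this]; rfl
  have outer := Complex.two_pi_I_inv_smul_circleIntegral_sub_inv_smul_of_differentiable_on_off_countable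
      countable_empty hp1 (f := fun z => f (z, p.2))
      (hf.comp (by fun_prop) fun z hz => hRU _ hz _ (Metric.ball_subset_closedBall hp2))
      (fun z hz => h1 (z, p.2) (hRU _ (Metric.ball_subset_closedBall hz.1) _
        (Metric.ball_subset_closedBall hp2)))
  have hcont : Continuous fun x => g x * (k1 p.1 * k2 p.2) x :=
    hg.mul (k1 p.1 * k2 p.2).continuous
  have hpe : f p = f (p.1, p.2) := rfl
  rw [hΛ, integral_prod _ (hcont_int _ hcont), hpe, ← outer]
  simp only [circleIntegral, smul_eq_mul]
  congr 1
  rw [intervalIntegral.integral_of_le (by positivity), ← integral_const_mul]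
  refine integral_congr_ae (Eventually.of_forall fun θ => ?_)
  simp only
  rw [inner _ (hmem a θ), intervalIntegral.integral_of_le (by positivity)]
  have hin : ∫ y in I, g (θ, y) * (k1 p.1 * k2 p.2) (θ, y) =
      deriv (circleMap a R) θ * ((circleMap a R θ - p.1)⁻¹ *
        ∫ y in I, deriv (circleMap b R) y *
          ((circleMap b R y - p.2)⁻¹ * f (circleMap a R θ, circleMap b R y))) := by
    rw [← integral_const_mul, ← integral_const_mul]
    refine integral_congr_ae (Eventually.of_forall fun t => ?_)
    simp only [g, BoundedContinuousFunction.mul_apply, hp3, hp4]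
    simp only [E1, E2, BoundedContinuousFunction.coe_ofNormedAddCommGroup]
    ring
  rw [hin]
  ring

/-- Holomorphic dependence of an integral on a parameter. No bound on the derivative is needed: Cauchy's
estimate on discs of radius `ε / 2` gives it. -/
theorem differentiableAt_integral_of_dominated {α : Type*} [MeasurableSpace α] {μ : Measure α}
    {f : ℂ → α → ℂ} {z₀ : ℂ} {U : Set ℂ} (hU : U ∈ 𝓝 z₀)
    (hm : ∀ z ∈ U, AEStronglyMeasurable (f z) μ)
    (hd : ∀ᵐ x ∂μ, ∀ z ∈ U, DifferentiableAt ℂ (fun z => f z x) z)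
    {g : α → ℝ} (hg : Integrable g μ) (hb : ∀ᵐ x ∂μ, ∀ z ∈ U, ‖f z x‖ ≤ g x) :
    DifferentiableAt ℂ (fun z => ∫ x, f z x ∂μ) z₀ := by
  obtain ⟨ε, hε, hsub⟩ := Metric.mem_nhds_iff.1 hU
  have hz₀ : z₀ ∈ U := mem_of_mem_nhds hU
  have hball : Metric.ball z₀ (ε / 2) ∈ 𝓝 z₀ := Metric.ball_mem_nhds _ (half_pos hε)
  -- the derivative is a pointwise limit of difference quotients, hence measurable
  have hmeas' : AEStronglyMeasurable (fun x => deriv (fun z => f z x) z₀) μ := by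
    let δ : ℕ → ℂ := fun n => ((ε / 2 / (n + 1) : ℝ) : ℂ)
    have hδ0 : Tendsto δ atTop (𝓝[≠] 0) := by
      refine tendsto_nhdsWithin_iff.2 ⟨?_, Eventually.of_forall fun n => ?_⟩
      · have : Tendsto (fun n : ℕ => (ε / 2 / (n + 1) : ℝ)) atTop (𝓝 0) :=
          by simpa [div_eq_mul_inv] using
            (tendsto_one_div_add_atTop_nhds_zero_nat (𝕜 := ℝ)).const_mul (ε / 2)
        exact (Complex.continuous_ofReal.tendsto' 0 0 (by simp)).comp this
      · simp only [δ, mem_compl_iff, mem_singleton_iff, Complex.ofReal_eq_zero]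
        positivity
    refine aestronglyMeasurable_of_tendsto_ae atTop
      (f := fun n x => (δ n)⁻¹ • (f (z₀ + δ n) x - f z₀ x)) (fun n => ?_) ?_
    · refine AEStronglyMeasurable.const_smul (𝕜 := ℂ) (f := fun x => f (z₀ + δ n) x - f z₀ x)
        ((hm _ (hsub ?_)).sub (hm _ hz₀)) (δ n)⁻¹
      have h0 : (0 : ℝ) ≤ ε / 2 / (n + 1) := by positivity
      have h1 : ε / 2 / (n + 1) ≤ ε / 2 := div_le_self (by positivity) (by linarith [n.cast_nonneg (α := ℝ)])
      simp only [δ, Metric.mem_ball, dist_eq_norm, add_sub_cancel_left, Complex.norm_real,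
        Real.norm_of_nonneg h0]
      linarith
    · filter_upwards [hd] with x hx
      exact ((hx z₀ hz₀).hasDerivAt.tendsto_slope_zero).comp hδ0
  refine (hasDerivAt_integral_of_dominated_loc_of_deriv_le (F' := fun z x => deriv (fun z => f z x) z)
    (bound := fun x => g x / (ε / 2)) hball ?_ ?_ hmeas' ?_ (hg.div_const _) ?_).2.differentiableAt
  · filter_upwards [hU] with z hz using hm z hz
  · exact hg.mono' (hm _ hz₀) (hb.mono fun x hx => hx _ hz₀)
  · filter_upwards [hd, hb] with x hx hbx z hz
    have hin : ∀ y ∈ Metric.closedBall z (ε / 2), y ∈ U := fun y hy => hsub (by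
      rw [Metric.mem_ball] at hz ⊢
      rw [Metric.mem_closedBall] at hy
      linarith [dist_triangle y z z₀])
    -- Cauchy’s estimate
    refine Complex.norm_deriv_le_of_forall_mem_sphere_norm_le (half_pos hε) ?_
      fun y hy => hbx y (hin y (Metric.sphere_subset_closedBall hy))
    refine DifferentiableOn.diffContOnCl fun y hy => ?_
    rw [closure_ball _ (half_pos hε).ne'] at hy
    exact (hx y (hin y hy)).differentiableWithinAt
  · filter_upwards [hd] with x hx z hz
    refine (hx z (hsub ?_)).hasDerivAt
    rw [Metric.mem_ball] at hz ⊢; linarith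

/-- Integrals that depend analytically on two complex parameters, under local domination. -/
theorem analyticOnNhd_integral {α : Type*} [MeasurableSpace α] {μ : Measure α}
    {f : ℂ × ℂ → α → ℂ} {U : Set (ℂ × ℂ)} (hU : IsOpen U)
    (hm : ∀ p ∈ U, AEStronglyMeasurable (f p) μ)
    (hd : ∀ᵐ x ∂μ, ∀ p ∈ U, DifferentiableAt ℂ (fun p => f p x) p)
    (hb : ∀ p ∈ U, ∃ g : α → ℝ, Integrable g μ ∧ ∃ V ∈ 𝓝 p, ∀ᵐ x ∂μ, ∀ q ∈ V, ‖f q x‖ ≤ g x) :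
    AnalyticOnNhd ℂ (fun p => ∫ x, f p x ∂μ) U := by
  refine analyticOnNhd_of_separately hU (fun p hp => ContinuousAt.continuousWithinAt ?_) ?_ ?_
  · obtain ⟨g, hg, V, hV, hbV⟩ := hb p hp
    refine continuousAt_of_dominated (bound := g) ?_ ?_ hg ?_
    · filter_upwards [hU.mem_nhds hp] with q hq using hm q hq
    · filter_upwards [hV] with q hq
      filter_upwards [hbV] with x hx using hx q hq
    · filter_upwards [hd] with x hx using (hx p hp).continuousAt
  · intro p hp
    obtain ⟨g, hg, V, hV, hbV⟩ := hb p hp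
    have hc : ContinuousAt (fun z : ℂ => (z, p.2)) p.1 := by fun_prop
    refine differentiableAt_integral_of_dominated
      (U := (fun z : ℂ => (z, p.2)) ⁻¹' (U ∩ V))
      (hc.preimage_mem_nhds (inter_mem (hU.mem_nhds hp) hV)) (fun z hz => hm _ hz.1) ?_ hg ?_
    · filter_upwards [hd] with x hx z hz
      exact (hx _ hz.1).comp z (by fun_prop : DifferentiableAt ℂ (fun z : ℂ => (z, p.2)) z)
    · filter_upwards [hbV] with x hx z hz using hx _ hz.2
  · intro p hp
    obtain ⟨g, hg, V, hV, hbV⟩ := hb p hp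
    have hc : ContinuousAt (fun z : ℂ => (p.1, z)) p.2 := by fun_prop
    refine differentiableAt_integral_of_dominated
      (U := (fun z : ℂ => (p.1, z)) ⁻¹' (U ∩ V))
      (hc.preimage_mem_nhds (inter_mem (hU.mem_nhds hp) hV)) (fun z hz => hm _ hz.1) ?_ hg ?_
    · filter_upwards [hd] with x hx z hz
      exact (hx _ hz.1).comp z (by fun_prop : DifferentiableAt ℂ (fun z : ℂ => (p.1, z)) z)
    · filter_upwards [hbV] with x hx z hz using hx _ hz.2

/-! ### The exponential kernel and its Laplace transforms -/

/-- `expKernel a t = ∫_{-t}^{t} e^{as} ds`, that is `2 sinh (a t) / a`, entire in `a`. -/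
noncomputable def expKernel (a : ℂ) (t : ℝ) : ℂ := ∫ s in (-t)..t, Complex.exp (a * s)

theorem expKernel_of_ne_zero {a : ℂ} (ha : a ≠ 0) (t : ℝ) :
    expKernel a t = (Complex.exp (a * t) - Complex.exp (-(a * t))) / a := by
  rw [expKernel, integral_exp_mul_complex ha]
  push_cast
  ring_nf

theorem expKernel_zero (t : ℝ) : expKernel 0 t = 2 * t := by
  simp [expKernel]; ring

theorem norm_expKernel_le (a : ℂ) {t : ℝ} (ht : 0 ≤ t) :
    ‖expKernel a t‖ ≤ 2 * t * Real.exp (|a.re| * t) := by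
  have := intervalIntegral.norm_integral_le_of_norm_le_const (a := -t) (b := t)
    (f := fun s : ℝ => Complex.exp (a * s)) (C := Real.exp (|a.re| * t)) (fun s hs => by
      rw [uIoc_of_le (by linarith)] at hs
      rw [Complex.norm_exp]
      refine Real.exp_le_exp.2 ?_
      simp only [Complex.mul_re, Complex.ofReal_re, Complex.ofReal_im, mul_zero, sub_zero]
      calc a.re * s ≤ |a.re * s| := le_abs_self _
        _ = |a.re| * |s| := abs_mul _ _
        _ ≤ _ := by
          gcongr
          exact abs_le.2 ⟨hs.1.le, hs.2⟩)
  refine this.trans (le_of_eq ?_)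
  rw [abs_of_nonneg (by linarith : (0 : ℝ) ≤ t - -t)]; ring

theorem continuous_expKernel (a : ℂ) : Continuous (expKernel a) := by
  have hc : Continuous fun s : ℝ => Complex.exp (a * s) := by fun_prop
  have h := intervalIntegral.continuous_primitive (μ := volume)
    (f := fun s : ℝ => Complex.exp (a * s)) (fun a b => hc.intervalIntegrable a b) 0
  have : expKernel a = fun t => (∫ s in (0 : ℝ)..t, Complex.exp (a * s)) -
      ∫ s in (0 : ℝ)..(-t), Complex.exp (a * s) := by
    ext t
    rw [expKernel, intervalIntegral.integral_interval_sub_left (hc.intervalIntegrable _ _)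
      (hc.intervalIntegrable _ _)]
  rw [this]
  exact h.sub (h.comp continuous_neg)

theorem differentiable_expKernel {t : ℝ} (ht : 0 ≤ t) : Differentiable ℂ fun a => expKernel a t := by
  intro a
  simp only [expKernel, intervalIntegral.integral_of_le (show -t ≤ t by linarith)]
  refine differentiableAt_integral_of_dominated (U := Metric.ball a 1)
    (Metric.ball_mem_nhds _ one_pos) (fun z _ => (by fun_prop : Continuous fun s : ℝ =>
      Complex.exp (z * s)).aestronglyMeasurable) (Eventually.of_forall fun s z _ => by fun_prop)
    (g := fun _ => Real.exp ((‖a‖ + 1) * t)) (integrableOn_const (by simp)) ?_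
  refine (ae_restrict_iff' measurableSet_Ioc).2 (Eventually.of_forall fun s hs z hz => ?_)
  rw [Complex.norm_exp]
  refine Real.exp_le_exp.2 ((Complex.re_le_norm _).trans ?_)
  rw [norm_mul, Complex.norm_real, Real.norm_eq_abs]
  have h1 : ‖z‖ ≤ ‖a‖ + 1 := by
    rw [mem_ball_iff_norm] at hz
    calc ‖z‖ = ‖a + (z - a)‖ := by ring_nf
      _ ≤ ‖a‖ + ‖z - a‖ := norm_add_le _ _
      _ ≤ _ := by linarith
  have h2 : |s| ≤ t := abs_le.2 ⟨hs.1.le, hs.2⟩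
  gcongr

theorem integrableOn_pow_mul_exp (i : ℕ) {r : ℝ} (hr : 0 < r) :
    IntegrableOn (fun t : ℝ => t ^ i * Real.exp (-r * t)) (Ioi 0) := by
  have := integrableOn_rpow_mul_exp_neg_mul_rpow (p := 1) (s := i) (b := r)
    (by linarith [i.cast_nonneg (α := ℝ)]) one_pos hr
  simpa using this

theorem integrableOn_pow_mul_cexp (i : ℕ) {c : ℂ} (hc : 0 < c.re) :
    IntegrableOn (fun t : ℝ => (t : ℂ) ^ i * Complex.exp (-c * t)) (Ioi 0) := by
  refine (integrableOn_pow_mul_exp i hc).mono' (by fun_prop) ?_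
  refine (ae_restrict_iff' measurableSet_Ioi).2 (Eventually.of_forall fun t ht => ?_)
  rw [norm_mul, norm_pow, Complex.norm_real, Complex.norm_exp, Real.norm_of_nonneg (le_of_lt ht)]
  simp

theorem integral_pow_mul_cexp (i : ℕ) {c : ℂ} (hc : 0 < c.re) :
    ∫ t in Ioi (0 : ℝ), (t : ℂ) ^ i * Complex.exp (-c * t) = i ! / c ^ (i + 1) := by
  have hc0 : c ≠ 0 := by rintro rfl; simp at hc
  induction i with
  | zero =>
    simp only [pow_zero, one_mul]
    rw [integral_exp_mul_complex_Ioi (by simpa using hc)]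
    simp
  | succ i ih =>
    have hder : ∀ t ∈ Ioi (0 : ℝ), HasDerivAt (fun t : ℝ => (t : ℂ) ^ (i + 1) * Complex.exp (-c * t))
        ((i + 1 : ℂ) * ((t : ℂ) ^ i * Complex.exp (-c * t)) -
          c * ((t : ℂ) ^ (i + 1) * Complex.exp (-c * t))) t := fun t _ => by
      have h1 : HasDerivAt (fun t : ℝ => (t : ℂ)) 1 t := Complex.ofRealCLM.hasDerivAt
      have h2 := (h1.fun_pow (i + 1)).mul ((h1.const_mul (-c)).cexp)
      convert! h2 using 1
      push_cast
      simp
      ring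
    have hint1 := integrableOn_pow_mul_cexp i hc
    have hint2 := integrableOn_pow_mul_cexp (i + 1) hc
    have hlim : Tendsto (fun t : ℝ => (t : ℂ) ^ (i + 1) * Complex.exp (-c * t)) atTop (𝓝 0) := by
      rw [tendsto_zero_iff_norm_tendsto_zero]
      have := tendsto_rpow_mul_exp_neg_mul_atTop_nhds_zero ((i + 1 : ℕ) : ℝ) c.re hc
      refine this.congr' ?_
      filter_upwards [eventually_gt_atTop 0] with t ht
      rw [norm_mul, norm_pow, Complex.norm_real, Complex.norm_exp, Real.norm_of_nonneg (le_of_lt ht)]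
      simp only [Real.rpow_natCast]
      simp
    have := integral_Ioi_of_hasDerivAt_of_tendsto
      (f := fun t : ℝ => (t : ℂ) ^ (i + 1) * Complex.exp (-c * t)) (a := 0) (m := 0)
      (by fun_prop) hder ((hint1.const_mul _).sub (hint2.const_mul _)) hlim
    rw [integral_sub (hint1.const_mul _) (hint2.const_mul _), integral_const_mul,
      integral_const_mul, ih] at this
    simp only [Complex.ofReal_zero, ne_eq, Nat.add_eq_zero_iff, one_ne_zero, and_false,
      not_false_eq_true, zero_pow, zero_mul, sub_self] at this
    have h3 : c * ∫ t in Ioi (0 : ℝ), (t : ℂ) ^ (i + 1) * Complex.exp (-c * t) =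
        (i + 1 : ℂ) * (i ! / c ^ (i + 1)) := by linear_combination -this
    rw [← mul_right_inj' hc0, h3, Nat.factorial_succ]
    push_cast
    field_simp
    ring

/-- The Laplace transform `∫₀^∞ tⁱ expKernel a t e^{-bt} dt` as a rational function of `b ± a`. -/
noncomputable def laplaceKernel (i : ℕ) (a b : ℂ) : ℂ :=
  2 * i ! * ∑ r ∈ Finset.range (i + 1), ((b - a) ^ (r + 1))⁻¹ * ((b + a) ^ (i + 1 - r))⁻¹

theorem norm_exp_le_of_abs_re {a b : ℂ} {t : ℝ} (ht : 0 ≤ t) (i : ℕ) :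
    ‖(t : ℂ) ^ i * expKernel a t * Complex.exp (-b * t)‖ ≤
      2 * (t ^ (i + 1) * Real.exp (-(b.re - |a.re|) * t)) := by
  rw [norm_mul, norm_mul, norm_pow, Complex.norm_real, Complex.norm_exp, Real.norm_of_nonneg ht]
  calc t ^ i * ‖expKernel a t‖ * Real.exp (-b * t : ℂ).re
      ≤ t ^ i * (2 * t * Real.exp (|a.re| * t)) * Real.exp (-b * t : ℂ).re := by
        gcongr; exact norm_expKernel_le a ht
    _ = 2 * (t ^ (i + 1) * (Real.exp (|a.re| * t) * Real.exp (-b.re * t))) := by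
        simp; ring
    _ = _ := by rw [← Real.exp_add]; ring_nf

theorem integrableOn_expKernel (i : ℕ) {a b : ℂ} (h : |a.re| < b.re) :
    IntegrableOn (fun t : ℝ => (t : ℂ) ^ i * expKernel a t * Complex.exp (-b * t)) (Ioi 0) := by
  refine ((integrableOn_pow_mul_exp (i + 1) (sub_pos.2 h)).const_mul 2).mono'
    (((by fun_prop : Continuous fun t : ℝ => (t : ℂ) ^ i).mul (continuous_expKernel a)).mul
      (by fun_prop)).aestronglyMeasurable ?_
  exact (ae_restrict_iff' measurableSet_Ioi).2 (Eventually.of_forall fun t ht =>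
    norm_exp_le_of_abs_re (le_of_lt ht) i)

theorem integral_expKernel (i : ℕ) {a b : ℂ} (h : |a.re| < b.re) :
    ∫ t in Ioi (0 : ℝ), (t : ℂ) ^ i * expKernel a t * Complex.exp (-b * t) =
      laplaceKernel i a b := by
  have h1 : 0 < (b - a).re := by simp; linarith [le_abs_self a.re]
  have h2 : 0 < (b + a).re := by simp; linarith [neg_le_abs a.re]
  have h10 : b - a ≠ 0 := by intro h; rw [h] at h1; simp at h1
  have h20 : b + a ≠ 0 := by intro h; rw [h] at h2; simp at h2
  -- at `a = 0` the kernel is `2t`, and all terms of `laplaceKernel` coincide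
  rcases eq_or_ne a 0 with rfl | ha
  · simp only [expKernel_zero, laplaceKernel, sub_zero, add_zero] at *
    have : ∀ t : ℝ, (t : ℂ) ^ i * (2 * t) * Complex.exp (-b * t) =
        2 * ((t : ℂ) ^ (i + 1) * Complex.exp (-b * t)) := fun t => by ring
    simp only [this]
    rw [integral_const_mul, integral_pow_mul_cexp (i + 1) h1]
    have : ∀ r ∈ Finset.range (i + 1), (b ^ (r + 1))⁻¹ * (b ^ (i + 1 - r))⁻¹ = (b ^ (i + 2))⁻¹ := by
      intro r hr
      rw [Finset.mem_range] at hr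
      rw [← mul_inv, ← pow_add]
      congr 2; omega
    rw [Finset.sum_congr rfl this, Finset.sum_const, Finset.card_range, Nat.factorial_succ]
    simp only [nsmul_eq_mul]
    push_cast
    field_simp
  · have e : ∀ t : ℝ, (t : ℂ) ^ i * expKernel a t * Complex.exp (-b * t) =
        a⁻¹ * ((t : ℂ) ^ i * Complex.exp (-(b - a) * t) - (t : ℂ) ^ i * Complex.exp (-(b + a) * t)) := by
      intro t
      rw [expKernel_of_ne_zero ha]
      have e1 : Complex.exp (-(b - a) * t) = Complex.exp (a * t) * Complex.exp (-b * t) := by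
        rw [← Complex.exp_add]; ring_nf
      have e2 : Complex.exp (-(b + a) * t) = Complex.exp (-(a * t)) * Complex.exp (-b * t) := by
        rw [← Complex.exp_add]; ring_nf
      rw [e1, e2]; field_simp
    simp only [e]
    rw [integral_const_mul, integral_sub (integrableOn_pow_mul_cexp i h1)
      (integrableOn_pow_mul_cexp i h2), integral_pow_mul_cexp i h1, integral_pow_mul_cexp i h2,
      laplaceKernel]
    -- the geometric sum of `1 / (b - a)` and `1 / (b + a)`
    have g := (Commute.all (b - a)⁻¹ (b + a)⁻¹).geom_sum₂_mul (i + 1)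
    have g2 : ∑ r ∈ Finset.range (i + 1), ((b - a) ^ (r + 1))⁻¹ * ((b + a) ^ (i + 1 - r))⁻¹ =
        (∑ r ∈ Finset.range (i + 1), (b - a)⁻¹ ^ r * (b + a)⁻¹ ^ (i + 1 - 1 - r)) *
          ((b - a)⁻¹ * (b + a)⁻¹) := by
      rw [Finset.sum_mul]
      refine Finset.sum_congr rfl fun r hr => ?_
      rw [Finset.mem_range] at hr
      have : i + 1 - r = (i + 1 - 1 - r) + 1 := by omega
      rw [this, ← inv_pow, ← inv_pow, pow_succ, pow_succ]; ring
    have g3 : (b - a)⁻¹ - (b + a)⁻¹ = 2 * a * ((b - a)⁻¹ * (b + a)⁻¹) := by field_simp; ring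
    rw [g3] at g
    have g4 : (∑ r ∈ Finset.range (i + 1), (b - a)⁻¹ ^ r * (b + a)⁻¹ ^ (i + 1 - 1 - r)) *
          ((b - a)⁻¹ * (b + a)⁻¹) = ((b - a)⁻¹ ^ (i + 1) - (b + a)⁻¹ ^ (i + 1)) / (2 * a) := by
      rw [eq_div_iff (by simpa using ha), ← g]; ring
    rw [g2, g4, inv_pow, inv_pow]
    field_simp

/-- Taylor's formula for `(1 - x)^{-n}` at `0`, uniformly on `[0, 1/2]`. -/
theorem eta_expansion (n M : ℕ) : ∃ C : ℝ, 0 ≤ C ∧ ∀ x : ℝ, 0 ≤ x → x ≤ 1 / 2 →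
    |((1 - x)⁻¹) ^ n - ∑ m ∈ Finset.range M, (n.multichoose m : ℝ) * x ^ m| ≤ C * x ^ M := by
  induction n with
  | zero =>
    refine ⟨1, zero_le_one, fun x hx0 hx => ?_⟩
    rcases M with _ | M
    · simp
    · rw [Finset.sum_range_succ']
      simp [Nat.multichoose_zero_succ]
      positivity
  | succ n ih =>
    obtain ⟨C, hC, h⟩ := ih
    rcases M with _ | M
    · refine ⟨2 ^ (n + 1), by positivity, fun x hx0 hx => ?_⟩
      have h1 : (1 - x)⁻¹ ≤ 2 := by
        rw [inv_le_comm₀ (by linarith) two_pos]; linarith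
      have h0 : 0 ≤ (1 - x)⁻¹ := inv_nonneg.2 (by linarith)
      simp only [Finset.range_zero, Finset.sum_empty, sub_zero, pow_zero, mul_one]
      rw [abs_of_nonneg (by positivity)]
      gcongr
    · refine ⟨2 * (C + (n + 1).multichoose M), by positivity, fun x hx0 hx => ?_⟩
      have hne : 1 - x ≠ 0 := by linarith
      -- by the recursion of the coefficients, multiplication by `1 - x` leads from `n + 1` to `n`
      have key : (1 - x) * ∑ m ∈ Finset.range (M + 1), ((n + 1).multichoose m : ℝ) * x ^ m =
          ∑ m ∈ Finset.range (M + 1), (n.multichoose m : ℝ) * x ^ m -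
            (n + 1).multichoose M * x ^ (M + 1) := by
        clear h
        induction M with
        | zero => simp
        | succ M ihM =>
          rw [Finset.sum_range_succ, mul_add, ihM, Finset.sum_range_succ _ (M + 1),
            Nat.multichoose_succ_succ]
          push_cast; ring
      have e : ((1 - x)⁻¹) ^ (n + 1) - ∑ m ∈ Finset.range (M + 1), ((n + 1).multichoose m : ℝ) * x ^ m
          = (1 - x)⁻¹ * ((((1 - x)⁻¹) ^ n - ∑ m ∈ Finset.range (M + 1), (n.multichoose m : ℝ) * x ^ m)
            + (n + 1).multichoose M * x ^ (M + 1)) := by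
        have : ∑ m ∈ Finset.range (M + 1), ((n + 1).multichoose m : ℝ) * x ^ m = (1 - x)⁻¹ *
          ((1 - x) * ∑ m ∈ Finset.range (M + 1), ((n + 1).multichoose m : ℝ) * x ^ m) := by
          rw [← mul_assoc, inv_mul_cancel₀ hne, one_mul]
        rw [this, key, pow_succ]; ring
      have h1 : (1 - x)⁻¹ ≤ 2 := by
        rw [inv_le_comm₀ (by linarith) two_pos]; linarith
      have h0 : 0 ≤ (1 - x)⁻¹ := inv_nonneg.2 (by linarith)
      rw [e, abs_mul, abs_of_nonneg h0, mul_assoc, add_mul]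
      refine mul_le_mul h1 ((abs_add_le _ _).trans (add_le_add (h x hx0 hx) (le_of_eq ?_)))
        (abs_nonneg _) (by norm_num)
      exact abs_of_nonneg (by positivity)

/-! ### Continuations with prescribed leading coefficients at the poles -/

/-- The location `w = z + l₀ - 1 + 2k` of the poles whose leading coefficients are computed. -/
noncomputable def poleW (l₀ : ℕ) (z : ℂ) (k : ℕ) : ℂ := z + l₀ - 1 + 2 * k

/-- The integral of `g w z` over `S` converges absolutely for `(w, z)` in the tube and has an analytic
continuation `Φ` to the complement of the polar hyperplanes, such that
`(w₀ - w)^{k+1} Φ(w, z) → c z k` as `w → w₀ = poleW l₀ z k`, for all `k > |Re z| + 1`. The lower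
bound on `k` keeps `w₀` away from the hyperplanes `w = -(m + z)`. The value `c z k = 0` only says
that the pole has order at most `k`. -/
def HasCont (l₀ : ℕ) (S : Set ℝ) (g : ℂ → ℂ → ℝ → ℂ) (c : ℂ → ℕ → ℂ) : Prop :=
  ∃ Φ : ℂ × ℂ → ℂ, AnalyticOnNhd ℂ Φ polarSetWᶜ ∧
    (∀ p ∈ tubeW, IntegrableOn (g p.1 p.2) S ∧ Φ p = ∫ t in S, g p.1 p.2 t) ∧
    ∀ (z : ℂ) (k : ℕ), |z.re| + 1 < k →
      Tendsto (fun w => (poleW l₀ z k - w) ^ (k + 1) * Φ (w, z)) (𝓝[≠] (poleW l₀ z k)) (𝓝 (c z k))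

theorem HasCont.congr {l₀ : ℕ} {S : Set ℝ} (hS : MeasurableSet S) {g g' : ℂ → ℂ → ℝ → ℂ}
    {c : ℂ → ℕ → ℂ} (h : HasCont l₀ S g c) (hg : ∀ w z, ∀ t ∈ S, g' w z t = g w z t) :
    HasCont l₀ S g' c := by
  obtain ⟨Φ, h1, h2, h3⟩ := h
  refine ⟨Φ, h1, fun p hp => ⟨(h2 p hp).1.congr_fun (fun t ht => (hg _ _ t ht).symm) hS, ?_⟩, h3⟩
  rw [(h2 p hp).2]
  exact (setIntegral_congr_fun hS fun t ht => hg _ _ t ht).symm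

theorem HasCont.const_mul {l₀ : ℕ} {S : Set ℝ} {g : ℂ → ℂ → ℝ → ℂ}
    {c : ℂ → ℕ → ℂ} (h : HasCont l₀ S g c) {a : ℂ → ℂ} (ha : AnalyticOnNhd ℂ a univ) :
    HasCont l₀ S (fun w z t => a z * g w z t) (fun z k => a z * c z k) := by
  obtain ⟨Φ, h1, h2, h3⟩ := h
  refine ⟨fun p => a p.2 * Φ p, fun p hp => ?_, fun p hp => ⟨(h2 p hp).1.const_mul _, ?_⟩,
    fun z k hk => ?_⟩
  · exact ((ha p.2 trivial).fun_comp analyticAt_snd).mul (h1 p hp)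
  · simp only [(h2 p hp).2, integral_const_mul]
  · refine ((h3 z k hk).const_mul (a z)).congr fun w => ?_
    ring

theorem HasCont.sum {ι : Type*} {l₀ : ℕ} {S : Set ℝ} {s : Finset ι} {g : ι → ℂ → ℂ → ℝ → ℂ}
    {c : ι → ℂ → ℕ → ℂ} (h : ∀ i ∈ s, HasCont l₀ S (g i) (c i)) :
    HasCont l₀ S (fun w z t => ∑ i ∈ s, g i w z t) (fun z k => ∑ i ∈ s, c i z k) := by
  classical
  choose! Φ h1 h2 h3 using h
  refine ⟨fun p => ∑ i ∈ s, Φ i p, fun p hp => ?_, fun p hp => ⟨?_, ?_⟩, fun z k hk => ?_⟩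
  · exact Finset.analyticAt_fun_sum s fun i hi => h1 i hi p hp
  · exact integrable_finsetSum s fun i hi => (h2 i hi p hp).1
  · rw [integral_finsetSum s fun i hi => (h2 i hi p hp).1]
    exact Finset.sum_congr rfl fun i hi => (h2 i hi p hp).2
  · refine (tendsto_finsetSum s fun i hi => h3 i hi z k hk).congr fun w => ?_
    rw [Finset.mul_sum]

theorem HasCont.add {l₀ : ℕ} {S : Set ℝ} {g g' : ℂ → ℂ → ℝ → ℂ}
    {c c' : ℂ → ℕ → ℂ} (h : HasCont l₀ S g c) (h' : HasCont l₀ S g' c') :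
    HasCont l₀ S (fun w z t => g w z t + g' w z t) (fun z k => c z k + c' z k) := by
  obtain ⟨Φ, h1, h2, h3⟩ := h
  obtain ⟨Φ', h1', h2', h3'⟩ := h'
  refine ⟨fun p => Φ p + Φ' p, fun p hp => (h1 p hp).add (h1' p hp),
    fun p hp => ⟨(h2 p hp).1.add (h2' p hp).1, ?_⟩, fun z k hk => ?_⟩
  · simp only [(h2 p hp).2, (h2' p hp).2]
    exact (integral_add (h2 p hp).1 (h2' p hp).1).symm
  · refine ((h3 z k hk).add (h3' z k hk)).congr fun w => ?_
    ring

/-- If `h z t` is of the order of `tⁿ e^{-dt}`, locally uniformly in `z`, then the integral of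
`h z t e^{-zt}` against the exponential kernel is analytic for `|Re (w + j)| < Re z + d`. -/
theorem analyticOnNhd_tail {h : ℂ → ℝ → ℂ} {d : ℝ} {j : ℤ}
    (hc : ∀ z, ContinuousOn (h z) (Ioi 1)) (hd : ∀ t ∈ Ioi (1 : ℝ), Differentiable ℂ fun z => h z t)
    (hb : ∀ Z : ℝ, ∃ C : ℝ, 0 ≤ C ∧ ∃ n : ℕ, ∀ z, ‖z‖ ≤ Z → ∀ t ∈ Ioi (1 : ℝ),
      ‖h z t‖ ≤ C * (t ^ n * Real.exp (-d * t))) :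
    AnalyticOnNhd ℂ (fun p : ℂ × ℂ => ∫ t in Ioi (1 : ℝ),
        h p.2 t * expKernel (p.1 + j) t * Complex.exp (-p.2 * t))
      {p | |(p.1 + j).re| < p.2.re + d} ∧
    ∀ p : ℂ × ℂ, |(p.1 + j).re| < p.2.re + d →
      IntegrableOn (fun t : ℝ => h p.2 t * expKernel (p.1 + j) t * Complex.exp (-p.2 * t))
        (Ioi 1) := by
  have hmeas : ∀ p : ℂ × ℂ, AEStronglyMeasurable
      (fun t : ℝ => h p.2 t * expKernel (p.1 + j) t * Complex.exp (-p.2 * t))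
      (volume.restrict (Ioi 1)) := fun p =>
    (((hc p.2).mul (continuous_expKernel _).continuousOn).mul
      (by fun_prop)).aestronglyMeasurable measurableSet_Ioi
  have hdom : ∀ p : ℂ × ℂ, |(p.1 + j).re| < p.2.re + d → ∃ g : ℝ → ℝ,
      Integrable g (volume.restrict (Ioi 1)) ∧ ∃ V ∈ 𝓝 p, ∀ᵐ t ∂(volume.restrict (Ioi (1 : ℝ))),
      ∀ q ∈ V, ‖h q.2 t * expKernel (q.1 + j) t * Complex.exp (-q.2 * t)‖ ≤ g t := by
    intro p hp
    obtain ⟨C, hC, n, hb⟩ := hb (‖p.2‖ + 1)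
    set δ : ℝ := (p.2.re + d - |(p.1 + j).re|) / 2 with hδ
    have hδ0 : 0 < δ := by rw [hδ]; linarith
    refine ⟨fun t => C * 2 * (t ^ (n + 1) * Real.exp (-δ * t)),
      ((integrableOn_pow_mul_exp (n + 1) hδ0).mono_set (Ioi_subset_Ioi zero_le_one)).const_mul _,
      {q : ℂ × ℂ | δ < q.2.re + d - |(q.1 + j).re| ∧ ‖q.2‖ < ‖p.2‖ + 1}, ?_, ?_⟩
    · have o1 : IsOpen {q : ℂ × ℂ | δ < q.2.re + d - |(q.1 + j).re|} :=
        isOpen_lt (by fun_prop) (by fun_prop)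
      have o2 : IsOpen {q : ℂ × ℂ | ‖q.2‖ < ‖p.2‖ + 1} := isOpen_lt (by fun_prop) (by fun_prop)
      exact (o1.inter o2).mem_nhds ⟨by simp only [mem_ofPred_eq]; rw [hδ]; linarith, by simp⟩
    · refine (ae_restrict_iff' measurableSet_Ioi).2 (Eventually.of_forall fun t ht q hq => ?_)
      have ht0 : (0 : ℝ) ≤ t := zero_le_one.trans (le_of_lt ht)
      rw [norm_mul, norm_mul, Complex.norm_exp]
      calc ‖h q.2 t‖ * ‖expKernel (q.1 + j) t‖ * Real.exp (-q.2 * t : ℂ).re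
          ≤ (C * (t ^ n * Real.exp (-d * t))) * (2 * t * Real.exp (|(q.1 + j).re| * t)) *
              Real.exp (-q.2 * t : ℂ).re := by
            gcongr
            · exact hb _ hq.2.le t ht
            · exact norm_expKernel_le _ ht0
        _ = C * 2 * (t ^ (n + 1) * (Real.exp (-d * t) * Real.exp (|(q.1 + j).re| * t) *
              Real.exp (-q.2 * t : ℂ).re)) := by ring
        _ ≤ C * 2 * (t ^ (n + 1) * Real.exp (-δ * t)) := by
            rw [← Real.exp_add, ← Real.exp_add]
            gcongr
            simp only [Complex.mul_re, Complex.neg_re, Complex.ofReal_re, Complex.ofReal_im,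
              mul_zero, sub_zero]
            have := hq.1
            nlinarith
  refine ⟨analyticOnNhd_integral (isOpen_lt (by fun_prop) (by fun_prop)) (fun p _ => hmeas p) ?_
    (fun p hp => hdom p hp), fun p hp => ?_⟩
  · refine (ae_restrict_iff' measurableSet_Ioi).2 (Eventually.of_forall fun t ht q _ => ?_)
    have ht0 : (0 : ℝ) ≤ t := zero_le_one.trans (le_of_lt ht)
    have h1 : DifferentiableAt ℂ (fun p : ℂ × ℂ => h p.2 t) q :=
      (hd t ht q.2).comp q differentiableAt_snd
    have h2 : DifferentiableAt ℂ (fun p : ℂ × ℂ => expKernel (p.1 + j) t) q :=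
      DifferentiableAt.comp (g := fun a => expKernel a t) (f := fun p : ℂ × ℂ => p.1 + (j : ℂ)) q
        (differentiable_expKernel ht0 (q.1 + j)) (by fun_prop)
    exact (h1.mul h2).mul (by fun_prop)
  · obtain ⟨g, hg, V, hV, hb⟩ := hdom p hp
    exact hg.mono' (hmeas p) (hb.mono fun t ht => ht p (mem_of_mem_nhds hV))

/-- Integrals over `(0, 1]` of locally bounded integrands are entire in the two parameters. -/
theorem analyticOnNhd_unitInterval {f : ℂ × ℂ → ℝ → ℂ}
    (hc : ∀ p, ContinuousOn (f p) (Ioc 0 1))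
    (hd : ∀ t ∈ Ioc (0 : ℝ) 1, Differentiable ℂ fun p => f p t)
    (hb : ∀ Z : ℝ, ∃ C : ℝ, ∀ p, ‖p‖ ≤ Z → ∀ t ∈ Ioc (0 : ℝ) 1, ‖f p t‖ ≤ C) :
    AnalyticOnNhd ℂ (fun p : ℂ × ℂ => ∫ t in Ioc (0 : ℝ) 1, f p t) univ ∧
    ∀ p, IntegrableOn (f p) (Ioc 0 1) := by
  have hmeas : ∀ p, AEStronglyMeasurable (f p) (volume.restrict (Ioc 0 1)) := fun p =>
    (hc p).aestronglyMeasurable measurableSet_Ioc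
  constructor
  · refine analyticOnNhd_integral isOpen_univ (fun p _ => hmeas p) ?_ fun p _ => ?_
    · exact (ae_restrict_iff' measurableSet_Ioc).2 (Eventually.of_forall fun t ht p _ => hd t ht p)
    · obtain ⟨C, hC⟩ := hb (‖p‖ + 1)
      refine ⟨fun _ => C, integrableOn_const (by simp), {q | ‖q‖ < ‖p‖ + 1},
        (isOpen_lt (by fun_prop) (by fun_prop)).mem_nhds (by simp), ?_⟩
      exact (ae_restrict_iff' measurableSet_Ioc).2 (Eventually.of_forall fun t ht q hq =>
        hC q (le_of_lt hq) t ht)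
  · intro p
    obtain ⟨C, hC⟩ := hb ‖p‖
    exact Integrable.mono' (integrableOn_const (C := C) (by simp)) (hmeas p)
      ((ae_restrict_iff' measurableSet_Ioc).2 (Eventually.of_forall fun t ht => hC p le_rfl t ht))

/-- The continuation of `∫₁^∞ tⁱ e^{-ft} expKernel (w + j) t e^{-zt} dt`. -/
noncomputable def laplaceTail (i : ℕ) (f j : ℤ) (p : ℂ × ℂ) : ℂ :=
  laplaceKernel i (p.1 + j) (p.2 + f) -
    ∫ t in Ioc (0 : ℝ) 1, (t : ℂ) ^ i * expKernel (p.1 + j) t * Complex.exp (-(p.2 + f) * t)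

theorem analyticOnNhd_laplaceHead (i : ℕ) (f j : ℤ) : AnalyticOnNhd ℂ (fun p : ℂ × ℂ =>
    ∫ t in Ioc (0 : ℝ) 1, (t : ℂ) ^ i * expKernel (p.1 + j) t * Complex.exp (-(p.2 + f) * t))
    univ := by
  refine (analyticOnNhd_unitInterval (f := fun p t =>
    (t : ℂ) ^ i * expKernel (p.1 + j) t * Complex.exp (-(p.2 + f) * t)) (fun p => ?_)
    (fun t ht q => ?_) fun Z => ?_).1
  · exact (((by fun_prop : Continuous fun t : ℝ => (t : ℂ) ^ i).mul
      (continuous_expKernel _)).mul (by fun_prop)).continuousOn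
  · have h2 : DifferentiableAt ℂ (fun p : ℂ × ℂ => expKernel (p.1 + j) t) q :=
      DifferentiableAt.comp (g := fun a => expKernel a t) (f := fun p : ℂ × ℂ => p.1 + (j : ℂ)) q
        (differentiable_expKernel ht.1.le (q.1 + j)) (by fun_prop)
    exact ((differentiableAt_const _).mul h2).mul (by fun_prop)
  · refine ⟨2 * Real.exp ((Z + |(f : ℝ)|) + (Z + |(j : ℝ)|)), fun p hp t ht => ?_⟩
    refine (norm_exp_le_of_abs_re ht.1.le i).trans ?_
    have h1 : t ^ (i + 1) ≤ 1 := pow_le_one₀ ht.1.le ht.2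
    have hp1 : |p.1.re| ≤ Z := (Complex.abs_re_le_norm _).trans ((norm_fst_le p).trans hp)
    have hp2 : |p.2.re| ≤ Z := (Complex.abs_re_le_norm _).trans ((norm_snd_le p).trans hp)
    have h3 : -((p.2 + (f : ℂ)).re - |(p.1 + (j : ℂ)).re|) * t ≤
        (Z + |(f : ℝ)|) + (Z + |(j : ℝ)|) := by
      have e1 : -(p.2 + (f : ℂ)).re ≤ Z + |(f : ℝ)| := by
        simp only [Complex.add_re, Complex.intCast_re]
        linarith [neg_abs_le p.2.re, neg_abs_le (f : ℝ)]
      have e2 : |(p.1 + (j : ℂ)).re| ≤ Z + |(j : ℝ)| := by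
        simp only [Complex.add_re, Complex.intCast_re]
        linarith [abs_add_le p.1.re (j : ℝ)]
      have e3 : 0 ≤ (Z + |(f : ℝ)|) + (Z + |(j : ℝ)|) := by
        have := (abs_nonneg _).trans hp1; positivity
      calc _ ≤ ((Z + |(f : ℝ)|) + (Z + |(j : ℝ)|)) * t :=
            mul_le_mul_of_nonneg_right (by linarith) ht.1.le
        _ ≤ _ := mul_le_of_le_one_right e3 ht.2
    have h4 := Real.exp_le_exp.2 h3
    have h5 := Real.exp_pos (-((p.2 + (f : ℂ)).re - |(p.1 + (j : ℂ)).re|) * t)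
    have h6 : (0 : ℝ) ≤ t ^ (i + 1) := pow_nonneg ht.1.le _
    nlinarith

theorem laplaceTail_eq (i : ℕ) (f j : ℤ) {p : ℂ × ℂ} (h : |(p.1 + j).re| < (p.2 + f).re) :
    IntegrableOn (fun t : ℝ => (t : ℂ) ^ i * expKernel (p.1 + j) t * Complex.exp (-(p.2 + f) * t))
      (Ioi 1) ∧
    laplaceTail i f j p =
      ∫ t in Ioi (1 : ℝ), (t : ℂ) ^ i * expKernel (p.1 + j) t * Complex.exp (-(p.2 + f) * t) := by
  have hint := integrableOn_expKernel i h
  refine ⟨hint.mono_set (Ioi_subset_Ioi zero_le_one), ?_⟩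
  rw [laplaceTail, ← integral_expKernel i h, ← Ioc_union_Ioi_eq_Ioi (zero_le_one' ℝ),
    setIntegral_union (Ioc_disjoint_Ioi le_rfl) measurableSet_Ioi
      (hint.mono_set Ioc_subset_Ioi_self) (hint.mono_set (Ioi_subset_Ioi zero_le_one))]
  ring

theorem analyticOnNhd_laplaceTail (i : ℕ) {f j : ℤ} (h1 : -1 ≤ f + j) (h2 : -1 ≤ f - j) :
    AnalyticOnNhd ℂ (laplaceTail i f j) polarSetWᶜ := by
  intro p hp
  refine AnalyticAt.sub ?_ (analyticOnNhd_laplaceHead i f j p trivial)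
  have e1 : p.2 + f - (p.1 + j) ≠ 0 := fun h =>
    hp ⟨f - j, h2, Or.inl (by push_cast; linear_combination -h)⟩
  have e2 : p.2 + f + (p.1 + j) ≠ 0 := fun h =>
    hp ⟨f + j, h1, Or.inr (by push_cast; linear_combination h)⟩
  have a1 : AnalyticAt ℂ (fun p : ℂ × ℂ => p.2 + f - (p.1 + j)) p :=
    (analyticAt_snd.add analyticAt_const).sub (analyticAt_fst.add analyticAt_const)
  have a2 : AnalyticAt ℂ (fun p : ℂ × ℂ => p.2 + f + (p.1 + j)) p :=
    (analyticAt_snd.add analyticAt_const).add (analyticAt_fst.add analyticAt_const)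
  refine analyticAt_const.mul (Finset.analyticAt_fun_sum _ fun r _ => ?_)
  exact ((a1.pow _).inv (pow_ne_zero _ e1)).mul ((a2.pow _).inv (pow_ne_zero _ e2))

theorem tendsto_poleW_sub_pow (l₀ : ℕ) (z : ℂ) (k : ℕ) :
    Tendsto (fun w => (poleW l₀ z k - w) ^ (k + 1)) (𝓝[≠] (poleW l₀ z k)) (𝓝 0) := by
  have : Continuous fun w => (poleW l₀ z k - w) ^ (k + 1) := by fun_prop
  exact (this.tendsto' _ _ (by simp)).mono_left nhdsWithin_le_nhds

/-- The Laplace transform of `tⁱ expKernel (w + j) t` at `z + f` has a pole of order at most `i + 1` in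
`w`, at `w = z + f - j`. By the bound `h2` it contributes to the pole of order `k + 1` at
`poleW l₀ z k` only if that bound is attained and `i = k`. -/
theorem tendsto_laplaceKernel {l₀ i : ℕ} {f j : ℤ} (h1 : -1 ≤ f + j)
    (h2 : (l₀ : ℤ) - 1 + 2 * i ≤ f - j) {z : ℂ} {k : ℕ} (hk : |z.re| + 1 < k) :
    Tendsto (fun w => (poleW l₀ z k - w) ^ (k + 1) * laplaceKernel i (w + j) (z + f))
      (𝓝[≠] (poleW l₀ z k))
      (𝓝 (if f - j = (l₀ : ℤ) - 1 + 2 * i ∧ i = k then k ! / (poleW l₀ z k + j) else 0)) := by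
  set w₀ := poleW l₀ z k with hw₀
  have hfj : (-1 : ℝ) ≤ f + j := by exact_mod_cast h1
  -- the other family of poles is avoided, since `Re (z + f + w₀ + j)` is positive
  have hs : (z + f + (w₀ + j)).re ≠ 0 := by
    have : (z + f + (w₀ + j)).re = 2 * z.re + (f + j) + l₀ - 1 + 2 * k := by
      simp [hw₀, poleW]; ring
    rw [this]
    have := neg_abs_le z.re
    have hl : (0 : ℝ) ≤ l₀ := l₀.cast_nonneg
    exact ne_of_gt (by linarith)
  have hs0 : z + f + (w₀ + j) ≠ 0 := fun h => hs (by rw [h]; simp)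
  have hplus : ∀ n : ℕ, Tendsto (fun w => ((z + f + (w + j)) ^ n)⁻¹) (𝓝[≠] w₀)
      (𝓝 (((z + f + (w₀ + j)) ^ n)⁻¹)) := fun n => by
    have : ContinuousAt (fun w => ((z + f + (w + j)) ^ n)⁻¹) w₀ :=
      ContinuousAt.inv₀ (by fun_prop) (pow_ne_zero _ hs0)
    exact this.tendsto.mono_left nhdsWithin_le_nhds
  have hterm : ∀ r ∈ Finset.range (i + 1), Tendsto (fun w => (w₀ - w) ^ (k + 1) *
      (((z + f - (w + j)) ^ (r + 1))⁻¹ * ((z + f + (w + j)) ^ (i + 1 - r))⁻¹)) (𝓝[≠] w₀)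
      (𝓝 (if f - j = (l₀ : ℤ) - 1 + 2 * k ∧ r = k then ((z + f + (w₀ + j)) ^ (i + 1 - r))⁻¹
        else 0)) := by
    intro r hr
    rw [Finset.mem_range] at hr
    by_cases he : f - j = (l₀ : ℤ) - 1 + 2 * k
    · have he' : (f : ℂ) - j = l₀ - 1 + 2 * k := by exact_mod_cast he
      -- `i ≤ k` by the bound `h2`, hence `r ≤ k`
      have hrk : r ≤ k := by omega
      have hz : Tendsto (fun w => (w₀ - w) ^ (k - r)) (𝓝[≠] w₀) (𝓝 (if r = k then 1 else 0)) := by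
        have : Continuous fun w => (w₀ - w) ^ (k - r) := by fun_prop
        refine (this.tendsto' _ _ ?_).mono_left nhdsWithin_le_nhds
        split_ifs with h
        · simp [h]
        · simp [Nat.sub_ne_zero_of_lt (lt_of_le_of_ne hrk h)]
      have := hz.mul (hplus (i + 1 - r))
      simp only [ite_mul, one_mul, zero_mul] at this
      simp only [he, true_and]
      refine this.congr' ?_
      filter_upwards [self_mem_nhdsWithin] with w hw
      have hne : w₀ - w ≠ 0 := sub_ne_zero.2 (Ne.symm hw)
      have e : z + f - (w + j) = w₀ - w := by rw [hw₀, poleW]; linear_combination he'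
      rw [e, show k + 1 = (k - r) + (r + 1) by omega, pow_add, mul_assoc, ← mul_assoc (_ ^ (r + 1)),
        mul_inv_cancel₀ (pow_ne_zero _ hne), one_mul]
    · rw [if_neg (fun h => he h.1)]
      have hne : z + f - (w₀ + j) ≠ 0 := fun h => he (by
        have : (f : ℂ) - j = l₀ - 1 + 2 * k := by rw [hw₀, poleW] at h; linear_combination h
        exact_mod_cast this)
      have hc : ContinuousAt (fun w => ((z + f - (w + j)) ^ (r + 1))⁻¹) w₀ :=
        ContinuousAt.inv₀ (by fun_prop) (pow_ne_zero _ hne)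
      have := (tendsto_poleW_sub_pow l₀ z k).mul
        ((hc.tendsto.mono_left nhdsWithin_le_nhds).mul (hplus (i + 1 - r)))
      simpa using this
  have := (tendsto_finsetSum _ hterm).const_mul (2 * (i ! : ℂ))
  refine (this.congr fun w => ?_).trans (le_of_eq ?_)
  · rw [laplaceKernel, Finset.mul_sum, Finset.mul_sum, Finset.mul_sum]
    refine Finset.sum_congr rfl fun r _ => by ring
  · congr 1
    by_cases hc : f - j = (l₀ : ℤ) - 1 + 2 * i ∧ i = k
    · obtain ⟨hc1, rfl⟩ := hc
      have he' : (f : ℂ) - j = l₀ - 1 + 2 * i := by exact_mod_cast hc1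
      rw [if_pos ⟨hc1, rfl⟩, Finset.sum_eq_single i]
      · rw [if_pos ⟨hc1, rfl⟩, show i + 1 - i = 1 by omega, pow_one]
        have e : z + f + (w₀ + j) = 2 * (w₀ + j) := by
          rw [hw₀, poleW]; linear_combination he'
        rw [e]
        have : w₀ + j ≠ 0 := fun h => hs0 (by rw [e, h, mul_zero])
        field_simp
      · intro r _ hr; rw [if_neg (fun h => hr h.2)]
      · intro h; simp at h
    · rw [if_neg hc, Finset.sum_eq_zero, mul_zero]
      intro r hr
      rw [Finset.mem_range] at hr
      rw [if_neg]
      rintro ⟨h3, rfl⟩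
      exact hc (by constructor <;> omega)

/-! ### Continuation of the basic integrands -/

/-- `eta t = 1 / (1 - e^{-2t})`. -/
noncomputable def eta (t : ℝ) : ℝ := (1 - Real.exp (-2 * t))⁻¹

/-- The factor `e^{-z t coth t}`. -/
noncomputable def phase (z : ℂ) (t : ℝ) : ℂ :=
  Complex.exp (-z * ((t * (Real.cosh t / Real.sinh t) : ℝ) : ℂ))

theorem one_sub_exp_pos {t : ℝ} (ht : 0 < t) : 0 < 1 - Real.exp (-2 * t) := by
  have : Real.exp (-2 * t) < 1 := by
    rw [← Real.exp_zero]; exact Real.exp_lt_exp.2 (by linarith)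
  linarith

theorem mul_coth_eq {t : ℝ} (ht : 0 < t) :
    t * (Real.cosh t / Real.sinh t) = t + 2 * (t * Real.exp (-2 * t) * eta t) := by
  have h1 := (one_sub_exp_pos ht).ne'
  have hs : Real.sinh t ≠ 0 := (Real.sinh_pos_iff.2 ht).ne'
  have e : Real.exp (-2 * t) = Real.exp (-t) * Real.exp (-t) := by
    rw [← Real.exp_add]; ring_nf
  have e2 : Real.exp t * Real.exp (-t) = 1 := by rw [← Real.exp_add]; simp
  have hc : Real.cosh t * (1 - Real.exp (-2 * t)) = (1 + Real.exp (-2 * t)) * Real.sinh t := by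
    rw [e, Real.cosh_eq, Real.sinh_eq]
    linear_combination (-Real.exp (-t)) * e2
  rw [eta]
  generalize Real.exp (-2 * t) = E at h1 hc
  field_simp
  linear_combination hc

/-- The remainder of the double power series of `η^N e^{-2z t x η}`, `η = 1 / (1 - x)`. -/
noncomputable def seriesRem (N M : ℕ) (z : ℂ) (t x : ℝ) : ℂ :=
  (((1 - x)⁻¹ : ℝ) : ℂ) ^ N * Complex.exp (-2 * z * ((t * x * (1 - x)⁻¹ : ℝ) : ℂ)) -
    ∑ i ∈ Finset.range M, ∑ m ∈ Finset.range M,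
      ((-2 * z) ^ i / i !) * ((N + i).multichoose m : ℂ) * ((t : ℂ) ^ i * (x : ℂ) ^ (i + m))

theorem seriesRem_bound (N M : ℕ) (Z : ℝ) : ∃ C : ℝ, 0 ≤ C ∧ ∀ (z : ℂ) (t x : ℝ), ‖z‖ ≤ Z → 1 ≤ t →
    0 ≤ x → x ≤ 1 / 2 → t * x ≤ 1 → ‖seriesRem N M z t x‖ ≤ C * (t * x) ^ M := by
  choose C hC hCb using fun i => eta_expansion (N + i) M
  refine ⟨|2 ^ N * (4 * Z) ^ M * Real.exp (4 * Z)| + |∑ i ∈ Finset.range M, (2 * Z) ^ i / (i !) * C i|,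
    by positivity, fun z t x hz ht hx0 hx htx => ?_⟩
  have hZ : 0 ≤ Z := (norm_nonneg z).trans hz
  have htx0 : 0 ≤ t * x := by positivity
  set η : ℝ := (1 - x)⁻¹ with hη
  have hη2 : η ≤ 2 := by rw [hη, inv_le_comm₀ (by linarith) two_pos]; linarith
  have hη0 : 0 ≤ η := inv_nonneg.2 (by linarith)
  set y : ℂ := -2 * z * ((t * x * η : ℝ) : ℂ) with hy
  -- first the remainder of the exponential series, then those of the powers of `η`
  have e : seriesRem N M z t x = (η : ℂ) ^ N * (Complex.exp y - ∑ i ∈ Finset.range M, y ^ i / i !) +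
      ∑ i ∈ Finset.range M, ((-2 * z) ^ i / i !) * (((t * x) ^ i : ℝ) : ℂ) *
        ((η ^ (N + i) - ∑ m ∈ Finset.range M, ((N + i).multichoose m : ℝ) * x ^ m : ℝ) : ℂ) := by
    rw [seriesRem, ← hη, ← hy, mul_sub, sub_add]
    congr 1
    rw [Finset.mul_sum, ← Finset.sum_sub_distrib]
    refine Finset.sum_congr rfl fun i _ => ?_
    rw [hy]
    push_cast
    rw [mul_sub, Finset.mul_sum]
    have : ∀ m, ((-2 * z) ^ i / (i ! : ℂ)) * ((N + i).multichoose m : ℂ) * ((t : ℂ) ^ i * (x : ℂ) ^ (i + m))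
      = (-2 * z) ^ i / (i ! : ℂ) * (t * x : ℂ) ^ i * (((N + i).multichoose m : ℂ) * (x : ℂ) ^ m) := by
      intro m; rw [pow_add]; ring
    simp only [this]
    ring
  have hy1 : ‖y‖ ≤ 4 * Z * (t * x) := by
    rw [hy, norm_mul, norm_mul, Complex.norm_real, Real.norm_of_nonneg (by positivity)]
    simp only [norm_neg, Complex.norm_ofNat]
    calc 2 * ‖z‖ * (t * x * η) ≤ 2 * Z * (t * x * 2) := by gcongr
      _ = _ := by ring
  have hy2 : ‖y‖ ≤ 4 * Z := hy1.trans (mul_le_of_le_one_right (by positivity) htx)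
  have b1 : ‖(η : ℂ) ^ N * (Complex.exp y - ∑ i ∈ Finset.range M, y ^ i / i !)‖ ≤
      (2 ^ N * (4 * Z) ^ M * Real.exp (4 * Z)) * (t * x) ^ M := by
    rw [norm_mul, norm_pow, Complex.norm_real, Real.norm_of_nonneg hη0]
    calc η ^ N * ‖Complex.exp y - ∑ i ∈ Finset.range M, y ^ i / (i ! : ℂ)‖
        ≤ 2 ^ N * (‖y‖ ^ M * Real.exp ‖y‖) := by
          gcongr
          exact Complex.norm_exp_sub_sum_le_norm_mul_exp y M
      _ ≤ 2 ^ N * ((4 * Z * (t * x)) ^ M * Real.exp (4 * Z)) := by gcongr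
      _ = _ := by rw [mul_pow]; ring
  have b2 : ‖∑ i ∈ Finset.range M, ((-2 * z) ^ i / i !) * (((t * x) ^ i : ℝ) : ℂ) *
        ((η ^ (N + i) - ∑ m ∈ Finset.range M, ((N + i).multichoose m : ℝ) * x ^ m : ℝ) : ℂ)‖ ≤
      (∑ i ∈ Finset.range M, (2 * Z) ^ i / (i !) * C i) * (t * x) ^ M := by
    rw [Finset.sum_mul]
    refine (norm_sum_le _ _).trans (Finset.sum_le_sum fun i _ => ?_)
    rw [norm_mul, norm_mul, Complex.norm_real, Complex.norm_real, norm_div, norm_pow, norm_mul]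
    simp only [norm_neg, Complex.norm_ofNat, Complex.norm_natCast]
    have h1 : ‖(t * x) ^ i‖ ≤ 1 := by
      rw [Real.norm_of_nonneg (by positivity)]; exact pow_le_one₀ htx0 htx
    have h2 := hCb i x hx0 hx
    have h3 : x ^ M ≤ (t * x) ^ M := by
      gcongr
      nlinarith
    have := hC i
    calc (2 * ‖z‖) ^ i / i ! * ‖(t * x) ^ i‖ * ‖η ^ (N + i) -
          ∑ m ∈ Finset.range M, ((N + i).multichoose m : ℝ) * x ^ m‖
        ≤ (2 * Z) ^ i / i ! * 1 * (C i * (t * x) ^ M) := by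
          gcongr
          exact h2.trans (by gcongr)
      _ = _ := by ring
  rw [e, add_mul]
  refine (norm_add_le _ _).trans (add_le_add (b1.trans ?_) (b2.trans ?_))
  · gcongr; exact le_abs_self _
  · gcongr; exact le_abs_self _

theorem exp_neg_two_le_half {t : ℝ} (ht : 1 ≤ t) : Real.exp (-2 * t) ≤ 1 / 2 := by
  have h := Real.add_one_le_exp (2 * t)
  have e : Real.exp (-2 * t) = (Real.exp (2 * t))⁻¹ := by rw [← Real.exp_neg]; ring_nf
  rw [e, inv_le_comm₀ (Real.exp_pos _) (by norm_num)]
  linarith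

theorem mul_exp_neg_two_le_one {t : ℝ} (ht : 0 ≤ t) : t * Real.exp (-2 * t) ≤ 1 := by
  have h := Real.add_one_le_exp (2 * t)
  have e : Real.exp (-2 * t) = (Real.exp (2 * t))⁻¹ := by rw [← Real.exp_neg]; ring_nf
  rw [e, ← div_eq_mul_inv, div_le_one (Real.exp_pos _)]
  linarith

/-- The basic integrand: `tᵃ e^{-ft} η^N expKernel (w + j) t e^{-z t coth t}`. -/
noncomputable def atom (a N : ℕ) (f j : ℤ) (w z : ℂ) (t : ℝ) : ℂ :=
  (t : ℂ) ^ a * Complex.exp (-f * t) * (eta t : ℂ) ^ N * expKernel (w + j) t * phase z t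

/-- The remainder of the expansion of an atom at infinity. -/
noncomputable def atomRem (a N M : ℕ) (f : ℤ) (z : ℂ) (t : ℝ) : ℂ :=
  (t : ℂ) ^ a * Complex.exp (-f * t) * seriesRem N M z t (Real.exp (-2 * t))

/-- The expansion of an atom at infinity. The terms with `m > 0` carry a factor `e^{-2t}` without a
factor `t`, so that they do not contribute to the leading coefficients. -/
theorem atom_eq (a N M : ℕ) (f j : ℤ) (w z : ℂ) {t : ℝ} (ht : 0 < t) :
    atom a N f j w z t =
      ∑ i ∈ Finset.range M, ∑ m ∈ Finset.range M,
        (((-2 * z) ^ i / i !) * ((N + i).multichoose m : ℂ)) * ((t : ℂ) ^ (a + i) *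
          expKernel (w + j) t * Complex.exp (-(z + (f + 2 * i + 2 * m : ℤ)) * t)) +
      atomRem a N M f z t * expKernel (w + j) t * Complex.exp (-z * t) := by
  -- `t coth t = t + 2 t e^{-2t} η`
  have e1 : phase z t = Complex.exp (-z * t) *
      Complex.exp (-2 * z * ((t * Real.exp (-2 * t) * (1 - Real.exp (-2 * t))⁻¹ : ℝ) : ℂ)) := by
    rw [phase, mul_coth_eq ht, ← Complex.exp_add, eta]
    congr 1; push_cast; ring
  have e2 : ∀ i m : ℕ, Complex.exp (-(z + (f + 2 * i + 2 * m : ℤ)) * t) =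
      Complex.exp (-f * t) * Complex.exp (-z * t) * ((Real.exp (-2 * t) : ℝ) : ℂ) ^ (i + m) := by
    intro i m
    push_cast
    rw [← Complex.exp_nat_mul, ← Complex.exp_add, ← Complex.exp_add]
    congr 1; push_cast; ring
  simp only [e2]
  rw [atom, atomRem, seriesRem, e1, eta, mul_sub, sub_mul, sub_mul, Finset.mul_sum, Finset.sum_mul,
    Finset.sum_mul]
  have : ∀ i ∈ Finset.range M, ((t : ℂ) ^ a * Complex.exp (-f * t) * (∑ m ∈ Finset.range M,
      ((-2 * z) ^ i / i !) * ((N + i).multichoose m : ℂ) *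
        ((t : ℂ) ^ i * ((Real.exp (-2 * t) : ℝ) : ℂ) ^ (i + m)))) * expKernel (w + j) t *
        Complex.exp (-z * t) = ∑ m ∈ Finset.range M,
        (((-2 * z) ^ i / i !) * ((N + i).multichoose m : ℂ)) * ((t : ℂ) ^ (a + i) *
          expKernel (w + j) t * (Complex.exp (-f * t) * Complex.exp (-z * t) *
            ((Real.exp (-2 * t) : ℝ) : ℂ) ^ (i + m))) := by
    intro i _
    rw [Finset.mul_sum, Finset.sum_mul, Finset.sum_mul]
    refine Finset.sum_congr rfl fun m _ => ?_
    rw [pow_add]; ring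
  rw [Finset.sum_congr rfl this]
  ring

theorem continuousOn_eta : ContinuousOn eta (Ioi 0) := by
  refine ContinuousOn.inv₀ (by fun_prop) fun t ht => (one_sub_exp_pos ht).ne'

theorem atomRem_spec (a N M : ℕ) (f j : ℤ) :
    AnalyticOnNhd ℂ (fun p : ℂ × ℂ => ∫ t in Ioi (1 : ℝ),
        atomRem a N M f p.2 t * expKernel (p.1 + j) t * Complex.exp (-p.2 * t))
      {p | |(p.1 + j).re| < p.2.re + ((f + 2 * M : ℤ) : ℝ)} ∧
    ∀ p : ℂ × ℂ, |(p.1 + j).re| < p.2.re + ((f + 2 * M : ℤ) : ℝ) →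
      IntegrableOn (fun t : ℝ => atomRem a N M f p.2 t * expKernel (p.1 + j) t *
        Complex.exp (-p.2 * t)) (Ioi 1) := by
  refine analyticOnNhd_tail (fun z => ?_) (fun t ht => ?_) fun Z => ?_
  · refine ContinuousOn.mul (by fun_prop) ?_
    have h : ContinuousOn (fun t : ℝ => (1 - Real.exp (-2 * t))⁻¹) (Ioi 1) :=
      continuousOn_eta.mono (Ioi_subset_Ioi zero_le_one)
    unfold seriesRem
    refine ContinuousOn.sub (ContinuousOn.mul ?_ ?_) (by fun_prop)
    · exact (Complex.continuous_ofReal.comp_continuousOn h).pow N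
    · refine Complex.continuous_exp.comp_continuousOn (continuousOn_const.mul ?_)
      exact Complex.continuous_ofReal.comp_continuousOn (ContinuousOn.mul (by fun_prop) h)
  · unfold atomRem seriesRem
    fun_prop
  · obtain ⟨C, hC, h⟩ := seriesRem_bound N M Z
    refine ⟨C, hC, a + M, fun z hz t ht => ?_⟩
    have ht1 : (1 : ℝ) ≤ t := le_of_lt ht
    have ht0 : (0 : ℝ) ≤ t := zero_le_one.trans ht1
    have h1 := h z t (Real.exp (-2 * t)) hz ht1 (Real.exp_pos _).le (exp_neg_two_le_half ht1)
      (mul_exp_neg_two_le_one ht0)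
    rw [atomRem, norm_mul, norm_mul, norm_pow, Complex.norm_real, Complex.norm_exp,
      Real.norm_of_nonneg ht0]
    calc t ^ a * Real.exp (-f * t : ℂ).re * ‖seriesRem N M z t (Real.exp (-2 * t))‖
        ≤ t ^ a * Real.exp (-f * t : ℂ).re * (C * (t * Real.exp (-2 * t)) ^ M) := by gcongr
      _ = C * (t ^ (a + M) * (Real.exp (-f * t : ℂ).re * Real.exp (-2 * t) ^ M)) := by
          rw [mul_pow, pow_add]; ring
      _ = _ := by
          rw [← Real.exp_nat_mul, ← Real.exp_add]
          congr 3
          simp; ring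

theorem eventually_notMem_polarSetW {l₀ : ℕ} {z : ℂ} {k : ℕ} (hk : |z.re| + 1 < k) :
    ∀ᶠ w in 𝓝[≠] (poleW l₀ z k), (w, z) ∉ polarSetW := by
  have h : ∀ᶠ w in 𝓝[≠] (poleW l₀ z k), w ∈ Metric.ball (poleW l₀ z k) (min (1 / 2) (k - |z.re| - 1)) :=
    mem_nhdsWithin_of_mem_nhds (Metric.ball_mem_nhds _ (lt_min (by norm_num) (by linarith)))
  filter_upwards [h, self_mem_nhdsWithin] with w hw hne
  rintro ⟨m, hm, h | h⟩
  · -- on the first family, distinct hyperplanes have distance at least one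
    simp only at h
    apply hne
    rw [mem_ball_iff_norm, h, poleW] at hw
    have e : (m : ℂ) + z - (z + l₀ - 1 + 2 * k) = ((m - (l₀ - 1 + 2 * k) : ℤ) : ℂ) := by
      push_cast; ring
    rw [e, Complex.norm_intCast] at hw
    replace hw := hw.trans_le (min_le_left _ _)
    have : |(m - (l₀ - 1 + 2 * k) : ℤ)| < 1 := by
      have h2 : |((m - (l₀ - 1 + 2 * k) : ℤ) : ℝ)| < 1 := by linarith
      exact_mod_cast h2
    have h3 : (m : ℤ) = l₀ - 1 + 2 * k := by
      have := Int.abs_lt_one_iff.1 this; omega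
    simp only [mem_singleton_iff]
    rw [h, h3, poleW]; push_cast; ring
  · simp only at h
    rw [mem_ball_iff_norm] at hw
    have h1 := (Complex.abs_re_le_norm _).trans_lt (hw.trans_le (min_le_right _ _))
    rw [h, poleW] at h1
    have h2 := (abs_lt.1 h1).1
    simp at h2
    have hm' : (-1 : ℝ) ≤ m := by exact_mod_cast hm
    have := neg_abs_le z.re
    have hl : (0 : ℝ) ≤ l₀ := l₀.cast_nonneg
    linarith

/-- The continuation of the integral of an atom. For each `J`, the sum of the continued terms of order
at most `J` and the integral of the remainder is analytic on `region J` off the polar hyperplanes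
and is the integral on the tube; these functions are glued. In the leading coefficient only the
term with `i = k - a` and `m = 0` survives, so it does not depend on the exponent `N` of `η`. -/
theorem hasCont_atom (l₀ a N : ℕ) (f j : ℤ) (h1 : -1 ≤ f + j)
    (h2 : (l₀ : ℤ) - 1 + 2 * a ≤ f - j) :
    HasCont l₀ (Ioi 1) (atom a N f j) (fun z k =>
      if f - j = (l₀ : ℤ) - 1 + 2 * a ∧ a ≤ k then
        (-2 * z) ^ (k - a) / (k - a)! * (k ! / (poleW l₀ z k + j)) else 0) := by
  let coef : ℕ → ℕ → ℂ → ℂ := fun i m z => ((-2 * z) ^ i / i !) * ((N + i).multichoose m : ℂ)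
  let F : ℕ → ℂ × ℂ → ℂ := fun J p =>
    ∑ i ∈ Finset.range (J + 1), ∑ m ∈ Finset.range (J + 1),
      coef i m p.2 * laplaceTail (a + i) (f + 2 * i + 2 * m) j p +
    ∫ t in Ioi (1 : ℝ), atomRem a N (J + 1) f p.2 t * expKernel (p.1 + j) t * Complex.exp (-p.2 * t)
  have hfj1 : (-1 : ℝ) ≤ f + j := by exact_mod_cast h1
  have hfj2 : (-1 : ℝ) ≤ f - j := by
    have : (-1 : ℤ) ≤ f - j := by omega
    exact_mod_cast this
  have hreg : ∀ J, region J ⊆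
      {p : ℂ × ℂ | |(p.1 + j).re| < p.2.re + ((f + 2 * (J + 1 : ℕ) : ℤ) : ℝ)} := by
    intro J p hp
    simp only [region, mem_ofPred_eq] at hp ⊢
    push_cast
    rw [abs_lt] at hp ⊢
    simp only [Complex.add_re, Complex.intCast_re]
    have : (0 : ℝ) ≤ J := J.cast_nonneg
    constructor <;> linarith [hp.1, hp.2]
  have hcoef : ∀ i m, AnalyticOnNhd ℂ (coef i m) univ := fun i m z _ => by
    have : Differentiable ℂ (coef i m) := by simp only [coef]; fun_prop
    exact this.analyticAt z
  have hsumA : ∀ J, AnalyticOnNhd ℂ (fun p : ℂ × ℂ => ∑ i ∈ Finset.range (J + 1),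
      ∑ m ∈ Finset.range (J + 1), coef i m p.2 * laplaceTail (a + i) (f + 2 * i + 2 * m) j p)
      polarSetWᶜ := by
    intro J p hp
    refine Finset.analyticAt_fun_sum _ fun i _ => Finset.analyticAt_fun_sum _ fun m _ => ?_
    exact ((hcoef i m p.2 trivial).fun_comp analyticAt_snd).mul
      (analyticOnNhd_laplaceTail (a + i) (by omega) (by omega) p hp)
  have hF : ∀ J, AnalyticOnNhd ℂ (F J) (region J \ polarSetW) := fun J p hp =>
    (hsumA J p hp.2).add ((atomRem_spec a N (J + 1) f j).1 p (hreg J hp.1))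
  -- on the tube, every `F J` is the integral
  have htube : ∀ J, ∀ p ∈ tubeW, IntegrableOn (atom a N f j p.1 p.2) (Ioi 1) ∧
      F J p = ∫ t in Ioi (1 : ℝ), atom a N f j p.1 p.2 t := by
    intro J p hp
    have hlap : ∀ i m : ℕ, |(p.1 + j).re| < (p.2 + ((f + 2 * i + 2 * m : ℤ) : ℂ)).re := by
      intro i m
      simp only [tubeW, mem_ofPred_eq] at hp
      have hp' := abs_le.1 (le_refl |p.1.re|)
      simp only [Complex.add_re, Complex.intCast_re]
      push_cast
      rw [abs_lt]
      have : (0 : ℝ) ≤ i := i.cast_nonneg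
      have : (0 : ℝ) ≤ m := m.cast_nonneg
      constructor <;> linarith [hp'.1, hp'.2]
    have hrem := (atomRem_spec a N (J + 1) f j).2 p (hreg J (tubeW_subset_region J hp))
    have hint := fun i m : ℕ => (laplaceTail_eq (a + i) (f + 2 * i + 2 * m) j (hlap i m)).1.const_mul
      (coef i m p.2)
    have hsum : IntegrableOn (fun t : ℝ => ∑ i ∈ Finset.range (J + 1), ∑ m ∈ Finset.range (J + 1),
        coef i m p.2 * ((t : ℂ) ^ (a + i) * expKernel (p.1 + j) t *
          Complex.exp (-(p.2 + (f + 2 * i + 2 * m : ℤ)) * t))) (Ioi 1) :=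
      integrable_finsetSum _ fun i _ => integrable_finsetSum _ fun m _ => hint i m
    have hat : ∀ t ∈ Ioi (1 : ℝ), _ = atom a N f j p.1 p.2 t := fun t ht =>
      (atom_eq a N (J + 1) f j p.1 p.2 (zero_lt_one.trans ht)).symm
    refine ⟨(hsum.add hrem).congr_fun hat measurableSet_Ioi, ?_⟩
    rw [← setIntegral_congr_fun measurableSet_Ioi hat, integral_add hsum hrem]
    simp only [F]
    congr 1
    rw [integral_finsetSum _ fun i _ => integrable_finsetSum _ fun m _ => hint i m]
    refine Finset.sum_congr rfl fun i _ => ?_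
    rw [integral_finsetSum _ fun m _ => hint i m]
    refine Finset.sum_congr rfl fun m _ => ?_
    rw [integral_const_mul, (laplaceTail_eq (a + i) (f + 2 * i + 2 * m) j (hlap i m)).2]
  obtain ⟨Φ, hΦ, hΦF⟩ := exists_glue hF fun J p hp =>
    (htube J p hp).2.trans (htube 0 p hp).2.symm
  refine ⟨Φ, hΦ, fun p hp => ⟨(htube 0 p hp).1, ?_⟩, fun z k hk => ?_⟩
  · rw [hΦF 0 ⟨tubeW_subset_region 0 hp, Set.disjoint_left.1 tubeW_disjoint_polarSetW hp⟩]
    exact (htube 0 p hp).2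
  set w₀ := poleW l₀ z k with hw₀
  obtain ⟨J₀, hJ₀⟩ := exists_mem_region (w₀, z)
  -- a region that contains the pole and whose expansion reaches the order `k`
  obtain ⟨J, hJ, hkJ⟩ : ∃ J, (w₀, z) ∈ region J ∧ k ≤ J :=
    ⟨max J₀ k, region_mono (le_max_left _ _) hJ₀, le_max_right _ _⟩
  have hcw : Continuous fun w : ℂ => (w, z) := by fun_prop
  have hnear : ∀ᶠ w in 𝓝[≠] w₀, (w, z) ∈ region J :=
    mem_nhdsWithin_of_mem_nhds (hcw.continuousAt.preimage_mem_nhds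
      ((isOpen_region J).mem_nhds hJ))
  have hlim0 := tendsto_poleW_sub_pow l₀ z k
  rw [← hw₀] at hlim0
  -- an analytic term contributes nothing
  have hkill : ∀ G : ℂ × ℂ → ℂ, AnalyticAt ℂ G (w₀, z) →
      Tendsto (fun w => (w₀ - w) ^ (k + 1) * G (w, z)) (𝓝[≠] w₀) (𝓝 0) := by
    intro G hG
    have : ContinuousAt (fun w => G (w, z)) w₀ :=
      ContinuousAt.comp (f := fun w : ℂ => (w, z)) hG.continuousAt hcw.continuousAt
    simpa using hlim0.mul (this.tendsto.mono_left nhdsWithin_le_nhds)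
  have hterm : ∀ i m : ℕ, Tendsto (fun w => (w₀ - w) ^ (k + 1) *
      (coef i m z * laplaceTail (a + i) (f + 2 * i + 2 * m) j (w, z))) (𝓝[≠] w₀)
      (𝓝 (coef i m z * if f + 2 * i + 2 * m - j = (l₀ : ℤ) - 1 + 2 * (a + i : ℕ) ∧ a + i = k then
        k ! / (w₀ + j) else 0)) := by
    intro i m
    have t1 := tendsto_laplaceKernel (l₀ := l₀) (i := a + i) (f := f + 2 * i + 2 * m) (j := j)
      (by omega) (by push_cast; omega) hk
    have t2 := hkill _ (analyticOnNhd_laplaceHead (a + i) (f + 2 * i + 2 * m) j (w₀, z) trivial)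
    have := (t1.sub t2).const_mul (coef i m z)
    rw [sub_zero] at this
    refine this.congr fun w => ?_
    simp only [laplaceTail]
    rw [hw₀]; ring
  have htot := (tendsto_finsetSum (Finset.range (J + 1)) fun i _ =>
    tendsto_finsetSum (Finset.range (J + 1)) fun m _ => hterm i m).add
    (hkill _ ((atomRem_spec a N (J + 1) f j).1 (w₀, z) (hreg J hJ)))
  refine (htot.congr' ?_).trans (le_of_eq ?_)
  · filter_upwards [hnear, eventually_notMem_polarSetW hk] with w hw1 hw2
    rw [hΦF J ⟨hw1, hw2⟩]
    simp only [F]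
    rw [mul_add, Finset.mul_sum]
    congr 1
    refine Finset.sum_congr rfl fun i _ => ?_
    rw [Finset.mul_sum]
  · congr 1
    rw [add_zero]
    beta_reduce
    by_cases hc : f - j = (l₀ : ℤ) - 1 + 2 * a ∧ a ≤ k
    · obtain ⟨hc1, hc2⟩ := hc
      rw [if_pos ⟨hc1, hc2⟩, Finset.sum_eq_single_of_mem (k - a) (Finset.mem_range.2 (by omega)),
        Finset.sum_eq_single_of_mem 0 (Finset.mem_range.2 (by omega)), if_pos ⟨by push_cast; omega, by omega⟩]
      · simp only [coef, Nat.multichoose_zero_right, Nat.cast_one, mul_one]; rfl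
      · intro m _ hm
        rw [if_neg (by push_cast; omega), mul_zero]
      · intro i _ hi
        refine Finset.sum_eq_zero fun m _ => ?_
        rw [if_neg (by push_cast; omega), mul_zero]
    · rw [if_neg hc]
      refine Finset.sum_eq_zero fun i _ => Finset.sum_eq_zero fun m _ => ?_
      rw [if_neg (by push_cast; omega), mul_zero]

/-! ### Matrix elements of the principal series in homogeneous coordinates -/

/-- The range of summation in `matT`. All differences `l - m - k`, `l - n - k`, `m + n + k` are
nonnegative on it. -/
def jacS (l : ℕ) (m n : ℤ) : Finset ℕ :=
  Finset.Icc (max 0 (-m - n)).toNat (min ((l : ℤ) - m) ((l : ℤ) - n)).toNat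

theorem mem_jacS {l : ℕ} {m n : ℤ} (hm : m ≤ l) (hn : n ≤ l) {k : ℕ} :
    k ∈ jacS l m n ↔ -m - n ≤ k ∧ (k : ℤ) ≤ l - m ∧ (k : ℤ) ≤ l - n := by
  rw [jacS, Finset.mem_Icc]; omega

/-- The coefficients of `jacobiR`. -/
noncomputable def jacC (l : ℕ) (m n : ℤ) (k : ℕ) : ℝ :=
  (-1) ^ k * ((((l : ℤ) - n).toNat.choose k : ℕ) : ℝ) *
    ((((l : ℤ) + n).toNat.choose ((l : ℤ) - m - k).toNat : ℕ) : ℝ)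

/-- The homogeneous polynomial of degree `2 l` that becomes `P^l_{m,n}(y)`, up to a constant, at
`a = √((1 + y) / 2)`, `b = √((1 - y) / 2)`. -/
noncomputable def jacobiR (l : ℕ) (m n : ℤ) (a b : ℝ) : ℝ :=
  ∑ k ∈ jacS l m n, jacC l m n k * (a ^ (2 * k + m + n).toNat * b ^ (2 * l - m - n - 2 * k).toNat)

/-- The normalization of the functions `P^l_{m,n}`. -/
noncomputable def jacN (l : ℕ) (m n : ℤ) : ℝ :=
  Real.sqrt (((((l : ℤ) - m).toNat ! : ℝ) * (((l : ℤ) + m).toNat ! : ℝ)) /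
        ((((l : ℤ) - n).toNat ! : ℝ) * (((l : ℤ) + n).toNat ! : ℝ)))

/-- The phase of the functions `P^l_{m,n}`, which collects all powers of `i`. -/
noncomputable def jacPhase (l : ℕ) (m n : ℤ) : ℂ :=
  (-1) ^ (2 * (l : ℤ) - m - n) * ((-1) ^ l * Complex.I ^ (-m - n))

theorem jacobiP_eq {l : ℕ} {m n : ℤ} (hm : m ≤ l) (hn : n ≤ l) (y : ℝ) :
    jacobiP l m n y = jacPhase l m n * jacN l m n *
      (jacobiR l m n (√((1 + y) / 2)) (√((1 - y) / 2)) : ℝ) := by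
  rw [jacobiP, matT, jacPhase, jacobiR, Complex.ofReal_sum]
  have assemble : ∀ p r i N S S' : ℂ, S = r * i * S' → p * N * S = p * (r * i) * N * S' := by
    rintro p r i N S S' rfl; ring
  refine assemble _ _ _ _ _ _ ?_
  rw [Finset.mul_sum]
  refine Finset.sum_congr rfl fun k hk => ?_
  have hk' := (mem_jacS hm hn).1 hk
  simp only [Matrix.of_apply, Matrix.cons_val', Matrix.cons_val_zero, Matrix.cons_val_one,
    Matrix.cons_val_fin_one]
  set a : ℂ := ((√((1 + y) / 2) : ℝ) : ℂ)
  set b : ℂ := ((√((1 - y) / 2) : ℝ) : ℂ)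
  have e1 : a ^ (2 * k + m + n).toNat = a ^ k * a ^ (m + n + k).toNat := by
    rw [← pow_add]; congr 1; omega
  have e2 : b ^ (2 * l - m - n - 2 * k).toNat =
      b ^ ((l : ℤ) - m - k).toNat * b ^ ((l : ℤ) - n - k).toNat := by
    rw [← pow_add]; congr 1; omega
  have e3 : Complex.I ^ ((l : ℤ) - m - k).toNat * Complex.I ^ ((l : ℤ) - n - k).toNat =
      (-1) ^ l * Complex.I ^ (-m - n) * (-1) ^ k := by
    rw [← pow_add, ← Complex.I_sq, ← pow_mul, ← pow_mul]
    have h1 : Complex.I ^ (2 * k) * Complex.I ^ (2 * k) = 1 := by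
      rw [← pow_add, ← two_mul, mul_comm 2, mul_assoc, mul_comm k, pow_mul]
      norm_num [Complex.I_pow_four]
    have h2 : Complex.I ^ (((l : ℤ) - m - k).toNat + ((l : ℤ) - n - k).toNat) * Complex.I ^ (2 * k) =
        Complex.I ^ (2 * l) * Complex.I ^ (-m - n) := by
      rw [← zpow_natCast, ← zpow_natCast, ← zpow_natCast, ← zpow_add₀ Complex.I_ne_zero,
        ← zpow_add₀ Complex.I_ne_zero]
      congr 1; omega
    calc _ = (Complex.I ^ (((l : ℤ) - m - k).toNat + ((l : ℤ) - n - k).toNat) *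
          Complex.I ^ (2 * k)) * Complex.I ^ (2 * k) := by rw [mul_assoc, h1, mul_one]
      _ = _ := by rw [h2]
  push_cast [jacC]
  rw [e1, e2, mul_pow, mul_pow]
  linear_combination ((((l : ℤ) - n).toNat.choose k : ℕ) : ℂ) *
    ((((l : ℤ) + n).toNat.choose ((l : ℤ) - m - k).toNat : ℕ) : ℂ) * a ^ k *
      a ^ (m + n + k).toNat * b ^ ((l : ℤ) - m - k).toNat * b ^ ((l : ℤ) - n - k).toNat * e3

theorem conj_jacPhase_mul (l l' : ℕ) (m n : ℤ) :
    conj (jacPhase l' m n) * jacPhase l m n = (-1) ^ (l + l') := by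
  have h1 : conj (Complex.I ^ (-m - n)) * Complex.I ^ (-m - n) = 1 := by
    rw [map_zpow₀, ← mul_zpow]; simp
  have h2 : ∀ l : ℕ, (-1 : ℂ) ^ (2 * (l : ℤ) - m - n) = (-1) ^ (-m - n) := by
    intro l
    rw [show 2 * (l : ℤ) - m - n = 2 * l + (-m - n) by ring, zpow_add₀ (by norm_num), zpow_mul]
    simp
  have h3 : (-1 : ℂ) ^ (-m - n) * (-1) ^ (-m - n) = 1 := by rw [← mul_zpow]; simp
  simp only [jacPhase, h2, map_mul, map_zpow₀, map_pow, map_neg, map_one, Complex.conj_I] at h1 ⊢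
  rw [pow_add]
  linear_combination (-1) ^ l * (-1) ^ l' * (h3 * ((-Complex.I) ^ (-m - n) * Complex.I ^ (-m - n)) + h1)

/-- The projective map `y ↦ (y - tanh t) / (1 - y tanh t)` of `[-1, 1]` that is induced by the
hyperbolic rotation with angle `t`. -/
noncomputable def boost (t y : ℝ) : ℝ :=
  (y - Real.tanh t) / (1 - Real.tanh t * y)

/-- The factor `u = cosh t - y sinh t`. It satisfies `boost t y = (y cosh t - sinh t) / u`, and
`u⁻²` is the derivative of `boost t`. -/
noncomputable def uu (t y : ℝ) : ℝ := Real.cosh t - y * Real.sinh t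

theorem uu_pos (t : ℝ) {y : ℝ} (hy : y ∈ Icc (-1 : ℝ) 1) : 0 < uu t y := by
  have e : uu t y = (1 + y) / 2 * Real.exp (-t) + (1 - y) / 2 * Real.exp t := by
    rw [uu, Real.cosh_eq, Real.sinh_eq]; ring
  rw [e]
  have := Real.exp_pos t
  have := Real.exp_pos (-t)
  rcases hy.2.eq_or_lt with rfl | h
  · norm_num; positivity
  · have h0 := hy.1
    exact add_pos_of_nonneg_of_pos (mul_nonneg (by linarith) (Real.exp_pos _).le)
      (mul_pos (by linarith) (Real.exp_pos _))

theorem cosh_mul_one_sub (t y : ℝ) : Real.cosh t * (1 - Real.tanh t * y) = uu t y := by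
  have := (Real.cosh_pos t).ne'
  rw [Real.tanh_eq_sinh_div_cosh, uu]; field_simp

theorem boost_eq (t : ℝ) {y : ℝ} (hy : y ∈ Icc (-1 : ℝ) 1) :
    boost t y = (y * Real.cosh t - Real.sinh t) / uu t y := by
  have h := cosh_mul_one_sub t y
  have hu := (uu_pos t hy).ne'
  have hc := (Real.cosh_pos t).ne'
  have h1 : 1 - Real.tanh t * y ≠ 0 := fun h0 => hu (by rw [← h, h0, mul_zero])
  rw [boost, div_eq_div_iff h1 hu, ← h, Real.tanh_eq_sinh_div_cosh]
  field_simp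

theorem one_add_boost (t : ℝ) {y : ℝ} (hy : y ∈ Icc (-1 : ℝ) 1) :
    (1 + boost t y) / 2 = (1 + y) / 2 * Real.exp (-t) / uu t y := by
  have hu := (uu_pos t hy).ne'
  rw [boost_eq t hy]
  field_simp
  rw [uu, Real.cosh_eq, Real.sinh_eq]
  ring

theorem one_sub_boost (t : ℝ) {y : ℝ} (hy : y ∈ Icc (-1 : ℝ) 1) :
    (1 - boost t y) / 2 = (1 - y) / 2 * Real.exp t / uu t y := by
  have hu := (uu_pos t hy).ne'
  rw [boost_eq t hy]
  field_simp
  rw [uu, Real.cosh_eq, Real.sinh_eq]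
  ring

theorem boost_mem (t : ℝ) {y : ℝ} (hy : y ∈ Icc (-1 : ℝ) 1) : boost t y ∈ Icc (-1 : ℝ) 1 := by
  have hu := uu_pos t hy
  have h1 := one_add_boost t hy
  have h2 := one_sub_boost t hy
  have h3 : 0 ≤ (1 + y) / 2 * Real.exp (-t) / uu t y := by
    have := hy.1
    exact div_nonneg (mul_nonneg (by linarith) (Real.exp_pos _).le) hu.le
  have h4 : 0 ≤ (1 - y) / 2 * Real.exp t / uu t y := by
    have := hy.2
    exact div_nonneg (mul_nonneg (by linarith) (Real.exp_pos _).le) hu.le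
  constructor <;> linarith

/-- `jacobiR` as a function on `[-1, 1]`. -/
noncomputable def jacF (l : ℕ) (m n : ℤ) (y : ℝ) : ℝ :=
  jacobiR l m n (√((1 + y) / 2)) (√((1 - y) / 2))

/-- The matrix elements of the principal series without normalization, in the variable `w = iρ`:
`1/2 ∫ u^{w-1} P^{l'}_{m,n}(y) P^l_{m,n}(boost t y) dy`, with the real polynomials `jacF` for the
functions `P`. -/
noncomputable def rInt (w : ℂ) (m n : ℤ) (l l' : ℕ) (t : ℝ) : ℂ :=
  1 / 2 * ∫ y in (-1 : ℝ)..1, (uu t y : ℂ) ^ (w - 1) * (jacF l' m n y * jacF l m n (boost t y) : ℝ)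

theorem matU_eq {l l' : ℕ} {m n : ℤ} (hm : m ≤ l) (hm' : m ≤ l') (hn : n ≤ l) (hn' : n ≤ l')
    (ρ : ℂ) (t : ℝ) :
    matU m ρ l n l' n t = (-1) ^ (l + l') * (√((2 * l' + 1) * (2 * l + 1)) : ℝ) * jacN l m n *
      jacN l' m n * rInt (Complex.I * ρ) m n l l' t := by
  rw [matU, if_pos rfl, rInt]
  have e : (Real.cosh t : ℂ) ^ (Complex.I * ρ - 1) *
      (∫ y in (-1 : ℝ)..1, ((1 - Real.tanh t * y : ℝ) : ℂ) ^ (Complex.I * ρ - 1) *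
          conj (jacobiP l' m n y) * jacobiP l m n ((y - Real.tanh t) / (1 - Real.tanh t * y))) =
      ∫ y in (-1 : ℝ)..1, ((-1) ^ (l + l') * (jacN l m n : ℂ) * jacN l' m n) *
        ((uu t y : ℂ) ^ (Complex.I * ρ - 1) * (jacF l' m n y * jacF l m n (boost t y) : ℝ)) := by
    rw [← intervalIntegral.integral_const_mul]
    refine intervalIntegral.integral_congr fun y hy => ?_
    rw [uIcc_of_le (by norm_num)] at hy
    have hc := Real.cosh_pos t
    have h1 : 0 ≤ 1 - Real.tanh t * y := by
      have := cosh_mul_one_sub t y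
      have hu := uu_pos t hy
      rw [← this] at hu
      exact (pos_of_mul_pos_right hu hc.le).le
    rw [jacobiP_eq hm' hn', jacobiP_eq hm hn, ← cosh_mul_one_sub, Complex.ofReal_mul,
      Complex.mul_cpow_ofReal_nonneg hc.le h1, map_mul, map_mul, Complex.conj_ofReal,
      Complex.conj_ofReal, ← conj_jacPhase_mul l l' m n]
    simp only [jacF, boost]
    push_cast
    ring
  rw [mul_assoc, e, intervalIntegral.integral_const_mul]
  ring

theorem jacF_boost_mul {l l' : ℕ} {m n : ℤ} (hm : m ≤ l) (hm' : m ≤ l') (hn : n ≤ l) (hn' : n ≤ l')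
    (t : ℝ) {y : ℝ} (hy : y ∈ Icc (-1 : ℝ) 1) :
    jacF l' m n y * jacF l m n (boost t y) = ∑ k ∈ jacS l m n, ∑ k' ∈ jacS l' m n,
      jacC l m n k * jacC l' m n k' * Real.exp (-((2 * k + m + n - l : ℤ) : ℝ) * t) *
        ((uu t y)⁻¹ ^ l * (((1 + y) / 2) ^ (k + k' + m + n).toNat *
          ((1 - y) / 2) ^ (l + l' - k - k' - m - n).toNat)) := by
  have hu := uu_pos t hy
  have ha : 0 ≤ (1 + y) / 2 := by linarith [hy.1]
  have hb : 0 ≤ (1 - y) / 2 := by linarith [hy.2]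
  rw [jacF, jacF, one_add_boost t hy, one_sub_boost t hy, jacobiR, jacobiR, Finset.sum_mul_sum,
    Finset.sum_comm]
  refine Finset.sum_congr rfl fun k hk => Finset.sum_congr rfl fun k' hk' => ?_
  rw [mem_jacS hm hn] at hk
  rw [mem_jacS hm' hn'] at hk'
  rw [mul_div_assoc, mul_div_assoc, Real.sqrt_mul ha, Real.sqrt_mul hb, Real.sqrt_div (Real.exp_pos _).le,
    Real.sqrt_div (Real.exp_pos _).le]
  set a := √((1 + y) / 2) with hadef
  set b := √((1 - y) / 2) with hbdef
  set v := √(uu t y) with hvdef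
  have hv : 0 < v := Real.sqrt_pos.2 hu
  have ha2 : (1 + y) / 2 = a ^ 2 := (Real.sq_sqrt ha).symm
  have hb2 : (1 - y) / 2 = b ^ 2 := (Real.sq_sqrt hb).symm
  have hv2 : uu t y = v ^ 2 := (Real.sq_sqrt hu.le).symm
  have hr1 : √(Real.exp (-t)) = Real.exp (-t / 2) := by rw [Real.exp_half]
  have hr2 : √(Real.exp t) = Real.exp (t / 2) := by rw [Real.exp_half]
  rw [ha2, hb2, hv2, hr1, hr2]
  have e1 : (a ^ 2) ^ (k + k' + m + n).toNat =
      a ^ (2 * k' + m + n).toNat * a ^ (2 * k + m + n).toNat := by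
    rw [← pow_mul, ← pow_add]; congr 1; omega
  have e2 : (b ^ 2) ^ (l + l' - k - k' - m - n).toNat =
      b ^ (2 * l' - m - n - 2 * k').toNat * b ^ (2 * l - m - n - 2 * k).toNat := by
    rw [← pow_mul, ← pow_add]; congr 1; omega
  have e3 : (v ^ 2)⁻¹ ^ l = (v ^ (2 * k + m + n).toNat)⁻¹ * (v ^ (2 * l - m - n - 2 * k).toNat)⁻¹ := by
    rw [inv_pow, ← pow_mul, ← mul_inv, ← pow_add]; congr 2; omega
  have e4 : Real.exp (-((2 * k + m + n - l : ℤ) : ℝ) * t) =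
      Real.exp (-t / 2) ^ (2 * k + m + n).toNat * Real.exp (t / 2) ^ (2 * l - m - n - 2 * k).toNat := by
    rw [← Real.exp_nat_mul, ← Real.exp_nat_mul, ← Real.exp_add]
    congr 1
    have h1 : (((2 * k + m + n).toNat : ℕ) : ℝ) = 2 * k + m + n := by
      have : (((2 * k + m + n).toNat : ℕ) : ℤ) = 2 * k + m + n := by omega
      exact_mod_cast this
    have h2 : (((2 * l - m - n - 2 * k).toNat : ℕ) : ℝ) = 2 * l - m - n - 2 * k := by
      have : (((2 * l - m - n - 2 * k).toNat : ℕ) : ℤ) = 2 * l - m - n - 2 * k := by omega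
      exact_mod_cast this
    rw [h1, h2]; push_cast; ring
  rw [e1, e2, e3, e4]
  simp only [mul_pow, div_pow]
  field_simp

/-! ### Matrix elements as sums of exponential kernels -/

theorem exp_neg_mul_eta {t : ℝ} (ht : 0 < t) : Real.exp (-t) * eta t = (2 * Real.sinh t)⁻¹ := by
  have h1 := (one_sub_exp_pos ht).ne'
  have hs : Real.sinh t ≠ 0 := (Real.sinh_pos_iff.2 ht).ne'
  have e : Real.exp (-2 * t) = Real.exp (-t) * Real.exp (-t) := by
    rw [← Real.exp_add]; ring_nf
  have e2 : Real.exp t * Real.exp (-t) = 1 := by rw [← Real.exp_add]; simp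
  rw [e] at h1
  rw [eta, e, ← div_eq_mul_inv, inv_eq_one_div, div_eq_div_iff h1 (by positivity), Real.sinh_eq]
  linear_combination e2

/-- The substitution `cosh t - y sinh t = e^r` in the integrals of the matrix elements. The factors
`(1 ± y) / 2` become `(e^t - e^r) / (2 sinh t)` and `(e^r - e^{-t}) / (2 sinh t)`. -/
theorem integral_uu_cpow {t : ℝ} (ht : 0 < t) (v : ℂ) (p q : ℕ) :
    1 / 2 * ∫ y in (-1 : ℝ)..1, (uu t y : ℂ) ^ (v - 1) *
      ((((1 + y) / 2) ^ p * ((1 - y) / 2) ^ q : ℝ) : ℂ) =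
    ((Real.exp (-t) * eta t : ℝ) : ℂ) ^ (p + q + 1) * ∫ r in -t..t, Complex.exp (v * r) *
      (((Real.exp t - Real.exp r) ^ p * (Real.exp r - Real.exp (-t)) ^ q : ℝ) : ℂ) := by
  have hs : 0 < Real.sinh t := Real.sinh_pos_iff.2 ht
  -- the inverse of the substitution, decreasing from `g (-t) = 1` to `g t = -1`
  set g : ℝ → ℝ := fun r => (Real.cosh t - Real.exp r) / Real.sinh t with hg
  set G : ℝ → ℂ := fun y => (uu t y : ℂ) ^ (v - 1) *
      ((((1 + y) / 2) ^ p * ((1 - y) / 2) ^ q : ℝ) : ℂ) with hG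
  have hg1 : g t = -1 := by
    simp only [hg]; rw [div_eq_iff hs.ne', Real.cosh_eq, Real.sinh_eq]; ring
  have hg2 : g (-t) = 1 := by
    simp only [hg]; rw [div_eq_iff hs.ne', Real.cosh_eq, Real.sinh_eq]; ring
  have hmem : ∀ r ∈ uIcc t (-t), g r ∈ Icc (-1 : ℝ) 1 := by
    intro r hr
    rw [uIcc_of_ge (by linarith)] at hr
    have h1 := Real.exp_le_exp.2 hr.1
    have h2 := Real.exp_le_exp.2 hr.2
    rw [← hg1, ← hg2]
    simp only [hg]
    constructor <;> gcongr
  have hGc : ContinuousOn G (Icc (-1) 1) := by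
    have : ContinuousOn (fun y : ℝ => (uu t y : ℂ) ^ (v - 1)) (Icc (-1) 1) := by
      intro y hy
      refine ContinuousAt.continuousWithinAt (ContinuousAt.cpow ?_ continuousAt_const ?_)
      · unfold uu; fun_prop
      · exact Or.inl (by simpa using uu_pos t hy)
    exact this.mul (by fun_prop)
  have key := intervalIntegral.integral_deriv_smul_comp' (a := t) (b := -t) (f := g)
    (f' := fun r => -Real.exp r / Real.sinh t) (g := G)
    (fun r _ => by
      simp only [hg]
      exact ((Real.hasDerivAt_exp r).const_sub _).div_const _)
    (by fun_prop) (hGc.mono (by rintro _ ⟨r, hr, rfl⟩; exact hmem r hr))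
  rw [hg1, hg2] at key
  rw [← key, intervalIntegral.integral_symm, ← intervalIntegral.integral_neg,
    ← intervalIntegral.integral_const_mul, ← intervalIntegral.integral_const_mul]
  refine intervalIntegral.integral_congr fun r _ => ?_
  have hu : uu t (g r) = Real.exp r := by
    simp only [uu, hg]; field_simp; ring
  have hE := exp_neg_mul_eta ht
  have h1 : (1 + g r) / 2 = (Real.exp (-t) * eta t) * (Real.exp t - Real.exp r) := by
    rw [hE]; simp only [hg]; field_simp; rw [Real.cosh_eq, Real.sinh_eq]; ring
  have h2 : (1 - g r) / 2 = (Real.exp (-t) * eta t) * (Real.exp r - Real.exp (-t)) := by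
    rw [hE]; simp only [hg]; field_simp; rw [Real.cosh_eq, Real.sinh_eq]; ring
  have h3 : ((Real.exp r : ℝ) : ℂ) ^ (v - 1) * (Real.exp r : ℂ) = Complex.exp (v * r) := by
    rw [Complex.cpow_def_of_ne_zero (by simp), ← Complex.ofReal_log (Real.exp_pos _).le,
      Real.log_exp, Complex.ofReal_exp, ← Complex.exp_add]
    congr 1; ring
  have h4 : -Real.exp r / Real.sinh t = -(2 * (Real.exp (-t) * eta t) * Real.exp r) := by
    rw [hE]; field_simp
  simp only [Function.comp, hG, hu, h1, h2, h4, Complex.real_smul, ← h3, mul_pow]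
  push_cast
  ring

theorem integral_exp_binomial (v : ℂ) (p q : ℕ) (t : ℝ) :
    ∫ r in -t..t, Complex.exp (v * r) *
      (((Real.exp t - Real.exp r) ^ p * (Real.exp r - Real.exp (-t)) ^ q : ℝ) : ℂ) =
    ∑ i ∈ Finset.range (q + 1), ∑ i' ∈ Finset.range (p + 1),
      ((-1) ^ (i + i') * (q.choose i : ℂ) * (p.choose i' : ℂ)) *
        Complex.exp (((p : ℂ) - i' - i) * t) * expKernel (v + (q - i + i' : ℤ)) t := by
  have hcont : ∀ a : ℂ, Continuous fun r : ℝ => Complex.exp (a * r) := fun a => by fun_prop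
  have e : ∀ r : ℝ, Complex.exp (v * r) *
      (((Real.exp t - Real.exp r) ^ p * (Real.exp r - Real.exp (-t)) ^ q : ℝ) : ℂ) =
      ∑ i ∈ Finset.range (q + 1), ∑ i' ∈ Finset.range (p + 1),
      (((-1) ^ (i + i') * (q.choose i : ℂ) * (p.choose i' : ℂ)) *
        Complex.exp (((p : ℂ) - i' - i) * t)) * Complex.exp ((v + (q - i + i' : ℤ)) * r) := by
    intro r
    rw [sub_eq_neg_add (Real.exp t), sub_eq_neg_add (Real.exp r), add_pow, add_pow, mul_comm
      (∑ _ ∈ _, _ : ℝ), Finset.sum_mul_sum, Complex.ofReal_sum, Finset.mul_sum]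
    refine Finset.sum_congr rfl fun i hi => ?_
    rw [Complex.ofReal_sum, Finset.mul_sum]
    refine Finset.sum_congr rfl fun i' hi' => ?_
    rw [Finset.mem_range] at hi hi'
    rw [neg_pow, neg_pow (Real.exp r), ← Real.exp_nat_mul, ← Real.exp_nat_mul, ← Real.exp_nat_mul,
      ← Real.exp_nat_mul, Nat.cast_sub (by omega), Nat.cast_sub (by omega), pow_add]
    have h : Complex.exp (((p : ℂ) - i' - i) * t) * Complex.exp ((v + (q - i + i' : ℤ)) * r) =
        Complex.exp (v * r) * ((Real.exp (i * -t) : ℝ) * (Real.exp ((q - i) * r) : ℝ) *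
          ((Real.exp (i' * r) : ℝ) * (Real.exp ((p - i') * t) : ℝ))) := by
      simp only [Complex.ofReal_exp, ← Complex.exp_add]
      congr 1; push_cast; ring
    push_cast at h ⊢
    linear_combination (-(-1) ^ i * (-1) ^ i' * (q.choose i : ℂ) * (p.choose i' : ℂ)) * h
  simp only [e]
  rw [intervalIntegral.integral_finsetSum fun i _ => (Continuous.intervalIntegrable (by fun_prop) _ _)]
  refine Finset.sum_congr rfl fun i _ => ?_
  rw [intervalIntegral.integral_finsetSum fun i _ => (Continuous.intervalIntegrable (by fun_prop) _ _)]
  refine Finset.sum_congr rfl fun i' _ => ?_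
  rw [intervalIntegral.integral_const_mul, expKernel]

/-- The exponent of `(1 + y) / 2`. -/
def rP (m n : ℤ) (k k' : ℕ) : ℕ := (k + k' + m + n).toNat

/-- The exponent of `(1 - y) / 2`. -/
def rQ (m n : ℤ) (l l' k k' : ℕ) : ℕ := (l + l' - k - k' - m - n : ℤ).toNat

/-- The coefficients of the expansion of the matrix elements. -/
noncomputable def rC (m n : ℤ) (l l' k k' i i' : ℕ) : ℝ :=
  jacC l m n k * jacC l' m n k' *
    ((-1) ^ (i + i') * ((rQ m n l l' k k').choose i : ℝ) * ((rP m n k k').choose i' : ℝ))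

/-- The exponents of `e^{-t}` in the expansion of the matrix elements. -/
def rF (m n : ℤ) (l l' k k' i i' : ℕ) : ℤ :=
  rQ m n l l' k k' + 1 + i + i' + 2 * k + m + n - l

/-- The shifts of `w` in the expansion of the matrix elements. -/
def rJ (m n : ℤ) (l l' k k' i i' : ℕ) : ℤ :=
  rQ m n l l' k k' - i + i' - l

/-- A finite sum over the index set of the expansion of the matrix elements. -/
def rSum {M : Type*} [AddCommMonoid M] (m n : ℤ) (l l' : ℕ) (g : ℕ → ℕ → ℕ → ℕ → M) : M :=
  ∑ k ∈ jacS l m n, ∑ k' ∈ jacS l' m n, ∑ i ∈ Finset.range (rQ m n l l' k k' + 1),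
    ∑ i' ∈ Finset.range (rP m n k k' + 1), g k k' i i'

/-- The matrix elements as finite sums of exponential kernels, with coefficients that are rational in
`e^{-t}` and do not depend on `w`. -/
theorem rInt_eq {l l' : ℕ} {m n : ℤ} (hm : m ≤ l) (hm' : m ≤ l') (hn : n ≤ l) (hn' : n ≤ l')
    (w : ℂ) {t : ℝ} (ht : 0 < t) :
    rInt w m n l l' t = rSum m n l l' fun k k' i i' =>
      (rC m n l l' k k' i i' : ℂ) * (Complex.exp (-(rF m n l l' k k' i i' : ℂ) * t) *
        (eta t : ℂ) ^ (l + l' + 1) * expKernel (w + rJ m n l l' k k' i i') t) := by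
  have e : ∫ y in (-1 : ℝ)..1, (uu t y : ℂ) ^ (w - 1) *
        (jacF l' m n y * jacF l m n (boost t y) : ℝ) =
      ∑ k ∈ jacS l m n, ∑ k' ∈ jacS l' m n, ∫ y in (-1 : ℝ)..1,
        (jacC l m n k * jacC l' m n k' * Real.exp (-((2 * k + m + n - l : ℤ) : ℝ) * t) : ℝ) *
        ((uu t y : ℂ) ^ (w - l - 1) * ((((1 + y) / 2) ^ (rP m n k k') *
          ((1 - y) / 2) ^ (rQ m n l l' k k') : ℝ) : ℂ)) := by
    have hint : ∀ (c : ℝ) (p q : ℕ), IntervalIntegrable (fun y : ℝ => (c : ℂ) *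
        ((uu t y : ℂ) ^ (w - l - 1) * ((((1 + y) / 2) ^ p * ((1 - y) / 2) ^ q : ℝ) : ℂ)))
        volume (-1) 1 := by
      intro c p q
      refine ContinuousOn.intervalIntegrable ?_
      rw [uIcc_of_le (by norm_num)]
      refine continuousOn_const.mul (ContinuousOn.mul (fun y hy => ?_) (by fun_prop))
      refine ContinuousAt.continuousWithinAt (ContinuousAt.cpow ?_ continuousAt_const ?_)
      · unfold uu; fun_prop
      · exact Or.inl (by simpa using uu_pos t hy)
    simp only [← intervalIntegral.integral_finsetSum fun k' _ => hint _ _ _]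
    rw [← intervalIntegral.integral_finsetSum]
    · refine intervalIntegral.integral_congr fun y hy => ?_
      rw [uIcc_of_le (by norm_num)] at hy
      have hu := uu_pos t hy
      have hu' : (uu t y : ℂ) ≠ 0 := by exact_mod_cast hu.ne'
      rw [jacF_boost_mul hm hm' hn hn' t hy, Complex.ofReal_sum, Finset.mul_sum]
      refine Finset.sum_congr rfl fun k hk => ?_
      rw [Complex.ofReal_sum, Finset.mul_sum]
      refine Finset.sum_congr rfl fun k' hk' => ?_
      have hc : (uu t y : ℂ) ^ (w - l - 1) = (uu t y : ℂ) ^ (w - 1) * ((uu t y : ℂ) ^ l)⁻¹ := by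
        rw [show w - l - 1 = w - 1 - l by ring, Complex.cpow_sub _ _ hu', Complex.cpow_natCast,
          div_eq_mul_inv]
      rw [hc]
      simp only [rP, rQ]
      push_cast
      rw [inv_pow]
      ring
    · intro k _
      have := IntervalIntegrable.sum (μ := volume) (a := -1) (b := 1) (jacS l' m n)
        (f := fun k' y => ((jacC l m n k * jacC l' m n k' *
          Real.exp (-((2 * k + m + n - l : ℤ) : ℝ) * t) : ℝ) : ℂ) *
        ((uu t y : ℂ) ^ (w - l - 1) * ((((1 + y) / 2) ^ (rP m n k k') *
          ((1 - y) / 2) ^ (rQ m n l l' k k') : ℝ) : ℂ))) fun k' _ => hint _ _ _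
      simpa only [Finset.sum_fn] using this
  rw [rInt, e, rSum, Finset.mul_sum]
  refine Finset.sum_congr rfl fun k hk => ?_
  rw [Finset.mul_sum]
  refine Finset.sum_congr rfl fun k' hk' => ?_
  rw [intervalIntegral.integral_const_mul, mul_left_comm, integral_uu_cpow ht,
    integral_exp_binomial, Finset.mul_sum, Finset.mul_sum]
  refine Finset.sum_congr rfl fun i _ => ?_
  rw [Finset.mul_sum, Finset.mul_sum]
  refine Finset.sum_congr rfl fun i' _ => ?_
  rw [mem_jacS hm hn] at hk
  rw [mem_jacS hm' hn'] at hk'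
  have hpq : rP m n k k' + rQ m n l l' k k' = l + l' := by
    simp only [rP, rQ]; omega
  have hj : w - l + ((rQ m n l l' k k' : ℤ) - i + i' : ℤ) = w + (rJ m n l l' k k' i i' : ℤ) := by
    simp only [rJ]; push_cast; ring
  have hx : Complex.exp (-(rF m n l l' k k' i i' : ℂ) * t) =
      (Real.exp (-((2 * k + m + n - l : ℤ) : ℝ) * t) : ℂ) * ((Real.exp (-t) : ℂ) ^ (l + l' + 1) *
        Complex.exp (((rP m n k k' : ℂ) - i' - i) * t)) := by
    have hp : (rP m n k k' : ℂ) = l + l' - rQ m n l l' k k' := by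
      rw [← Nat.cast_add, ← hpq]; push_cast; ring
    rw [hp]
    simp only [Complex.ofReal_exp, ← Complex.exp_nat_mul, ← Complex.exp_add]
    congr 1
    simp only [rF]
    push_cast
    ring
  rw [hpq, hj, hx, rC]
  push_cast
  ring

/-! ### Expansions at infinity and their symbols -/

/-- The value of a polynomial in `x` with coefficients that are polynomials in `T` at `x = e^{-2t}`,
`T = t e^{-2t}`. -/
noncomputable def evalTX (t : ℝ) : Polynomial ℂ[X] →+* ℂ :=
  Polynomial.eval₂RingHom (Polynomial.evalRingHom ((t * Real.exp (-2 * t) : ℝ) : ℂ))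
    ((Real.exp (-2 * t) : ℝ) : ℂ)

/-- `g = e^{-dt} (1 - x)^{-N} G(T, x)` on `(0, ∞)` for some `N` and some polynomial `G` with
`G(T, 0) = s(T)`, where `x = e^{-2t}` and `T = t e^{-2t}`; the polynomial `s` is the symbol
of `g`. Powers of `T` are compatible with the maximal order of the poles, whereas each further factor
`x` lowers it. -/
def HasExpansion (d : ℤ) (g : ℝ → ℂ) (s : ℂ[X]) : Prop :=
  ∃ (N : ℕ) (G : Polynomial ℂ[X]), G.coeff 0 = s ∧
    ∀ t : ℝ, 0 < t → g t = Complex.exp (-d * t) * (eta t : ℂ) ^ N * evalTX t G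

theorem HasExpansion.congr {d : ℤ} {g g' : ℝ → ℂ} {s s' : ℂ[X]} (h : HasExpansion d g s)
    (hg : ∀ t : ℝ, 0 < t → g' t = g t) (hs : s' = s) : HasExpansion d g' s' := by
  obtain ⟨N, G, h1, h2⟩ := h
  exact ⟨N, G, h1.trans hs.symm, fun t ht => (hg t ht).trans (h2 t ht)⟩

theorem eta_mul {t : ℝ} (ht : 0 < t) : (eta t : ℂ) * evalTX t (1 - Polynomial.X) = 1 := by
  have h := (one_sub_exp_pos ht).ne'
  have e : evalTX t (1 - Polynomial.X) = ((1 - Real.exp (-2 * t) : ℝ) : ℂ) := by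
    simp [evalTX]
  rw [e, eta, ← Complex.ofReal_mul, inv_mul_cancel₀ h, Complex.ofReal_one]

theorem HasExpansion.mul {d d' : ℤ} {g g' : ℝ → ℂ} {s s' : ℂ[X]} (h : HasExpansion d g s)
    (h' : HasExpansion d' g' s') : HasExpansion (d + d') (fun t => g t * g' t) (s * s') := by
  obtain ⟨N, G, h1, h2⟩ := h
  obtain ⟨N', G', h1', h2'⟩ := h'
  refine ⟨N + N', G * G', by rw [Polynomial.mul_coeff_zero, h1, h1'], fun t ht => ?_⟩
  have e : Complex.exp (-((d + d' : ℤ) : ℂ) * t) = Complex.exp (-d * t) * Complex.exp (-d' * t) := by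
    rw [← Complex.exp_add]; congr 1; push_cast; ring
  beta_reduce
  rw [h2 t ht, h2' t ht, e, map_mul]
  ring

theorem HasExpansion.add {d : ℤ} {g g' : ℝ → ℂ} {s s' : ℂ[X]} (h : HasExpansion d g s)
    (h' : HasExpansion d g' s') : HasExpansion d (fun t => g t + g' t) (s + s') := by
  obtain ⟨N, G, h1, h2⟩ := h
  obtain ⟨N', G', h1', h2'⟩ := h'
  refine ⟨N + N', G * (1 - Polynomial.X) ^ N' + G' * (1 - Polynomial.X) ^ N, ?_, fun t ht => ?_⟩
  · simp [Polynomial.coeff_zero_eq_eval_zero, ← h1, ← h1']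
  · have e := eta_mul ht
    have e1 : (eta t : ℂ) ^ N * evalTX t (1 - Polynomial.X) ^ N = 1 := by rw [← mul_pow, e, one_pow]
    have e2 : (eta t : ℂ) ^ N' * evalTX t (1 - Polynomial.X) ^ N' = 1 := by
      rw [← mul_pow, e, one_pow]
    beta_reduce
    rw [h2 t ht, h2' t ht, map_add, map_mul, map_mul, map_pow, map_pow, pow_add]
    linear_combination -Complex.exp (-d * t) * (eta t : ℂ) ^ N * evalTX t G * e2 -
      Complex.exp (-d * t) * (eta t : ℂ) ^ N' * evalTX t G' * e1

theorem hasExpansion_const (c : ℂ) : HasExpansion 0 (fun _ => c) (Polynomial.C c) :=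
  ⟨0, Polynomial.C (Polynomial.C c), by simp, fun t _ => by simp [evalTX]⟩

theorem hasExpansion_zero (d : ℤ) : HasExpansion d (fun _ => 0) 0 :=
  ⟨0, 0, by simp, fun t _ => by simp⟩

theorem HasExpansion.const_mul {d : ℤ} {g : ℝ → ℂ} {s : ℂ[X]} (h : HasExpansion d g s) (c : ℂ) :
    HasExpansion d (fun t => c * g t) (Polynomial.C c * s) := by
  simpa using (hasExpansion_const c).mul h

theorem HasExpansion.sum {ι : Type*} {S : Finset ι} {d : ℤ} {g : ι → ℝ → ℂ} {s : ι → ℂ[X]}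
    (h : ∀ i ∈ S, HasExpansion d (g i) (s i)) :
    HasExpansion d (fun t => ∑ i ∈ S, g i t) (∑ i ∈ S, s i) := by
  classical
  induction S using Finset.induction_on with
  | empty => simpa using hasExpansion_zero d
  | insert a S ha ih =>
    simp only [Finset.sum_insert ha]
    exact (h a (Finset.mem_insert_self _ _)).add
      (ih fun i hi => h i (Finset.mem_insert_of_mem hi))

theorem hasExpansion_eta_pow (N : ℕ) : HasExpansion 0 (fun t => (eta t : ℂ) ^ N) 1 :=
  ⟨N, 1, by simp, fun t _ => by simp⟩

theorem hasExpansion_exp {d e : ℤ} (m : ℕ) (h : e = d + 2 * m) :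
    HasExpansion d (fun t => Complex.exp (-e * t)) (if m = 0 then 1 else 0) := by
  refine ⟨0, Polynomial.X ^ m, by simp [Polynomial.coeff_X_pow, eq_comm], fun t _ => ?_⟩
  simp only [evalTX, map_pow, Polynomial.coe_eval₂RingHom, Polynomial.eval₂_X, pow_zero, mul_one,
    Complex.ofReal_exp, ← Complex.exp_nat_mul, ← Complex.exp_add]
  congr 1
  rw [h]; push_cast; ring

/-- The factor `t` is paid for by a factor `e^{-2t}`. -/
theorem hasExpansion_mul_exp {d e : ℤ} (m : ℕ) (h : e = d + 2 + 2 * m) :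
    HasExpansion d (fun t => t * Complex.exp (-e * t)) (if m = 0 then Polynomial.X else 0) := by
  refine ⟨0, Polynomial.X ^ m * Polynomial.C Polynomial.X, ?_, fun t _ => ?_⟩
  · rw [Polynomial.mul_coeff_zero]
    simp [Polynomial.coeff_X_pow, eq_comm]
  · simp only [evalTX, map_pow, map_mul, Polynomial.coe_eval₂RingHom, Polynomial.eval₂_X, pow_zero,
      mul_one, Polynomial.eval₂_C, Polynomial.coe_evalRingHom, Polynomial.eval_X, Complex.ofReal_mul]
    have e1 : Complex.exp (-e * t) = Complex.exp (-d * t) * (((Real.exp (-2 * t) : ℝ) : ℂ) ^ m *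
        ((Real.exp (-2 * t) : ℝ) : ℂ)) := by
      simp only [Complex.ofReal_exp, ← Complex.exp_nat_mul, ← Complex.exp_add]
      congr 1
      rw [h]; push_cast; ring
    rw [e1]; ring

theorem hasExpansion_sinh_sq :
    HasExpansion (-2) (fun t => ((Real.sinh t ^ 2 : ℝ) : ℂ)) (Polynomial.C (1 / 4)) := by
  have h1 := (hasExpansion_exp (d := -2) (e := -2) 0 (by norm_num)).const_mul (1 / 4)
  have h2 := (hasExpansion_exp (d := -2) (e := 0) 1 (by norm_num)).const_mul (-1 / 2)
  have h3 := (hasExpansion_exp (d := -2) (e := 2) 2 (by norm_num)).const_mul (1 / 4)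
  refine ((h1.add h2).add h3).congr (fun t _ => ?_) (by simp)
  have e1 : Complex.exp (-((-2 : ℤ) : ℂ) * t) = Complex.exp t * Complex.exp t := by
    rw [← Complex.exp_add]; congr 1; push_cast; ring
  have e2 : Complex.exp (-((2 : ℤ) : ℂ) * t) = Complex.exp (-t) * Complex.exp (-t) := by
    rw [← Complex.exp_add]; congr 1; push_cast; ring
  have e3 : Complex.exp t * Complex.exp (-t) = 1 := by rw [← Complex.exp_add]; simp
  rw [e1, e2, Real.sinh_eq]
  simp
  linear_combination (-1 / 2) * e3

/-- The leading coefficient at the pole `poleW l₀ z k` that belongs to the symbol `s`, up to a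
factor that depends on the shift of `w`. The monomial `T^a` contributes the term of order `k - a` of
the exponential series of `e^{-2zT}`, since `t^k` is needed for a pole of order `k + 1`. -/
noncomputable def symbolCoeff (s : ℂ[X]) (z : ℂ) (k : ℕ) : ℂ :=
  ∑ a ∈ Finset.range (s.natDegree + 1),
    s.coeff a * (if a ≤ k then (-2 * z) ^ (k - a) / (k - a)! * k ! else 0)

theorem HasCont.congr_coeff {l₀ : ℕ} {S : Set ℝ} {g : ℂ → ℂ → ℝ → ℂ} {c c' : ℂ → ℕ → ℂ}
    (h : HasCont l₀ S g c) (hc : ∀ z k, c' z k = c z k) : HasCont l₀ S g c' := by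
  have : c' = c := funext fun z => funext fun k => hc z k
  rwa [this]

/-- Continuation of the integral of a function with an expansion against an exponential kernel. The
leading coefficient is nonzero only if the exponents fit the first possible pole. -/
theorem hasCont_of_hasExpansion {d : ℤ} {g : ℝ → ℂ} {s : ℂ[X]} (hg : HasExpansion d g s)
    (l₀ N : ℕ) {f j : ℤ} (h1 : -1 ≤ d + f + j) (h2 : (l₀ : ℤ) - 1 ≤ d + f - j) :
    HasCont l₀ (Ioi 1) (fun w z t => g t *
      (Complex.exp (-f * t) * (eta t : ℂ) ^ N * expKernel (w + j) t) * phase z t)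
      (fun z k => if d + f - j = (l₀ : ℤ) - 1 then symbolCoeff s z k / (poleW l₀ z k + j) else 0) := by
  obtain ⟨N', G, rfl, hG⟩ := hg
  have key := HasCont.sum (s := Finset.range (G.natDegree + 1)) fun m _ =>
    HasCont.sum (s := Finset.range ((G.coeff m).natDegree + 1)) fun a _ =>
      (hasCont_atom l₀ a (N' + N) (d + f + 2 * m + 2 * a) j (by omega) (by omega)).const_mul
        (a := fun _ => (G.coeff m).coeff a) analyticOnNhd_const
  refine (key.congr measurableSet_Ioi fun w z t ht => ?_).congr_coeff fun z k => ?_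
  · have ht0 : 0 < t := zero_lt_one.trans ht
    rw [hG t ht0]
    simp only [evalTX, Polynomial.coe_eval₂RingHom, Polynomial.eval₂_eq_sum_range,
      Polynomial.coe_evalRingHom, Polynomial.eval_eq_sum_range, Finset.mul_sum, Finset.sum_mul]
    refine Finset.sum_congr rfl fun m _ => Finset.sum_congr rfl fun a _ => ?_
    have e : Complex.exp (-((d + f + 2 * m + 2 * a : ℤ) : ℂ) * t) =
        Complex.exp (-d * t) * Complex.exp (-f * t) * ((Real.exp (-2 * t) : ℝ) : ℂ) ^ m *
          ((Real.exp (-2 * t) : ℝ) : ℂ) ^ a := by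
      simp only [Complex.ofReal_exp, ← Complex.exp_nat_mul, ← Complex.exp_add]
      congr 1
      push_cast; ring
    rw [atom, e]
    push_cast
    ring
  -- only the part of degree zero in `x`, that is, the symbol, contributes
  rw [Finset.sum_eq_single_of_mem 0 (by simp)]
  · by_cases h : d + f - j = (l₀ : ℤ) - 1
    · rw [if_pos h, symbolCoeff, Finset.sum_div]
      refine Finset.sum_congr rfl fun a _ => ?_
      by_cases ha : a ≤ k
      · rw [if_pos ha, if_pos ⟨by push_cast; omega, ha⟩]; ring
      · rw [if_neg ha, if_neg (by tauto)]; ring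
    · rw [if_neg h]
      refine (Finset.sum_eq_zero fun a _ => ?_).symm
      rw [if_neg (by push_cast; omega), mul_zero]
  · intro m _ hm
    refine Finset.sum_eq_zero fun a _ => ?_
    rw [if_neg (by omega), mul_zero]

/-- The coefficient of `e^{(w - 1 - m - n) t}` in `rInt w m n l l' t` as `t → ∞` (for large `Re w`), up
to the factor `jacC l m n 0`. It comes from the terms with `k = i = 0`. -/
noncomputable def leadSum (m n : ℤ) (l' : ℕ) (w : ℂ) : ℂ :=
  ∑ k' ∈ jacS l' m n, ∑ i' ∈ Finset.range (rP m n 0 k' + 1),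
    (jacC l' m n k' * ((-1) ^ i' * ((rP m n 0 k').choose i' : ℝ)) : ℝ) /
      (w + (l' - rP m n 0 k' + i'))

theorem rF_sub_rJ (m n : ℤ) (l l' k k' i i' : ℕ) :
    rF m n l l' k k' i i' - rJ m n l l' k k' i i' = 1 + m + n + 2 * k + 2 * i := by
  rw [rF, rJ]; ring

theorem rF_add_rJ {m n : ℤ} {l l' k k' : ℕ} (hm : m ≤ l) (hm' : m ≤ l') (hn : n ≤ l) (hn' : n ≤ l')
    (hk : k ∈ jacS l m n) (hk' : k' ∈ jacS l' m n) (i i' : ℕ) :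
    rF m n l l' k k' i i' + rJ m n l l' k k' i i' = 1 + 2 * l' - 2 * k' - m - n + 2 * i' := by
  rw [mem_jacS hm hn] at hk
  rw [mem_jacS hm' hn'] at hk'
  have : (rQ m n l l' k k' : ℤ) = l + l' - k - k' - m - n := by rw [rQ]; omega
  rw [rF, rJ, this]; ring

/-- Continuation of the integral of `g` times a matrix element. The order of growth `|n| - 2` of `g` is
that of a coefficient `A` with index `n`, multiplied by `sinh² t`. The terms with
`-l₀ ≤ n ≤ 0` alone reach the maximal order of the poles. -/
theorem hasCont_mul_rInt {l₀ l l' : ℕ} {n : ℤ} (hl : l₀ ≤ l) (hl' : l₀ ≤ l') (hn : |n| ≤ l)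
    (hn' : |n| ≤ l') {g : ℝ → ℂ} {s : ℂ[X]} (hg : HasExpansion (|n| - 2) g s) :
    HasCont l₀ (Ioi 1) (fun w z t => g t * rInt w l₀ n l l' t * phase z t) (fun z k =>
      if -(l₀ : ℤ) ≤ n ∧ n ≤ 0 then
        symbolCoeff s z k * (jacC l l₀ n 0 * leadSum l₀ n l' (poleW l₀ z k)) else 0) := by
  have hm : (l₀ : ℤ) ≤ l := by omega
  have hm' : (l₀ : ℤ) ≤ l' := by omega
  have hnl : n ≤ l := (le_abs_self n).trans hn
  have hnl' : n ≤ l' := (le_abs_self n).trans hn'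
  have key := HasCont.sum (s := jacS l l₀ n) fun k hk => HasCont.sum (s := jacS l' l₀ n)
    fun k' hk' => HasCont.sum (s := Finset.range (rQ l₀ n l l' k k' + 1)) fun i _ =>
    HasCont.sum (s := Finset.range (rP l₀ n k k' + 1)) fun i' _ =>
      (hasCont_of_hasExpansion hg l₀ (l + l' + 1) (f := rF l₀ n l l' k k' i i')
        (j := rJ l₀ n l l' k k' i i') (by
          have := rF_add_rJ hm hm' hnl hnl' hk hk' i i'
          rw [mem_jacS hm' hnl'] at hk'
          have := abs_nonneg n
          omega) (by
          have := rF_sub_rJ l₀ n l l' k k' i i'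
          rw [mem_jacS hm hnl] at hk
          have := neg_le_abs n
          have := le_abs_self n
          omega)).const_mul
        (a := fun _ => (rC l₀ n l l' k k' i i' : ℂ)) analyticOnNhd_const
  refine (key.congr measurableSet_Ioi fun w z t ht => ?_).congr_coeff fun z k => ?_
  · rw [rInt_eq hm hm' hnl hnl' w (zero_lt_one.trans ht), rSum]
    simp only [Finset.mul_sum, Finset.sum_mul]
    refine Finset.sum_congr rfl fun k _ => Finset.sum_congr rfl fun k' _ =>
      Finset.sum_congr rfl fun i _ => Finset.sum_congr rfl fun i' _ => ?_
    ring
  · -- for the difference of the exponents to be minimal, `k = i = 0` and `|n| = -n` are needed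
    have hsub := rF_sub_rJ l₀ n l l'
    by_cases h : -(l₀ : ℤ) ≤ n ∧ n ≤ 0
    · have habs : |n| = -n := abs_of_nonpos h.2
      have h0 : 0 ∈ jacS l l₀ n := by rw [mem_jacS hm hnl]; push_cast; omega
      rw [if_pos h, Finset.sum_eq_single_of_mem 0 h0, leadSum, Finset.mul_sum, Finset.mul_sum]
      · refine Finset.sum_congr rfl fun k' hk' => ?_
        rw [mem_jacS hm' hnl'] at hk'
        rw [Finset.sum_eq_single_of_mem (s := Finset.range (rQ l₀ n l l' 0 k' + 1)) 0 (by simp),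
          Finset.mul_sum, Finset.mul_sum]
        · refine Finset.sum_congr rfl fun i' _ => ?_
          have := hsub 0 k' 0 i'
          rw [if_pos (by push_cast at this; omega)]
          have hj : rJ l₀ n l l' 0 k' 0 i' = l' - rP l₀ n 0 k' + i' := by
            simp only [rJ, rQ, rP]; omega
          rw [hj, rC]
          push_cast
          simp only [zero_add, Nat.choose_zero_right, Nat.cast_one, mul_one]
          ring
        · intro i _ hi
          refine Finset.sum_eq_zero fun i' _ => ?_
          have := hsub 0 k' i i'
          rw [if_neg (by push_cast at this; omega), mul_zero]
      · intro k _ hk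
        refine Finset.sum_eq_zero fun k' _ => Finset.sum_eq_zero fun i _ =>
          Finset.sum_eq_zero fun i' _ => ?_
        have := hsub k k' i i'
        rw [if_neg (by omega), mul_zero]
    · rw [if_neg h]
      refine (Finset.sum_eq_zero fun k hk => Finset.sum_eq_zero fun k' _ =>
        Finset.sum_eq_zero fun i _ => Finset.sum_eq_zero fun i' _ => ?_).symm
      have := hsub k k' i i'
      rw [mem_jacS hm hnl] at hk
      have := neg_le_abs n
      have := le_abs_self n
      rw [if_neg (by omega), mul_zero]

/-! ### Falling factorials and the leading term of the matrix elements -/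

/-- The falling factorial `x (x - 1) ⋯ (x - M + 1)`. -/
noncomputable def fallFact (x : ℂ) (M : ℕ) : ℂ := ∏ i ∈ Finset.range M, (x - i)

theorem fallFact_succ (x : ℂ) (M : ℕ) : fallFact x (M + 1) = fallFact x M * (x - M) :=
  Finset.prod_range_succ _ _

theorem fallFact_succ' (x : ℂ) (M : ℕ) : fallFact x (M + 1) = x * fallFact (x - 1) M := by
  rw [fallFact, Finset.prod_range_succ', mul_comm, fallFact]
  congr 1
  · simp
  · refine Finset.prod_congr rfl fun i _ => ?_
    push_cast; ring

theorem fallFact_add (x : ℂ) (M N : ℕ) : fallFact x (M + N) = fallFact x M * fallFact (x - M) N := by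
  induction N with
  | zero => simp [fallFact]
  | succ N ih => rw [← add_assoc, fallFact_succ, ih, fallFact_succ]; push_cast; ring

theorem fallFact_ne_zero {x : ℂ} {M : ℕ} : fallFact x M ≠ 0 ↔ ∀ i < M, x ≠ i := by
  simp [fallFact, Finset.prod_ne_zero_iff, sub_ne_zero]

theorem fallFact_natCast (M j : ℕ) (h : j ≤ M) : fallFact M j * ((M - j)! : ℂ) = M ! := by
  induction j with
  | zero => simp [fallFact]
  | succ j ih =>
    rw [← ih (by omega), fallFact_succ, mul_assoc]
    congr 1
    obtain ⟨r, rfl⟩ := Nat.exists_eq_add_of_le h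
    rw [show j + 1 + r - (j + 1) = r by omega, show j + 1 + r - j = r + 1 by omega,
      Nat.factorial_succ]
    push_cast; ring

/-- A beta integral as a sum: `∫₀¹ s^{x-1} (1 - s)^M ds`. -/
theorem sum_choose_div (M : ℕ) : ∀ x : ℂ, (∀ i : ℕ, i ≤ M → x + i ≠ 0) →
    ∑ i ∈ Finset.range (M + 1), (-1 : ℂ) ^ i * (M.choose i : ℂ) / (x + i) =
      M ! / fallFact (x + M) (M + 1) := by
  induction M with
  | zero => intro x _; simp [fallFact]
  | succ M ih =>
    intro x hx
    have h1 := ih x fun i hi => hx i (by omega)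
    have h2 := ih (x + 1) fun i hi => by
      have := hx (i + 1) (by omega)
      push_cast at this
      rwa [add_assoc, add_comm (1 : ℂ)]
    have hx0 : x ≠ 0 := by simpa using hx 0 (by omega)
    have hxM : x + (M + 1) ≠ 0 := by
      have := hx (M + 1) le_rfl; push_cast at this; exact this
    have e : ∑ i ∈ Finset.range (M + 1 + 1), (-1 : ℂ) ^ i * ((M + 1).choose i : ℂ) / (x + i) =
        ∑ i ∈ Finset.range (M + 1), (-1 : ℂ) ^ i * (M.choose i : ℂ) / (x + i) -
        ∑ i ∈ Finset.range (M + 1), (-1 : ℂ) ^ i * (M.choose i : ℂ) / (x + 1 + i) := by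
      rw [Finset.sum_range_succ' _ (M + 1)]
      have h3 : ∑ i ∈ Finset.range (M + 1), (-1 : ℂ) ^ (i + 1) * ((M + 1).choose (i + 1) : ℂ) /
          (x + (i + 1 : ℕ)) = ∑ i ∈ Finset.range (M + 1), (-1 : ℂ) ^ (i + 1) * (M.choose (i + 1) : ℂ) /
          (x + (i + 1 : ℕ)) -
          ∑ i ∈ Finset.range (M + 1), (-1 : ℂ) ^ i * (M.choose i : ℂ) / (x + 1 + i) := by
        rw [← Finset.sum_sub_distrib]
        refine Finset.sum_congr rfl fun i _ => ?_
        rw [Nat.choose_succ_succ]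
        push_cast
        rw [show x + ((i : ℂ) + 1) = x + 1 + i by ring, ← sub_div]
        congr 1; ring
      have h4 := Finset.sum_range_succ' (fun i => (-1 : ℂ) ^ i * (M.choose i : ℂ) / (x + i)) (M + 1)
      have h5 := Finset.sum_range_succ (fun i => (-1 : ℂ) ^ i * (M.choose i : ℂ) / (x + i)) (M + 1)
      rw [h3]
      simp only [Nat.choose_succ_self, Nat.cast_zero, mul_zero, zero_div, Nat.choose_zero_right]
        at h4 h5 ⊢
      linear_combination h5 - h4
    rw [e, h1, h2]
    have f1 : fallFact (x + (M + 1 : ℕ)) (M + 1 + 1) = (x + (M + 1)) * fallFact (x + M) (M + 1) := by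
      rw [fallFact_succ']; push_cast; congr 2; ring
    have f2 : fallFact (x + 1 + M) (M + 1) * x = (x + (M + 1)) * fallFact (x + M) (M + 1) := by
      rw [← f1, fallFact_succ _ (M + 1)]; push_cast
      rw [show x + 1 + (M : ℂ) = x + (M + 1) by ring]; congr 1; ring
    have f3 : fallFact (x + M) (M + 1) ≠ 0 := by
      rw [fallFact_ne_zero]
      intro i hi h
      refine hx (M - i) (by omega) ?_
      rw [Nat.cast_sub (by omega)]
      linear_combination h
    have f4 : fallFact (x + 1 + M) (M + 1) = (x + (M + 1)) * fallFact (x + M) (M + 1) / x := by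
      rw [← f2, mul_div_assoc, div_self hx0, mul_one]
    rw [f1, f4, Nat.factorial_succ]
    push_cast
    field_simp
    ring

/-- The Chu–Vandermonde identity, in terms of falling factorials. Pascal's rule gives the recursion in
`M`. -/
theorem chu_vandermonde (M : ℕ) : ∀ b c : ℂ, (∀ i : ℕ, i < M → c ≠ i) →
    ∑ k ∈ Finset.range (M + 1), (-1 : ℂ) ^ k * (M.choose k : ℂ) * (fallFact b k / fallFact c k) =
      fallFact (c - b) M / fallFact c M := by
  induction M with
  | zero => intro b c _; simp [fallFact]
  | succ M ih =>
    intro b c hc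
    have h1 := ih b c fun i hi => hc i (by omega)
    have h2 := ih (b - 1) (c - 1) fun i hi h => by
      refine hc (i + 1) (by omega) ?_
      push_cast
      linear_combination h
    have hc0 : c ≠ 0 := by simpa using hc 0 (by omega)
    have hcM : c - M ≠ 0 := sub_ne_zero.2 (hc M (by omega))
    have e : ∑ k ∈ Finset.range (M + 1 + 1), (-1 : ℂ) ^ k * ((M + 1).choose k : ℂ) *
        (fallFact b k / fallFact c k) =
        ∑ k ∈ Finset.range (M + 1), (-1 : ℂ) ^ k * (M.choose k : ℂ) * (fallFact b k / fallFact c k) -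
        (b / c) * ∑ k ∈ Finset.range (M + 1), (-1 : ℂ) ^ k * (M.choose k : ℂ) *
          (fallFact (b - 1) k / fallFact (c - 1) k) := by
      rw [Finset.sum_range_succ' _ (M + 1), Finset.mul_sum]
      have h3 : ∑ i ∈ Finset.range (M + 1), (-1 : ℂ) ^ (i + 1) * ((M + 1).choose (i + 1) : ℂ) *
          (fallFact b (i + 1) / fallFact c (i + 1)) =
          ∑ i ∈ Finset.range (M + 1), (-1 : ℂ) ^ (i + 1) * (M.choose (i + 1) : ℂ) *
            (fallFact b (i + 1) / fallFact c (i + 1)) -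
          ∑ k ∈ Finset.range (M + 1), b / c * ((-1 : ℂ) ^ k * (M.choose k : ℂ) *
            (fallFact (b - 1) k / fallFact (c - 1) k)) := by
        rw [← Finset.sum_sub_distrib]
        refine Finset.sum_congr rfl fun i _ => ?_
        have : fallFact b (i + 1) / fallFact c (i + 1) =
            b / c * (fallFact (b - 1) i / fallFact (c - 1) i) := by
          rw [fallFact_succ', fallFact_succ', mul_div_mul_comm]
        rw [Nat.choose_succ_succ, this]
        push_cast
        ring
      have h4 := Finset.sum_range_succ' (fun k => (-1 : ℂ) ^ k * (M.choose k : ℂ) *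
        (fallFact b k / fallFact c k)) (M + 1)
      have h5 := Finset.sum_range_succ (fun k => (-1 : ℂ) ^ k * (M.choose k : ℂ) *
        (fallFact b k / fallFact c k)) (M + 1)
      rw [h3]
      simp only [Nat.choose_succ_self, Nat.cast_zero, mul_zero, zero_mul, Nat.choose_zero_right]
        at h4 h5 ⊢
      linear_combination h5 - h4
    have f0 : fallFact c M ≠ 0 := fallFact_ne_zero.2 fun i hi => hc i (by omega)
    have f1 : fallFact (c - 1) M = fallFact c M * (c - M) / c := by
      rw [← fallFact_succ, fallFact_succ', mul_div_cancel_left₀ _ hc0]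
    rw [e, h1, h2, f1, fallFact_succ, fallFact_succ, show c - 1 - (b - 1) = c - b by ring]
    field_simp
    ring

theorem choose_eq_fallFact (a k : ℕ) (h : k ≤ a) : (a.choose k : ℂ) = fallFact a k / k ! := by
  have h1 := fallFact_natCast a k h
  have h2 : (a.choose k : ℂ) * k ! * (a - k)! = a ! := by
    exact_mod_cast Nat.choose_mul_factorial_mul_factorial h
  have h3 : (k ! : ℂ) ≠ 0 := by exact_mod_cast k.factorial_ne_zero
  have h4 : ((a - k)! : ℂ) ≠ 0 := by exact_mod_cast (a - k).factorial_ne_zero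
  rw [eq_div_iff h3]
  exact mul_right_cancel₀ h4 (h2.trans h1.symm)

/-- The closed form of the leading coefficient of the matrix elements. The inner sum over `i'` is a
beta integral, and the outer sum is then of Chu–Vandermonde type. -/
theorem leadSum_eq {m l' : ℕ} {n : ℤ} (hm : m ≤ l') (hn : -(m : ℤ) ≤ n) (hn0 : n ≤ 0) {w : ℂ}
    (hw : ∀ i : ℕ, w + i ≠ 0) :
    leadSum m n l' w = ((l' + n).toNat ! : ℂ) / ((l' - m)! : ℂ) *
      (fallFact (w - m - 1) (l' - m) / fallFact (w + l') (l' + n + 1).toNat) := by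
  have hS : jacS l' m n = Finset.range (l' - m + 1) := by
    ext k
    rw [mem_jacS (by omega) (by omega), Finset.mem_range]; omega
  obtain ⟨ν, rfl⟩ : ∃ ν : ℕ, n = -ν := ⟨(-n).toNat, by omega⟩
  obtain ⟨r, rfl⟩ : ∃ r : ℕ, m = ν + r := Nat.exists_eq_add_of_le (by omega)
  obtain ⟨M, rfl⟩ := Nat.exists_eq_add_of_le hm
  have hP : ∀ k', rP (ν + r : ℕ) (-ν) 0 k' = k' + r := fun k' => by rw [rP]; push_cast; omega
  have t1 : (((ν + r + M : ℕ) : ℤ) + -ν).toNat = r + M := by push_cast; omega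
  have t2 : (((ν + r + M : ℕ) : ℤ) + -ν + 1).toNat = r + 1 + M := by push_cast; omega
  have t3 : ν + r + M - (ν + r) = M := by omega
  have t4 : (((ν + r + M : ℕ) : ℤ) - -ν).toNat = ν + r + M + ν := by push_cast; omega
  have hcne : ∀ i : ℕ, i < r + 1 + M → w + ((ν + r + M : ℕ) : ℂ) ≠ i := by
    intro i hi h
    refine hw (ν + r + M - i) ?_
    rw [Nat.cast_sub (by omega)]
    linear_combination h
  have hc2 : ∀ i : ℕ, i < M → w + ((ν + r + M : ℕ) : ℂ) - (r + 1 : ℕ) ≠ i := by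
    intro i hi h
    refine hcne (i + (r + 1)) (by omega) ?_
    push_cast at h ⊢
    linear_combination h
  have hM : (M ! : ℂ) ≠ 0 := by exact_mod_cast M.factorial_ne_zero
  rw [leadSum, hS, t1, t2, t3, fallFact_add _ (r + 1) M]
  have chu := chu_vandermonde M ((ν + r + M + ν : ℕ) : ℂ)
    (w + ((ν + r + M : ℕ) : ℂ) - (r + 1 : ℕ)) hc2
  rw [show w + ((ν + r + M : ℕ) : ℂ) - (r + 1 : ℕ) - ((ν + r + M + ν : ℕ) : ℂ) =
    w - ((ν + r : ℕ) : ℂ) - 1 by push_cast; ring] at chu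
  rw [mul_comm (fallFact (w + ((ν + r + M : ℕ) : ℂ)) (r + 1)), ← div_div, ← chu, Finset.sum_div,
    Finset.mul_sum]
  refine Finset.sum_congr rfl fun k hk => ?_
  rw [Finset.mem_range] at hk
  have hinner := sum_choose_div (k + r) (w + ((ν + r + M : ℕ) : ℂ) - (k + r : ℕ)) fun i hi h => by
    refine hcne (k + r - i) (by omega) ?_
    rw [Nat.cast_sub hi]
    linear_combination h
  have e : ∑ i' ∈ Finset.range (rP (ν + r : ℕ) (-ν) 0 k + 1),
      ((jacC (ν + r + M) (ν + r : ℕ) (-ν) k * ((-1) ^ i' * ((rP (ν + r : ℕ) (-ν) 0 k).choose i' : ℝ)) :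
        ℝ) : ℂ) / (w + (((ν + r + M : ℕ) : ℂ) - rP (ν + r : ℕ) (-ν) 0 k + i')) =
      jacC (ν + r + M) (ν + r : ℕ) (-ν) k * ∑ i ∈ Finset.range (k + r + 1),
        (-1 : ℂ) ^ i * ((k + r).choose i : ℂ) /
          (w + ((ν + r + M : ℕ) : ℂ) - (k + r : ℕ) + i) := by
    rw [hP, Finset.mul_sum]
    refine Finset.sum_congr rfl fun i _ => ?_
    push_cast
    rw [← mul_div_assoc]
    congr 1
    ring
  have t5 : (((ν + r + M : ℕ) : ℤ) - ((ν + r : ℕ) : ℤ) - k).toNat = M - k := by push_cast; omega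
  have hch : ((r + M).choose (M - k) : ℂ) * (M - k)! * (k + r)! = (r + M)! := by
    have := Nat.choose_mul_factorial_mul_factorial (n := r + M) (k := M - k) (by omega)
    rw [show r + M - (M - k) = k + r by omega] at this
    exact_mod_cast this
  have hMk : ((M - k)! : ℂ) ≠ 0 := by exact_mod_cast (M - k).factorial_ne_zero
  have hk0 : (k ! : ℂ) ≠ 0 := by exact_mod_cast k.factorial_ne_zero
  have hff := fallFact_natCast M k (by omega)
  have hg1 : fallFact (w + ((ν + r + M : ℕ) : ℂ)) (r + 1) ≠ 0 :=
    fallFact_ne_zero.2 fun i hi => hcne i (by omega)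
  have hg2 : fallFact (w + ((ν + r + M : ℕ) : ℂ) - (r + 1 : ℕ)) k ≠ 0 :=
    fallFact_ne_zero.2 fun i hi => hc2 i (by omega)
  rw [e, hinner, sub_add_cancel, show k + r + 1 = r + 1 + k by omega, fallFact_add, jacC, t1, t4, t5,
    choose_eq_fallFact M k (by omega)]
  push_cast [choose_eq_fallFact (ν + r + M + ν) k (by omega)]
  rw [← hch, ← hff]
  push_cast at hg1 hg2
  have hff' : fallFact (M : ℂ) k ≠ 0 := fun h => by rw [h, zero_mul] at hff; exact hM hff.symm
  field_simp

/-! ### Symbols of the matrix elements at `w = -1` -/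

/-- The constant coefficient of the symbol of `e^{-et} expKernel (j - 1) t`. -/
noncomputable def kernelAlpha (d e j : ℤ) : ℂ :=
  if j ≠ 1 ∧ e + j = 1 + d then -1 / (j - 1) else 0

/-- The linear coefficient of the symbol of `e^{-et} expKernel (j - 1) t`. -/
noncomputable def kernelBeta (d e j : ℤ) : ℂ :=
  if j = 1 ∧ e - j = 1 + d then 2 else 0

/-- The expansion of the exponential kernel at `w = -1`. The linear term `2t` arises for `j = 1`, where
`expKernel 0 t = 2 t`. For `j ≠ 1` the kernel is a sum of two exponentials, of which only
`e^{(1 - j) t} / (1 - j)` can be of leading order. -/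
theorem hasExpansion_expKernel {d e j : ℤ} {a b : ℕ} (h1 : e - j = 1 + d + 2 * a)
    (h2 : e + j = 1 + d + 2 * b) :
    HasExpansion d (fun t => Complex.exp (-e * t) * expKernel (-1 + j) t)
      (Polynomial.C (kernelAlpha d e j) + Polynomial.C (kernelBeta d e j) * Polynomial.X) := by
  by_cases hj : j = 1
  · subst hj
    refine ((hasExpansion_mul_exp (d := d) (e := e) a (by omega)).const_mul 2).congr
      (fun t _ => ?_) ?_
    · simp only [Int.cast_one, neg_add_cancel, expKernel_zero]; ring
    · by_cases ha : a = 0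
      · rw [if_pos ha, kernelAlpha, kernelBeta, if_neg (by simp), if_pos (by omega)]; simp
      · rw [if_neg ha, kernelAlpha, kernelBeta, if_neg (by simp), if_neg (by omega)]; simp
  · have hj1 : (-1 + j : ℂ) ≠ 0 := fun h => hj (by
      have : (j : ℂ) = 1 := by linear_combination h
      exact_mod_cast this)
    have t1 := (hasExpansion_exp (d := d) (e := e + 1 - j) (a + 1) (by push_cast; omega)).const_mul
      (1 / (-1 + j))
    have t2 := (hasExpansion_exp (d := d) (e := e + j - 1) b (by omega)).const_mul
      (-1 / (-1 + j))
    refine (t1.add t2).congr (fun t _ => ?_) ?_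
    · rw [expKernel_of_ne_zero hj1]
      have e1 : Complex.exp (-((e + 1 - j : ℤ) : ℂ) * t) =
          Complex.exp (-e * t) * Complex.exp ((-1 + j) * t) := by
        rw [← Complex.exp_add]; congr 1; push_cast; ring
      have e2 : Complex.exp (-((e + j - 1 : ℤ) : ℂ) * t) =
          Complex.exp (-e * t) * Complex.exp (-((-1 + j) * t)) := by
        rw [← Complex.exp_add]; congr 1; push_cast; ring
      rw [e1, e2]; ring
    · by_cases hb : b = 0
      · rw [if_neg (by omega), if_pos hb, kernelAlpha, kernelBeta, if_pos ⟨hj, by omega⟩,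
          if_neg (by tauto)]
        simp [sub_eq_neg_add]
      · rw [if_neg (by omega), if_neg hb, kernelAlpha, kernelBeta, if_neg (by omega),
          if_neg (by tauto)]
        simp

/-- The constant coefficient of the symbol of `rInt (-1) 0 n l l'`. -/
noncomputable def symAlpha (n : ℤ) (l l' : ℕ) : ℂ :=
  rSum 0 n l l' fun k k' i i' => (rC 0 n l l' k k' i i' : ℂ) *
    kernelAlpha |n| (rF 0 n l l' k k' i i') (rJ 0 n l l' k k' i i')

/-- The linear coefficient of the symbol of `rInt (-1) 0 n l l'`. -/
noncomputable def symBeta (n : ℤ) (l l' : ℕ) : ℂ :=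
  rSum 0 n l l' fun k k' i i' => (rC 0 n l l' k k' i i' : ℂ) *
    kernelBeta |n| (rF 0 n l l' k k' i i') (rJ 0 n l l' k k' i i')

/-- The expansion of the matrix elements with `l₀ = 0` at `w = -1`. The symbol has degree at most one,
since `expKernel 0 t = 2 t` is the only source of factors `t`. -/
theorem hasExpansion_rInt {l l' : ℕ} {n : ℤ} (hn : |n| ≤ l) (hn' : |n| ≤ l') :
    HasExpansion |n| (rInt (-1) 0 n l l')
      (Polynomial.C (symAlpha n l l') + Polynomial.C (symBeta n l l') * Polynomial.X) := by
  have hm : (0 : ℤ) ≤ l := by omega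
  have hm' : (0 : ℤ) ≤ l' := by omega
  have hnl : n ≤ l := (le_abs_self n).trans hn
  have hnl' : n ≤ l' := (le_abs_self n).trans hn'
  have key := HasExpansion.sum (S := jacS l 0 n) fun k hk => HasExpansion.sum (S := jacS l' 0 n)
    fun k' hk' => HasExpansion.sum (S := Finset.range (rQ 0 n l l' k k' + 1)) fun i _ =>
    HasExpansion.sum (S := Finset.range (rP 0 n k k' + 1)) fun i' _ =>
      (hasExpansion_expKernel (d := |n|) (e := rF 0 n l l' k k' i i') (j := rJ 0 n l l' k k' i i')
        (a := (k + i + min n 0).toNat) (b := (l' - k' + i' - max n 0).toNat) (by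
          have := rF_sub_rJ 0 n l l' k k' i i'
          rw [mem_jacS hm hnl] at hk
          rcases abs_cases n with h | h <;> omega) (by
          have := rF_add_rJ hm hm' hnl hnl' hk hk' i i'
          rw [mem_jacS hm' hnl'] at hk'
          rcases abs_cases n with h | h <;> omega)).const_mul (rC 0 n l l' k k' i i' : ℂ)
  have key2 := key.mul (hasExpansion_eta_pow (l + l' + 1))
  rw [add_zero] at key2
  refine key2.congr (fun t ht => ?_) ?_
  · rw [rInt_eq hm hm' hnl hnl' _ ht, rSum]
    simp only [Finset.sum_mul]
    refine Finset.sum_congr rfl fun k _ => Finset.sum_congr rfl fun k' _ =>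
      Finset.sum_congr rfl fun i _ => Finset.sum_congr rfl fun i' _ => ?_
    ring
  · simp only [symAlpha, symBeta, rSum, map_sum, map_mul, Finset.sum_mul, mul_one, mul_add,
      Finset.sum_add_distrib, mul_assoc]

theorem jacC_eq_zero {l : ℕ} {n : ℤ} {k : ℕ} (h : (k : ℤ) < -n) (hn : -(l : ℤ) ≤ n) (hk : k ≤ l) :
    jacC l 0 n k = 0 := by
  rw [jacC, Nat.choose_eq_zero_of_lt (n := ((l : ℤ) + n).toNat) (by omega)]
  simp

theorem sum_jacS_eq {l : ℕ} {n : ℤ} (hn : -(l : ℤ) ≤ n) (hn0 : n ≤ 0) (g : ℕ → ℂ) :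
    ∑ k ∈ jacS l 0 n, (jacC l 0 n k : ℂ) * g k =
      ∑ k ∈ Finset.range (l + 1), (jacC l 0 n k : ℂ) * g k := by
  refine Finset.sum_subset (fun k hk => ?_) fun k hk hk' => ?_
  · rw [mem_jacS (by omega) (by omega)] at hk
    rw [Finset.mem_range]; omega
  · rw [Finset.mem_range] at hk
    rw [mem_jacS (by omega) (by omega)] at hk'
    rw [jacC_eq_zero (by omega) hn (by omega)]; simp

theorem symBeta_eq {l l' : ℕ} {n : ℤ} (hn : -(l : ℤ) ≤ n) (hn' : -(l' : ℤ) ≤ n) (hn0 : n ≤ 0)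
    (hl' : 1 ≤ l') : symBeta n l l' =
      2 * jacC l 0 n (-n).toNat * (jacC l' 0 n (l' - 1) - l' * jacC l' 0 n l') := by
  have hm : (0 : ℤ) ≤ l := by omega
  have hm' : (0 : ℤ) ≤ l' := by omega
  have hnl : n ≤ l := by omega
  have hnl' : n ≤ l' := by omega
  have hsub := rF_sub_rJ 0 n l l'
  have habs : |n| = -n := abs_of_nonpos hn0
  have hk0 : (-n).toNat ∈ jacS l 0 n := by rw [mem_jacS hm hnl]; omega
  rw [symBeta, rSum, Finset.sum_eq_single_of_mem _ hk0]
  · have e : ∀ k' ∈ jacS l' 0 n, (∑ i ∈ Finset.range (rQ 0 n l l' (-n).toNat k' + 1),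
        ∑ i' ∈ Finset.range (rP 0 n (-n).toNat k' + 1), (rC 0 n l l' (-n).toNat k' i i' : ℂ) *
          kernelBeta |n| (rF 0 n l l' (-n).toNat k' i i') (rJ 0 n l l' (-n).toNat k' i i')) =
        jacC l' 0 n k' * (2 * jacC l 0 n (-n).toNat * ∑ i' ∈ Finset.range (k' + 1),
          if (l' : ℤ) - k' + i' = 1 then (-1 : ℂ) ^ i' * k'.choose i' else 0) := by
      intro k' hk'
      rw [mem_jacS hm' hnl'] at hk'
      rw [Finset.sum_eq_single_of_mem 0 (by simp)]
      · have hP : rP 0 n (-n).toNat k' = k' := by rw [rP]; omega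
        rw [hP, Finset.mul_sum, Finset.mul_sum]
        refine Finset.sum_congr rfl fun i' _ => ?_
        have hj : rJ 0 n l l' (-n).toNat k' 0 i' = l' - k' + i' := by rw [rJ, rQ]; omega
        have := hsub (-n).toNat k' 0 i'
        rw [kernelBeta, rC, hP, hj]
        by_cases h : (l' : ℤ) - k' + i' = 1
        · rw [if_pos h, if_pos ⟨h, by omega⟩]; push_cast; simp; ring
        · rw [if_neg h, if_neg (by tauto)]; simp
      · intro i _ hi
        refine Finset.sum_eq_zero fun i' _ => ?_
        have := hsub (-n).toNat k' i i'
        rw [kernelBeta, if_neg (by omega), mul_zero]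
    rw [Finset.sum_congr rfl e, sum_jacS_eq hn' hn0]
    obtain ⟨r, rfl⟩ : ∃ r, l' = r + 1 := ⟨l' - 1, by omega⟩
    -- the condition `l' - k' + i' = 1` leaves `k' = l' - 1`, `i' = 0` and `k' = l'`, `i' = 1`
    rw [Finset.sum_range_succ, Finset.sum_range_succ, Finset.sum_eq_zero, Nat.add_sub_cancel,
      Finset.sum_eq_single_of_mem (s := Finset.range (r + 1)) 0 (by simp),
      Finset.sum_eq_single_of_mem (s := Finset.range (r + 1 + 1)) 1 (by simp)]
    · rw [if_pos (by push_cast; ring), if_pos (by push_cast; ring)]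
      simp
      ring
    · intro i _ hi
      rw [if_neg (by push_cast; omega)]
    · intro i _ hi
      rw [if_neg (by push_cast; omega)]
    · intro k' hk'
      rw [Finset.mem_range] at hk'
      rw [Finset.sum_eq_zero fun i' _ => ?_]
      · simp
      · rw [if_neg (by push_cast; omega)]
  · intro k hk hne
    rw [mem_jacS hm hnl] at hk
    refine Finset.sum_eq_zero fun k' _ => Finset.sum_eq_zero fun i _ =>
      Finset.sum_eq_zero fun i' _ => ?_
    have := hsub k k' i i'
    rw [kernelBeta, if_neg (by omega), mul_zero]

theorem symBeta_ne_zero {l l' : ℕ} {n : ℤ} (hn : -(l : ℤ) ≤ n) (hn' : -(l' : ℤ) ≤ n) (hn0 : n ≤ 0)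
    (hl' : 1 ≤ l') : symBeta n l l' ≠ 0 := by
  obtain ⟨r, rfl⟩ : ∃ r, l' = r + 1 := ⟨l' - 1, by omega⟩
  rw [symBeta_eq hn hn' hn0 hl']
  refine mul_ne_zero (mul_ne_zero two_ne_zero ?_) ?_
  · have h1 : 0 < ((l : ℤ) - n).toNat.choose (-n).toNat := Nat.choose_pos (by omega)
    have h2 : 0 < ((l : ℤ) + n).toNat.choose ((l : ℤ) - 0 - (-n).toNat).toNat :=
      Nat.choose_pos (by omega)
    rw [jacC]
    push_cast
    refine mul_ne_zero (mul_ne_zero (by simp) ?_) ?_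
    · exact_mod_cast h1.ne'
    · exact_mod_cast h2.ne'
  · have h1 : 0 < (((r + 1 : ℕ) : ℤ) - n).toNat.choose (r + 1) := Nat.choose_pos (by omega)
    have e : (((jacC (r + 1) 0 n (r + 1 - 1) : ℝ) : ℂ) -
        (r + 1 : ℕ) * (jacC (r + 1) 0 n (r + 1) : ℝ) : ℂ) = (-1) ^ r *
        (((((r + 1 : ℕ) : ℤ) - n).toNat.choose r *
          (((r + 1 : ℕ) : ℤ) + n).toNat.choose 1 + (r + 1) *
            (((r + 1 : ℕ) : ℤ) - n).toNat.choose (r + 1) : ℕ) : ℂ) := by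
      have t1 : (((r + 1 : ℕ) : ℤ) - 0 - (r : ℕ)).toNat = 1 := by omega
      have t2 : (((r + 1 : ℕ) : ℤ) - 0 - (r + 1 : ℕ)).toNat = 0 := by omega
      rw [jacC, jacC, Nat.add_sub_cancel, t1, t2]
      push_cast
      simp only [Nat.choose_zero_right]
      push_cast
      ring
    rw [e]
    refine mul_ne_zero (by simp) ?_
    have : 0 < (r + 1) * (((r + 1 : ℕ) : ℤ) - n).toNat.choose (r + 1) := by positivity
    exact_mod_cast (by omega)

theorem symAlpha_eq {l l' : ℕ} {n : ℤ} (hn' : -(l' : ℤ) ≤ n) (hn0 : n ≤ 0) :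
    symAlpha n l l' = jacC l' 0 n l' * ∑ k ∈ jacS l 0 n, (jacC l 0 n k : ℂ) *
      ((((l : ℤ) - k - n).toNat ! * ((k : ℤ) + n).toNat ! : ℕ) / (l + 1)! : ℂ) := by
  have hm : (0 : ℤ) ≤ l := by omega
  have hm' : (0 : ℤ) ≤ l' := by omega
  have hnl : n ≤ l := by omega
  have hnl' : n ≤ l' := by omega
  have habs : |n| = -n := abs_of_nonpos hn0
  have hk0 : l' ∈ jacS l' 0 n := by rw [mem_jacS hm' hnl']; omega
  rw [symAlpha, rSum, Finset.mul_sum]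
  refine Finset.sum_congr rfl fun k hk => ?_
  have hadd := fun k' hk' => rF_add_rJ hm hm' hnl hnl' hk (k' := k') hk'
  have hk2 := hk
  rw [mem_jacS hm hnl] at hk2
  rw [Finset.sum_eq_single_of_mem _ hk0]
  · set M := ((l : ℤ) - k - n).toNat with hM
    obtain ⟨c, hc⟩ : ∃ c : ℕ, (c : ℤ) = k + n := ⟨(k + n).toNat, by omega⟩
    have hcn : ((k : ℤ) + n).toNat = c := by omega
    have hMc : M + c = l := by omega
    have hQ : rQ 0 n l l' k l' = M := by rw [rQ]; omega
    -- the sum over `i` is a beta integral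
    have hx := sum_choose_div M ((1 + c : ℕ) : ℂ) fun i _ => by
      rw [← Nat.cast_add]; exact Nat.cast_ne_zero.2 (by omega)
    have hf := fallFact_natCast (l + 1) (M + 1) (by omega)
    rw [show l + 1 - (M + 1) = c by omega] at hf
    rw [← Nat.cast_add, show 1 + c + M = l + 1 by omega] at hx
    have hc0 : (c ! : ℂ) ≠ 0 := by exact_mod_cast c.factorial_ne_zero
    have e : ∀ i ∈ Finset.range (rQ 0 n l l' k l' + 1),
        (∑ i' ∈ Finset.range (rP 0 n k l' + 1), (rC 0 n l l' k l' i i' : ℂ) *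
          kernelAlpha |n| (rF 0 n l l' k l' i i') (rJ 0 n l l' k l' i i')) =
        (jacC l' 0 n l' * jacC l 0 n k : ℂ) *
          ((-1 : ℂ) ^ i * (M.choose i : ℂ) / (((1 + c : ℕ) : ℂ) + i)) := by
      intro i _
      rw [Finset.sum_eq_single_of_mem 0 (by simp)]
      · have hj : rJ 0 n l l' k l' i 0 = -(c + i) := by rw [rJ, hQ]; push_cast; omega
        have := hadd l' hk0 i 0
        have hne : ((1 + c : ℕ) : ℂ) + i ≠ 0 := by
          rw [← Nat.cast_add]; exact Nat.cast_ne_zero.2 (by omega)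
        have hne2 : (((-(c + i) : ℤ) : ℂ) - 1) = -(((1 + c : ℕ) : ℂ) + i) := by push_cast; ring
        rw [kernelAlpha, if_pos ⟨by omega, by push_cast at this; omega⟩, rC, hQ, hj, hne2,
          neg_div_neg_eq]
        push_cast
        simp
        ring
      · intro i' _ hi'
        have := hadd l' hk0 i i'
        rw [kernelAlpha, if_neg (by omega), mul_zero]
    rw [Finset.sum_congr rfl e, ← Finset.mul_sum, hQ, hx, hcn, ← hf]
    have hff : fallFact ((l + 1 : ℕ) : ℂ) (M + 1) ≠ 0 := by
      intro h
      rw [h, zero_mul] at hf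
      exact (Nat.cast_ne_zero.2 (l + 1).factorial_ne_zero) hf.symm
    push_cast at hff ⊢
    field_simp
  · intro k' hk' hne
    refine Finset.sum_eq_zero fun i _ => Finset.sum_eq_zero fun i' _ => ?_
    have := hadd k' hk' i i'
    rw [mem_jacS hm' hnl'] at hk'
    rw [kernelAlpha, if_neg (by omega), mul_zero]

theorem jacC_zero (l k : ℕ) : jacC l 0 0 k = (-1) ^ k * (l.choose k : ℝ) * (l.choose (l - k) : ℝ) := by
  rw [jacC]
  have h1 : ((l : ℤ) - 0).toNat = l := by omega
  have h2 : ((l : ℤ) + 0).toNat = l := by omega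
  have h3 : ((l : ℤ) - 0 - k).toNat = l - k := by omega
  rw [h1, h2, h3]

/-- For `n = 0` the constant coefficient is an alternating sum of binomial coefficients, which
vanishes. -/
theorem symAlpha_zero {l : ℕ} (hl : 1 ≤ l) (l' : ℕ) : symAlpha 0 l l' = 0 := by
  rw [symAlpha_eq (by omega) le_rfl, sum_jacS_eq (by omega) le_rfl]
  have e : ∀ k ∈ Finset.range (l + 1), (jacC l 0 0 k : ℂ) *
      ((((l : ℤ) - k - 0).toNat ! * ((k : ℤ) + 0).toNat ! : ℕ) / (l + 1)! : ℂ) =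
      (l ! / (l + 1)! : ℂ) * ((-1) ^ k * (l.choose k : ℂ)) := by
    intro k hk
    rw [Finset.mem_range] at hk
    have h1 : ((l : ℤ) - k - 0).toNat = l - k := by omega
    have h2 : ((k : ℤ) + 0).toNat = k := by omega
    have h3 := Nat.choose_mul_factorial_mul_factorial (n := l) (k := k) (by omega)
    rw [jacC_zero, h1, h2, ← h3, Nat.choose_symm (by omega)]
    push_cast
    ring
  have h := Int.alternating_sum_range_choose_of_ne (n := l) (by omega)
  have h' : ∑ m ∈ Finset.range (l + 1), (-1 : ℂ) ^ m * (l.choose m : ℂ) = 0 := by exact_mod_cast h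
  rw [Finset.sum_congr rfl e, ← Finset.mul_sum, h', mul_zero, mul_zero]

theorem symAlpha_zero_zero (l' : ℕ) : symAlpha 0 0 l' = (-1) ^ l' := by
  rw [symAlpha_eq (by omega) le_rfl, sum_jacS_eq (by omega) le_rfl]
  simp [jacC_zero]

theorem symBeta_zero (l : ℕ) {l' : ℕ} (hl' : 1 ≤ l') :
    symBeta 0 l l' = -2 * (-1) ^ l' * (l' * (l' + 1)) := by
  rw [symBeta_eq (by omega) (by omega) le_rfl hl']
  obtain ⟨r, rfl⟩ : ∃ r, l' = r + 1 := ⟨l' - 1, by omega⟩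
  have h1 : r + 1 - r = 1 := by omega
  simp only [jacC_zero, neg_zero, Int.toNat_zero, Nat.add_sub_cancel, h1, Nat.sub_self,
    Nat.choose_self, Nat.choose_zero_right, Nat.choose_one_right, Nat.sub_zero]
  rw [Nat.choose_symm_add (a := r) (b := 1)]
  push_cast
  simp
  ring

theorem jacC_neg_one (l k : ℕ) (hl : 1 ≤ l) : jacC l 0 (-1) k =
    (-1) ^ k * ((l + 1).choose k : ℝ) * ((l - 1).choose (l - k) : ℝ) := by
  rw [jacC]
  have h1 : ((l : ℤ) - -1).toNat = l + 1 := by omega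
  have h2 : ((l : ℤ) + -1).toNat = l - 1 := by omega
  have h3 : ((l : ℤ) - 0 - k).toNat = l - k := by omega
  rw [h1, h2, h3]

theorem symAlpha_neg_one {l l' : ℕ} (hl : 1 ≤ l) (hl' : 1 ≤ l') :
    symAlpha (-1) l l' = -(-1) ^ l' * (l' + 1) / l := by
  rw [symAlpha_eq (by omega) (by omega), sum_jacS_eq (by omega) (by omega), Finset.sum_range_succ']
  have e0 : jacC l 0 (-1) 0 = 0 := jacC_eq_zero (by omega) (by omega) (by omega)
  have hl0 : (l : ℂ) ≠ 0 := by exact_mod_cast (by omega : l ≠ 0)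
  have e : ∀ k ∈ Finset.range l, (jacC l 0 (-1) (k + 1) : ℂ) *
      ((((l : ℤ) - (k + 1 : ℕ) - -1).toNat ! * (((k + 1 : ℕ) : ℤ) + -1).toNat ! : ℕ) / (l + 1)! : ℂ) =
      (1 / l : ℂ) * ((-1) ^ (k + 1) * (l.choose (k + 1) : ℂ)) := by
    intro k hk
    rw [Finset.mem_range] at hk
    have h1 : ((l : ℤ) - (k + 1 : ℕ) - -1).toNat = l - k := by omega
    have h2 : (((k + 1 : ℕ) : ℤ) + -1).toNat = k := by omega
    have h3 := Nat.choose_mul_factorial_mul_factorial (n := l + 1) (k := k + 1) (by omega)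
    rw [show l + 1 - (k + 1) = l - k by omega, Nat.factorial_succ k] at h3
    have h4 := Nat.add_one_mul_choose_eq (l - 1) k
    rw [Nat.sub_add_cancel hl] at h4
    have h5 : (l - 1).choose (l - (k + 1)) = (l - 1).choose k := by
      rw [← Nat.choose_symm (n := l - 1) (k := k) (by omega)]
      congr 1; omega
    have h4' : (l : ℂ) * ((l - 1).choose k : ℂ) = (l.choose (k + 1) : ℂ) * (k + 1) := by
      exact_mod_cast h4
    have h6 : ((l - k)! : ℂ) ≠ 0 := by exact_mod_cast (l - k).factorial_ne_zero
    have h7 : (k ! : ℂ) ≠ 0 := by exact_mod_cast k.factorial_ne_zero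
    have h8 : ((k : ℂ) + 1) ≠ 0 := by exact_mod_cast k.succ_ne_zero
    have h9 : ((l + 1).choose (k + 1) : ℂ) ≠ 0 := by
      exact_mod_cast (Nat.choose_pos (by omega : k + 1 ≤ l + 1)).ne'
    rw [jacC_neg_one _ _ hl, h1, h2, h5, ← h3]
    push_cast
    field_simp
    linear_combination h4'
  have h := Int.alternating_sum_range_choose_of_ne (n := l) (by omega)
  have h' : ∑ m ∈ Finset.range (l + 1), (-1 : ℂ) ^ m * (l.choose m : ℂ) = 0 := by exact_mod_cast h
  rw [Finset.sum_range_succ'] at h'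
  have h'' : ∑ k ∈ Finset.range l, (-1 : ℂ) ^ (k + 1) * (l.choose (k + 1) : ℂ) = -1 := by
    simp at h'
    linear_combination h'
  rw [Finset.sum_congr rfl e, ← Finset.mul_sum, h'', e0, jacC_neg_one _ _ hl']
  simp
  field_simp

theorem symBeta_neg_one {l l' : ℕ} (hl : 1 ≤ l) (hl' : 1 ≤ l') :
    symBeta (-1) l l' = (-1) ^ l' * ((l + 1) * l' * (l' + 1) ^ 2) := by
  rw [symBeta_eq (by omega) (by omega) (by omega) hl']
  obtain ⟨r, rfl⟩ : ∃ r, l' = r + 1 := ⟨l' - 1, by omega⟩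
  have h1 : r + 1 - r = 1 := by omega
  have h2 : (-(-1 : ℤ)).toNat = 1 := rfl
  rw [h2, jacC_neg_one _ _ hl, jacC_neg_one _ _ hl', jacC_neg_one _ _ hl']
  simp only [Nat.add_sub_cancel, h1, Nat.sub_self, Nat.choose_self, Nat.choose_zero_right,
    Nat.choose_one_right]
  have h3 : (r + 1 + 1).choose r = (r + 2).choose 2 := by
    rw [← Nat.choose_symm_add (a := r) (b := 2)]
  have h4 : (r + 1 + 1).choose (r + 1) = r + 2 := by
    rw [Nat.choose_succ_self_right]
  rw [h3, h4]
  push_cast [Nat.cast_choose_two]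
  ring

/-! ### Legendre functions and the coefficients `A` -/

/-- The associated Legendre functions are the polynomials `jacF l 0 n`, up to a constant: Leibniz' rule
for `(y - 1)^l (y + 1)^l` in Rodrigues' formula. -/
theorem legendreP_eq {l : ℕ} {n : ℤ} (hn : |n| ≤ l) {y : ℝ} (hy : y ∈ Ioo (-1 : ℝ) 1) :
    legendreP l n y = (-1) ^ l * ((l ! : ℝ) / (((l : ℤ) - n).toNat ! : ℝ)) * jacF l 0 n y := by
  obtain ⟨hn1, hn2⟩ := abs_le.1 hn
  have ha0 : 0 < (1 + y) / 2 := by linarith [hy.1]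
  have hb0 : 0 < (1 - y) / 2 := by linarith [hy.2]
  set a := √((1 + y) / 2) with hadef
  set b := √((1 - y) / 2) with hbdef
  have ha : 0 < a := Real.sqrt_pos.2 ha0
  have hb : 0 < b := Real.sqrt_pos.2 hb0
  have ha2 : y + 1 = 2 * a ^ 2 := by rw [hadef, Real.sq_sqrt ha0.le]; ring
  have hb2 : y - 1 = -2 * b ^ 2 := by rw [hbdef, Real.sq_sqrt hb0.le]; ring
  have hpow : (1 - y ^ 2) ^ ((n : ℝ) / 2) = 2 ^ n * a ^ n * b ^ n := by
    have : 1 - y ^ 2 = (2 * a * b) ^ 2 := by linear_combination (-(y - 1)) * ha2 - 2 * a ^ 2 * hb2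
    rw [this, ← Real.rpow_natCast, ← Real.rpow_mul (by positivity), ← mul_zpow, ← mul_zpow,
      ← Real.rpow_intCast]
    congr 1; push_cast; ring
  -- the term of index `k` of `jacF` corresponds to the term of index `l - k` in Leibniz’ rule
  set D := ((l : ℤ) + n).toNat with hD
  have hder : (Polynomial.derivative^[D] ((Polynomial.X ^ 2 - 1) ^ l : ℝ[X])).eval y =
      ∑ j ∈ Finset.range (D + 1), (D.choose j : ℝ) * ((l.descFactorial (D - j) : ℝ) *
        (y - 1) ^ (l - (D - j)) * ((l.descFactorial j : ℝ) * (y + 1) ^ (l - j))) := by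
    have e : ((Polynomial.X ^ 2 - 1) ^ l : ℝ[X]) =
        (Polynomial.X - Polynomial.C 1) ^ l * (Polynomial.X + Polynomial.C 1) ^ l := by
      rw [← mul_pow]; congr 1; simp; ring
    rw [e, Polynomial.iterate_derivative_mul, Polynomial.eval_finsetSum]
    refine Finset.sum_congr rfl fun j _ => ?_
    rw [Polynomial.iterate_derivative_X_add_pow, Polynomial.iterate_derivative_X_sub_pow]
    simp
  rw [legendreP, hpow, hder, jacF, ← hadef, ← hbdef, jacobiR, Finset.mul_sum, Finset.mul_sum]
  symm
  have hmem := fun k : ℕ => mem_jacS (l := l) (m := 0) (n := n) (by omega) (by omega) (k := k)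
  refine Finset.sum_of_injOn (fun k => l - k) ?_ ?_ ?_ ?_
  · intro k hk k' hk' h
    rw [Finset.mem_coe, hmem] at hk hk'
    simp only at h
    omega
  · intro k hk
    rw [Finset.mem_coe, hmem] at hk
    simp only [Finset.coe_range, mem_Iio]
    omega
  · intro j hj hj'
    rw [Finset.mem_range] at hj
    have : l < j ∨ l < D - j := by
      by_contra! h
      refine hj' ⟨l - j, ?_, by simp only; omega⟩
      rw [Finset.mem_coe, hmem]; omega
    rcases this with h | h
    · rw [Nat.descFactorial_of_lt h]; simp
    · rw [Nat.descFactorial_of_lt h]; simp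
  · intro k hk
    rw [hmem] at hk
    set N := ((l : ℤ) - n).toNat with hN
    have e1 : ((l : ℤ) - 0 - k).toNat = l - k := by omega
    have e2 : D - (l - k) = (k + n).toNat := by omega
    have e3 : l - (k + n).toNat = N - k := by omega
    have e4 : l - (l - k) = k := by omega
    have f1 : (l.descFactorial (k + n).toNat : ℝ) = l ! / (N - k)! := by
      rw [eq_div_iff (by exact_mod_cast (N - k).factorial_ne_zero)]
      have := Nat.factorial_mul_descFactorial (n := l) (k := (k + n).toNat) (by omega)
      rw [e3] at this
      rw [← this]; push_cast; ring
    have f2 : (l.descFactorial (l - k) : ℝ) = l ! / k ! := by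
      rw [eq_div_iff (by exact_mod_cast k.factorial_ne_zero)]
      have := Nat.factorial_mul_descFactorial (n := l) (k := l - k) (by omega)
      rw [e4] at this
      rw [← this]; push_cast; ring
    have f3 : (N.choose k : ℝ) = N ! / (k ! * (N - k)!) :=
      Nat.cast_choose ℝ (by omega)
    have g1 : (a : ℝ) ^ (2 * (k : ℤ) + 0 + n).toNat = a ^ n * (a ^ 2) ^ k := by
      rw [← pow_mul, ← zpow_natCast, ← zpow_natCast, ← zpow_add₀ ha.ne']; congr 1; omega
    have g2 : (b : ℝ) ^ (2 * (l : ℤ) - 0 - n - 2 * k).toNat = b ^ n * (b ^ 2) ^ (N - k) := by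
      rw [← pow_mul, ← zpow_natCast, ← zpow_natCast, ← zpow_add₀ hb.ne']; congr 1; omega
    have g3 : (2 : ℝ) ^ n * 2 ^ (N - k) * 2 ^ k = 2 ^ l := by
      rw [← zpow_natCast, ← zpow_natCast, ← zpow_natCast, ← zpow_add₀ two_ne_zero,
        ← zpow_add₀ two_ne_zero]; congr 1; omega
    have g4 : (-1 : ℝ) ^ n * (-1) ^ (N - k) = (-1) ^ l * (-1) ^ k := by
      rw [← zpow_natCast, ← zpow_natCast, ← zpow_natCast, ← zpow_add₀ (by norm_num),
        ← zpow_add₀ (by norm_num)]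
      rw [show n + ((N - k : ℕ) : ℤ) = (l : ℤ) + k + 2 * (-k) by omega, zpow_add₀ (by norm_num),
        zpow_mul]
      norm_num
    have hl0 : (l ! : ℝ) ≠ 0 := by exact_mod_cast l.factorial_ne_zero
    have hk0 : (k ! : ℝ) ≠ 0 := by exact_mod_cast k.factorial_ne_zero
    have hN0 : (N ! : ℝ) ≠ 0 := by exact_mod_cast N.factorial_ne_zero
    have hNk : ((N - k)! : ℝ) ≠ 0 := by exact_mod_cast (N - k).factorial_ne_zero
    have ht : (2 : ℝ) ^ l ≠ 0 := by positivity
    rw [e2, e3, e4, f1, f2, jacC, e1, ← hN, ← hD, f3, g1, g2, ha2, hb2, mul_pow, mul_pow,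
      neg_pow (2 : ℝ)]
    field_simp
    rw [← g3]
    linear_combination (-(D.choose (l - k) : ℝ) * (2 : ℝ) ^ n * 2 ^ (N - k) * 2 ^ k) * g4

theorem continuous_jacF (l : ℕ) (m n : ℤ) : Continuous (jacF l m n) := by
  unfold jacF jacobiR
  fun_prop

theorem continuousOn_boost : ContinuousOn (fun p : ℝ × ℝ => boost p.1 p.2) (univ ×ˢ Icc (-1) 1) := by
  have h : ∀ p ∈ (univ ×ˢ Icc (-1) 1 : Set (ℝ × ℝ)),
      boost p.1 p.2 = (p.2 * Real.cosh p.1 - Real.sinh p.1) / uu p.1 p.2 := fun p hp =>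
    boost_eq p.1 hp.2
  refine ContinuousOn.congr (ContinuousOn.div (by fun_prop) ?_ fun p hp => (uu_pos p.1 hp.2).ne') h
  unfold uu; fun_prop

theorem boost_neg_boost (t : ℝ) {y : ℝ} (hy : y ∈ Icc (-1 : ℝ) 1) : boost (-t) (boost t y) = y := by
  have hu := (uu_pos t hy).ne'
  have hv := (uu_pos (-t) (boost_mem t hy)).ne'
  rw [boost_eq (-t) (boost_mem t hy), div_eq_iff hv, uu, boost_eq t hy]
  simp only [Real.cosh_neg, Real.sinh_neg]
  field_simp
  rw [uu]
  ring

theorem uu_neg_boost (t : ℝ) {y : ℝ} (hy : y ∈ Icc (-1 : ℝ) 1) :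
    uu (-t) (boost t y) = (uu t y)⁻¹ := by
  have hu := (uu_pos t hy).ne'
  rw [uu, boost_eq t hy]
  simp only [Real.cosh_neg, Real.sinh_neg]
  field_simp
  rw [uu]
  linear_combination Real.cosh_sq_sub_sinh_sq t

theorem hasDerivAt_boost (t : ℝ) {y : ℝ} (hy : y ∈ Icc (-1 : ℝ) 1) :
    HasDerivAt (boost t) ((uu t y ^ 2)⁻¹) y := by
  have hu := (uu_pos t hy).ne'
  have hev : boost t =ᶠ[𝓝 y] fun y => (y * Real.cosh t - Real.sinh t) / uu t y := by
    have hc : ContinuousAt (fun y => uu t y) y := by unfold uu; fun_prop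
    filter_upwards [hc.eventually_ne hu] with x hx
    have h := cosh_mul_one_sub t x
    have hch := (Real.cosh_pos t).ne'
    have h1 : 1 - Real.tanh t * x ≠ 0 := fun h0 => hx (by rw [← h, h0, mul_zero])
    rw [boost, div_eq_div_iff h1 hx, ← h, Real.tanh_eq_sinh_div_cosh]
    field_simp
  refine HasDerivAt.congr_of_eventuallyEq ?_ hev
  have d1 : HasDerivAt (fun y => y * Real.cosh t - Real.sinh t) (Real.cosh t) y := by
    simpa using ((hasDerivAt_id y).mul_const (Real.cosh t)).sub_const (Real.sinh t)
  have d2 : HasDerivAt (fun y => uu t y) (-Real.sinh t) y := by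
    unfold uu
    simpa using ((hasDerivAt_id y).mul_const (Real.sinh t)).const_sub (Real.cosh t)
  refine (d1.div d2 hu).congr_deriv ?_
  rw [inv_eq_one_div]
  congr 1
  rw [uu]
  linear_combination Real.cosh_sq_sub_sinh_sq t

theorem boost_one (t : ℝ) : boost t 1 = 1 := by
  have hy : (1 : ℝ) ∈ Icc (-1 : ℝ) 1 := by simp
  have h := one_sub_boost t hy
  simp at h
  linarith

theorem boost_neg_one (t : ℝ) : boost t (-1) = -1 := by
  have hy : (-1 : ℝ) ∈ Icc (-1 : ℝ) 1 := by simp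
  have h := one_add_boost t hy
  simp at h
  linarith

/-- The substitution `y ↦ boost t y`. -/
theorem integral_boost {E : Type*} [NormedAddCommGroup E] [NormedSpace ℝ E] [CompleteSpace E]
    (t : ℝ) {G : ℝ → E} (hG : ContinuousOn G (Icc (-1) 1)) :
    ∫ y in (-1 : ℝ)..1, G y = ∫ y in (-1 : ℝ)..1, (uu t y ^ 2)⁻¹ • G (boost t y) := by
  have h1 : uIcc (-1 : ℝ) 1 = Icc (-1) 1 := uIcc_of_le (by norm_num)
  have key := intervalIntegral.integral_deriv_smul_comp' (a := -1) (b := 1) (f := boost t)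
    (f' := fun y => (uu t y ^ 2)⁻¹) (g := G)
    (fun y hy => hasDerivAt_boost t (h1 ▸ hy)) (by
      rw [h1]
      refine ContinuousOn.inv₀ (by unfold uu; fun_prop) fun y hy => ?_
      exact pow_ne_zero 2 (uu_pos t hy).ne')
    (hG.mono (by rw [h1]; rintro _ ⟨y, hy, rfl⟩; exact boost_mem t hy))
  rw [boost_one, boost_neg_one] at key
  exact key.symm

theorem rInt_neg_one (m n : ℤ) (l l' : ℕ) (t : ℝ) : rInt (-1) m n l l' t =
    ((1 / 2 * ∫ y in (-1 : ℝ)..1, (uu t y ^ 2)⁻¹ * (jacF l' m n y * jacF l m n (boost t y)) : ℝ) :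
      ℂ) := by
  rw [rInt, Complex.ofReal_mul, ← intervalIntegral.integral_ofReal]
  push_cast
  congr 1
  refine intervalIntegral.integral_congr fun y _ => ?_
  have : (-1 - 1 : ℂ) = ((-2 : ℤ) : ℂ) := by norm_num
  rw [this, Complex.cpow_intCast]
  congr 1

/-- The constant that relates `matA` to `rInt (-1) 0`. -/
noncomputable def constA (l : ℕ) (n : ℤ) (l' : ℕ) : ℝ :=
  Real.sqrt
      (((l : ℝ) * (l + 1) * (2 * l + 1) * (((l : ℤ) - n).toNat ! : ℝ) *
          (2 * l' + 1) * (((l' : ℤ) - n).toNat ! : ℝ)) /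
        ((l' : ℝ) * (l' + 1) * 2 * (((l : ℤ) + n).toNat ! : ℝ) *
          2 * (((l' : ℤ) + n).toNat ! : ℝ))) *
    ((-1) ^ (l + l') * ((l ! : ℝ) / (((l : ℤ) - n).toNat ! : ℝ)) *
      ((l' ! : ℝ) / (((l' : ℤ) - n).toNat ! : ℝ)) * 2)

/-- The coefficients `A` are matrix elements with `l₀ = 0` at `w = -1`: substitute `y ↦ boost t y`, whose
derivative is `u⁻²`. -/
theorem matA_eq {l l' : ℕ} {n : ℤ} (hn : |n| ≤ l) (hn' : |n| ≤ l') (t : ℝ) :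
    (matA l n l' n t : ℂ) = constA l n l' * rInt (-1) 0 n l l' t := by
  rw [matA, if_pos rfl, rInt_neg_one, ← Complex.ofReal_mul, constA]
  congr 1
  set c := ((-1) ^ l * ((l ! : ℝ) / (((l : ℤ) - n).toNat ! : ℝ))) with hc
  set c' := ((-1) ^ l' * ((l' ! : ℝ) / (((l' : ℤ) - n).toNat ! : ℝ))) with hc'
  have e : ∫ y in (-1 : ℝ)..1,
        legendreP l n y * legendreP l' n ((Real.tanh t + y) / (1 + Real.tanh t * y)) =
      ∫ y in (-1 : ℝ)..1, c * c' * (jacF l 0 n y * jacF l' 0 n (boost (-t) y)) := by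
    refine intervalIntegral.integral_congr_Ioo_of_le (by norm_num) fun y hy => ?_
    have hy' := Ioo_subset_Icc_self hy
    have hb : (Real.tanh t + y) / (1 + Real.tanh t * y) = boost (-t) y := by
      rw [boost, Real.tanh_neg]; congr 1 <;> ring
    have hbm : boost (-t) y ∈ Ioo (-1 : ℝ) 1 := by
      have h1 := one_add_boost (-t) hy'
      have h2 := one_sub_boost (-t) hy'
      have hu := uu_pos (-t) hy'
      have h3 : 0 < (1 + y) / 2 * Real.exp (- -t) / uu (-t) y := by
        have := hy.1
        exact div_pos (mul_pos (by linarith) (Real.exp_pos _)) hu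
      have h4 : 0 < (1 - y) / 2 * Real.exp (-t) / uu (-t) y := by
        have := hy.2
        exact div_pos (mul_pos (by linarith) (Real.exp_pos _)) hu
      constructor <;> linarith
    rw [hb, legendreP_eq hn hy, legendreP_eq hn' hbm]
    ring
  have hG : ContinuousOn (fun y => jacF l 0 n y * jacF l' 0 n (boost (-t) y)) (Icc (-1) 1) := by
    refine (continuous_jacF l 0 n).continuousOn.mul ((continuous_jacF l' 0 n).comp_continuousOn ?_)
    exact continuousOn_boost.comp (f := fun y : ℝ => (-t, y)) (by fun_prop) fun y hy => ⟨trivial, hy⟩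
  rw [e, intervalIntegral.integral_const_mul, integral_boost t hG]
  have e2 : ∫ y in (-1 : ℝ)..1, (uu t y ^ 2)⁻¹ •
        (jacF l 0 n (boost t y) * jacF l' 0 n (boost (-t) (boost t y))) =
      ∫ y in (-1 : ℝ)..1, (uu t y ^ 2)⁻¹ * (jacF l' 0 n y * jacF l 0 n (boost t y)) := by
    refine intervalIntegral.integral_congr fun y hy => ?_
    rw [uIcc_of_le (by norm_num)] at hy
    rw [boost_neg_boost t hy, smul_eq_mul, mul_comm (jacF l 0 n (boost t y))]
  rw [e2, hc, hc', pow_add]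
  ring

/-! ### Differentiation under the integral and the components `B` -/

theorem continuous_integral_Icc {X : Type*} [TopologicalSpace X] {F : X → ℝ → ℂ}
    (hF : ContinuousOn (Function.uncurry F) (univ ×ˢ Icc (-1) 1)) :
    Continuous fun x => ∫ y in (-1 : ℝ)..1, F x y := by
  have h11 : (-1 : ℝ) ≤ 1 := by norm_num
  have hc : Continuous (Function.uncurry fun (x : X) (y : ℝ) => F x (projIcc (-1) 1 h11 y)) :=
    hF.comp_continuous (f := fun p : X × ℝ => (p.1, (projIcc (-1 : ℝ) 1 h11 p.2 : ℝ))) (by fun_prop)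
      fun p => ⟨trivial, (projIcc (-1 : ℝ) 1 h11 p.2).2⟩
  have := intervalIntegral.continuous_parametric_intervalIntegral_of_continuous' (μ := volume) hc (-1) 1
  refine this.congr fun x => intervalIntegral.integral_congr fun y hy => ?_
  rw [uIcc_of_le h11] at hy
  rw [projIcc_of_mem h11 hy]

/-- Differentiation under the integral over `[-1, 1]`. -/
theorem hasDerivAt_integral_Icc {F F' : ℝ → ℝ → ℂ} (hF : ∀ t, ContinuousOn (F t) (Icc (-1) 1))
    (hF' : ContinuousOn (Function.uncurry F') (univ ×ˢ Icc (-1) 1))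
    (hd : ∀ t, ∀ y ∈ Icc (-1 : ℝ) 1, HasDerivAt (fun t => F t y) (F' t y) t) (t : ℝ) :
    HasDerivAt (fun t => ∫ y in (-1 : ℝ)..1, F t y) (∫ y in (-1 : ℝ)..1, F' t y) t := by
  have h11 : (-1 : ℝ) ≤ 1 := by norm_num
  have hI : uIoc (-1 : ℝ) 1 ⊆ Icc (-1) 1 := by
    rw [uIoc_of_le h11]; exact Ioc_subset_Icc_self
  obtain ⟨C, hC⟩ := ((isCompact_closedBall t 1).prod (isCompact_Icc (a := (-1 : ℝ)) (b := 1))).exists_bound_of_continuousOn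
    (hF'.mono (prod_mono (subset_univ _) subset_rfl))
  have hm : ∀ {f : ℝ → ℂ}, ContinuousOn f (Icc (-1) 1) →
      AEStronglyMeasurable f (volume.restrict (uIoc (-1 : ℝ) 1)) := fun hf =>
    (hf.mono hI).aestronglyMeasurable measurableSet_uIoc
  refine (intervalIntegral.hasDerivAt_integral_of_dominated_loc_of_deriv_le (bound := fun _ => C)
    (Metric.closedBall_mem_nhds t one_pos) (Eventually.of_forall fun x => hm (hF x)) ?_ (hm ?_) ?_
    (by simp) ?_).2
  · exact ContinuousOn.intervalIntegrable (by rw [uIcc_of_le h11]; exact hF t)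
  · exact hF'.comp (f := fun y : ℝ => (t, y)) (by fun_prop) fun y hy => ⟨trivial, hy⟩
  · exact Eventually.of_forall fun y hy x hx => hC (x, y) ⟨hx, hI hy⟩
  · exact Eventually.of_forall fun y hy x _ => hd x y (hI hy)

theorem continuousOn_uu_cpow {X : Type*} [TopologicalSpace X] {f : X → ℂ} {g : X → ℝ}
    (hf : Continuous f) (hg : Continuous g) :
    ContinuousOn (fun p : X × ℝ => (uu (g p.1) p.2 : ℂ) ^ f p.1) (univ ×ˢ Icc (-1) 1) := by
  intro p hp
  refine ContinuousAt.continuousWithinAt (ContinuousAt.cpow ?_ (by fun_prop) ?_)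
  · unfold uu; fun_prop
  · exact Or.inl (by simpa using uu_pos (g p.1) hp.2)

theorem continuousOn_boost' {X : Type*} [TopologicalSpace X] {g : X → ℝ} (hg : Continuous g) :
    ContinuousOn (fun p : X × ℝ => boost (g p.1) p.2) (univ ×ˢ Icc (-1) 1) :=
  continuousOn_boost.comp (f := fun p : X × ℝ => (g p.1, p.2)) (by fun_prop)
    fun _ hp => ⟨trivial, hp.2⟩

theorem continuous_rInt (m n : ℤ) (l l' : ℕ) :
    Continuous fun p : ℂ × ℝ => rInt p.1 m n l l' p.2 := by
  unfold rInt
  refine continuous_const.mul (continuous_integral_Icc ?_)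
  refine ContinuousOn.mul ?_ ?_
  · exact continuousOn_uu_cpow (f := fun p : ℂ × ℝ => p.1 - 1) (g := fun p : ℂ × ℝ => p.2)
      (by fun_prop) (by fun_prop)
  · refine Complex.continuous_ofReal.comp_continuousOn (ContinuousOn.mul ?_ ?_)
    · exact ((continuous_jacF l' m n).comp continuous_snd).continuousOn
    · exact (continuous_jacF l m n).comp_continuousOn
        (continuousOn_boost' (g := fun p : ℂ × ℝ => p.2) (by fun_prop))

theorem continuous_rInt_right (w : ℂ) (m n : ℤ) (l l' : ℕ) :
    Continuous fun t : ℝ => rInt w m n l l' t := by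
  have h : Continuous fun t : ℝ => ((w, t) : ℂ × ℝ) := by fun_prop
  have h2 := (continuous_rInt m n l l').comp h
  simpa only [Function.comp_def] using h2

theorem hasDerivAt_cpow_ofReal {f : ℝ → ℝ} {f' x : ℝ} (hf : HasDerivAt f f' x) (h0 : 0 < f x)
    (v : ℂ) : HasDerivAt (fun x => (f x : ℂ) ^ v) (v * (f x : ℂ) ^ (v - 1) * f') x := by
  have h1 : HasDerivAt (fun z : ℂ => z ^ v) (v * (f x : ℂ) ^ (v - 1)) (f x : ℂ) := by
    have := (hasDerivAt_id (f x : ℂ)).cpow_const (c := v) (by simpa using h0)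
    simpa using this
  exact h1.comp x hf.ofReal_comp

theorem hasDerivAt_uu_left (t y : ℝ) :
    HasDerivAt (fun t => uu t y) (Real.sinh t - y * Real.cosh t) t := by
  unfold uu
  exact (Real.hasDerivAt_cosh t).sub ((Real.hasDerivAt_sinh t).const_mul y)

theorem hasDerivAt_uu_right (t y : ℝ) : HasDerivAt (fun y => uu t y) (-Real.sinh t) y := by
  unfold uu
  simpa using ((hasDerivAt_id y).mul_const (Real.sinh t)).const_sub (Real.cosh t)

theorem jacS_nat (l : ℕ) : jacS l 0 0 = Finset.range (l + 1) := by
  ext k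
  rw [mem_jacS (by omega) (by omega), Finset.mem_range]; omega

theorem jacF_zero (y : ℝ) : jacF 0 0 0 y = 1 := by
  rw [jacF, jacobiR, jacS_nat]
  simp [jacC_zero]

theorem jacF_one {y : ℝ} (hy : y ∈ Icc (-1 : ℝ) 1) : jacF 1 0 0 y = -y := by
  have ha : 0 ≤ (1 + y) / 2 := by linarith [hy.1]
  have hb : 0 ≤ (1 - y) / 2 := by linarith [hy.2]
  rw [jacF, jacobiR, jacS_nat]
  have ha' := Real.sq_sqrt ha
  have hb' := Real.sq_sqrt hb
  generalize √((1 + y) / 2) = a at ha' ⊢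
  generalize √((1 - y) / 2) = b at hb' ⊢
  simp [Finset.sum_range_succ, jacC_zero]
  rw [ha', hb']
  ring

/-- The integral of the Legendre polynomials of positive degree. -/
theorem integral_jacF {l : ℕ} (hl : 1 ≤ l) : ∫ y in (-1 : ℝ)..1, jacF l 0 0 y = 0 := by
  set Q : ℝ[X] := (Polynomial.X ^ 2 - 1) ^ l with hQ
  have e : ∀ y ∈ Ioo (-1 : ℝ) 1, jacF l 0 0 y =
      ((-1) ^ l / (2 ^ l * l !)) * (Polynomial.derivative^[l] Q).eval y := by
    intro y hy
    have h1 := legendreP_eq (l := l) (n := 0) (by simp) hy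
    have h2 : (l ! : ℝ) ≠ 0 := by exact_mod_cast l.factorial_ne_zero
    have h3 : ((l : ℤ) - 0).toNat = l := by omega
    have h4 : ((l : ℤ) + 0).toNat = l := by omega
    have h5 : (-1 : ℝ) ^ l * (-1) ^ l = 1 := by rw [← mul_pow]; simp
    rw [h3, div_self h2, mul_one, legendreP, h4, ← hQ] at h1
    simp only [zpow_zero, Int.cast_zero, zero_div, Real.rpow_zero, mul_one] at h1
    calc jacF l 0 0 y = (-1) ^ l * ((-1) ^ l * jacF l 0 0 y) := by rw [← mul_assoc, h5, one_mul]
      _ = _ := by rw [← h1]; ring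
  rw [intervalIntegral.integral_congr_Ioo_of_le (by norm_num) e, intervalIntegral.integral_const_mul]
  obtain ⟨r, rfl⟩ : ∃ r, l = r + 1 := ⟨l - 1, by omega⟩
  have hder : ∀ y : ℝ, HasDerivAt (fun y => (Polynomial.derivative^[r] Q).eval y)
      ((Polynomial.derivative^[r + 1] Q).eval y) y := by
    intro y
    rw [Function.iterate_succ_apply']
    exact Polynomial.hasDerivAt _ y
  -- the derivative of order `r` of `(X² - 1)^{r+1}` still vanishes at `±1`
  have hdvd : (Polynomial.X ^ 2 - 1 : ℝ[X]) ∣ Polynomial.derivative^[r] Q := by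
    have := Polynomial.pow_sub_dvd_iterate_derivative_pow (Polynomial.X ^ 2 - 1 : ℝ[X]) (r + 1) r
    rwa [Nat.add_sub_cancel_left, pow_one] at this
  have h0 : ∀ y : ℝ, y ^ 2 = 1 → (Polynomial.derivative^[r] Q).eval y = 0 := by
    intro y hy
    obtain ⟨R, hR⟩ := hdvd
    rw [hR]; simp [hy]
  rw [intervalIntegral.integral_eq_sub_of_hasDerivAt (fun y _ => hder y)
    (Continuous.intervalIntegrable (by fun_prop) _ _), h0 1 (by norm_num), h0 (-1) (by norm_num)]
  simp

/-- The derivative of `u⁻²` with respect to `t` is `2 u⁻² boost t y`, and `jacF 1 0 0 y = -y`. -/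
theorem hasDerivAt_rInt_zero (l : ℕ) (t : ℝ) :
    HasDerivAt (fun t => rInt (-1) 0 0 0 l t) (-2 * rInt (-1) 0 0 1 l t) t := by
  have key := hasDerivAt_integral_Icc
    (F := fun t y => (uu t y : ℂ) ^ (-1 - 1 : ℂ) * (jacF l 0 0 y * jacF 0 0 0 (boost t y) : ℝ))
    (F' := fun t y => ((-1 - 1 : ℂ) * (uu t y : ℂ) ^ (-1 - 1 - 1 : ℂ) *
      ((Real.sinh t - y * Real.cosh t : ℝ) : ℂ)) * (jacF l 0 0 y : ℝ)) ?_ ?_ ?_ t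
  · have h2 := key.const_mul (1 / 2)
    refine h2.congr_deriv ?_
    rw [rInt, ← mul_assoc, ← intervalIntegral.integral_const_mul,
      ← intervalIntegral.integral_const_mul]
    refine intervalIntegral.integral_congr fun y hy => ?_
    rw [uIcc_of_le (by norm_num)] at hy
    have hu := uu_pos t hy
    have hu' : (uu t y : ℂ) ≠ 0 := by exact_mod_cast hu.ne'
    rw [jacF_one (boost_mem t hy), boost_eq t hy, Complex.cpow_sub _ _ hu', Complex.cpow_one]
    push_cast
    field_simp
    ring
  · intro t
    have h1 := (continuousOn_uu_cpow (X := ℝ) (f := fun _ => (-1 - 1 : ℂ)) (g := fun t => t)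
      (by fun_prop) (by fun_prop)).comp (f := fun y : ℝ => (t, y)) (s := Icc (-1) 1) (by fun_prop)
      fun y hy => ⟨trivial, hy⟩
    refine h1.mul (Complex.continuous_ofReal.comp_continuousOn ?_)
    simp only [jacF_zero, mul_one]
    exact (continuous_jacF l 0 0).continuousOn
  · refine ContinuousOn.mul (ContinuousOn.mul (continuousOn_const.mul ?_) ?_) ?_
    · exact continuousOn_uu_cpow (X := ℝ) (f := fun _ => (-1 - 1 - 1 : ℂ)) (g := fun t => t)
        (by fun_prop) (by fun_prop)
    · fun_prop
    · exact (Complex.continuous_ofReal.comp ((continuous_jacF l 0 0).comp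
        continuous_snd)).continuousOn
  · intro t y hy
    simp only [jacF_zero, mul_one]
    exact (hasDerivAt_cpow_ofReal (hasDerivAt_uu_left t y) (uu_pos t hy) _).mul_const _

/-- The constant that relates the components of the inhomogeneous term to `rInt (-1) 0 0 0`. -/
noncomputable def constB (l : ℕ) : ℝ := -constA 1 0 l / 2

theorem matA_one_eq (l : ℕ) :
    (fun s => (matA 1 0 l 0 s : ℂ)) = fun s => (constA 1 0 l : ℂ) * rInt (-1) 0 0 1 l s :=
  funext fun s => matA_eq (l := 1) (l' := l) (n := 0) (by simp) (by simp) s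

/-- The components `B`, without their constant prefactor, are matrix elements with `l₀ = 0`, `l = 0`
at `w = -1`. -/
theorem integral_matA {l : ℕ} (hl : 1 ≤ l) (t : ℝ) :
    ((∫ s in (0 : ℝ)..t, matA 1 0 l 0 s : ℝ) : ℂ) = constB l * rInt (-1) 0 0 0 l t := by
  have hd : ∀ s : ℝ, HasDerivAt (fun s => (constB l : ℂ) * rInt (-1) 0 0 0 l s)
      (matA 1 0 l 0 s : ℂ) s := by
    intro s
    refine ((hasDerivAt_rInt_zero l s).const_mul (constB l : ℂ)).congr_deriv ?_
    rw [congrFun (matA_one_eq l) s, constB]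
    push_cast; ring
  have hc : Continuous fun s => (matA 1 0 l 0 s : ℂ) := by
    rw [matA_one_eq l]
    exact continuous_const.mul (continuous_rInt_right _ _ _ _ _)
  have h0 : rInt (-1) 0 0 0 l 0 = 0 := by
    rw [rInt_neg_one]
    simp [uu, jacF_zero, integral_jacF hl]
  rw [← intervalIntegral.integral_ofReal, intervalIntegral.integral_eq_sub_of_hasDerivAt
    (fun s _ => hd s) (hc.intervalIntegrable _ _), h0]
  simp

/-! ### From continued integrals to vanishing and nonvanishing -/

theorem HasCont.union {l₀ : ℕ} {g : ℂ → ℂ → ℝ → ℂ} {c : ℂ → ℕ → ℂ}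
    (h : HasCont l₀ (Ioc 0 1) g fun _ _ => 0) (h' : HasCont l₀ (Ioi 1) g c) :
    HasCont l₀ (Ioi 0) g c := by
  obtain ⟨Φ, h1, h2, h3⟩ := h
  obtain ⟨Φ', h1', h2', h3'⟩ := h'
  refine ⟨fun p => Φ p + Φ' p, fun p hp => (h1 p hp).add (h1' p hp), fun p hp => ?_,
    fun z k hk => ?_⟩
  · rw [← Ioc_union_Ioi_eq_Ioi (zero_le_one' ℝ)]
    refine ⟨(h2 p hp).1.union (h2' p hp).1, ?_⟩
    rw [setIntegral_union (Ioc_disjoint_Ioi le_rfl) measurableSet_Ioi (h2 p hp).1 (h2' p hp).1]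
    simp only [(h2 p hp).2, (h2' p hp).2]
  · have := (h3 z k hk).add (h3' z k hk)
    rw [zero_add] at this
    refine this.congr fun w => ?_
    ring

theorem continuousOn_phase (z : ℂ) : ContinuousOn (phase z) (Ioi 0) := by
  unfold phase
  refine Complex.continuous_exp.comp_continuousOn (continuousOn_const.mul
    (Complex.continuous_ofReal.comp_continuousOn (continuousOn_id.mul
      (ContinuousOn.div (by fun_prop) (by fun_prop) fun t ht => (Real.sinh_pos_iff.2 ht).ne'))))

theorem norm_phase_le {Z : ℝ} {z : ℂ} (hz : ‖z‖ ≤ Z) {t : ℝ} (ht : t ∈ Ioc (0 : ℝ) 1) :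
    ‖phase z t‖ ≤ Real.exp (Z * Real.cosh 1) := by
  have hs : 0 < Real.sinh t := Real.sinh_pos_iff.2 ht.1
  have h1 : t * (Real.cosh t / Real.sinh t) ≤ Real.cosh 1 := by
    rw [← mul_div_assoc, div_le_iff₀ hs, mul_comm]
    have h2 : Real.cosh t ≤ Real.cosh 1 := by
      rw [Real.cosh_le_cosh, abs_of_pos ht.1, abs_one]; exact ht.2
    exact mul_le_mul h2 (Real.self_le_sinh_iff.2 ht.1.le) ht.1.le (Real.cosh_pos _).le
  have h0 : 0 ≤ t * (Real.cosh t / Real.sinh t) := by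
    have := Real.cosh_pos t
    have := ht.1
    positivity
  rw [phase, Complex.norm_exp, Complex.re_mul_ofReal]
  refine Real.exp_le_exp.2 ?_
  have h3 : (-z).re ≤ Z := (Complex.re_le_norm _).trans (by rwa [norm_neg])
  exact (mul_le_mul_of_nonneg_right h3 h0).trans
    (mul_le_mul_of_nonneg_left h1 ((norm_nonneg z).trans hz))

/-- On `(0, 1]` the factor `e^{-z t coth t}` is bounded, since `t coth t ≤ cosh 1` there, so the integral is
entire and does not contribute to the leading coefficients. -/
theorem hasCont_unitInterval (l₀ : ℕ) {g : ℂ → ℂ → ℝ → ℂ}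
    (hc : Continuous fun q : (ℂ × ℂ) × ℝ => g q.1.1 q.1.2 q.2)
    (hd : ∀ t ∈ Ioc (0 : ℝ) 1, Differentiable ℂ fun p : ℂ × ℂ => g p.1 p.2 t) :
    HasCont l₀ (Ioc 0 1) (fun w z t => g w z t * phase z t) fun _ _ => 0 := by
  have key := analyticOnNhd_unitInterval (f := fun p t => g p.1 p.2 t * phase p.2 t)
    (fun p => ?_) (fun t ht => ?_) fun Z => ?_
  · obtain ⟨h1, h2⟩ := key
    refine ⟨_, h1.mono (subset_univ _), fun p _ => ⟨h2 p, rfl⟩, fun z k _ => ?_⟩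
    have hcont : ContinuousAt (fun w : ℂ => ∫ t in Ioc (0 : ℝ) 1, g w z t * phase z t)
        (poleW l₀ z k) :=
      ContinuousAt.comp (f := fun w : ℂ => (w, z)) (h1 (poleW l₀ z k, z) trivial).continuousAt
        (by fun_prop)
    simpa using (tendsto_poleW_sub_pow l₀ z k).mul (hcont.tendsto.mono_left nhdsWithin_le_nhds)
  · refine ContinuousOn.mul ?_ ((continuousOn_phase p.2).mono Ioc_subset_Ioi_self)
    exact (hc.comp (by fun_prop : Continuous fun t : ℝ => (p, t))).continuousOn
  · refine (hd t ht).mul ?_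
    unfold phase
    fun_prop
  · obtain ⟨C, hC⟩ := ((isCompact_closedBall (0 : ℂ × ℂ) Z).prod
      (isCompact_Icc (a := (0 : ℝ)) (b := 1))).exists_bound_of_continuousOn hc.continuousOn
    refine ⟨C * Real.exp (Z * Real.cosh 1), fun p hp t ht => ?_⟩
    have h1 := hC (p, t) ⟨by simpa using hp, Ioc_subset_Icc_self ht⟩
    rw [norm_mul]
    exact mul_le_mul h1 (norm_phase_le ((norm_snd_le p).trans hp) ht) (norm_nonneg _)
      ((norm_nonneg _).trans h1)

theorem differentiable_rInt {l l' : ℕ} {m n : ℤ} (hm : m ≤ l) (hm' : m ≤ l') (hn : n ≤ l)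
    (hn' : n ≤ l') {t : ℝ} (ht : 0 < t) : Differentiable ℂ fun w => rInt w m n l l' t := by
  simp only [rInt_eq hm hm' hn hn' _ ht, rSum]
  refine Differentiable.fun_sum fun k _ => Differentiable.fun_sum fun k' _ =>
    Differentiable.fun_sum fun i _ => Differentiable.fun_sum fun i' _ => ?_
  have := differentiable_expKernel ht.le
  fun_prop

/-- Multiplication by `i` in the first variable exchanges the two families of hyperplanes, so the
polar sets in the variables `ρ` and `w = iρ` correspond. -/
theorem mem_polarSet_iff (ρ z : ℂ) : (ρ, z) ∈ polarSet ↔ (Complex.I * ρ, z) ∈ polarSetW := by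
  have hI := Complex.I_mul_I
  constructor
  · rintro ⟨m, hm, h | h⟩
    · refine ⟨m, hm, Or.inr ?_⟩
      simp only at h ⊢
      rw [h]; linear_combination ((m : ℂ) + z) * hI
    · refine ⟨m, hm, Or.inl ?_⟩
      simp only at h ⊢
      rw [h]; linear_combination -((m : ℂ) + z) * hI
  · rintro ⟨m, hm, h | h⟩
    · refine ⟨m, hm, Or.inr ?_⟩
      simp only at h ⊢
      linear_combination -Complex.I * h + ρ * hI
    · refine ⟨m, hm, Or.inl ?_⟩
      simp only at h ⊢
      linear_combination -Complex.I * h + ρ * hI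

theorem mem_convergenceTube_iff (ρ z : ℂ) :
    (ρ, z) ∈ convergenceTube ↔ (Complex.I * ρ, z) ∈ tubeW := by
  simp [convergenceTube, tubeW]

theorem HasCont.exists_isIntegralContinuation {l₀ : ℕ} {g : ℂ → ℂ → ℝ → ℂ} {c : ℂ → ℕ → ℂ}
    (h : HasCont l₀ (Ioi 0) g c) :
    ∃ Φ, IsIntegralContinuation (fun ρ z t => g (Complex.I * ρ) z t) Φ := by
  obtain ⟨Φ, h1, h2, h3⟩ := h
  refine ⟨fun p => Φ (Complex.I * p.1, p.2), fun p hp => ?_, fun p hp => ?_, fun p hp => ?_⟩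
  · exact (h2 (Complex.I * p.1, p.2) ((mem_convergenceTube_iff _ _).1 hp)).1
  · exact (h2 (Complex.I * p.1, p.2) ((mem_convergenceTube_iff _ _).1 hp)).2
  · have := h1 (Complex.I * p.1, p.2) fun h => hp ((mem_polarSet_iff _ _).2 h)
    exact this.comp_of_eq ((analyticAt_const.mul analyticAt_fst).prod analyticAt_snd) rfl

/-- A continuation in the variables `(ρ, z)` as a continuation in the variables `(w, z)`. -/
theorem IsIntegralContinuation.analyticOnNhd_rotate {g : ℂ → ℂ → ℝ → ℂ} {Ψ : ℂ × ℂ → ℂ}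
    (hΨ : IsIntegralContinuation (fun ρ z t => g (Complex.I * ρ) z t) Ψ) :
    AnalyticOnNhd ℂ (fun p : ℂ × ℂ => Ψ (-Complex.I * p.1, p.2)) polarSetWᶜ ∧
    ∀ p ∈ tubeW, Ψ (-Complex.I * p.1, p.2) = ∫ t in Ioi (0 : ℝ), g p.1 p.2 t := by
  have e : ∀ w : ℂ, Complex.I * (-Complex.I * w) = w := fun w => by
    linear_combination -w * Complex.I_mul_I
  constructor
  · intro p hp
    have := hΨ.analytic (-Complex.I * p.1, p.2) fun h => hp (by
      rw [mem_polarSet_iff, e] at h; exact h)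
    exact this.comp_of_eq ((analyticAt_const.mul analyticAt_fst).prod analyticAt_snd) rfl
  · intro p hp
    have := hΨ.eq_integral (-Complex.I * p.1, p.2) (by rw [mem_convergenceTube_iff, e]; exact hp)
    rw [this]
    simp only [e]

/-- A nonzero leading coefficient at one pole excludes that the continuation vanishes identically in
`ρ`. By uniqueness it suffices to have the leading coefficients of one continuation. -/
theorem not_vanishesAt {l₀ : ℕ} {g : ℂ → ℂ → ℝ → ℂ} {c : ℂ → ℕ → ℂ} (h : HasCont l₀ (Ioi 0) g c)
    {a : ℂ → ℂ} {F : ℂ × ℂ → ℂ} (hF : IsContinuation a (fun ρ z t => g (Complex.I * ρ) z t) F)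
    {z : ℂ} (ha : a z ≠ 0) {k : ℕ} (hk : |z.re| + 1 < k) (hc : c z k ≠ 0) : ¬ VanishesAt F z := by
  obtain ⟨Φ, h1, h2, h3⟩ := h
  obtain ⟨Ψ, hΨ, hF⟩ := hF
  intro hv
  have e : ∀ w : ℂ, Complex.I * (-Complex.I * w) = w := fun w => by
    linear_combination -w * Complex.I_mul_I
  obtain ⟨a1, a2⟩ := hΨ.analyticOnNhd_rotate
  have heq := eqOn_of_eqOn_tubeW convex_univ isOpen_univ (subset_univ _)
    (h1.mono fun p hp => hp.2) (a1.mono fun p hp => hp.2)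
    fun p hp => (h2 p hp).2.trans (a2 p hp).symm
  refine hc (tendsto_nhds_unique (h3 z k hk) (tendsto_const_nhds.congr' ?_))
  filter_upwards [eventually_notMem_polarSetW hk] with w hw
  have h4 := heq (x := (w, z)) ⟨trivial, hw⟩
  have h5 := hv (-Complex.I * w) (by rw [mem_polarSet_iff, e]; exact hw)
  rw [hF] at h5
  rw [h4]
  beta_reduce
  rw [(mul_eq_zero.1 h5).resolve_left ha, mul_zero]

/-- If the integral vanishes on the tube, then its continuation vanishes for every `z`, also for
those without convergent integrals. -/
theorem vanishesAt_of_integral_eq_zero {g : ℂ → ℂ → ℝ → ℂ}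
    (h : ∀ p ∈ tubeW, ∫ t in Ioi (0 : ℝ), g p.1 p.2 t = 0) {a : ℂ → ℂ} {F : ℂ × ℂ → ℂ}
    (hF : IsContinuation a (fun ρ z t => g (Complex.I * ρ) z t) F) (z : ℂ) : VanishesAt F z := by
  obtain ⟨Ψ, hΨ, hF⟩ := hF
  intro ρ hρ
  obtain ⟨a1, a2⟩ := hΨ.analyticOnNhd_rotate
  have heq := eqOn_of_eqOn_tubeW convex_univ isOpen_univ (subset_univ _)
    (a1.mono fun p hp => hp.2) (analyticOnNhd_const (v := (0 : ℂ)))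
    fun p hp => (a2 p hp).trans (h p hp)
  have h4 := heq (x := (Complex.I * ρ, z)) ⟨trivial, fun h' => hρ ((mem_polarSet_iff _ _).2 h')⟩
  have e : -Complex.I * (Complex.I * ρ) = ρ := by linear_combination -ρ * Complex.I_mul_I
  simp only [e] at h4
  rw [hF, h4, mul_zero]

/-! ### The integrands of the projection functions -/

/-- The constant that relates `matU` to `rInt`. -/
noncomputable def constU (l₀ n : ℤ) (l l' : ℕ) : ℝ :=
  (-1) ^ (l + l') * √((2 * l' + 1) * (2 * l + 1)) * jacN l l₀ n * jacN l' l₀ n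

/-- The constant in front of the terms of the sum over `n`. -/
noncomputable def constN (l₀ n : ℤ) (l l' : ℕ) : ℝ :=
  Real.pi ^ 2 * (constA l n l' * constU l₀ n l l')

/-- The constant in front of the term that comes from the components `B`. -/
noncomputable def constBB (l₀ : ℤ) (l l' : ℕ) : ℝ :=
  Real.pi ^ 2 * (2 / 3 * (-1) ^ l * (constB l * constB l') * constU l₀ 0 l l')

/-- The integrand of the projection functions without the factor `e^{-z t coth t}`, as a function of
`w = iρ`. -/
noncomputable def projCore (l₀ : ℤ) (l l' : ℕ) (w z : ℂ) (t : ℝ) : ℂ :=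
  (∑ n ∈ Finset.Icc (-(min l l' : ℤ)) (min l l' : ℤ),
      ((constN l₀ n l l' : ℂ) * (rInt (-1) 0 n l l' t * ((Real.sinh t ^ 2 : ℝ) : ℂ))) *
        rInt w l₀ n l l' t) +
    z * (((constBB l₀ l l' : ℂ) * ((rInt (-1) 0 0 0 l t * rInt (-1) 0 0 0 l' t) *
      ((Real.sinh t ^ 2 : ℝ) : ℂ))) * rInt w l₀ 0 l l' t)

theorem matU_eq_constU {l₀ l l' : ℕ} {n : ℤ} (hl : l₀ ≤ l) (hl' : l₀ ≤ l') (hn : n ≤ l)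
    (hn' : n ≤ l') (ρ : ℂ) (t : ℝ) :
    matU l₀ ρ l n l' n t = constU l₀ n l l' * rInt (Complex.I * ρ) l₀ n l l' t := by
  rw [matU_eq (by omega) (by omega) hn hn', constU]
  push_cast
  ring

theorem vecB_eq {q : ℝ} (hq : q ≠ 0) (l : ℕ) (t : ℝ) :
    1 / (q : ℂ) * vecB q l 0 t =
      Complex.I * ((√(8 / 3) : ℝ) : ℂ) * ((∫ s in (0 : ℝ)..t, matA 1 0 l 0 s : ℝ) : ℂ) := by
  have : (q : ℂ) ≠ 0 := by exact_mod_cast hq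
  rw [vecB]
  field_simp

theorem conj_vecB_mul {q : ℝ} (hq : q ≠ 0) (l l' : ℕ) (t : ℝ) :
    conj (1 / (q : ℂ) * vecB q l' 0 t) * (1 / (q : ℂ) * vecB q l 0 t) =
      8 / 3 * (((∫ s in (0 : ℝ)..t, matA 1 0 l' 0 s : ℝ) : ℂ) *
        ((∫ s in (0 : ℝ)..t, matA 1 0 l 0 s : ℝ) : ℂ)) := by
  have h : ((√(8 / 3) : ℝ) : ℂ) * ((√(8 / 3) : ℝ) : ℂ) = 8 / 3 := by
    rw [← Complex.ofReal_mul, Real.mul_self_sqrt (by norm_num)]; norm_num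
  rw [vecB_eq hq, vecB_eq hq, map_mul, map_mul, Complex.conj_I, Complex.conj_ofReal,
    Complex.conj_ofReal]
  set X := ((∫ s in (0 : ℝ)..t, matA 1 0 l' 0 s : ℝ) : ℂ)
  set Y := ((∫ s in (0 : ℝ)..t, matA 1 0 l 0 s : ℝ) : ℂ)
  linear_combination X * Y * h - X * Y * ((√(8 / 3) : ℝ) : ℂ) * ((√(8 / 3) : ℝ) : ℂ) * Complex.I_mul_I

theorem radialWeight_eq (z : ℂ) (t : ℝ) :
    radialWeight z t = phase z t * ((Real.sinh t ^ 2 : ℝ) : ℂ) := rfl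

theorem projIntegrand_eq {q : ℝ} (hq : q ≠ 0) {l₀ : ℕ} {α α' : ℕ × ℤ} (hα : 1 ≤ α.1)
    (hα' : 1 ≤ α'.1) (hl : l₀ ≤ α.1) (hl' : l₀ ≤ α'.1) :
    projIntegrand q l₀ α α' =
      fun ρ z t => projCore l₀ α.1 α'.1 (Complex.I * ρ) z t * phase z t := by
  funext ρ z t
  have hb := conj_vecB_mul hq α.1 α'.1 t
  rw [integral_matA hα, integral_matA hα'] at hb
  rw [projIntegrand, mul_assoc (z / 4 * (-1) ^ α.1), hb, radialWeight_eq, projCore,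
    matU_eq_constU hl hl' (by omega) (by omega), add_mul, add_mul, Finset.sum_mul, Finset.sum_mul]
  congr 1
  · refine Finset.sum_congr rfl fun n hn => ?_
    rw [Finset.mem_Icc] at hn
    have h1 : |n| ≤ α.1 := abs_le.2 (by omega)
    have h2 : |n| ≤ α'.1 := abs_le.2 (by omega)
    rw [Complex.conj_ofReal, matA_eq h1 h2, matU_eq_constU hl hl' (by omega) (by omega), constN]
    push_cast
    ring
  · rw [constBB]
    push_cast
    ring

/-- The diagonal Fourier weight is the projection function with `α = α'`. -/
theorem fourierIntegrand_eq (q : ℝ) (l₀ : ℕ) (α : ℕ × ℤ) :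
    fourierIntegrand q l₀ α = projIntegrand q l₀ α α := by
  funext ρ z t
  rw [fourierIntegrand, projIntegrand, min_self]
  congr 2
  rw [mul_assoc (z / 4 * (-1) ^ α.1) (conj _), Complex.conj_mul']
  push_cast
  rfl

/-- The symbol of the coefficient of `rInt w l₀ n l l'` in `projCore`. -/
noncomputable def symN (l₀ n : ℤ) (l l' : ℕ) : ℂ[X] :=
  Polynomial.C (constN l₀ n l l' : ℂ) * ((Polynomial.C (symAlpha n l l') +
    Polynomial.C (symBeta n l l') * Polynomial.X) * Polynomial.C (1 / 4))

/-- The symbol of the coefficient of `z` in `projCore`. -/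
noncomputable def symBB (l₀ : ℤ) (l l' : ℕ) : ℂ[X] :=
  Polynomial.C (constBB l₀ l l' : ℂ) * (((Polynomial.C (symAlpha 0 0 l) +
    Polynomial.C (symBeta 0 0 l) * Polynomial.X) * (Polynomial.C (symAlpha 0 0 l') +
    Polynomial.C (symBeta 0 0 l') * Polynomial.X)) * Polynomial.C (1 / 4))

/-- The leading coefficient of the continued projection function at `poleW l₀ z k`. The sum extends over
the indices `-l₀ ≤ n ≤ 0` whose terms reach the order `k + 1` of the pole. -/
noncomputable def projCoeff (l₀ l l' : ℕ) (z : ℂ) (k : ℕ) : ℂ :=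
  (∑ n ∈ Finset.Icc (-(l₀ : ℤ)) 0, symbolCoeff (symN l₀ n l l') z k *
      (jacC l l₀ n 0 * leadSum l₀ n l' (poleW l₀ z k))) +
    z * (symbolCoeff (symBB l₀ l l') z k * (jacC l l₀ 0 0 * leadSum l₀ 0 l' (poleW l₀ z k)))

theorem hasCont_projCore {l₀ l l' : ℕ} (hl : l₀ ≤ l) (hl' : l₀ ≤ l') :
    HasCont l₀ (Ioi 0) (fun w z t => projCore l₀ l l' w z t * phase z t) (projCoeff l₀ l l') := by
  refine HasCont.union (hasCont_unitInterval l₀ ?_ ?_) ?_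
  · have h1 : ∀ (w : ℂ) (m n : ℤ) (l l' : ℕ),
        Continuous fun q : (ℂ × ℂ) × ℝ => rInt w m n l l' q.2 := fun w m n l l' =>
      (continuous_rInt_right w m n l l').comp continuous_snd
    have h2 : ∀ (m n : ℤ) (l l' : ℕ),
        Continuous fun q : (ℂ × ℂ) × ℝ => rInt q.1.1 m n l l' q.2 := fun m n l l' => by
      have := (continuous_rInt m n l l').comp (by fun_prop : Continuous
        fun q : (ℂ × ℂ) × ℝ => (q.1.1, q.2))
      simpa only [Function.comp_def] using this
    have h3 : Continuous fun q : (ℂ × ℂ) × ℝ => ((Real.sinh q.2 ^ 2 : ℝ) : ℂ) := by fun_prop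
    unfold projCore
    refine Continuous.add (continuous_finsetSum _ fun n _ => ?_) (Continuous.mul (by fun_prop) ?_)
    · exact (continuous_const.mul ((h1 _ _ _ _ _).mul h3)).mul (h2 _ _ _ _)
    · exact (continuous_const.mul (((h1 _ _ _ _ _).mul (h1 _ _ _ _ _)).mul h3)).mul (h2 _ _ _ _)
  · intro t ht
    unfold projCore
    have h : ∀ n ∈ Finset.Icc (-(min l l' : ℤ)) (min l l' : ℤ),
        Differentiable ℂ fun p : ℂ × ℂ => rInt p.1 l₀ n l l' t := by
      intro n hn
      rw [Finset.mem_Icc] at hn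
      exact (differentiable_rInt (by omega) (by omega) (by omega) (by omega) ht.1).comp
        differentiable_fst
    refine Differentiable.add (Differentiable.fun_sum fun n hn => ?_)
      (differentiable_snd.mul ?_)
    · exact (differentiable_const _).mul (h n hn)
    · exact (differentiable_const _).mul (h 0 (by rw [Finset.mem_Icc]; omega))
  · have t1 := HasCont.sum (s := Finset.Icc (-(min l l' : ℤ)) (min l l' : ℤ)) (l₀ := l₀)
      (S := Ioi 1) (g := fun n w z t => ((constN l₀ n l l' : ℂ) * (rInt (-1) 0 n l l' t *
        ((Real.sinh t ^ 2 : ℝ) : ℂ))) * rInt w l₀ n l l' t * phase z t) fun n hn => by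
      rw [Finset.mem_Icc] at hn
      have h1 : |n| ≤ l := abs_le.2 (by omega)
      have h2 : |n| ≤ l' := abs_le.2 (by omega)
      exact hasCont_mul_rInt hl hl' h1 h2
        (((hasExpansion_rInt h1 h2).mul hasExpansion_sinh_sq).const_mul (constN l₀ n l l' : ℂ))
    have e1 := hasExpansion_rInt (n := 0) (l := 0) (l' := l) (by simp) (by simp)
    have e2 := hasExpansion_rInt (n := 0) (l := 0) (l' := l') (by simp) (by simp)
    have t2 := (hasCont_mul_rInt hl hl' (n := 0) (by simp) (by simp)
      (((e1.mul e2).mul hasExpansion_sinh_sq).const_mul (constBB l₀ l l' : ℂ))).const_mul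
        (a := fun z => z) analyticOnNhd_id
    refine ((t1.add t2).congr measurableSet_Ioi fun w z t _ => ?_).congr_coeff fun z k => ?_
    · rw [projCore, add_mul, Finset.sum_mul]
      congr 1
      ring
    · rw [projCoeff, if_pos (by omega), ← Finset.sum_filter]
      congr 1
      refine Finset.sum_congr ?_ fun n _ => rfl
      ext n
      simp only [Finset.mem_Icc, Finset.mem_filter]
      omega

/-- The constant in front of the integrand of the cyclic projection function. -/
noncomputable def constC (q : ℝ) (l : ℕ) : ℂ :=
  -Complex.I * q * ((√(8 / 3) : ℝ) : ℂ) * constB l * constU 0 0 0 l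

theorem cyclicIntegrand_eq (q : ℝ) {l : ℕ} (hl : 1 ≤ l) :
    cyclicIntegrand q l = fun ρ z t => ((constC q l * (rInt (-1) 0 0 0 l t *
      ((Real.sinh t ^ 2 : ℝ) : ℂ))) * rInt (Complex.I * ρ) 0 0 0 l t) * phase z t := by
  funext ρ z t
  have h := matU_eq_constU (l₀ := 0) (l := 0) (l' := l) (n := 0) le_rfl (by omega) (by omega)
    (by omega) ρ t
  rw [Nat.cast_zero] at h
  rw [cyclicIntegrand, vecB, h, integral_matA hl, radialWeight_eq, map_mul, map_mul, map_mul,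
    Complex.conj_I, Complex.conj_ofReal, Complex.conj_ofReal, ← integral_matA hl,
    Complex.conj_ofReal, integral_matA hl, constC]
  ring

theorem hasCont_mul_rInt_zero (a : ℂ) {l₀ l l' : ℕ} (hl : l₀ ≤ l) (hl' : l₀ ≤ l') :
    HasCont l₀ (Ioi 0) (fun w z t => ((a * (rInt (-1) 0 0 0 l' t *
      ((Real.sinh t ^ 2 : ℝ) : ℂ))) * rInt w l₀ 0 l l' t) * phase z t) (fun z k =>
      symbolCoeff (Polynomial.C a * ((Polynomial.C (symAlpha 0 0 l') +
        Polynomial.C (symBeta 0 0 l') * Polynomial.X) * Polynomial.C (1 / 4))) z k *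
      (jacC l l₀ 0 0 * leadSum l₀ 0 l' (poleW l₀ z k))) := by
  refine HasCont.union (hasCont_unitInterval l₀ ?_ ?_) ?_
  · have h1 : Continuous fun q : (ℂ × ℂ) × ℝ => rInt (-1) 0 0 0 l' q.2 :=
      (continuous_rInt_right _ _ _ _ _).comp continuous_snd
    have h2 : Continuous fun q : (ℂ × ℂ) × ℝ => rInt q.1.1 l₀ 0 l l' q.2 := by
      have := (continuous_rInt l₀ 0 l l').comp (by fun_prop : Continuous
        fun q : (ℂ × ℂ) × ℝ => (q.1.1, q.2))
      simpa only [Function.comp_def] using this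
    exact (continuous_const.mul (h1.mul (by fun_prop))).mul h2
  · intro t ht
    exact (differentiable_const _).mul ((differentiable_rInt (by omega) (by omega) (by simp)
      (by simp) ht.1).comp differentiable_fst)
  · have e := hasExpansion_rInt (n := 0) (l := 0) (l' := l') (by simp) (by simp)
    have t2 := hasCont_mul_rInt hl hl' (n := 0) (by simp) (by simp)
      ((e.mul hasExpansion_sinh_sq).const_mul a)
    exact (t2.congr measurableSet_Ioi fun w z t _ => rfl).congr_coeff fun z k => by
      rw [if_pos (by simp)]

/-! ### Leading coefficients of the projection functions -/

theorem symbolCoeff_eq_sum {s : ℂ[X]} {M : ℕ} (hs : s.natDegree ≤ M) (z : ℂ) (k : ℕ) :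
    symbolCoeff s z k = ∑ a ∈ Finset.range (M + 1),
      s.coeff a * (if a ≤ k then (-2 * z) ^ (k - a) / (k - a)! * k ! else 0) := by
  refine Finset.sum_subset (fun a ha => ?_) fun a _ ha => ?_
  · rw [Finset.mem_range] at ha ⊢; omega
  · rw [Finset.mem_range] at ha
    rw [Polynomial.coeff_eq_zero_of_natDegree_lt (by omega), zero_mul]

theorem symbolCoeff_quadratic (c c₀ c₁ c₂ : ℂ) {z : ℂ} (hz : z ≠ 0) {k : ℕ} (hk : 2 ≤ k) :
    symbolCoeff (Polynomial.C c * ((Polynomial.C c₀ + Polynomial.C c₁ * Polynomial.X +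
      Polynomial.C c₂ * Polynomial.X ^ 2) * Polynomial.C (1 / 4))) z k =
      (-2 * z) ^ k * (c / 4) * (c₀ + c₁ * (k / (-2 * z)) + c₂ * (k * (k - 1) / (4 * z ^ 2))) := by
  have e : Polynomial.C c * ((Polynomial.C c₀ + Polynomial.C c₁ * Polynomial.X +
      Polynomial.C c₂ * Polynomial.X ^ 2) * Polynomial.C (1 / 4)) =
      Polynomial.C (c * c₂ / 4) * Polynomial.X ^ 2 + Polynomial.C (c * c₁ / 4) * Polynomial.X +
        Polynomial.C (c * c₀ / 4) := by
    simp only [div_eq_mul_inv, map_mul, one_mul]; ring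
  obtain ⟨r, rfl⟩ := Nat.exists_eq_add_of_le hk
  have h1 : 2 + r - 1 = r + 1 := by omega
  have h2 : 2 + r - 2 = r := by omega
  have f1 : ((2 + r)! : ℂ) = (r + 2) * (r + 1) * r ! := by
    rw [show 2 + r = r + 1 + 1 by omega, Nat.factorial_succ, Nat.factorial_succ]; push_cast; ring
  have f2 : ((r + 1)! : ℂ) = (r + 1) * r ! := by rw [Nat.factorial_succ]; push_cast; ring
  have hr : (r ! : ℂ) ≠ 0 := by exact_mod_cast r.factorial_ne_zero
  have hr1 : (r : ℂ) + 1 ≠ 0 := by exact_mod_cast r.succ_ne_zero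
  have hr2 : (r : ℂ) + 2 ≠ 0 := by exact_mod_cast (r + 1).succ_ne_zero
  rw [e, symbolCoeff_eq_sum Polynomial.natDegree_quadratic_le]
  simp only [Finset.sum_range_succ, Finset.sum_range_zero, zero_add]
  rw [if_pos (by omega), if_pos (by omega), if_pos (by omega), h1, h2, Nat.sub_zero, f1, f2]
  simp only [Polynomial.coeff_add, Polynomial.coeff_C_mul, Polynomial.coeff_X_pow,
    Polynomial.coeff_X, Polynomial.coeff_C]
  have h3 : (-2 * z) ^ (2 + r) = (-2 * z) ^ r * (4 * z ^ 2) := by rw [pow_add]; ring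
  have h4 : (-2 * z) ^ (r + 1) = (-2 * z) ^ r * (-2 * z) := pow_succ _ _
  rw [h3, h4]
  have h5 : (-2 * z) ^ r ≠ 0 := pow_ne_zero _ (mul_ne_zero (by norm_num) hz)
  generalize (-2 * z) ^ r = y at h5
  push_cast
  simp
  field_simp
  ring

theorem symbolCoeff_linear (c c₀ c₁ : ℂ) {z : ℂ} (hz : z ≠ 0) {k : ℕ} (hk : 2 ≤ k) :
    symbolCoeff (Polynomial.C c * ((Polynomial.C c₀ + Polynomial.C c₁ * Polynomial.X) *
      Polynomial.C (1 / 4))) z k =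
      (-2 * z) ^ k * (c / 4) * (c₀ + c₁ * (k / (-2 * z))) := by
  have := symbolCoeff_quadratic c c₀ c₁ 0 hz hk
  simpa using this

/-- The common constant in the coefficients of the integrand; the square roots in the normalization of
`A`, `B` and `U` combine to this one, the same for all `n`. -/
noncomputable def constK (l₀ l l' : ℕ) : ℝ :=
  Real.pi ^ 2 * ((2 * l + 1) * (2 * l' + 1) *
    √(((l - l₀)! * (l + l₀)! * (l' - l₀)! * (l' + l₀)! : ℕ) / (l * (l + 1) * (l' * (l' + 1)))))

theorem constK_ne_zero {l₀ l l' : ℕ} (hl : 1 ≤ l) (hl' : 1 ≤ l') : constK l₀ l l' ≠ 0 := by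
  have h1 : (0 : ℝ) < l := by exact_mod_cast hl
  have h2 : (0 : ℝ) < l' := by exact_mod_cast hl'
  have h3 : 0 < (l - l₀)! * (l + l₀)! * (l' - l₀)! * (l' + l₀)! := by positivity
  have h4 : (0 : ℝ) < ((l - l₀)! * (l + l₀)! * (l' - l₀)! * (l' + l₀)! : ℕ) := by exact_mod_cast h3
  rw [constK]
  positivity

theorem neg_one_pow_mul_self (l : ℕ) : (-1 : ℝ) ^ l * (-1) ^ l = 1 := by
  rw [← mul_pow]; simp

theorem constN_eq {l₀ l l' : ℕ} {n : ℤ} (hl : 1 ≤ l) (hl' : 1 ≤ l') (h0 : l₀ ≤ l) (h0' : l₀ ≤ l') :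
    constN l₀ n l l' = constK l₀ l l' * (l * (l + 1) * (l ! * l' !) /
      ((((l : ℤ) - n).toNat ! * ((l : ℤ) + n).toNat !) *
        (((l' : ℤ) - n).toNat ! * ((l' : ℤ) + n).toNat !))) := by
  have h1 : (0 : ℝ) < l := by exact_mod_cast hl
  have h2 : (0 : ℝ) < l' := by exact_mod_cast hl'
  have t1 : ((l : ℤ) - (l₀ : ℤ)).toNat = l - l₀ := by omega
  have t2 : ((l : ℤ) + (l₀ : ℤ)).toNat = l + l₀ := by omega
  have t1' : ((l' : ℤ) - (l₀ : ℤ)).toNat = l' - l₀ := by omega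
  have t2' : ((l' : ℤ) + (l₀ : ℤ)).toNat = l' + l₀ := by omega
  rw [constN, constA, constU, constK, jacN, jacN, t1, t2, t1', t2', pow_add]
  have p : ∀ m : ℕ, (0 : ℝ) < (m ! : ℝ) := fun m => by exact_mod_cast m.factorial_pos
  push_cast
  have g1 := p ((l : ℤ) - n).toNat
  have g2 := p ((l : ℤ) + n).toNat
  have g3 := p ((l' : ℤ) - n).toNat
  have g4 := p ((l' : ℤ) + n).toNat
  have g5 := p (l - l₀)
  have g6 := p (l + l₀)
  have g7 := p (l' - l₀)
  have g8 := p (l' + l₀)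
  have g9 := p l
  have g10 := p l'
  generalize (((l : ℤ) - n).toNat ! : ℝ) = f1 at *
  generalize (((l : ℤ) + n).toNat ! : ℝ) = f2 at *
  generalize (((l' : ℤ) - n).toNat ! : ℝ) = f3 at *
  generalize (((l' : ℤ) + n).toNat ! : ℝ) = f4 at *
  generalize ((l - l₀)! : ℝ) = f5 at *
  generalize ((l + l₀)! : ℝ) = f6 at *
  generalize ((l' - l₀)! : ℝ) = f7 at *
  generalize ((l' + l₀)! : ℝ) = f8 at *
  have hs : √((l * (l + 1) * (2 * l + 1) * f1 * (2 * l' + 1) * f3) /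
      (l' * (l' + 1) * 2 * f2 * 2 * f4)) * √((2 * l' + 1) * (2 * l + 1)) * √((f5 * f6) / (f1 * f2)) *
      √((f7 * f8) / (f3 * f4)) = √((f5 * f6 * f7 * f8) / (l * (l + 1) * (l' * (l' + 1)))) *
        ((2 * l + 1) * (2 * l' + 1) * (l * (l + 1)) / (2 * f2 * f4)) := by
    rw [← Real.sqrt_mul (by positivity), ← Real.sqrt_mul (by positivity),
      ← Real.sqrt_mul (by positivity)]
    rw [← Real.sqrt_sq (show 0 ≤ (2 * l + 1) * (2 * l' + 1) * (l * (l + 1)) / (2 * f2 * f4) by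
      positivity), ← Real.sqrt_mul (by positivity)]
    congr 1
    field_simp
  have e1 := neg_one_pow_mul_self l
  have e2 := neg_one_pow_mul_self l'
  generalize √((l * (l + 1) * (2 * l + 1) * f1 * (2 * l' + 1) * f3) /
      (l' * (l' + 1) * 2 * f2 * 2 * f4)) = s1 at *
  generalize √((2 * (l' : ℝ) + 1) * (2 * l + 1)) = s2 at *
  generalize √((f5 * f6) / (f1 * f2)) = s3 at *
  generalize √((f7 * f8) / (f3 * f4)) = s4 at *
  generalize √((f5 * f6 * f7 * f8) / (l * (l + 1) * (l' * (l' + 1)))) = s5 at *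
  generalize (-1 : ℝ) ^ l = x at *
  generalize (-1 : ℝ) ^ l' = x' at *
  have e3 : Real.pi ^ 2 * (s1 * (x * x' * (l ! / f1) * (l' ! / f3) * 2) * (x * x' * s2 * s3 * s4)) =
      Real.pi ^ 2 * ((x * x) * (x' * x') * ((l ! / f1) * (l' ! / f3) * 2) * (s1 * s2 * s3 * s4)) := by
    ring
  rw [e3, e1, e2, hs]
  field_simp

theorem constB_eq {l : ℕ} (hl : 1 ≤ l) :
    constB l = (-1) ^ l * √(3 * (2 * l + 1) / (2 * (l * (l + 1)))) := by
  have h1 : (0 : ℝ) < l := by exact_mod_cast hl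
  have p : (0 : ℝ) < (l ! : ℝ) := by exact_mod_cast l.factorial_pos
  have t1 : ((1 : ℕ) - 0 : ℤ).toNat = 1 := rfl
  have t2 : ((1 : ℕ) + 0 : ℤ).toNat = 1 := rfl
  have t3 : ((l : ℤ) - 0).toNat = l := by omega
  have t4 : ((l : ℤ) + 0).toNat = l := by omega
  rw [constB, constA, t1, t2, t3, t4, div_self p.ne', pow_add]
  have : ((1 : ℕ) : ℝ) * ((1 : ℕ) + 1) * (2 * (1 : ℕ) + 1) * (1 ! : ℝ) * (2 * l + 1) * (l ! : ℝ) /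
      (l * (l + 1) * 2 * (1 ! : ℝ) * 2 * (l ! : ℝ)) = 3 * (2 * l + 1) / (2 * (l * (l + 1))) := by
    simp
    field_simp
    ring
  rw [this]
  simp
  ring

theorem constBB_eq {l₀ l l' : ℕ} (hl : 1 ≤ l) (hl' : 1 ≤ l') (h0 : l₀ ≤ l) (h0' : l₀ ≤ l') :
    constBB l₀ l l' = constK l₀ l l' * ((-1) ^ l / (l ! * l' !)) := by
  have h1 : (0 : ℝ) < l := by exact_mod_cast hl
  have h2 : (0 : ℝ) < l' := by exact_mod_cast hl'
  have t1 : ((l : ℤ) - (l₀ : ℤ)).toNat = l - l₀ := by omega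
  have t2 : ((l : ℤ) + (l₀ : ℤ)).toNat = l + l₀ := by omega
  have t1' : ((l' : ℤ) - (l₀ : ℤ)).toNat = l' - l₀ := by omega
  have t2' : ((l' : ℤ) + (l₀ : ℤ)).toNat = l' + l₀ := by omega
  have t3 : ((l : ℤ) - 0).toNat = l := by omega
  have t4 : ((l : ℤ) + 0).toNat = l := by omega
  have t3' : ((l' : ℤ) - 0).toNat = l' := by omega
  have t4' : ((l' : ℤ) + 0).toNat = l' := by omega
  rw [constBB, constB_eq hl, constB_eq hl', constU, constK, jacN, jacN, t1, t2, t1', t2', t3, t4,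
    t3', t4', pow_add]
  have p : ∀ m : ℕ, (0 : ℝ) < (m ! : ℝ) := fun m => by exact_mod_cast m.factorial_pos
  push_cast
  have g5 := p (l - l₀)
  have g6 := p (l + l₀)
  have g7 := p (l' - l₀)
  have g8 := p (l' + l₀)
  have g9 := p l
  have g10 := p l'
  generalize ((l - l₀)! : ℝ) = f5 at *
  generalize ((l + l₀)! : ℝ) = f6 at *
  generalize ((l' - l₀)! : ℝ) = f7 at *
  generalize ((l' + l₀)! : ℝ) = f8 at *
  generalize (l ! : ℝ) = f1 at *
  generalize (l' ! : ℝ) = f2 at *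
  have hs : √(3 * (2 * l + 1) / (2 * (l * (l + 1)))) * √(3 * (2 * l' + 1) / (2 * (l' * (l' + 1)))) *
      √((2 * l' + 1) * (2 * l + 1)) * √((f5 * f6) / (f1 * f1)) *
      √((f7 * f8) / (f2 * f2)) = √((f5 * f6 * f7 * f8) / (l * (l + 1) * (l' * (l' + 1)))) *
        (3 / 2 * (2 * l + 1) * (2 * l' + 1) / (f1 * f2)) := by
    rw [← Real.sqrt_mul (by positivity), ← Real.sqrt_mul (by positivity),
      ← Real.sqrt_mul (by positivity), ← Real.sqrt_mul (by positivity)]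
    rw [← Real.sqrt_sq (show 0 ≤ 3 / 2 * (2 * (l : ℝ) + 1) * (2 * l' + 1) / (f1 * f2) by
      positivity), ← Real.sqrt_mul (by positivity)]
    congr 1
    field_simp
  have e1 := neg_one_pow_mul_self l
  have e2 := neg_one_pow_mul_self l'
  generalize √(3 * (2 * l + 1) / (2 * (l * ((l : ℝ) + 1)))) = s1 at *
  generalize √(3 * (2 * l' + 1) / (2 * (l' * ((l' : ℝ) + 1)))) = s0 at *
  generalize √((2 * (l' : ℝ) + 1) * (2 * l + 1)) = s2 at *
  generalize √((f5 * f6) / (f1 * f1)) = s3 at *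
  generalize √((f7 * f8) / (f2 * f2)) = s4 at *
  generalize √((f5 * f6 * f7 * f8) / (l * (l + 1) * (l' * (l' + 1)))) = s5 at *
  generalize (-1 : ℝ) ^ l = x at *
  generalize (-1 : ℝ) ^ l' = x' at *
  have e3 : Real.pi ^ 2 * (2 / 3 * x * (x * s1 * (x' * s0)) * (x * x' * s2 * s3 * s4)) =
      Real.pi ^ 2 * (2 / 3 * x * ((x * x) * (x' * x')) * (s1 * s0 * s2 * s3 * s4)) := by
    ring
  rw [e3, e1, e2, hs]
  field_simp

/-- The factor of the leading coefficients of the matrix elements that does not depend on `n`. -/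
noncomputable def leadV (l₀ l' : ℕ) (w : ℂ) : ℂ :=
  fallFact (w - l₀ - 1) (l' - l₀) / (((l' - l₀)! : ℂ) * fallFact (w + l') (l' - l₀ + 1))

theorem leadSum_eq_leadV {l₀ l' : ℕ} {n : ℤ} (hm : l₀ ≤ l') (hn : -(l₀ : ℤ) ≤ n) (hn0 : n ≤ 0)
    {w : ℂ} (hw : ∀ i : ℕ, w + i ≠ 0) :
    leadSum l₀ n l' w =
      leadV l₀ l' w * (((l' + n).toNat ! : ℂ) / fallFact (w + l₀ - 1) (n + l₀).toNat) := by
  have e : ((l' : ℤ) + n + 1).toNat = (l' - l₀ + 1) + (n + l₀).toNat := by omega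
  rw [leadSum_eq hm hn hn0 hw, leadV, e, fallFact_add]
  have e2 : w + l' - ((l' - l₀ + 1 : ℕ) : ℂ) = w + l₀ - 1 := by
    push_cast [Nat.cast_sub hm]; ring
  rw [e2]
  rw [mul_div_assoc', div_mul_eq_mul_div, div_div, mul_div_assoc', div_mul_eq_mul_div, div_div]
  congr 1
  · ring
  · ring

theorem poleW_add_ne_zero {l₀ k : ℕ} {z : ℂ} (hk : |z.re| + 1 < k) (i : ℕ) :
    poleW l₀ z k + i ≠ 0 := by
  intro h
  have h2 := congrArg Complex.re h
  simp [poleW] at h2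
  have := neg_abs_le z.re
  have : (0 : ℝ) ≤ l₀ := l₀.cast_nonneg
  have : (0 : ℝ) ≤ i := i.cast_nonneg
  linarith [abs_nonneg z.re]

theorem leadV_ne_zero {l₀ l' k : ℕ} {z : ℂ} (hm : l₀ ≤ l') (hk : |z.re| + 1 + l' < k) :
    leadV l₀ l' (poleW l₀ z k) ≠ 0 := by
  have hl' : (0 : ℝ) ≤ l' := l'.cast_nonneg
  have hre := neg_abs_le z.re
  refine div_ne_zero (fallFact_ne_zero.2 fun i hi h => ?_) (mul_ne_zero ?_
    (fallFact_ne_zero.2 fun i hi h => ?_))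
  · have h2 := congrArg Complex.re h
    simp [poleW] at h2
    have : (i : ℝ) ≤ l' := by exact_mod_cast (by omega : i ≤ l')
    linarith [abs_nonneg z.re]
  · exact_mod_cast Nat.factorial_ne_zero _
  · refine poleW_add_ne_zero (l₀ := l₀) (k := k) (z := z) (by linarith) (l' - i) ?_
    rw [Nat.cast_sub (by omega)]
    linear_combination h

/-- The leading coefficient without the nonvanishing common factors. -/
noncomputable def reducedCoeff (l₀ l l' : ℕ) (z : ℂ) (k : ℕ) : ℂ :=
  (∑ n ∈ Finset.Icc (-(l₀ : ℤ)) 0,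
    (l * (l + 1) * (l ! * l' !) / ((((l : ℤ) - n).toNat ! * ((l : ℤ) + n).toNat !) *
        (((l' : ℤ) - n).toNat ! * ((l' : ℤ) + n).toNat !)) : ℂ) *
      (symAlpha n l l' + symBeta n l l' * (k / (-2 * z))) *
      ((((l : ℤ) + n).toNat.choose (l - l₀) : ℂ) * (((l' + n).toNat ! : ℂ) /
        fallFact (poleW l₀ z k + l₀ - 1) (n + l₀).toNat))) +
  z * ((-1) ^ l' / (l ! * l' !) * (1 + (l * (l + 1) + l' * (l' + 1)) * (k / z) +
      (l * (l + 1) * (l' * (l' + 1))) * (k * (k - 1) / z ^ 2)) *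
    ((l.choose (l - l₀) : ℂ) * (l' ! / fallFact (poleW l₀ z k + l₀ - 1) l₀)))

theorem symBB_eq {l₀ l l' : ℕ} (hl : 1 ≤ l) (hl' : 1 ≤ l') : symBB l₀ l l' =
    Polynomial.C (constBB l₀ l l' : ℂ) * ((Polynomial.C ((-1) ^ (l + l') : ℂ) +
      Polynomial.C (-2 * (-1) ^ (l + l') * (l * (l + 1) + l' * (l' + 1)) : ℂ) * Polynomial.X +
      Polynomial.C (4 * (-1) ^ (l + l') * (l * (l + 1) * (l' * (l' + 1))) : ℂ) * Polynomial.X ^ 2) *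
        Polynomial.C (1 / 4)) := by
  rw [symBB, symAlpha_zero_zero, symAlpha_zero_zero, symBeta_zero 0 hl, symBeta_zero 0 hl', pow_add]
  congr 2
  simp only [map_mul, map_add, map_pow, map_neg, map_one, map_ofNat, map_natCast]
  ring

/-- The leading coefficient, up to nonvanishing factors, is `reducedCoeff`. -/
theorem projCoeff_eq {l₀ l l' : ℕ} (hl : 1 ≤ l) (hl' : 1 ≤ l') (h0 : l₀ ≤ l) (h0' : l₀ ≤ l')
    {z : ℂ} (hz : z ≠ 0) {k : ℕ} (hk : |z.re| + 1 < k) : projCoeff l₀ l l' z k =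
      (-2 * z) ^ k * (constK l₀ l l' / 4) * leadV l₀ l' (poleW l₀ z k) *
        reducedCoeff l₀ l l' z k := by
  have hk2 : 2 ≤ k := by
    have : (1 : ℝ) < k := by linarith [abs_nonneg z.re]
    exact_mod_cast this
  have hw := poleW_add_ne_zero (l₀ := l₀) hk
  rw [projCoeff, reducedCoeff, mul_add, Finset.mul_sum]
  congr 1
  · refine Finset.sum_congr rfl fun n hn => ?_
    rw [Finset.mem_Icc] at hn
    rw [symN, symbolCoeff_linear _ _ _ hz hk2, leadSum_eq_leadV h0' hn.1 hn.2 hw,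
      constN_eq hl hl' h0 h0', jacC]
    have t : ((l : ℤ) - l₀ - (0 : ℕ)).toNat = l - l₀ := by omega
    rw [t]
    push_cast
    simp
    ring
  · rw [symBB_eq hl hl', symbolCoeff_quadratic _ _ _ _ hz hk2,
      leadSum_eq_leadV h0' (by omega) le_rfl hw, constBB_eq hl hl' h0 h0', jacC]
    have t1 : ((l : ℤ) - l₀ - (0 : ℕ)).toNat = l - l₀ := by omega
    have t2 : ((l' : ℤ) + 0).toNat = l' := by omega
    have t3 : ((0 : ℤ) + l₀).toNat = l₀ := by omega
    have t4 : ((l : ℤ) + 0).toNat = l := by omega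
    have e1 : (-1 : ℂ) ^ l * (-1) ^ l = 1 := by rw [← mul_pow]; simp
    rw [t1, t2, t3, t4, pow_add]
    push_cast
    simp only [Nat.choose_zero_right, pow_zero, Nat.cast_one, mul_one, one_mul]
    have e2 : ∀ x y a b c d : ℂ, x * x = 1 → a * (b * (x / c) / 4) * (x * y +
        -2 * (x * y) * (l * (l + 1) + l' * (l' + 1)) * (k / (-2 * z)) +
        4 * (x * y) * (l * (l + 1) * (l' * (l' + 1))) * (k * (k - 1) / (4 * z ^ 2))) * d =
        a * (b / 4) * (y / c * (1 + (l * (l + 1) + l' * (l' + 1)) * (k / z) +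
      (l * (l + 1) * (l' * (l' + 1))) * (k * (k - 1) / z ^ 2))) * d := by
      intro x y a b c d hx
      have : a * (b * (x / c) / 4) * (x * y +
        -2 * (x * y) * (l * (l + 1) + l' * (l' + 1)) * (k / (-2 * z)) +
        4 * (x * y) * (l * (l + 1) * (l' * (l' + 1))) * (k * (k - 1) / (4 * z ^ 2))) * d =
        a * (b / 4) * ((x * x) * y / c * (1 + (l * (l + 1) + l' * (l' + 1)) * (k / z) +
      (l * (l + 1) * (l' * (l' + 1))) * (k * (k - 1) / z ^ 2))) * d := by
        field_simp
      rw [this, hx, one_mul]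
    rw [e2 _ _ _ _ _ _ e1]
    ring

/-! ### Nonvanishing leading coefficients -/

/-- For `l₀ = 0` the only summand is `n = 0`; together with the term from the components `B` it gives a
product of linear factors. -/
theorem reducedCoeff_zero {l l' : ℕ} (hl : 1 ≤ l) (hl' : 1 ≤ l') {z : ℂ} (hz : z ≠ 0) (k : ℕ) :
    reducedCoeff 0 l l' z k =
      (-1) ^ l' / l ! * ((z + l * (l + 1) * k) * (z + l' * (l' + 1) * k) / z) := by
  have f1 : (l ! : ℂ) ≠ 0 := by exact_mod_cast l.factorial_ne_zero
  have f2 : (l' ! : ℂ) ≠ 0 := by exact_mod_cast l'.factorial_ne_zero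
  simp only [reducedCoeff, Nat.cast_zero, neg_zero, Finset.Icc_self, Finset.sum_singleton, sub_zero,
    add_zero, Int.toNat_natCast, Int.toNat_zero, Nat.sub_zero, Nat.choose_self, Nat.cast_one]
  rw [symAlpha_zero hl, symBeta_zero l hl']
  have e : ∀ x, fallFact x 0 = 1 := fun x => by simp [fallFact]
  rw [e]
  field_simp
  ring

/-- For `l₀ = 1` the summands `n = -1`, `n = 0` and the term from the components `B` combine to a
product that vanishes for `l = 1` and for `l' = 1`. -/
theorem reducedCoeff_one {l l' : ℕ} (hl : 1 ≤ l) (hl' : 1 ≤ l') {z : ℂ} (hz : z ≠ 0) {k : ℕ}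
    (hk : z + 2 * k ≠ 0) :
    reducedCoeff 1 l l' z k = (-1) ^ l' / (l - 1)! *
      (-(k / 2) * (l * (l + 1) - 2) * (l' * (l' + 1) - 2) / (z + 2 * k)) := by
  have hs : Finset.Icc (-((1 : ℕ) : ℤ)) 0 = {-1, 0} := by decide
  have hx : poleW 1 z k + (1 : ℕ) - 1 = z + 2 * k := by rw [poleW]; push_cast; ring
  rw [reducedCoeff, hs, Finset.sum_pair (by decide), hx, symAlpha_zero hl, symBeta_zero l hl',
    symAlpha_neg_one hl hl', symBeta_neg_one hl hl']
  have e : ∀ x, fallFact x 0 = 1 := fun x => by simp [fallFact]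
  have e' : ∀ x, fallFact x 1 = x := fun x => by simp [fallFact]
  obtain ⟨r, rfl⟩ : ∃ r, l = r + 1 := ⟨l - 1, by omega⟩
  obtain ⟨r', rfl⟩ : ∃ r', l' = r' + 1 := ⟨l' - 1, by omega⟩
  have t1 : ∀ r : ℕ, (((r + 1 : ℕ) : ℤ) - -1).toNat = r + 2 := fun r => by omega
  have t2 : ∀ r : ℕ, (((r + 1 : ℕ) : ℤ) + -1).toNat = r := fun r => by omega
  have t3 : ∀ r : ℕ, (((r + 1 : ℕ) : ℤ) - 0).toNat = r + 1 := fun r => by omega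
  have t4 : ∀ r : ℕ, (((r + 1 : ℕ) : ℤ) + 0).toNat = r + 1 := fun r => by omega
  have t5 : ((-1 : ℤ) + (1 : ℕ)).toNat = 0 := rfl
  have t6 : ((0 : ℤ) + (1 : ℕ)).toNat = 1 := rfl
  have t7 : (r + 1).choose r = r + 1 := by simp
  rw [t1, t1, t2, t2, t3, t3, t4, t4, t5, t6, e, e', Nat.add_sub_cancel, Nat.choose_self, t7]
  have f1 : (r ! : ℂ) ≠ 0 := by exact_mod_cast r.factorial_ne_zero
  have f2 : (r' ! : ℂ) ≠ 0 := by exact_mod_cast r'.factorial_ne_zero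
  have f3 : (r : ℂ) + 1 ≠ 0 := by exact_mod_cast r.succ_ne_zero
  have f4 : (r' : ℂ) + 1 ≠ 0 := by exact_mod_cast r'.succ_ne_zero
  have f5 : (r : ℂ) + 1 + 1 ≠ 0 := by exact_mod_cast (r + 1).succ_ne_zero
  have f6 : (r' : ℂ) + 1 + 1 ≠ 0 := by exact_mod_cast (r' + 1).succ_ne_zero
  rw [Nat.factorial_succ (r + 1), Nat.factorial_succ (r' + 1), Nat.factorial_succ r,
    Nat.factorial_succ r']
  push_cast
  generalize (r ! : ℂ) = p at *
  generalize (r' ! : ℂ) = p' at *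
  generalize (-1 : ℂ) ^ (r' + 1) = y at *
  generalize hw : z + 2 * (k : ℂ) = w at *
  field_simp
  subst hw
  ring

theorem tendsto_natCast_div_linear (c : ℂ) :
    Tendsto (fun k : ℕ => (k : ℂ) / (2 * k + c)) atTop (𝓝 (1 / 2)) := by
  have h1 : Tendsto (fun k : ℕ => (k : ℂ)⁻¹) atTop (𝓝 0) := tendsto_inv_atTop_nhds_zero_nat
  have h2 : Tendsto (fun k : ℕ => (2 + c * (k : ℂ)⁻¹)⁻¹) atTop (𝓝 ((2 + c * 0)⁻¹)) :=
    (tendsto_const_nhds.add (tendsto_const_nhds.mul h1)).inv₀ (by simp)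
  rw [mul_zero, add_zero, ← one_div] at h2
  refine h2.congr' ?_
  filter_upwards [eventually_ge_atTop 1] with k hk
  have : (k : ℂ) ≠ 0 := by exact_mod_cast (by omega : k ≠ 0)
  rw [show 2 + c * (k : ℂ)⁻¹ = (2 * k + c) / k by field_simp, inv_div]

theorem tendsto_pow_div_fallFact (l₀ : ℕ) (z : ℂ) (j : ℕ) :
    Tendsto (fun k : ℕ => (k : ℂ) ^ j / fallFact (poleW l₀ z k + l₀ - 1) j) atTop
      (𝓝 ((1 / 2) ^ j)) := by
  induction j with
  | zero => simp [fallFact]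
  | succ j ih =>
    have h := ih.mul (tendsto_natCast_div_linear (z + l₀ - 1 + l₀ - 1 - j))
    rw [← pow_succ] at h
    refine h.congr fun k => ?_
    rw [fallFact_succ, div_mul_div_comm, ← pow_succ, poleW]
    congr 2
    ring

theorem tendsto_inv_fallFact (l₀ : ℕ) (z : ℂ) {j : ℕ} (hj : 1 ≤ j) :
    Tendsto (fun k : ℕ => (fallFact (poleW l₀ z k + l₀ - 1) j)⁻¹) atTop (𝓝 0) := by
  have h1 : Tendsto (fun k : ℕ => (k : ℂ)⁻¹ ^ j) atTop (𝓝 (0 ^ j)) :=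
    tendsto_inv_atTop_nhds_zero_nat.pow j
  have h := (tendsto_pow_div_fallFact l₀ z j).mul h1
  rw [zero_pow (by omega), mul_zero] at h
  refine h.congr' ?_
  filter_upwards [eventually_ge_atTop 1] with k hk
  have : (k : ℂ) ^ j ≠ 0 := pow_ne_zero _ (by exact_mod_cast (by omega : k ≠ 0))
  rw [inv_pow]
  field_simp

theorem tendsto_natCast_div_fallFact (l₀ : ℕ) (z : ℂ) {j : ℕ} (hj : 2 ≤ j) :
    Tendsto (fun k : ℕ => k * (fallFact (poleW l₀ z k + l₀ - 1) j)⁻¹) atTop (𝓝 0) := by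
  have h1 : Tendsto (fun k : ℕ => (k : ℂ)⁻¹ ^ (j - 1)) atTop (𝓝 (0 ^ (j - 1))) :=
    tendsto_inv_atTop_nhds_zero_nat.pow (j - 1)
  have h := (tendsto_pow_div_fallFact l₀ z j).mul h1
  rw [zero_pow (by omega), mul_zero] at h
  refine h.congr' ?_
  filter_upwards [eventually_ge_atTop 1] with k hk
  obtain ⟨r, rfl⟩ : ∃ r, j = r + 1 := ⟨j - 1, by omega⟩
  have : (k : ℂ) ^ r ≠ 0 := pow_ne_zero _ (by exact_mod_cast (by omega : k ≠ 0))
  rw [inv_pow, Nat.add_sub_cancel, pow_succ]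
  field_simp

theorem tendsto_linear_div_natCast (a b : ℂ) :
    Tendsto (fun k : ℕ => (a + b * k) * (k : ℂ)⁻¹) atTop (𝓝 b) := by
  have h1 : Tendsto (fun k : ℕ => (k : ℂ)⁻¹) atTop (𝓝 0) := tendsto_inv_atTop_nhds_zero_nat
  have h2 : Tendsto (fun k : ℕ => a * (k : ℂ)⁻¹ + b) atTop (𝓝 (a * 0 + b)) :=
    (tendsto_const_nhds.mul h1).add tendsto_const_nhds
  rw [mul_zero, zero_add] at h2
  refine h2.congr' ?_
  filter_upwards [eventually_ge_atTop 1] with k hk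
  have : (k : ℂ) ≠ 0 := by exact_mod_cast (by omega : k ≠ 0)
  field_simp

/-- For `l₀ ≥ 2` the summand `n = -l₀` dominates for large `k`: it grows linearly, whereas all other
terms are divided by a falling factorial of positive degree, and the term from the components `B`,
which is quadratic in `k`, by one of degree `l₀`. -/
theorem tendsto_reducedCoeff {l₀ l l' : ℕ} (h2 : 2 ≤ l₀) (z : ℂ) :
    Tendsto (fun k => reducedCoeff l₀ l l' z k * (k : ℂ)⁻¹) atTop
      (𝓝 ((l * (l + 1) * (l ! * l' !) /
        ((((l : ℤ) - -(l₀ : ℤ)).toNat ! * ((l : ℤ) + -(l₀ : ℤ)).toNat !) *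
        (((l' : ℤ) - -(l₀ : ℤ)).toNat ! * ((l' : ℤ) + -(l₀ : ℤ)).toNat !)) : ℂ) *
      (symBeta (-(l₀ : ℤ)) l l' / (-2 * z)) *
      ((((l : ℤ) + -(l₀ : ℤ)).toNat.choose (l - l₀) : ℂ) * ((l' + -(l₀ : ℤ)).toNat ! : ℂ)))) := by
  have hsum : ∀ n ∈ Finset.Icc (-(l₀ : ℤ)) 0, ∀ c d : ℂ,
      Tendsto (fun k : ℕ => c * (symAlpha n l l' + symBeta n l l' * (k / (-2 * z))) *
        (d * ((fallFact (poleW l₀ z k + l₀ - 1) (n + l₀).toNat)⁻¹)) * (k : ℂ)⁻¹) atTop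
      (𝓝 (if n = -(l₀ : ℤ) then c * (symBeta n l l' / (-2 * z)) * d else 0)) := by
    intro n hn c d
    rw [Finset.mem_Icc] at hn
    have h1 := tendsto_linear_div_natCast (symAlpha n l l') (symBeta n l l' / (-2 * z))
    split_ifs with h
    · have h3 := (h1.const_mul c).mul_const d
      refine h3.congr fun k => ?_
      have e : (n + l₀).toNat = 0 := by omega
      rw [e, fallFact, Finset.prod_range_zero, inv_one]
      ring
    · have h3 := ((h1.const_mul c).mul_const d).mul
        (tendsto_inv_fallFact l₀ z (j := (n + l₀).toNat) (by omega))
      rw [mul_zero] at h3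
      refine h3.congr fun k => ?_
      ring
  have hBB : ∀ c A B d : ℂ, Tendsto (fun k : ℕ => z * (c * (1 + A * (k / z) +
      B * (k * (k - 1) / z ^ 2)) * (d * (fallFact (poleW l₀ z k + l₀ - 1) l₀)⁻¹)) * (k : ℂ)⁻¹) atTop
      (𝓝 0) := by
    intro c A B d
    have h3 := (tendsto_natCast_div_fallFact l₀ z h2).const_mul (B / z ^ 2)
    have h4 := (tendsto_inv_fallFact l₀ z (j := l₀) (by omega))
    have h5 := (tendsto_linear_div_natCast 1 (A / z - B / z ^ 2)).mul h4
    have h6 := ((h3.add h5).const_mul (z * c)).mul_const d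
    simp only [mul_zero, add_zero, zero_mul] at h6
    refine h6.congr' ?_
    filter_upwards [eventually_ge_atTop 1] with k hk
    have hk0 : (k : ℂ) * (k : ℂ)⁻¹ = 1 :=
      mul_inv_cancel₀ (by exact_mod_cast (by omega : k ≠ 0))
    simp only [div_eq_mul_inv]
    linear_combination -(z * c * d * B * (z ^ 2)⁻¹ * k *
      (fallFact (poleW l₀ z k + l₀ - 1) l₀)⁻¹) * hk0
  have h := (tendsto_finsetSum (Finset.Icc (-(l₀ : ℤ)) 0) fun n hn => hsum n hn
    (l * (l + 1) * (l ! * l' !) / ((((l : ℤ) - n).toNat ! * ((l : ℤ) + n).toNat !) *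
        (((l' : ℤ) - n).toNat ! * ((l' : ℤ) + n).toNat !)) : ℂ)
    ((((l : ℤ) + n).toNat.choose (l - l₀) : ℂ) * ((l' + n).toNat ! : ℂ))).add
    (hBB ((-1) ^ l' / (l ! * l' !)) (l * (l + 1) + l' * (l' + 1)) (l * (l + 1) * (l' * (l' + 1)))
      ((l.choose (l - l₀) : ℂ) * l' !))
  rw [add_zero, Finset.sum_ite_eq' , if_pos (by rw [Finset.mem_Icc]; omega)] at h
  refine h.congr fun k => ?_
  rw [reducedCoeff, add_mul (Finset.sum _ _), Finset.sum_mul]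
  simp only [div_eq_mul_inv, mul_assoc]

theorem exists_reducedCoeff_ne_zero {l₀ l l' : ℕ} (hl : 1 ≤ l) (hl' : 1 ≤ l') (h0 : l₀ ≤ l)
    (h0' : l₀ ≤ l') (h : ¬(l₀ = 1 ∧ (l = 1 ∨ l' = 1))) {z : ℂ} (hz : z ≠ 0) (b : ℝ) :
    ∃ k : ℕ, b < k ∧ reducedCoeff l₀ l l' z k ≠ 0 := by
  obtain ⟨N, hN⟩ := exists_nat_gt (max b (max ‖z‖ 0))
  have hNb : b < N := (le_max_left _ _).trans_lt hN
  have hNz : ‖z‖ < N := ((le_max_left _ _).trans (le_max_right _ _)).trans_lt hN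
  have hN0 : (0 : ℝ) < N := (norm_nonneg z).trans_lt hNz
  -- `z + m N` does not vanish for `m ≥ 1`, because `N > |z|`
  have hlin : ∀ m : ℝ, 1 ≤ m → z + (m : ℂ) * N ≠ 0 := by
    intro m hm h1
    have h2 : ‖z‖ = m * N := by
      rw [eq_neg_of_add_eq_zero_left h1, norm_neg, norm_mul, Complex.norm_real, Complex.norm_natCast,
        Real.norm_of_nonneg (by linarith)]
    nlinarith
  have hL : ∀ l : ℕ, 1 ≤ l → (1 : ℝ) ≤ l * (l + 1) := fun l hl => by
    have : (1 : ℝ) ≤ l := by exact_mod_cast hl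
    nlinarith
  have f : ∀ l : ℕ, (l ! : ℂ) ≠ 0 := fun l => by exact_mod_cast l.factorial_ne_zero
  rcases (by omega : l₀ = 0 ∨ l₀ = 1 ∨ 2 ≤ l₀) with rfl | rfl | h2
  · refine ⟨N, hNb, ?_⟩
    rw [reducedCoeff_zero hl hl' hz]
    refine mul_ne_zero (div_ne_zero (by simp) (f l)) (div_ne_zero (mul_ne_zero ?_ ?_) hz)
    · simpa using hlin _ (hL l hl)
    · simpa using hlin _ (hL l' hl')
  · refine ⟨N, hNb, ?_⟩
    have h2 : z + 2 * N ≠ 0 := by simpa using hlin 2 (by norm_num)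
    have hq : ∀ l : ℕ, 2 ≤ l → (l * (l + 1) - 2 : ℂ) ≠ 0 := by
      intro l hl
      have : (2 : ℝ) ≤ l := by exact_mod_cast hl
      have : ((l * (l + 1) - 2 : ℝ) : ℂ) ≠ 0 := by
        rw [Complex.ofReal_ne_zero]; nlinarith
      exact_mod_cast this
    rw [reducedCoeff_one hl hl' hz h2]
    refine mul_ne_zero (div_ne_zero (by simp) (f _)) (div_ne_zero (mul_ne_zero (mul_ne_zero ?_
      (hq l (by omega))) (hq l' (by omega))) h2)
    have : (N : ℂ) ≠ 0 := by exact_mod_cast hN0.ne'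
    simpa using this
  · have ht := (tendsto_reducedCoeff (l := l) (l' := l') h2 z).eventually_ne (b₂ := 0) (by
      have hb := symBeta_ne_zero (l := l) (l' := l') (n := -(l₀ : ℤ)) (by omega) (by omega) (by omega)
        hl'
      have hl0 : (l : ℂ) ≠ 0 := by exact_mod_cast (by omega : l ≠ 0)
      have hl1 : (l : ℂ) + 1 ≠ 0 := by exact_mod_cast l.succ_ne_zero
      have hc : ((((l : ℤ) + -(l₀ : ℤ)).toNat.choose (l - l₀) : ℕ) : ℂ) ≠ 0 := by
        have : 0 < ((l : ℤ) + -(l₀ : ℤ)).toNat.choose (l - l₀) := Nat.choose_pos (by omega)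
        exact_mod_cast this.ne'
      refine mul_ne_zero (mul_ne_zero (div_ne_zero (mul_ne_zero (mul_ne_zero hl0 hl1)
        (mul_ne_zero (f _) (f _))) ?_) (div_ne_zero hb (by simpa using hz))) (mul_ne_zero hc (f _))
      exact mul_ne_zero (mul_ne_zero (f _) (f _)) (mul_ne_zero (f _) (f _)))
    obtain ⟨k, hk, hkN⟩ := (ht.and (eventually_ge_atTop N)).exists
    exact ⟨k, hNb.trans_le (by exact_mod_cast hkN), left_ne_zero_of_mul hk⟩

theorem exists_projCoeff_ne_zero {l₀ l l' : ℕ} (hl : 1 ≤ l) (hl' : 1 ≤ l') (h0 : l₀ ≤ l)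
    (h0' : l₀ ≤ l') (h : ¬(l₀ = 1 ∧ (l = 1 ∨ l' = 1))) {z : ℂ} (hz : z ≠ 0) :
    ∃ k : ℕ, |z.re| + 1 < k ∧ projCoeff l₀ l l' z k ≠ 0 := by
  obtain ⟨k, hk, hne⟩ := exists_reducedCoeff_ne_zero hl hl' h0 h0' h hz (|z.re| + 1 + l')
  have hk1 : |z.re| + 1 < k := by linarith [(l'.cast_nonneg : (0 : ℝ) ≤ l')]
  refine ⟨k, hk1, ?_⟩
  rw [projCoeff_eq hl hl' h0 h0' hz hk1]
  refine mul_ne_zero (mul_ne_zero (mul_ne_zero (pow_ne_zero _ (by simpa using hz)) ?_)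
    (leadV_ne_zero h0' hk)) hne
  exact div_ne_zero (by exact_mod_cast constK_ne_zero hl hl') (by norm_num)

theorem constC_ne_zero {q : ℝ} (hq : q ≠ 0) {l : ℕ} (hl : 1 ≤ l) : constC q l ≠ 0 := by
  have h1 : (0 : ℝ) < l := by exact_mod_cast hl
  have hB : constB l ≠ 0 := by
    rw [constB_eq hl]
    exact mul_ne_zero (by simp) (by positivity)
  have hN : ∀ l : ℕ, jacN l 0 0 ≠ 0 := fun l => by
    rw [jacN]
    have : (0 : ℝ) < ((l : ℤ) - 0).toNat ! := by exact_mod_cast Nat.factorial_pos _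
    have : (0 : ℝ) < ((l : ℤ) + 0).toNat ! := by exact_mod_cast Nat.factorial_pos _
    positivity
  have hU : constU 0 0 0 l ≠ 0 := by
    rw [constU]
    exact mul_ne_zero (mul_ne_zero (mul_ne_zero (by simp) (by positivity)) (hN 0)) (hN l)
  have h8 : √(8 / 3) ≠ 0 := by positivity
  rw [constC]
  refine mul_ne_zero (mul_ne_zero (mul_ne_zero (mul_ne_zero (by simp) ?_) ?_) ?_) ?_ <;>
    rw [Complex.ofReal_ne_zero] <;> assumption

/-- The leading coefficient for the cyclic vector `|u⟩` is a nonzero multiple of `(z + l (l + 1) k) / z`,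
hence nonzero for large `k`. -/
theorem exists_cyclicCoeff_ne_zero {q : ℝ} (hq : q ≠ 0) {l : ℕ} (hl : 1 ≤ l) {z : ℂ} (hz : z ≠ 0) :
    ∃ k : ℕ, |z.re| + 1 < k ∧
      symbolCoeff (Polynomial.C (constC q l) * ((Polynomial.C (symAlpha 0 0 l) +
        Polynomial.C (symBeta 0 0 l) * Polynomial.X) * Polynomial.C (1 / 4))) z k *
      (jacC 0 0 0 0 * leadSum 0 0 l (poleW 0 z k)) ≠ 0 := by
  obtain ⟨k, hk⟩ := exists_nat_gt (max (|z.re| + 1 + l) (max ‖z‖ 1))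
  have hkl : |z.re| + 1 + l < k := (le_max_left _ _).trans_lt hk
  have hkz : ‖z‖ < k := ((le_max_left _ _).trans (le_max_right _ _)).trans_lt hk
  have hk1 : (1 : ℝ) < k := ((le_max_right _ _).trans (le_max_right _ _)).trans_lt hk
  have hk0 : |z.re| + 1 < k := by linarith [(l.cast_nonneg : (0 : ℝ) ≤ l)]
  have hk2 : 2 ≤ k := by exact_mod_cast hk1
  refine ⟨k, hk0, ?_⟩
  have hlead := leadSum_eq_leadV (l₀ := 0) (l' := l) (n := 0) (by omega) (by simp) le_rfl
    (poleW_add_ne_zero (l₀ := 0) hk0)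
  rw [Nat.cast_zero] at hlead
  rw [hlead, symbolCoeff_linear _ _ _ hz hk2, symAlpha_zero_zero, symBeta_zero 0 hl]
  refine mul_ne_zero (mul_ne_zero (mul_ne_zero (pow_ne_zero _ (by simpa using hz))
    (div_ne_zero (constC_ne_zero hq hl) (by norm_num))) ?_) (mul_ne_zero ?_
    (mul_ne_zero (leadV_ne_zero (by omega) hkl) (div_ne_zero ?_ ?_)))
  · have h1 : z + l * (l + 1) * k ≠ 0 := by
      intro h1
      have hl1 : (1 : ℝ) ≤ l := by exact_mod_cast hl
      have h2 : ‖z‖ = l * (l + 1) * k := by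
        have e : z = -((l * (l + 1) * k : ℕ) : ℂ) := by
          push_cast; exact eq_neg_of_add_eq_zero_left h1
        rw [e, norm_neg, Complex.norm_natCast]
        push_cast; ring
      have : (1 : ℝ) ≤ l * (l + 1) := by nlinarith
      nlinarith
    have e : (-1 : ℂ) ^ l + -2 * (-1) ^ l * (l * (l + 1)) * (k / (-2 * z)) =
        (-1) ^ l * ((z + l * (l + 1) * k) / z) := by
      field_simp
    rw [e]
    exact mul_ne_zero (by simp) (div_ne_zero h1 hz)
  · simp [jacC]
  · exact_mod_cast Nat.factorial_ne_zero _
  · simp [fallFact]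

/-! ### Polynomials in homogeneous form and Legendre’s equation -/

/-- The homogeneous form of degree `M` with coefficients `c`, at `((1 + y) / 2, (1 - y) / 2)`. -/
noncomputable def form (c : ℕ → ℝ) (M : ℕ) (y : ℝ) : ℝ :=
  ∑ k ∈ Finset.range (M + 1), c k * (((1 + y) / 2) ^ k * ((1 - y) / 2) ^ (M - k))

/-- The sequence `c` shifted by one place. -/
def shiftSeq (c : ℕ → ℝ) : ℕ → ℝ
  | 0 => 0
  | k + 1 => c k

theorem continuous_form (c : ℕ → ℝ) (M : ℕ) : Continuous (form c M) := by
  unfold form; fun_prop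

theorem hasDerivAt_form (c : ℕ → ℝ) (N : ℕ) (y : ℝ) :
    HasDerivAt (form c (N + 1))
      (1 / 2 * form (fun k => (k + 1) * c (k + 1) - (N + 1 - k) * c k) N y) y := by
  have ha : HasDerivAt (fun y : ℝ => (1 + y) / 2) (1 / 2) y :=
    ((hasDerivAt_id y).const_add 1).div_const 2
  have hb : HasDerivAt (fun y : ℝ => (1 - y) / 2) (-1 / 2) y :=
    ((hasDerivAt_id y).const_sub 1).div_const 2
  have h := HasDerivAt.fun_sum (u := Finset.range (N + 1 + 1)) fun k _ =>
    ((ha.pow k).mul (hb.pow (N + 1 - k))).const_mul (c k)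
  simp only [Pi.mul_apply, Pi.pow_apply] at h
  refine h.congr_deriv ?_
  set α := (1 + y) / 2
  set β := (1 - y) / 2
  have e : ∀ k ∈ Finset.range (N + 1 + 1), c k * (((k : ℝ) * α ^ (k - 1) * (1 / 2)) *
      β ^ (N + 1 - k) + α ^ k * ((N + 1 - k : ℕ) * β ^ (N + 1 - k - 1) * (-1 / 2))) =
      1 / 2 * (k * c k * (α ^ (k - 1) * β ^ (N + 1 - k))) -
        1 / 2 * ((N + 1 - k : ℕ) * c k * (α ^ k * β ^ (N - k))) := by
    intro k _
    rw [show N + 1 - k - 1 = N - k by omega]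
    ring
  rw [form, Finset.sum_congr rfl e, Finset.sum_sub_distrib, Finset.sum_range_succ',
    Finset.sum_range_succ _ (N + 1), Nat.sub_self, Nat.cast_zero, Finset.mul_sum]
  simp only [zero_mul, mul_zero, add_zero, Nat.add_sub_cancel]
  rw [← Finset.sum_sub_distrib]
  refine Finset.sum_congr rfl fun k hk => ?_
  rw [Finset.mem_range] at hk
  rw [show N + 1 - (k + 1) = N - k by omega, Nat.cast_sub (by omega)]
  push_cast
  ring

theorem mul_form_left (c : ℕ → ℝ) (M : ℕ) (y : ℝ) :
    (1 + y) / 2 * form c M y = form (shiftSeq c) (M + 1) y := by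
  rw [form, form, Finset.sum_range_succ' _ (M + 1), Finset.mul_sum]
  simp only [shiftSeq, zero_mul, add_zero]
  refine Finset.sum_congr rfl fun k _ => ?_
  rw [show M + 1 - (k + 1) = M - k by omega, pow_succ]
  ring

theorem mul_form_right {c : ℕ → ℝ} {M : ℕ} (hc : c (M + 1) = 0) (y : ℝ) :
    (1 - y) / 2 * form c M y = form c (M + 1) y := by
  rw [form, form, Finset.sum_range_succ _ (M + 1), Finset.mul_sum, hc, zero_mul, add_zero]
  refine Finset.sum_congr rfl fun k hk => ?_
  rw [Finset.mem_range] at hk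
  rw [show M + 1 - k = M - k + 1 by omega, pow_succ]
  ring

theorem form_eq_mul {a : ℝ} {c d : ℕ → ℝ} {M : ℕ} (h : ∀ k ≤ M, c k = a * d k) (y : ℝ) :
    form c M y = a * form d M y := by
  rw [form, form, Finset.mul_sum]
  refine Finset.sum_congr rfl fun k hk => ?_
  rw [Finset.mem_range] at hk
  rw [h k (by omega), mul_assoc]

/-- The Legendre polynomial of degree `r + 1`, up to the sign. -/
noncomputable def formP (r : ℕ) : ℝ → ℝ :=
  form (fun k => (-1) ^ k * ((r + 1).choose k : ℝ) ^ 2) (r + 1)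

/-- The derivative of the Legendre polynomial of degree `r + 1`, up to a constant. -/
noncomputable def formQ (r : ℕ) : ℝ → ℝ :=
  form (fun k => (-1) ^ k * ((r.choose k : ℝ) * ((r + 2).choose (k + 1) : ℝ))) r

/-- The polynomial factor of `jacF (r + 1) 1 0`. -/
noncomputable def formH (r : ℕ) : ℝ → ℝ :=
  form (fun k => (-1) ^ k * (((r + 1).choose k : ℝ) * ((r + 1).choose (k + 1) : ℝ))) r

/-- The polynomial factor of `jacF (r + 1) 1 1`. -/
noncomputable def formG (r : ℕ) : ℝ → ℝ :=
  form (fun k => (-1) ^ k * ((r.choose k : ℝ) * ((r + 2).choose (k + 2) : ℝ))) r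

/-- The polynomial factor of `jacF (r + 1) 1 (-1)`. -/
noncomputable def formG' (r : ℕ) : ℝ → ℝ :=
  form (fun k => (-1) ^ k * ((r.choose k : ℝ) * ((r + 2).choose k : ℝ))) r

theorem cast_choose_succ_mul (n k : ℕ) (h : k ≤ n) :
    ((k : ℝ) + 1) * (n.choose (k + 1) : ℝ) = (n - k) * n.choose k := by
  have := Nat.choose_succ_right_eq n k
  have h2 : ((n.choose (k + 1) * (k + 1) : ℕ) : ℝ) = (n.choose k * (n - k) : ℕ) := by rw [this]
  rw [Nat.cast_mul, Nat.cast_mul, Nat.cast_sub h] at h2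
  push_cast at h2
  linarith

theorem cast_succ_mul_choose (n k : ℕ) :
    ((n : ℝ) + 1) * (n.choose k : ℝ) = (k + 1) * (n + 1).choose (k + 1) := by
  have := Nat.add_one_mul_choose_eq n k
  have h2 : (((n + 1) * n.choose k : ℕ) : ℝ) = ((n + 1).choose (k + 1) * (k + 1) : ℕ) := by rw [this]
  push_cast at h2
  linarith

theorem hasDerivAt_formP (r : ℕ) (y : ℝ) :
    HasDerivAt (formP r) (-((r + 1) / 2) * formQ r y) y := by
  refine (hasDerivAt_form _ r y).congr_deriv ?_
  rw [formQ, show -(((r : ℝ) + 1) / 2) = 1 / 2 * -(r + 1) by ring, mul_assoc]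
  congr 1
  refine form_eq_mul (fun k hk => ?_) y
  have h1 := cast_choose_succ_mul (r + 1) k (by omega)
  have h2 := cast_succ_mul_choose r k
  have h3 : ((r + 2).choose (k + 1) : ℝ) = (r + 1).choose k + (r + 1).choose (k + 1) := by
    exact_mod_cast Nat.choose_succ_succ (r + 1) k
  rw [h3, pow_succ]
  push_cast at h1
  linear_combination (-1 : ℝ) ^ k * (((r + 1).choose k : ℝ) + ((r + 1).choose (k + 1) : ℝ)) * h2 +
    (-1 : ℝ) ^ k * ((r + 1).choose k : ℝ) * h1

/-- Legendre's differential equation `((1 - y²) P')' = -l (l + 1) P`, `l = r + 1`, divided by a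
constant. -/
theorem hasDerivAt_mul_formQ (r : ℕ) (y : ℝ) :
    HasDerivAt (fun y => (1 + y) / 2 * ((1 - y) / 2 * formQ r y)) ((r + 2) / 2 * formP r y) y := by
  have e : (fun y => (1 + y) / 2 * ((1 - y) / 2 * formQ r y)) = form (shiftSeq
      (fun k => (-1) ^ k * ((r.choose k : ℝ) * ((r + 2).choose (k + 1) : ℝ)))) (r + 1 + 1) := by
    funext y
    rw [formQ, mul_form_right (by simp), mul_form_left]
  rw [e]
  refine (hasDerivAt_form _ (r + 1) y).congr_deriv ?_
  rw [formP, show ((r : ℝ) + 2) / 2 = 1 / 2 * (r + 2) by ring, mul_assoc]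
  congr 1
  refine form_eq_mul (fun k hk => ?_) y
  have h1 := cast_succ_mul_choose (r + 1) k
  rcases k with _ | k
  · simp [shiftSeq]
  · have h2 := cast_choose_succ_mul (r + 2) (k + 1) (by omega)
    have h3 : ((r + 1).choose (k + 1) : ℝ) = r.choose k + r.choose (k + 1) := by
      exact_mod_cast Nat.choose_succ_succ r k
    simp only [shiftSeq]
    rw [pow_succ]
    push_cast at h1 h2 ⊢
    linear_combination (-1 : ℝ) ^ k * (r.choose (k + 1) : ℝ) * h1 +
      (-1 : ℝ) ^ k * (r.choose k : ℝ) * (h1 + h2) +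
      (-1 : ℝ) ^ k * ((r + 2) * ((r + 1).choose (k + 1) : ℝ)) * h3

/-- A lowering relation in the index `n`, for `l₀ = 1`. -/
theorem hasDerivAt_mul_formH_right (r : ℕ) (y : ℝ) :
    HasDerivAt (fun y => (1 - y) / 2 * formH r y) (-((r + 1) / 2) * formG r y) y := by
  have e : (fun y => (1 - y) / 2 * formH r y) = form
      (fun k => (-1) ^ k * (((r + 1).choose k : ℝ) * ((r + 1).choose (k + 1) : ℝ))) (r + 1) := by
    funext y
    rw [formH, mul_form_right (by simp)]
  rw [e]
  refine (hasDerivAt_form _ r y).congr_deriv ?_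
  rw [formG, show -(((r : ℝ) + 1) / 2) = 1 / 2 * -(r + 1) by ring, mul_assoc]
  congr 1
  refine form_eq_mul (fun k hk => ?_) y
  have h1 := cast_choose_succ_mul (r + 1) k (by omega)
  have h2 := cast_succ_mul_choose r k
  have h3 : ((r + 2).choose (k + 2) : ℝ) = (r + 1).choose (k + 1) + (r + 1).choose (k + 2) := by
    exact_mod_cast Nat.choose_succ_succ (r + 1) (k + 1)
  rw [h3, pow_succ]
  push_cast at h1
  linear_combination (-1 : ℝ) ^ k * (((r + 1).choose (k + 1) : ℝ)) * h1 +
    (-1 : ℝ) ^ k * (((r + 1).choose (k + 1) : ℝ) + ((r + 1).choose (k + 2) : ℝ)) * h2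

/-- A raising relation in the index `n`, for `l₀ = 1`. -/
theorem hasDerivAt_mul_formH_left (r : ℕ) (y : ℝ) :
    HasDerivAt (fun y => (1 + y) / 2 * formH r y) ((r + 1) / 2 * formG' r y) y := by
  have e : (fun y => (1 + y) / 2 * formH r y) = form (shiftSeq
      (fun k => (-1) ^ k * (((r + 1).choose k : ℝ) * ((r + 1).choose (k + 1) : ℝ)))) (r + 1) := by
    funext y
    rw [formH, mul_form_left]
  rw [e]
  refine (hasDerivAt_form _ r y).congr_deriv ?_
  rw [formG', show ((r : ℝ) + 1) / 2 = 1 / 2 * (r + 1) by ring, mul_assoc]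
  congr 1
  refine form_eq_mul (fun k hk => ?_) y
  have h1 := cast_choose_succ_mul (r + 1) k (by omega)
  have h2 := cast_succ_mul_choose r k
  rcases k with _ | k
  · simp [shiftSeq]
  · have h3 : ((r + 2).choose (k + 1) : ℝ) = (r + 1).choose k + (r + 1).choose (k + 1) := by
      exact_mod_cast Nat.choose_succ_succ (r + 1) k
    simp only [shiftSeq]
    rw [h3, pow_succ]
    push_cast at h1 h2 ⊢
    linear_combination (-1 : ℝ) ^ k * ((r + 1).choose k : ℝ) * h1 +
      (-1 : ℝ) ^ k * (((r + 1).choose k : ℝ) + ((r + 1).choose (k + 1) : ℝ)) * h2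

/-! ### Integration by parts for `l = 1` -/

theorem jacF_eq_form {r : ℕ} {y : ℝ} (hy : y ∈ Icc (-1 : ℝ) 1) : jacF (r + 1) 0 0 y = formP r y := by
  have ha : 0 ≤ (1 + y) / 2 := by linarith [hy.1]
  have hb : 0 ≤ (1 - y) / 2 := by linarith [hy.2]
  have hS : jacS (r + 1) 0 0 = Finset.range (r + 1 + 1) := by
    ext k; rw [mem_jacS (by omega) (by omega), Finset.mem_range]; omega
  rw [jacF, jacobiR, formP, form, hS]
  refine Finset.sum_congr rfl fun k hk => ?_
  rw [Finset.mem_range] at hk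
  have e1 : (2 * (k : ℤ) + 0 + 0).toNat = 2 * k := by omega
  have e2 : (2 * ((r + 1 : ℕ) : ℤ) - 0 - 0 - 2 * k).toNat = 2 * (r + 1 - k) := by omega
  rw [jacC_zero, Nat.choose_symm (by omega), e1, e2, pow_mul, pow_mul, Real.sq_sqrt ha,
    Real.sq_sqrt hb]
  ring

theorem jacF_zero_one {r : ℕ} {y : ℝ} (hy : y ∈ Icc (-1 : ℝ) 1) :
    jacF (r + 1) 0 1 y = √((1 + y) / 2) * √((1 - y) / 2) * formQ r y := by
  have ha : 0 ≤ (1 + y) / 2 := by linarith [hy.1]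
  have hb : 0 ≤ (1 - y) / 2 := by linarith [hy.2]
  have hS : jacS (r + 1) 0 1 = Finset.range (r + 1) := by
    ext k; rw [mem_jacS (by omega) (by omega), Finset.mem_range]; omega
  rw [jacF, jacobiR, formQ, form, hS, Finset.mul_sum]
  refine Finset.sum_congr rfl fun k hk => ?_
  rw [Finset.mem_range] at hk
  have e1 : (2 * (k : ℤ) + 0 + 1).toNat = 2 * k + 1 := by omega
  have e2 : (2 * ((r + 1 : ℕ) : ℤ) - 0 - 1 - 2 * k).toNat = 2 * (r - k) + 1 := by omega
  have e3 : (((r + 1 : ℕ) : ℤ) - 1).toNat = r := by omega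
  have e4 : (((r + 1 : ℕ) : ℤ) + 1).toNat = r + 2 := by omega
  have e5 : (((r + 1 : ℕ) : ℤ) - 0 - k).toNat = r + 1 - k := by omega
  have e6 : (r + 2).choose (r + 1 - k) = (r + 2).choose (k + 1) := by
    rw [← Nat.choose_symm (by omega)]; congr 1; omega
  rw [jacC, e1, e2, e3, e4, e5, e6, pow_succ, pow_succ, pow_mul, pow_mul, Real.sq_sqrt ha,
    Real.sq_sqrt hb]
  ring

theorem jacF_zero_neg_one (r : ℕ) (y : ℝ) : jacF (r + 1) 0 (-1) y = -jacF (r + 1) 0 1 y := by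
  have hS : jacS (r + 1) 0 1 = Finset.range (r + 1) := by
    ext k; rw [mem_jacS (by omega) (by omega), Finset.mem_range]; omega
  have hS' : jacS (r + 1) 0 (-1) = Finset.Ico 1 (r + 2) := by
    ext k; rw [mem_jacS (by omega) (by omega), Finset.mem_Ico]; omega
  rw [jacF, jacobiR, jacF, jacobiR, hS, hS', Finset.sum_Ico_eq_sum_range, ← Finset.sum_neg_distrib,
    show r + 2 - 1 = r + 1 by omega]
  refine Finset.sum_congr rfl fun k hk => ?_
  rw [Finset.mem_range] at hk
  have e1 : (2 * ((1 + k : ℕ) : ℤ) + 0 + -1).toNat = (2 * (k : ℤ) + 0 + 1).toNat := by omega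
  have e2 : (2 * ((r + 1 : ℕ) : ℤ) - 0 - -1 - 2 * ((1 + k : ℕ) : ℤ)).toNat =
    (2 * ((r + 1 : ℕ) : ℤ) - 0 - 1 - 2 * (k : ℤ)).toNat := by omega
  have e3 : (((r + 1 : ℕ) : ℤ) - 1).toNat = r := by omega
  have e4 : (((r + 1 : ℕ) : ℤ) + 1).toNat = r + 2 := by omega
  have e3' : (((r + 1 : ℕ) : ℤ) - -1).toNat = r + 2 := by omega
  have e4' : (((r + 1 : ℕ) : ℤ) + -1).toNat = r := by omega
  have e5 : (((r + 1 : ℕ) : ℤ) - 0 - k).toNat = r + 1 - k := by omega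
  have e5' : (((r + 1 : ℕ) : ℤ) - 0 - (1 + k : ℕ)).toNat = r - k := by omega
  have e6 : (r + 2).choose (r + 1 - k) = (r + 2).choose (1 + k) := by
    rw [← Nat.choose_symm (by omega)]; congr 1; omega
  rw [jacC, jacC, e1, e2, e3, e4, e3', e4', e5, e5', e6, Nat.choose_symm (by omega), pow_add]
  ring

theorem jacF_one_zero {r : ℕ} {y : ℝ} (hy : y ∈ Icc (-1 : ℝ) 1) :
    jacF (r + 1) 1 0 y = √((1 + y) / 2) * √((1 - y) / 2) * formH r y := by
  have ha : 0 ≤ (1 + y) / 2 := by linarith [hy.1]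
  have hb : 0 ≤ (1 - y) / 2 := by linarith [hy.2]
  have hS : jacS (r + 1) 1 0 = Finset.range (r + 1) := by
    ext k; rw [mem_jacS (by omega) (by omega), Finset.mem_range]; omega
  rw [jacF, jacobiR, formH, form, hS, Finset.mul_sum]
  refine Finset.sum_congr rfl fun k hk => ?_
  rw [Finset.mem_range] at hk
  have e1 : (2 * (k : ℤ) + 1 + 0).toNat = 2 * k + 1 := by omega
  have e2 : (2 * ((r + 1 : ℕ) : ℤ) - 1 - 0 - 2 * k).toNat = 2 * (r - k) + 1 := by omega
  have e3 : (((r + 1 : ℕ) : ℤ) - 0).toNat = r + 1 := by omega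
  have e4 : (((r + 1 : ℕ) : ℤ) + 0).toNat = r + 1 := by omega
  have e5 : (((r + 1 : ℕ) : ℤ) - 1 - k).toNat = r - k := by omega
  have e6 : (r + 1).choose (r - k) = (r + 1).choose (k + 1) := by
    rw [← Nat.choose_symm (by omega)]; congr 1; omega
  rw [jacC, e1, e2, e3, e4, e5, e6, pow_succ, pow_succ, pow_mul, pow_mul, Real.sq_sqrt ha,
    Real.sq_sqrt hb]
  ring

theorem jacF_one_one {r : ℕ} {y : ℝ} (hy : y ∈ Icc (-1 : ℝ) 1) :
    jacF (r + 1) 1 1 y = (1 + y) / 2 * formG r y := by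
  have ha : 0 ≤ (1 + y) / 2 := by linarith [hy.1]
  have hb : 0 ≤ (1 - y) / 2 := by linarith [hy.2]
  have hS : jacS (r + 1) 1 1 = Finset.range (r + 1) := by
    ext k; rw [mem_jacS (by omega) (by omega), Finset.mem_range]; omega
  rw [jacF, jacobiR, formG, form, hS, Finset.mul_sum]
  refine Finset.sum_congr rfl fun k hk => ?_
  rw [Finset.mem_range] at hk
  have e1 : (2 * (k : ℤ) + 1 + 1).toNat = 2 * (k + 1) := by omega
  have e2 : (2 * ((r + 1 : ℕ) : ℤ) - 1 - 1 - 2 * k).toNat = 2 * (r - k) := by omega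
  have e3 : (((r + 1 : ℕ) : ℤ) - 1).toNat = r := by omega
  have e4 : (((r + 1 : ℕ) : ℤ) + 1).toNat = r + 2 := by omega
  have e5 : (((r + 1 : ℕ) : ℤ) - 1 - k).toNat = r - k := by omega
  have e6 : (r + 2).choose (r - k) = (r + 2).choose (k + 2) := by
    rw [← Nat.choose_symm (by omega)]; congr 1; omega
  rw [jacC, e1, e2, e3, e4, e5, e6, pow_mul, pow_mul, Real.sq_sqrt ha, Real.sq_sqrt hb]
  ring

theorem jacF_one_neg_one {r : ℕ} {y : ℝ} (hy : y ∈ Icc (-1 : ℝ) 1) :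
    jacF (r + 1) 1 (-1) y = (1 - y) / 2 * formG' r y := by
  have ha : 0 ≤ (1 + y) / 2 := by linarith [hy.1]
  have hb : 0 ≤ (1 - y) / 2 := by linarith [hy.2]
  have hS : jacS (r + 1) 1 (-1) = Finset.range (r + 1) := by
    ext k; rw [mem_jacS (by omega) (by omega), Finset.mem_range]; omega
  rw [jacF, jacobiR, formG', form, hS, Finset.mul_sum]
  refine Finset.sum_congr rfl fun k hk => ?_
  rw [Finset.mem_range] at hk
  have e1 : (2 * (k : ℤ) + 1 + -1).toNat = 2 * k := by omega
  have e2 : (2 * ((r + 1 : ℕ) : ℤ) - 1 - -1 - 2 * k).toNat = 2 * (r - k + 1) := by omega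
  have e3 : (((r + 1 : ℕ) : ℤ) - -1).toNat = r + 2 := by omega
  have e4 : (((r + 1 : ℕ) : ℤ) + -1).toNat = r := by omega
  have e5 : (((r + 1 : ℕ) : ℤ) - 1 - k).toNat = r - k := by omega
  rw [jacC, e1, e2, e3, e4, e5, Nat.choose_symm (by omega), pow_mul, pow_mul, Real.sq_sqrt ha,
    Real.sq_sqrt hb]
  ring

theorem form_zero (c : ℕ → ℝ) (y : ℝ) : form c 0 y = c 0 := by simp [form]

theorem sqrt_boost_mul (t : ℝ) {y : ℝ} (hy : y ∈ Icc (-1 : ℝ) 1) :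
    √((1 + boost t y) / 2) * √((1 - boost t y) / 2) =
      √((1 + y) / 2) * √((1 - y) / 2) / uu t y := by
  have hu := uu_pos t hy
  have ha : 0 ≤ (1 + y) / 2 := by linarith [hy.1]
  have hb := boost_mem t hy
  have hc : 0 ≤ (1 + boost t y) / 2 := by linarith [hb.1]
  have e : (1 + boost t y) / 2 * ((1 - boost t y) / 2) =
      (1 + y) / 2 * ((1 - y) / 2) / uu t y ^ 2 := by
    have : Real.exp (-t) * Real.exp t = 1 := by rw [← Real.exp_add]; simp
    rw [one_add_boost t hy, one_sub_boost t hy]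
    field_simp
    linear_combination (1 + y) * (1 - y) * this
  rw [← Real.sqrt_mul hc, e, Real.sqrt_div' _ (sq_nonneg _), Real.sqrt_sq hu.le, Real.sqrt_mul ha]

theorem sqrt_mul_self_mul {y : ℝ} (hy : y ∈ Icc (-1 : ℝ) 1) :
    (√((1 + y) / 2) * √((1 - y) / 2)) * (√((1 + y) / 2) * √((1 - y) / 2)) =
      (1 + y) / 2 * ((1 - y) / 2) := by
  have ha : 0 ≤ (1 + y) / 2 := by linarith [hy.1]
  have hb : 0 ≤ (1 - y) / 2 := by linarith [hy.2]
  rw [mul_mul_mul_comm, Real.mul_self_sqrt ha, Real.mul_self_sqrt hb]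

theorem jacF_mul_boost_zero_one (r : ℕ) (t : ℝ) {y : ℝ} (hy : y ∈ Icc (-1 : ℝ) 1) :
    jacF (r + 1) 0 1 y * jacF 1 0 1 (boost t y) =
      2 * ((1 + y) / 2 * ((1 - y) / 2 * formQ r y)) / uu t y := by
  have h := jacF_zero_one (r := 0) (boost_mem t hy)
  rw [zero_add, sqrt_boost_mul t hy, formQ, form_zero] at h
  have h2 := sqrt_mul_self_mul hy
  rw [jacF_zero_one hy, h]
  generalize √((1 + y) / 2) * √((1 - y) / 2) = x at *
  simp
  linear_combination 2 * formQ r y / uu t y * h2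

theorem jacF_mul_boost_zero_neg_one (r : ℕ) (t y : ℝ) :
    jacF (r + 1) 0 (-1) y * jacF 1 0 (-1) (boost t y) =
      jacF (r + 1) 0 1 y * jacF 1 0 1 (boost t y) := by
  have h := jacF_zero_neg_one 0 (boost t y)
  rw [zero_add] at h
  rw [h, jacF_zero_neg_one, neg_mul_neg]

theorem rInt_zero_neg_one (w : ℂ) (r : ℕ) (t : ℝ) :
    rInt w 0 (-1) 1 (r + 1) t = rInt w 0 1 1 (r + 1) t := by
  simp only [rInt, jacF_mul_boost_zero_neg_one]

theorem integral_eq_zero_of_hasDerivAt {E : Type*} [NormedAddCommGroup E] [NormedSpace ℝ E]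
    [CompleteSpace E] {f f' : ℝ → E}
    (hd : ∀ y ∈ Icc (-1 : ℝ) 1, HasDerivAt f (f' y) y) (hc : ContinuousOn f' (Icc (-1) 1))
    (h : f (-1) = 0) (h' : f 1 = 0) : ∫ y in (-1 : ℝ)..1, f' y = 0 := by
  have e : uIcc (-1 : ℝ) 1 = Icc (-1) 1 := uIcc_of_le (by norm_num)
  rw [intervalIntegral.integral_eq_sub_of_hasDerivAt (f := f) (by rwa [e])
    (ContinuousOn.intervalIntegrable (by rwa [e])), h, h', sub_zero]

theorem continuousOn_uu_inv (t : ℝ) : ContinuousOn (fun y => (uu t y)⁻¹) (Icc (-1) 1) :=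
  ContinuousOn.inv₀ (by unfold uu; fun_prop) fun y hy => (uu_pos t hy).ne'

theorem hasDerivAt_uu_inv (t : ℝ) {y : ℝ} (hy : y ∈ Icc (-1 : ℝ) 1) :
    HasDerivAt (fun y => (uu t y)⁻¹) (Real.sinh t * (uu t y)⁻¹ ^ 2) y := by
  refine ((hasDerivAt_uu_right t y).inv (uu_pos t hy).ne').congr_deriv ?_
  rw [neg_neg, inv_pow, div_eq_mul_inv]

theorem hasDerivAt_weight (y : ℝ) :
    HasDerivAt (fun y : ℝ => (1 + y) / 2 * ((1 - y) / 2)) (-(y / 2)) y := by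
  have ha : HasDerivAt (fun y : ℝ => (1 + y) / 2) (1 / 2) y :=
    ((hasDerivAt_id y).const_add 1).div_const 2
  have hb : HasDerivAt (fun y : ℝ => (1 - y) / 2) (-1 / 2) y :=
    ((hasDerivAt_id y).const_sub 1).div_const 2
  refine (ha.mul hb).congr_deriv ?_
  ring

theorem rInt_neg_one_zero_zero (r : ℕ) (t : ℝ) : rInt (-1) 0 0 0 (r + 1) t =
    ((1 / 2 * ∫ y in (-1 : ℝ)..1, (uu t y)⁻¹ ^ 2 * formP r y : ℝ) : ℂ) := by
  rw [rInt_neg_one]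
  congr 2
  refine intervalIntegral.integral_congr fun y hy => ?_
  rw [uIcc_of_le (by norm_num)] at hy
  rw [jacF_zero, jacF_eq_form hy, inv_pow, mul_one]

theorem rInt_neg_one_zero_one (r : ℕ) (t : ℝ) : rInt (-1) 0 1 1 (r + 1) t =
    ((∫ y in (-1 : ℝ)..1, (uu t y)⁻¹ ^ 3 * ((1 + y) / 2 * ((1 - y) / 2 * formQ r y)) : ℝ) : ℂ) := by
  rw [rInt_neg_one, ← intervalIntegral.integral_const_mul]
  congr 1
  refine intervalIntegral.integral_congr fun y hy => ?_
  rw [uIcc_of_le (by norm_num)] at hy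
  rw [jacF_mul_boost_zero_one r t hy]
  field_simp

theorem rInt_one (m n : ℤ) (l l' : ℕ) (t : ℝ) : rInt 1 m n l l' t =
    ((1 / 2 * ∫ y in (-1 : ℝ)..1, jacF l' m n y * jacF l m n (boost t y) : ℝ) : ℂ) := by
  rw [rInt, Complex.ofReal_mul, ← intervalIntegral.integral_ofReal]
  simp

theorem rInt_one_zero_one (r : ℕ) (t : ℝ) : rInt 1 0 1 1 (r + 1) t =
    ((∫ y in (-1 : ℝ)..1, (uu t y)⁻¹ * ((1 + y) / 2 * ((1 - y) / 2 * formQ r y)) : ℝ) : ℂ) := by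
  rw [rInt_one, ← intervalIntegral.integral_const_mul]
  congr 1
  refine intervalIntegral.integral_congr fun y hy => ?_
  rw [uIcc_of_le (by norm_num)] at hy
  rw [jacF_mul_boost_zero_one r t hy]
  ring

theorem continuous_formP (r : ℕ) : Continuous (formP r) := continuous_form _ _

theorem continuous_formQ (r : ℕ) : Continuous (formQ r) := continuous_form _ _

/-- The coefficients `A` with `l = 1`, `n = 1` are multiples of the components `B` divided by `sinh t`:
integration by parts, by Legendre's equation. -/
theorem sinh_mul_rInt_zero_one (r : ℕ) (t : ℝ) :
    2 * Real.sinh t * rInt (-1) 0 1 1 (r + 1) t = -((r + 2) * rInt (-1) 0 0 0 (r + 1) t) := by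
  have hP := continuous_formP r
  have hQ := continuous_formQ r
  have hu := continuousOn_uu_inv t
  have h0 := integral_eq_zero_of_hasDerivAt
    (f := fun y => (1 + y) / 2 * ((1 - y) / 2 * formQ r y) * (uu t y)⁻¹ ^ 2)
    (f' := fun y => 2 * Real.sinh t *
      ((uu t y)⁻¹ ^ 3 * ((1 + y) / 2 * ((1 - y) / 2 * formQ r y))) +
      (r + 2) * (1 / 2) * ((uu t y)⁻¹ ^ 2 * formP r y)) (fun y hy => by
      refine ((hasDerivAt_mul_formQ r y).mul ((hasDerivAt_uu_inv t hy).pow 2)).congr_deriv ?_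
      simp only [Pi.pow_apply]
      push_cast
      ring) (by fun_prop) (by simp) (by simp)
  rw [intervalIntegral.integral_add, intervalIntegral.integral_const_mul,
    intervalIntegral.integral_const_mul] at h0
  · rw [rInt_neg_one_zero_zero, rInt_neg_one_zero_one]
    have h1 := congrArg (fun x : ℝ => (x : ℂ)) h0
    push_cast at h1 ⊢
    linear_combination h1
  all_goals
    refine ContinuousOn.intervalIntegrable ?_
    rw [uIcc_of_le (by norm_num)]
    fun_prop

/-- The matrix elements with `l₀ = 0`, `l = 1` at `w = 1` and `w = -1` are proportional, here for
`n = 1`; the representations with `w` and `-w` are equivalent. The difference is the integral of a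
derivative. -/
theorem rInt_one_eq_rInt_neg_one_of_one (r : ℕ) {t : ℝ} (ht : t ≠ 0) :
    (r + 1) * (r + 2) / 2 * rInt 1 0 1 1 (r + 1) t = rInt (-1) 0 1 1 (r + 1) t := by
  have hP := continuous_formP r
  have hQ := continuous_formQ r
  have hu := continuousOn_uu_inv t
  have hs : Complex.sinh t ≠ 0 := by
    rw [← Complex.ofReal_sinh]; exact_mod_cast Real.sinh_ne_zero.2 ht
  have h0 := integral_eq_zero_of_hasDerivAt
    (f := fun y => -(r + 2) * Real.sinh t * ((1 + y) / 2 * ((1 - y) / 2) * formP r y * (uu t y)⁻¹) -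
      1 / 2 * ((1 + y) / 2 * ((1 - y) / 2 * formQ r y) * (uu t y)⁻¹ ^ 2) +
      1 / 2 * ((1 + y) / 2 * ((1 - y) / 2 * formQ r y)))
    (f' := fun y => Real.sinh t * ((r + 1) * (r + 2) / 2) *
      ((uu t y)⁻¹ * ((1 + y) / 2 * ((1 - y) / 2 * formQ r y))) -
      Real.sinh t * ((uu t y)⁻¹ ^ 3 * ((1 + y) / 2 * ((1 - y) / 2 * formQ r y)))) (fun y hy => by
      have d1 := (((hasDerivAt_weight y).mul (hasDerivAt_formP r y)).mul
        (hasDerivAt_uu_inv t hy)).const_mul (-(r + 2) * Real.sinh t)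
      have d2 := ((hasDerivAt_mul_formQ r y).mul ((hasDerivAt_uu_inv t hy).pow 2)).const_mul (1 / 2)
      have d3 := (hasDerivAt_mul_formQ r y).const_mul (1 / 2)
      refine ((d1.sub d2).add d3).congr_deriv ?_
      simp only [Pi.pow_apply, Pi.mul_apply]
      have h1 := mul_inv_cancel₀ (uu_pos t hy).ne'
      have h2 := Real.cosh_sq_sub_sinh_sq t
      have h3 : uu t y = Real.cosh t - y * Real.sinh t := rfl
      generalize (uu t y)⁻¹ = v at *
      push_cast
      -- the relation between `y` and `v = 1 / u`, from `u = cosh t - y sinh t`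
      have h4 : 2 * Real.sinh t * y * v - Real.sinh t ^ 2 * (1 - y ^ 2) * v ^ 2 =
          v ^ 2 - 1 := by
        rw [h3] at h1
        linear_combination (-(2 * Real.sinh t * y * v) -
          ((Real.cosh t - y * Real.sinh t) * v + 1)) * h1 + v ^ 2 * h2
      linear_combination (r + 2) / 4 * formP r y * h4) (by fun_prop) (by simp) (by simp)
  rw [intervalIntegral.integral_sub, intervalIntegral.integral_const_mul,
    intervalIntegral.integral_const_mul] at h0
  · rw [rInt_one_zero_one, rInt_neg_one_zero_one]
    have h1 := congrArg (fun x : ℝ => (x : ℂ)) h0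
    push_cast at h1 ⊢
    refine mul_left_cancel₀ hs ?_
    linear_combination h1
  all_goals
    refine ContinuousOn.intervalIntegrable ?_
    rw [uIcc_of_le (by norm_num)]
    fun_prop

/-- The matrix elements with `l₀ = 0`, `l = 1` at `w = 1` and `w = -1` are proportional, here for
`n = 0`. -/
theorem rInt_one_eq_rInt_neg_one_of_zero (r : ℕ) (t : ℝ) :
    (r + 1) * (r + 2) / 2 * rInt 1 0 0 1 (r + 1) t = rInt (-1) 0 0 1 (r + 1) t := by
  have hP := continuous_formP r
  have hQ := continuous_formQ r
  have hu := continuousOn_uu_inv t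
  have hJ : ContinuousOn (fun y => jacF (r + 1) 0 0 y * jacF 1 0 0 (boost t y)) (Icc (-1) 1) :=
    (continuous_jacF (r + 1) 0 0).continuousOn.mul ((continuous_jacF 1 0 0).comp_continuousOn
      ((continuousOn_boost' (X := ℝ) (g := fun t => t) continuous_id).comp
        (f := fun y : ℝ => (t, y)) (by fun_prop) fun y hy => ⟨trivial, hy⟩))
  have hu2 : ContinuousOn (fun y => (uu t y ^ 2)⁻¹) (Icc (-1) 1) := by
    simp only [← inv_pow]
    fun_prop
  have h0 := integral_eq_zero_of_hasDerivAt
    (f := fun y => -(r + 1) / 2 * ((1 + y) / 2 * ((1 - y) / 2 * formQ r y) * boost t y) -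
      (1 + y) / 2 * ((1 - y) / 2) * formP r y * (uu t y)⁻¹ ^ 2)
    (f' := fun y => ((r + 1) * (r + 2) / 2) * (1 / 2) * (jacF (r + 1) 0 0 y * jacF 1 0 0 (boost t y))
       - 1 / 2 * ((uu t y ^ 2)⁻¹ * (jacF (r + 1) 0 0 y * jacF 1 0 0 (boost t y)))) (fun y hy => by
      have d1 := ((hasDerivAt_mul_formQ r y).mul (hasDerivAt_boost t hy)).const_mul (-(r + 1) / 2 : ℝ)
      have d2 := ((hasDerivAt_weight y).mul (hasDerivAt_formP r y)).mul ((hasDerivAt_uu_inv t hy).pow 2)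
      refine (d1.sub d2).congr_deriv ?_
      simp only [Pi.pow_apply, Pi.mul_apply]
      rw [jacF_eq_form hy, jacF_one (boost_mem t hy), boost_eq t hy]
      have h1 := mul_inv_cancel₀ (uu_pos t hy).ne'
      have h2 := Real.cosh_sq_sub_sinh_sq t
      have h3 : uu t y = Real.cosh t - y * Real.sinh t := rfl
      rw [← inv_pow, div_eq_mul_inv _ (uu t y)]
      generalize (uu t y)⁻¹ = v at *
      push_cast
      rw [h3] at h1
      linear_combination -(1 / 2 * formP r y * v ^ 2 * y) * h1) (by fun_prop) (by simp) (by simp)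
  rw [intervalIntegral.integral_sub, intervalIntegral.integral_const_mul,
    intervalIntegral.integral_const_mul] at h0
  · rw [rInt_one, rInt_neg_one]
    have h1 := congrArg (fun x : ℝ => (x : ℂ)) h0
    push_cast at h1 ⊢
    linear_combination h1
  all_goals
    refine ContinuousOn.intervalIntegrable ?_
    rw [uIcc_of_le (by norm_num)]
    fun_prop

/-! ### Symmetry and derivatives of the matrix elements -/

theorem jacF_neg {l : ℕ} {m n : ℤ} (hm : m ≤ l) (hn : |n| ≤ l) (y : ℝ) :
    jacF l m n (-y) = (-1) ^ (l - m).toNat * jacF l m (-n) y := by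
  obtain ⟨hn1, hn2⟩ := abs_le.1 hn
  rw [jacF, jacF, ← sub_eq_add_neg, sub_neg_eq_add, jacobiR, jacobiR, Finset.mul_sum]
  have hS := fun k => mem_jacS hm hn2 (k := k)
  have hS' := fun k => mem_jacS (n := -n) hm (by omega) (k := k)
  refine Finset.sum_nbij' (fun k => (l - m - k).toNat) (fun k => (l - m - k).toNat) ?_ ?_ ?_ ?_ ?_
  · intro k hk
    rw [hS] at hk
    rw [hS']; omega
  · intro k hk
    rw [hS'] at hk
    rw [hS]; omega
  · intro k hk
    rw [hS] at hk
    omega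
  · intro k hk
    rw [hS'] at hk
    omega
  · intro k hk
    rw [hS] at hk
    obtain ⟨j, hj⟩ : ∃ j : ℕ, (j : ℤ) = l - m - k := ⟨(l - m - k).toNat, by omega⟩
    have e1 : ((l : ℤ) - m - k).toNat = j := by omega
    have e2 : ((l : ℤ) - m - j).toNat = k := by omega
    have e3 : (2 * (j : ℤ) + m + -n).toNat = (2 * (l : ℤ) - m - n - 2 * k).toNat := by omega
    have e4 : (2 * (l : ℤ) - m - -n - 2 * j).toNat = (2 * (k : ℤ) + m + n).toNat := by omega
    have e5 : ((l : ℤ) - -n).toNat = ((l : ℤ) + n).toNat := by omega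
    have e6 : ((l : ℤ) + -n).toNat = ((l : ℤ) - n).toNat := by omega
    have e7 : ((l : ℤ) - m).toNat = k + j := by omega
    have e8 : (-1 : ℝ) ^ j * (-1) ^ j = 1 := by rw [← mul_pow]; simp
    rw [e1, e3, e4, e7, jacC, jacC, e1, e2, e5, e6, pow_add]
    linear_combination -((-1 : ℝ) ^ k * (((l : ℤ) - n).toNat.choose k : ℝ) *
      (((l : ℤ) + n).toNat.choose j : ℝ) * √((1 + y) / 2) ^ (2 * (l : ℤ) - m - n - 2 * k).toNat *
      √((1 - y) / 2) ^ (2 * (k : ℤ) + m + n).toNat) * e8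

theorem boost_neg (t y : ℝ) : boost (-t) (-y) = -boost t y := by
  rw [boost, boost, Real.tanh_neg, neg_mul_neg, ← neg_div]
  congr 1
  ring

/-- The symmetry of the matrix elements under the inverse of the hyperbolic rotation: substitute
`y ↦ -boost t y`. -/
theorem rInt_symm {l l' : ℕ} {m n : ℤ} (hm : m ≤ l) (hm' : m ≤ l') (hn : |n| ≤ l) (hn' : |n| ≤ l') (w : ℂ) (t : ℝ) :
    rInt w m n l l' t = (-1) ^ (l + l') * rInt (-w) m (-n) l' l t := by
  have hc : ContinuousOn (fun y => (uu t y : ℂ) ^ (w - 1) *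
      (jacF l' m n y * jacF l m n (boost t y) : ℝ)) (Icc (-1) 1) := by
    have h1 := (continuousOn_uu_cpow (X := ℝ) (f := fun _ => w - 1) (g := fun t => t)
      (by fun_prop) (by fun_prop)).comp (f := fun y : ℝ => (t, y)) (s := Icc (-1) 1) (by fun_prop)
      fun y hy => ⟨trivial, hy⟩
    refine h1.mul (Complex.continuous_ofReal.comp_continuousOn
      ((continuous_jacF l' m n).continuousOn.mul ((continuous_jacF l m n).comp_continuousOn
      ((continuousOn_boost' (X := ℝ) (g := fun t => t) continuous_id).comp
        (f := fun y : ℝ => (t, y)) (by fun_prop) fun y hy => ⟨trivial, hy⟩))))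
  have key := integral_boost (E := ℂ) (-t) hc
  set G : ℝ → ℂ := fun y => (uu (-t) y ^ 2)⁻¹ • ((uu t (boost (-t) y) : ℂ) ^ (w - 1) *
    (jacF l' m n (boost (-t) y) * jacF l m n (boost t (boost (-t) y)) : ℝ)) with hG
  have h2 := intervalIntegral.integral_comp_neg (a := -1) (b := 1) (f := G)
  rw [neg_neg] at h2
  rw [rInt, key, ← h2, rInt, mul_left_comm,
    ← intervalIntegral.integral_const_mul ((-1) ^ (l + l'))]
  congr 1
  refine intervalIntegral.integral_congr fun y hy => ?_
  rw [uIcc_of_le (by norm_num)] at hy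
  have hy' : -y ∈ Icc (-1 : ℝ) 1 := ⟨by linarith [hy.2], by linarith [hy.1]⟩
  have hu : uu (-t) (-y) = uu t y := by rw [uu, uu]; simp
  have e1 := boost_neg_boost (-t) hy'
  have e2 := uu_neg_boost (-t) hy'
  rw [neg_neg] at e1 e2
  have hpos := uu_pos t hy
  have hpos' : (uu t y : ℂ) ≠ 0 := by exact_mod_cast hpos.ne'
  simp only [hG]
  rw [e1, e2, hu, boost_neg, jacF_neg hm' hn', jacF_neg hm hn, Complex.real_smul]
  have e3 : (-1 : ℂ) ^ (l' - m).toNat * (-1) ^ (l - m).toNat = (-1) ^ (l + l') := by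
    have h3 : ((l' : ℤ) - m).toNat + ((l : ℤ) - m).toNat + (2 * m.toNat) =
        l + l' + 2 * (-m).toNat := by omega
    have h4 := congrArg (fun n => (-1 : ℂ) ^ n) h3
    simpa [pow_add, pow_mul] using h4
  have e4 : (((uu t y ^ 2)⁻¹ : ℝ) : ℂ) * (((uu t y)⁻¹ : ℝ) : ℂ) ^ (w - 1) =
      (uu t y : ℂ) ^ (-w - 1) := by
    push_cast
    rw [Complex.inv_cpow _ _ (by
      rw [Complex.arg_ofReal_of_nonneg hpos.le]; exact Real.pi_pos.ne), ← Complex.cpow_neg,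
      ← Complex.cpow_two, ← Complex.cpow_neg,
      ← Complex.cpow_add _ _ hpos']
    congr 1
    ring
  rw [← mul_assoc, e4, ← e3]
  push_cast
  ring

/-- The first-order relation between the matrix elements with `l₀ = 1`, `l = 1`. The derivative under
the integral and the right-hand side differ by the integral of a derivative in `y`. -/
theorem hasDerivAt_sinh_sq_mul_rInt (w : ℂ) (r : ℕ) (t : ℝ) :
    HasDerivAt (fun t => ((Real.sinh t ^ 2 : ℝ) : ℂ) * rInt w 1 0 1 (r + 1) t)
      ((Real.sinh t : ℂ) * ((r + 1) / 2) * (rInt w 1 1 1 (r + 1) t + rInt w 1 (-1) 1 (r + 1) t))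
      t := by
  set h : ℝ → ℝ := fun y => (1 + y) / 2 * ((1 - y) / 2 * formH r y) with hh
  have hH : Continuous (formH r) := continuous_form _ _
  have hG : Continuous (formG r) := continuous_form _ _
  have hG' : Continuous (formG' r) := continuous_form _ _
  have hhc : Continuous h := by fun_prop
  have cp : ∀ v : ℂ, ContinuousOn (fun y => (uu t y : ℂ) ^ v) (Icc (-1) 1) := fun v =>
    (continuousOn_uu_cpow (X := ℝ) (f := fun _ => v) (g := fun t => t)
      (by fun_prop) (by fun_prop)).comp (f := fun y : ℝ => (t, y)) (s := Icc (-1) 1) (by fun_prop)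
      fun y hy => ⟨trivial, hy⟩
  have e0 : ∀ t : ℝ, rInt w 1 0 1 (r + 1) t =
      1 / 2 * ∫ y in (-1 : ℝ)..1, (uu t y : ℂ) ^ (w - 2) * (h y : ℂ) := by
    intro t
    rw [rInt]
    congr 1
    refine intervalIntegral.integral_congr fun y hy => ?_
    rw [uIcc_of_le (by norm_num)] at hy
    have h1 := jacF_one_zero (r := 0) (boost_mem t hy)
    have h2 := sqrt_mul_self_mul hy
    have hu : (uu t y : ℂ) ≠ 0 := by exact_mod_cast (uu_pos t hy).ne'
    rw [zero_add, sqrt_boost_mul t hy, formH, form_zero] at h1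
    have h3 : jacF (r + 1) 1 0 y * jacF 1 1 0 (boost t y) = h y / uu t y := by
      rw [jacF_one_zero hy, h1, hh]
      generalize √((1 + y) / 2) * √((1 - y) / 2) = x at *
      simp
      linear_combination formH r y / uu t y * h2
    rw [h3, show w - 2 = w - 1 - 1 by ring, Complex.cpow_sub (w - 1) 1 hu, Complex.cpow_one]
    push_cast
    ring
  have e1 : ∀ n : ℤ, ∀ g : ℝ → ℝ, (∀ y ∈ Icc (-1 : ℝ) 1,
      jacF (r + 1) 1 n y * jacF 1 1 n (boost t y) = g y / uu t y) → rInt w 1 n 1 (r + 1) t =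
      1 / 2 * ∫ y in (-1 : ℝ)..1, (uu t y : ℂ) ^ (w - 2) * (g y : ℂ) := by
    intro n g hg
    rw [rInt]
    congr 1
    refine intervalIntegral.integral_congr fun y hy => ?_
    rw [uIcc_of_le (by norm_num)] at hy
    have hu : (uu t y : ℂ) ≠ 0 := by exact_mod_cast (uu_pos t hy).ne'
    rw [hg y hy, show w - 2 = w - 1 - 1 by ring, Complex.cpow_sub (w - 1) 1 hu, Complex.cpow_one]
    push_cast
    ring
  have e2 := e1 1 (fun y => ((1 + y) / 2) ^ 2 * Real.exp (-t) * formG r y) fun y hy => by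
    have h1 := jacF_one_one (r := 0) (boost_mem t hy)
    rw [zero_add, one_add_boost t hy, formG, form_zero] at h1
    rw [h1, jacF_one_one hy]
    simp
    ring
  have e3 := e1 (-1) (fun y => ((1 - y) / 2) ^ 2 * Real.exp t * formG' r y) fun y hy => by
    have h1 := jacF_one_neg_one (r := 0) (boost_mem t hy)
    rw [zero_add, one_sub_boost t hy, formG', form_zero] at h1
    rw [h1, jacF_one_neg_one hy]
    simp
    ring
  have hd := hasDerivAt_integral_Icc (F := fun t y => (uu t y : ℂ) ^ (w - 2) * (h y : ℂ))
    (F' := fun t y => ((w - 2) * (uu t y : ℂ) ^ (w - 2 - 1) *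
      ((Real.sinh t - y * Real.cosh t : ℝ) : ℂ)) * (h y : ℂ)) ?_ ?_ ?_ t
  · have hs : HasDerivAt (fun t => ((Real.sinh t ^ 2 : ℝ) : ℂ))
        ((2 * Real.sinh t * Real.cosh t : ℝ) : ℂ) t := by
      refine HasDerivAt.ofReal_comp (((Real.hasDerivAt_sinh t).pow 2).congr_deriv ?_)
      simp
    simp only [e0]
    refine (hs.mul (hd.const_mul (1 / 2))).congr_deriv ?_
    rw [e2, e3]
    -- the derivative of `(1 - y²) / 4 * formH r y`, computed in two ways
    have hR : ∀ y, formH r y = (r + 1) * ((1 + y) / 2 * formG r y + (1 - y) / 2 * formG' r y) := by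
      intro y
      have ha : HasDerivAt (fun y : ℝ => (1 + y) / 2) (1 / 2) y :=
        ((hasDerivAt_id y).const_add 1).div_const 2
      have hb : HasDerivAt (fun y : ℝ => (1 - y) / 2) (-1 / 2) y :=
        ((hasDerivAt_id y).const_sub 1).div_const 2
      have d1 := ha.mul (hasDerivAt_mul_formH_right r y)
      have d2 := hb.mul (hasDerivAt_mul_formH_left r y)
      have hfun : ((fun y : ℝ => (1 + y) / 2) * fun y => (1 - y) / 2 * formH r y) =
          (fun y : ℝ => (1 - y) / 2) * fun y => (1 + y) / 2 * formH r y := by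
        funext y; simp only [Pi.mul_apply]; ring
      rw [hfun] at d1
      have := d1.unique d2
      linear_combination 2 * this
    have h0 := integral_eq_zero_of_hasDerivAt
      (f := fun y => (uu t y : ℂ) ^ (w - 2) *
        ((-(1 / 2) * (Real.sinh t - y * Real.cosh t) * h y : ℝ) : ℂ))
      (f' := fun y => Real.cosh t * ((uu t y : ℂ) ^ (w - 2) * (h y : ℂ)) +
        Real.sinh t / 2 * (((w - 2) * (uu t y : ℂ) ^ (w - 2 - 1) *
      ((Real.sinh t - y * Real.cosh t : ℝ) : ℂ)) * (h y : ℂ)) -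
        (r + 1) / 4 * ((uu t y : ℂ) ^ (w - 2) *
          ((((1 + y) / 2) ^ 2 * Real.exp (-t) * formG r y : ℝ) : ℂ)) -
        (r + 1) / 4 * ((uu t y : ℂ) ^ (w - 2) *
          ((((1 - y) / 2) ^ 2 * Real.exp t * formG' r y : ℝ) : ℂ))) (fun y hy => by
        have ha : HasDerivAt (fun y : ℝ => (1 + y) / 2) (1 / 2) y :=
          ((hasDerivAt_id y).const_add 1).div_const 2
        have d1 := ha.mul (hasDerivAt_mul_formH_right r y)
        have d2 : HasDerivAt (fun y : ℝ => -(1 / 2) * (Real.sinh t - y * Real.cosh t))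
            (1 / 2 * Real.cosh t) y := by
          refine ((((hasDerivAt_id y).mul_const (Real.cosh t)).const_sub
            (Real.sinh t)).const_mul (-(1 / 2))).congr_deriv ?_
          ring
        have d3 := (d2.mul d1).ofReal_comp
        have d4 := (hasDerivAt_cpow_ofReal (hasDerivAt_uu_right t y) (uu_pos t hy) (w - 2)).mul d3
        refine d4.congr_deriv ?_
        have hRc := congrArg (fun x : ℝ => (x : ℂ)) (hR y)
        rw [← Real.cosh_sub_sinh, ← Real.cosh_add_sinh]
        simp only [Pi.mul_apply, hh]
        push_cast at hRc ⊢
        linear_combination (-(uu t y : ℂ) ^ (w - 2) * ((1 - y) / 2) *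
          (Complex.cosh t + Complex.sinh t) / 4) * hRc) ?_ (by simp [hh]) (by simp [hh])
    · rw [intervalIntegral.integral_sub, intervalIntegral.integral_sub, intervalIntegral.integral_add,
        intervalIntegral.integral_const_mul, intervalIntegral.integral_const_mul,
        intervalIntegral.integral_const_mul, intervalIntegral.integral_const_mul] at h0
      · push_cast at h0 ⊢
        linear_combination Complex.sinh t * h0
      all_goals
        refine ContinuousOn.intervalIntegrable ?_
        rw [uIcc_of_le (by norm_num)]
        have c1 := cp (w - 2)
        have c2 := cp (w - 2 - 1)
        fun_prop
    · have c1 := cp (w - 2)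
      have c2 := cp (w - 2 - 1)
      fun_prop
  · intro t
    have h1 := (continuousOn_uu_cpow (X := ℝ) (f := fun _ => (w - 2 : ℂ)) (g := fun t => t)
      (by fun_prop) (by fun_prop)).comp (f := fun y : ℝ => (t, y)) (s := Icc (-1) 1) (by fun_prop)
      fun y hy => ⟨trivial, hy⟩
    exact h1.mul (by fun_prop)
  · refine ContinuousOn.mul (ContinuousOn.mul (continuousOn_const.mul ?_) ?_) ?_
    · exact continuousOn_uu_cpow (X := ℝ) (f := fun _ => (w - 2 - 1 : ℂ)) (g := fun t => t)
        (by fun_prop) (by fun_prop)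
    · fun_prop
    · fun_prop
  · intro t y hy
    exact (hasDerivAt_cpow_ofReal (hasDerivAt_uu_left t y) (uu_pos t hy) _).mul_const _

theorem hasDerivAt_mul_coth {t : ℝ} (ht : t ≠ 0) :
    HasDerivAt (fun t => t * (Real.cosh t / Real.sinh t))
      ((Real.cosh t * Real.sinh t - t) / Real.sinh t ^ 2) t := by
  have hs := Real.sinh_ne_zero.2 ht
  refine ((hasDerivAt_id t).mul ((Real.hasDerivAt_cosh t).div (Real.hasDerivAt_sinh t)
    hs)).congr_deriv ?_
  have := Real.cosh_sq_sub_sinh_sq t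
  simp only [id_eq, Pi.div_apply]
  field_simp
  linear_combination -t * this

/-- The unnormalized component `B_{1,0}` is the derivative of `-t coth t`. -/
theorem rInt_neg_one_zero_zero_one {t : ℝ} (ht : t ≠ 0) : rInt (-1) 0 0 0 1 t =
    ((-((Real.cosh t * Real.sinh t - t) / Real.sinh t ^ 2) : ℝ) : ℂ) := by
  have hs := Real.sinh_ne_zero.2 ht
  have h := rInt_neg_one_zero_zero 0 t
  rw [zero_add] at h
  rw [h]
  congr 1
  have hd : ∀ y ∈ uIcc (-1 : ℝ) 1, HasDerivAt (fun y => -(Real.cosh t * (uu t y)⁻¹ +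
      Real.log (uu t y)) / Real.sinh t ^ 2) ((uu t y)⁻¹ ^ 2 * formP 0 y) y := by
    intro y hy
    rw [uIcc_of_le (by norm_num)] at hy
    have hu := uu_pos t hy
    refine ((((hasDerivAt_uu_inv t hy).const_mul (Real.cosh t)).add
      ((hasDerivAt_uu_right t y).log hu.ne')).neg.div_const _).congr_deriv ?_
    have hP : formP 0 y = -y := by simp [formP, form, Finset.sum_range_succ]; ring
    rw [hP]
    field_simp
    rw [uu]
    ring
  rw [intervalIntegral.integral_eq_sub_of_hasDerivAt hd (ContinuousOn.intervalIntegrable (by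
    have := continuous_formP 0
    have := continuousOn_uu_inv t
    rw [uIcc_of_le (by norm_num)]
    fun_prop))]
  have u1 : uu t 1 = Real.exp (-t) := by rw [uu, ← Real.cosh_sub_sinh]; ring
  have u2 : uu t (-1) = Real.exp t := by rw [uu, ← Real.cosh_add_sinh]; ring
  rw [u1, u2, Real.log_exp, Real.log_exp, Real.exp_neg, inv_inv, ← Real.exp_neg,
    ← Real.cosh_sub_sinh, ← Real.cosh_add_sinh]
  field_simp
  ring

theorem hasDerivAt_phase (z : ℂ) {t : ℝ} (ht : t ≠ 0) :
    HasDerivAt (phase z) (phase z t * (z * rInt (-1) 0 0 0 1 t)) t := by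
  rw [rInt_neg_one_zero_zero_one ht]
  unfold phase
  refine ((((hasDerivAt_mul_coth ht).ofReal_comp).const_mul (-z)).cexp).congr_deriv ?_
  push_cast
  ring

/-! ### The case `l₀ = 1` and the criterion for vanishing -/

theorem constN_one (r : ℕ) : constN 1 0 1 (r + 1) = 2 * (constK 1 1 (r + 1) / (r + 1)!) ∧
    (r + 2) * constN 1 1 1 (r + 1) = (r + 1) * (constK 1 1 (r + 1) / (r + 1)!) ∧
    (r + 2) * constN 1 (-1) 1 (r + 1) = (r + 1) * (constK 1 1 (r + 1) / (r + 1)!) := by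
  have h := fun n => constN_eq (l₀ := 1) (l := 1) (l' := r + 1) (n := n) le_rfl (by omega) le_rfl
    (by omega)
  have e1 : (((1 : ℕ) : ℤ) - 0).toNat = 1 := rfl
  have e2 : (((1 : ℕ) : ℤ) + 0).toNat = 1 := rfl
  have e3 : (((1 : ℕ) : ℤ) - 1).toNat = 0 := rfl
  have e4 : (((1 : ℕ) : ℤ) + 1).toNat = 2 := rfl
  have e5 : (((1 : ℕ) : ℤ) - -1).toNat = 2 := rfl
  have e6 : (((1 : ℕ) : ℤ) + -1).toNat = 0 := rfl
  have f1 : (((r + 1 : ℕ) : ℤ) - 0).toNat = r + 1 := by omega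
  have f2 : (((r + 1 : ℕ) : ℤ) + 0).toNat = r + 1 := by omega
  have f3 : (((r + 1 : ℕ) : ℤ) - 1).toNat = r := by omega
  have f4 : (((r + 1 : ℕ) : ℤ) + 1).toNat = r + 2 := by omega
  have f5 : (((r + 1 : ℕ) : ℤ) - -1).toNat = r + 2 := by omega
  have f6 : (((r + 1 : ℕ) : ℤ) + -1).toNat = r := by omega
  have g : (r ! : ℝ) ≠ 0 := by exact_mod_cast r.factorial_ne_zero
  have g1 : (r : ℝ) + 1 ≠ 0 := by exact_mod_cast r.succ_ne_zero
  have g2 : (r : ℝ) + 2 ≠ 0 := by exact_mod_cast (r + 1).succ_ne_zero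
  have k1 : (((r + 1)! : ℕ) : ℝ) = (r + 1) * r ! := by rw [Nat.factorial_succ]; push_cast; ring
  have k2 : (((r + 2)! : ℕ) : ℝ) = (r + 2) * ((r + 1) * r !) := by
    rw [Nat.factorial_succ, Nat.factorial_succ]; push_cast; ring
  have h0 := h 0
  have h1 := h 1
  have h2 := h (-1)
  rw [e1, e2, f1, f2, k1] at h0
  rw [e3, e4, f3, f4, k1, k2] at h1
  rw [e5, e6, f5, f6, k1, k2] at h2
  simp only [Nat.cast_one, Nat.factorial_one, Nat.factorial_zero, Nat.factorial_two] at h0 h1 h2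
  rw [k1, h0, h1, h2]
  push_cast
  refine ⟨?_, ?_, ?_⟩ <;> field_simp <;> ring

theorem constBB_one (r : ℕ) : constBB 1 1 (r + 1) = -(constK 1 1 (r + 1) / (r + 1)!) := by
  have h := constBB_eq (l₀ := 1) (l := 1) (l' := r + 1) le_rfl (by omega) le_rfl (by omega)
  rw [Nat.cast_one] at h
  rw [h]
  simp
  ring

theorem projCore_one (r : ℕ) (w z : ℂ) (t : ℝ) : projCore 1 1 (r + 1) w z t =
    (constN 1 (-1) 1 (r + 1) * (rInt (-1) 0 (-1) 1 (r + 1) t * ((Real.sinh t ^ 2 : ℝ) : ℂ))) *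
        rInt w 1 (-1) 1 (r + 1) t +
    (constN 1 0 1 (r + 1) * (rInt (-1) 0 0 1 (r + 1) t * ((Real.sinh t ^ 2 : ℝ) : ℂ))) *
        rInt w 1 0 1 (r + 1) t +
    (constN 1 1 1 (r + 1) * (rInt (-1) 0 1 1 (r + 1) t * ((Real.sinh t ^ 2 : ℝ) : ℂ))) *
        rInt w 1 1 1 (r + 1) t +
    z * ((constBB 1 1 (r + 1) * ((rInt (-1) 0 0 0 1 t * rInt (-1) 0 0 0 (r + 1) t) *
      ((Real.sinh t ^ 2 : ℝ) : ℂ))) * rInt w 1 0 1 (r + 1) t) := by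
  have hS : Finset.Icc (-(min (1 : ℕ) (r + 1 : ℕ) : ℤ)) (min (1 : ℕ) (r + 1 : ℕ) : ℤ) = {-1, 0, 1} := by
    have : (min (1 : ℕ) (r + 1 : ℕ) : ℤ) = 1 := by omega
    rw [this]; decide
  rw [projCore, hS, Finset.sum_insert (by decide), Finset.sum_insert (by decide),
    Finset.sum_singleton, ← add_assoc]

/-- Exchanging `l` and `l'` amounts to reversing the sign of `w`. The symmetry `rInt_symm` also turns
the coefficients `A` into matrix elements at `w = 1`, which are proportional to those at `w = -1`. -/
theorem projCore_swap (r : ℕ) (w z : ℂ) {t : ℝ} (ht : t ≠ 0) :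
    projCore 1 (r + 1) 1 w z t = projCore 1 1 (r + 1) (-w) z t := by
  have hS : Finset.Icc (-(min (r + 1 : ℕ) (1 : ℕ) : ℤ)) (min (r + 1 : ℕ) (1 : ℕ) : ℤ) = {-1, 0, 1} := by
    have : (min (r + 1 : ℕ) (1 : ℕ) : ℤ) = 1 := by omega
    rw [this]; decide
  rw [projCore_one, projCore, hS, Finset.sum_insert (by decide), Finset.sum_insert (by decide),
    Finset.sum_singleton, ← add_assoc]
  have s1 : ∀ (m n : ℤ) (w : ℂ), m ≤ 1 → |n| ≤ 1 → rInt w m n (r + 1) 1 t =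
      (-1) ^ (r + 1 + 1) * rInt (-w) m (-n) 1 (r + 1) t := fun m n w hm hn =>
    rInt_symm (by omega) (by omega) (by omega) (by omega) w t
  have hK : constK 1 (r + 1) 1 = constK 1 1 (r + 1) := by
    have e : ((((r + 1 - 1)! * (r + 1 + 1)! * (1 - 1)! * (1 + 1)! : ℕ) : ℝ) /
        ((r + 1 : ℕ) * ((r + 1 : ℕ) + 1) * ((1 : ℕ) * ((1 : ℕ) + 1)))) =
        (((1 - 1)! * (1 + 1)! * (r + 1 - 1)! * (r + 1 + 1)! : ℕ) : ℝ) /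
        ((1 : ℕ) * ((1 : ℕ) + 1) * ((r + 1 : ℕ) * ((r + 1 : ℕ) + 1))) := by
      push_cast
      ring
    rw [constK, constK, e]
    ring
  -- the ratio of the coefficients is compensated by the ratio of the values at `w = ±1`
  have hN : ∀ n : ℤ, |n| ≤ 1 → constN 1 n (r + 1) 1 =
      (r + 1) * (r + 2) / 2 * constN 1 (-n) 1 (r + 1) := by
    intro n hn
    have h1 := constN_eq (l₀ := 1) (l := 1) (l' := r + 1) (n := -n) le_rfl (by omega) le_rfl
      (by omega)
    have h2 := constN_eq (l₀ := 1) (l := r + 1) (l' := 1) (n := n) (by omega) le_rfl (by omega)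
      le_rfl
    rw [Nat.cast_one] at h1 h2
    rw [h1, h2, hK]
    simp only [sub_neg_eq_add, ← sub_eq_add_neg]
    push_cast
    ring
  have hB : constBB 1 (r + 1) 1 = -(-1) ^ (r + 1) * constBB 1 1 (r + 1) := by
    have h1 := constBB_eq (l₀ := 1) (l := r + 1) (l' := 1) (by omega) le_rfl (by omega) le_rfl
    rw [Nat.cast_one] at h1
    rw [h1, hK, constBB_one]
    simp
    ring
  have e1 := rInt_one_eq_rInt_neg_one_of_one r ht
  have e0 := rInt_one_eq_rInt_neg_one_of_zero r t
  rw [hN _ (by simp), hN _ (by simp), hN _ (by simp), hB, s1 0 (-1) (-1) (by simp) (by simp),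
    s1 0 0 (-1) (by simp) (by simp), s1 0 1 (-1) (by simp) (by simp), s1 1 (-1) w le_rfl (by simp),
    s1 1 0 w le_rfl (by simp), s1 1 1 w le_rfl (by simp)]
  simp only [neg_neg, neg_zero]
  rw [rInt_zero_neg_one, rInt_zero_neg_one, ← e1, ← e0]
  have h1 : (-1 : ℂ) ^ (r + 1 + 1) * (-1) ^ (r + 1 + 1) = 1 := by rw [← mul_pow]; simp
  have h2 : (-1 : ℂ) ^ (r + 1) * (-1) ^ (r + 1 + 1) = -1 := by
    rw [pow_succ _ (r + 1), ← mul_assoc, ← mul_pow]; simp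
  push_cast
  generalize (-1 : ℂ) ^ (r + 1 + 1) = x at *
  generalize (-1 : ℂ) ^ (r + 1) = x' at *
  linear_combination ((r + 1) * (r + 2) / 2 * Complex.sinh t ^ 2 *
    (constN 1 1 1 (r + 1) * rInt 1 0 1 1 (r + 1) t * rInt (-w) 1 1 1 (r + 1) t +
      constN 1 0 1 (r + 1) * rInt 1 0 0 1 (r + 1) t * rInt (-w) 1 0 1 (r + 1) t +
      constN 1 (-1) 1 (r + 1) * rInt 1 0 1 1 (r + 1) t * rInt (-w) 1 (-1) 1 (r + 1) t)) * h1 -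
    (z * constBB 1 1 (r + 1) * rInt (-1) 0 0 0 1 t * rInt (-1) 0 0 0 (r + 1) t *
      Complex.sinh t ^ 2 * rInt (-w) 1 0 1 (r + 1) t) * h2

/-- For `l₀ = l = 1` the integrand is a derivative. Differentiating the three factors of the primitive
gives the summand `n = 0`, the summands `n = ±1` and the term with the factor `z`, respectively. -/
theorem hasDerivAt_primitive (r : ℕ) (w z : ℂ) {t : ℝ} (ht : t ≠ 0) :
    HasDerivAt (fun t => ((((-(constK 1 1 (r + 1) / (r + 1)!) : ℝ) : ℂ) *
      (rInt (-1) 0 0 0 (r + 1) t * ((Real.sinh t ^ 2 : ℝ) : ℂ))) * rInt w 1 0 1 (r + 1) t) *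
        phase z t) (projCore 1 1 (r + 1) w z t * phase z t) t := by
  have h := ((hasDerivAt_rInt_zero (r + 1) t).mul (hasDerivAt_sinh_sq_mul_rInt w r t)).mul
    (hasDerivAt_phase z ht)
  have h2 := h.const_mul ((-(constK 1 1 (r + 1) / (r + 1)!) : ℝ) : ℂ)
  refine (h2.congr_deriv ?_).congr_of_eventuallyEq (Eventually.of_forall fun t => ?_)
  · obtain ⟨k0, k1, k2⟩ := constN_one r
    have e := sinh_mul_rInt_zero_one r t
    have g2 : (r : ℂ) + 2 ≠ 0 := by exact_mod_cast (r + 1).succ_ne_zero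
    replace k1 := congrArg (fun x : ℝ => (x : ℂ)) k1
    replace k2 := congrArg (fun x : ℝ => (x : ℂ)) k2
    rw [projCore_one, rInt_zero_neg_one, constBB_one, k0]
    simp only [Pi.mul_apply]
    refine mul_left_cancel₀ g2 ?_
    push_cast at k1 k2 e ⊢
    generalize (constN 1 1 1 (r + 1) : ℂ) = n1 at *
    generalize (constN 1 (-1) 1 (r + 1) : ℂ) = n2 at *
    generalize rInt (-1) 0 0 0 (r + 1) t = b at *
    generalize rInt (-1) 0 1 1 (r + 1) t = ρ at *
    generalize rInt w 1 1 1 (r + 1) t = u1 at *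
    generalize rInt w 1 (-1) 1 (r + 1) t = u2 at *
    generalize (constK 1 1 (r + 1) : ℂ) / ((r + 1)! : ℂ) = C at *
    linear_combination -(Complex.sinh t ^ 2 * ρ * u1 * phase z t) * k1 -
      (Complex.sinh t ^ 2 * ρ * u2 * phase z t) * k2 -
      ((r + 1) / 2 * C * Complex.sinh t * phase z t * (u1 + u2)) * e
  · simp only [Pi.mul_apply]
    ring

theorem tendsto_phase_mul {f : ℝ → ℂ} (hf : Continuous f) (h0 : f 0 = 0) (z : ℂ) :
    Tendsto (fun t => f t * phase z t) (𝓝[>] 0) (𝓝 0) := by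
  have h1 : Tendsto f (𝓝[>] 0) (𝓝 0) := by
    have := hf.tendsto 0
    rw [h0] at this
    exact this.mono_left nhdsWithin_le_nhds
  refine h1.zero_mul_isBoundedUnder_le ⟨Real.exp (‖z‖ * Real.cosh 1), ?_⟩
  rw [eventually_map]
  filter_upwards [Ioc_mem_nhdsGT one_pos] with t ht
  exact norm_phase_le le_rfl ht

/-- The integral of the derivative vanishes: the primitive is `0` at `t = 0` because of the factor
`sinh² t`, and it tends to `0` at infinity because it is integrable together with its derivative. -/
theorem integral_projCore_one (r : ℕ) {p : ℂ × ℂ} (hp : p ∈ tubeW) :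
    ∫ t in Ioi (0 : ℝ), projCore 1 1 (r + 1) p.1 p.2 t * phase p.2 t = 0 := by
  obtain ⟨_, -, h1, -⟩ := hasCont_projCore (l₀ := 1) (l := 1) (l' := r + 1) le_rfl (by omega)
  obtain ⟨_, -, h2, -⟩ := hasCont_mul_rInt_zero ((-(constK 1 1 (r + 1) / (r + 1)!) : ℝ) : ℂ)
    (l₀ := 1) (l := 1) (l' := r + 1) le_rfl (by omega)
  have i1 := (h1 p hp).1
  have i2 := (h2 p hp).1
  rw [Nat.cast_one] at i1 i2
  have hd : ∀ t ∈ Ioi (0 : ℝ), _ := fun t ht => hasDerivAt_primitive r p.1 p.2 (ne_of_gt ht)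
  have hinf := tendsto_zero_of_hasDerivAt_of_integrableOn_Ioi hd i1 i2
  have h := integral_Ioi_of_hasDerivAt_of_tendsto ?_ hd i1 hinf
  · rw [h]
    simp
  · refine continuousWithinAt_Ioi_iff_Ici.1 ?_
    have := tendsto_phase_mul (f := fun t => (((-(constK 1 1 (r + 1) / (r + 1)!) : ℝ) : ℂ) *
      (rInt (-1) 0 0 0 (r + 1) t * ((Real.sinh t ^ 2 : ℝ) : ℂ))) * rInt p.1 1 0 1 (r + 1) t) (by
        have c1 := continuous_rInt_right (-1) 0 0 0 (r + 1)
        have c2 := continuous_rInt_right p.1 1 0 1 (r + 1)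
        fun_prop) (by simp) p.2
    rw [ContinuousWithinAt]
    simpa using this

theorem integral_projCore_eq_zero {l l' : ℕ} (hl : 1 ≤ l) (hl' : 1 ≤ l') (h : l = 1 ∨ l' = 1)
    {p : ℂ × ℂ} (hp : p ∈ tubeW) :
    ∫ t in Ioi (0 : ℝ), projCore 1 l l' p.1 p.2 t * phase p.2 t = 0 := by
  rcases h with rfl | rfl
  · obtain ⟨r, rfl⟩ : ∃ r, l' = r + 1 := ⟨l' - 1, by omega⟩
    exact integral_projCore_one r hp
  · obtain ⟨r, rfl⟩ : ∃ r, l = r + 1 := ⟨l - 1, by omega⟩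
    -- the tube is invariant under `w ↦ -w`
    have hp' : (-p.1, p.2) ∈ tubeW := by
      simpa [tubeW] using hp
    rw [← integral_projCore_one r hp']
    refine setIntegral_congr_fun measurableSet_Ioi fun t ht => ?_
    simp only [projCore_swap r p.1 p.2 (ne_of_gt ht)]

theorem vanishesAt_proj_iff {q : ℝ} (hq : q ≠ 0) {l₀ : ℕ} {α α' : ℕ × ℤ} (hα : 1 ≤ α.1)
    (hα' : 1 ≤ α'.1) (hl : l₀ ≤ α.1) (hl' : l₀ ≤ α'.1) {a : ℂ → ℂ} {F : ℂ × ℂ → ℂ}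
    (hF : IsContinuation a (projIntegrand q l₀ α α') F) {z : ℂ} (ha : a z ≠ 0) (hz : z ≠ 0) :
    VanishesAt F z ↔ l₀ = 1 ∧ (α.1 = 1 ∨ α'.1 = 1) := by
  rw [projIntegrand_eq hq hα hα' hl hl'] at hF
  constructor
  · intro hv
    by_contra h
    obtain ⟨k, hk, hne⟩ := exists_projCoeff_ne_zero hα hα' hl hl' h hz
    exact not_vanishesAt (hasCont_projCore hl hl') hF ha hk hne hv
  · rintro ⟨rfl, h⟩
    exact vanishesAt_of_integral_eq_zero
      (g := fun w z t => projCore ((1 : ℕ) : ℤ) α.1 α'.1 w z t * phase z t)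
      (fun p hp => by rw [Nat.cast_one]; exact integral_projCore_eq_zero hα hα' h hp) hF z

end CoulombField

theorem mainTheorem8 (q : ℝ) (hq : q ≠ 0) :
    -- the diagonal Fourier weight
    (∀ (l₀ : ℕ) (α : ℕ × ℤ), CoulombField.IsIndex α → l₀ ≤ α.1 →
      (∃ F : ℂ × ℂ → ℂ, CoulombField.IsContinuation
        (CoulombField.fourierFactor q α) (CoulombField.fourierIntegrand q l₀ α) F) ∧
      ∀ F : ℂ × ℂ → ℂ, CoulombField.IsContinuation
        (CoulombField.fourierFactor q α) (CoulombField.fourierIntegrand q l₀ α) F →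
        ∀ z : ℂ, z ≠ 0 → (CoulombField.VanishesAt F z ↔ l₀ = 1 ∧ α.1 = 1)) ∧
    -- the projection functions with `β = α`, `β' = α'`
    (∀ (l₀ : ℕ) (α α' : ℕ × ℤ), CoulombField.IsIndex α → CoulombField.IsIndex α' →
      l₀ ≤ α.1 → l₀ ≤ α'.1 →
      (∃ F : ℂ × ℂ → ℂ, CoulombField.IsContinuation
        (CoulombField.projFactor q α α α' α') (CoulombField.projIntegrand q l₀ α α') F) ∧
      ∀ F : ℂ × ℂ → ℂ, CoulombField.IsContinuation
        (CoulombField.projFactor q α α α' α') (CoulombField.projIntegrand q l₀ α α') F →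
        ∀ z : ℂ, z ≠ 0 →
          (CoulombField.VanishesAt F z ↔ l₀ = 1 ∧ (α.1 = 1 ∨ α'.1 = 1))) ∧
    -- the projection functions that join `|u⟩` and `c_{l,0}⁺|u⟩`
    (∀ l : ℕ, 1 ≤ l →
      (∃ F : ℂ × ℂ → ℂ, CoulombField.IsContinuation
        (CoulombField.cyclicFactor l) (CoulombField.cyclicIntegrand q l) F) ∧
      ∀ F : ℂ × ℂ → ℂ, CoulombField.IsContinuation
        (CoulombField.cyclicFactor l) (CoulombField.cyclicIntegrand q l) F →
        ∀ z : ℂ, z ≠ 0 → ¬ CoulombField.VanishesAt F z) := by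
  have hqc : (q : ℂ) ≠ 0 := by exact_mod_cast hq
  have hpi : (Real.pi : ℂ) ≠ 0 := by exact_mod_cast Real.pi_ne_zero
  have hl : ∀ l : ℕ, (2 * (l : ℂ) + 1) ≠ 0 := fun l => by exact_mod_cast (2 * l).succ_ne_zero
  have hex : ∀ (l₀ : ℕ) (α α' : ℕ × ℤ), 1 ≤ α.1 → 1 ≤ α'.1 → l₀ ≤ α.1 → l₀ ≤ α'.1 →
      ∃ Φ, CoulombField.IsIntegralContinuation (CoulombField.projIntegrand q l₀ α α') Φ := by
    intro l₀ α α' h1 h2 h3 h4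
    rw [CoulombField.projIntegrand_eq hq h1 h2 h3 h4]
    exact (CoulombField.hasCont_projCore h3 h4).exists_isIntegralContinuation
  refine ⟨fun l₀ α hα h0 => ⟨?_, fun F hF z hz => ?_⟩, fun l₀ α α' hα hα' h0 h0' =>
    ⟨?_, fun F hF z hz => ?_⟩, fun l h1 => ⟨?_, fun F hF z hz => ?_⟩⟩
  · obtain ⟨Φ, hΦ⟩ := hex l₀ α α hα.1 hα.1 h0 h0
    exact ⟨_, Φ, by rwa [CoulombField.fourierIntegrand_eq], fun p => rfl⟩
  · rw [CoulombField.fourierIntegrand_eq] at hF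
    have := CoulombField.vanishesAt_proj_iff hq hα.1 hα.1 h0 h0 hF
      (mul_ne_zero (pow_ne_zero 2 (div_ne_zero (mul_ne_zero (mul_ne_zero (by norm_num) hpi) hqc)
        (hl _))) (Complex.exp_ne_zero z)) hz
    rwa [or_self] at this
  · obtain ⟨Φ, hΦ⟩ := hex l₀ α α' hα.1 hα'.1 h0 h0'
    exact ⟨_, Φ, hΦ, fun p => rfl⟩
  · refine CoulombField.vanishesAt_proj_iff hq hα.1 hα'.1 h0 h0' hF ?_ hz
    rw [CoulombField.projFactor, if_pos rfl, if_pos rfl, one_mul, one_mul]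
    exact div_ne_zero (mul_ne_zero (pow_ne_zero 2 (mul_ne_zero (mul_ne_zero (by norm_num) hpi) hqc))
      (Complex.exp_ne_zero z)) (mul_ne_zero (hl _) (hl _))
  · rw [CoulombField.cyclicIntegrand_eq q h1]
    obtain ⟨Φ, hΦ⟩ := (CoulombField.hasCont_mul_rInt_zero (CoulombField.constC q l) (l₀ := 0)
      (l := 0) (l' := l) le_rfl (by omega)).exists_isIntegralContinuation
    exact ⟨_, Φ, hΦ, fun p => rfl⟩
  · rw [CoulombField.cyclicIntegrand_eq q h1] at hF
    obtain ⟨k, hk, hne⟩ := CoulombField.exists_cyclicCoeff_ne_zero hq h1 hz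
    refine CoulombField.not_vanishesAt (CoulombField.hasCont_mul_rInt_zero
      (CoulombField.constC q l) (l₀ := 0) (l := 0) (l' := l) le_rfl (by omega)) hF ?_ hk hne
    have h7 : ((Real.pi ^ (7 / 2 : ℝ) : ℝ) : ℂ) ≠ 0 := by
      exact_mod_cast (Real.rpow_pos_of_pos Real.pi_pos _).ne'
    have hzs : z ^ (1 / 2 : ℂ) ≠ 0 := by
      rw [Complex.cpow_def_of_ne_zero hz]; exact Complex.exp_ne_zero _
    exact div_ne_zero (mul_ne_zero (mul_ne_zero (mul_ne_zero (by norm_num) h7) hzs)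
      (Complex.exp_ne_zero z)) (hl l)
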